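/- **Setting.** Let $1\le n\le 3$, let $\Omega\subset\mathbb R^n$ be open with $C^\infty$ boundary, $T>0$, $Q=\Omega\times(0,T)$, $\gamma\ge 0$, $y_0,y_{dT}\in H^1_0(\Omega)$, $f,y_d\in L^2(Q)$, $b=(b_0,\dots,b_m)\in W^{1,\infty}(\Omega)^{m+1}$, $c_j\in H^2(\Omega)\cap H^1_0(\Omega)$ and $d_j\in\mathbb R$ $(1\le j\le q)$, $\alpha\in\mathbb R^m$, $\check u_i<\hat u_i$. Put $Y=\{y\in H^{2,1}(Q): y=0 \text{ on } \partial\Omega\times(0,T)\}$; its elements are identified with their versions in $C([0,T];L^2(\Omega))$. Let $\mathcal U_{ad}=\{u\in L^2(0,T)^m:\check u_i\le u_i\le\hat u_i \text{ a.e.}\}$, $g_j(y(\cdot,t))=\int_\Omega c_j y(\cdot,t)\,dx+d_j$. Let $(\bar u,\bar y)$ be an admissible trajectory, i.e. $\bar u\in\mathcal U_{ad}$, $\bar y\in Y$, with $\bar u_0\equiv1$, $$\dot{\bar y}-\Delta\bar y+\gamma\bar y^3=f+\bar y\sum_{i=0}^m\bar u_ib_i\ \text{ in }Q,\qquad \bar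 y(\cdot,0)=y_0,$$ and $g_j(\bar y(\cdot,t))\le0$ for all $t\in[0,T]$ and all $j$. Put $Az=-\Delta z+3\gamma\bar y^2z-\sum_{i=0}^m\bar u_ib_iz$. For $v\in L^2(0,T)^m$ let $z[v]\in Y$ be the solution of $\dot z+Az=\sum_{i=1}^m v_ib_i\bar y$, $z(\cdot,0)=0$. **Hypotheses.** (1) There are junction points $0=\tau_0<\dots<\tau_N=T$ such that on each arc $(\tau_k,\tau_{k+1})$ the set $B_k$ of active control bounds (lower and upper ones separately, up to null sets of times) and the set $C_k$ of active state constraints are constant. (2) For each $j$ there are $\varepsilon>0$ and $u\in\mathcal U_{ad}$ with $g_j(\bar y(\cdot,t))+\int_\Omega c_j z[u-\bar u](\cdot,t)\,dx<-\varepsilon$ on $[0,T]$. (3) With $M_{ij}(t)=\int_\Omega b_ic_j\bar y(\cdot,t)\,dx$ and $\bar M_k(t)=(M_{ij}(t))_{i\notin B_k,\,j\in C_k}$, one has $|C_k|\le m-|B_k|$ and there is $a>0$ with $|\bar M_k(t)\lambda|\ge a|\lambda|$ for all $\lambda$, a.e. on $(\tau_k,\tau_{k+1})$, for all $k$. (4)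 For some $a>0$, $g_j(\bar y(\cdot,t))\le -a\,\mathrm{dist}(t,I^C_j)$ on $[0,T]$, where $I_j^C=\{t\in[0,T]:g_j(\bar y(\cdot,t))=0\}$ (if $I_j^C=\emptyset$ nothing is required). (5) For some $\delta>0$, for each $i$ and a.e. $t$ with $\bar u_i(t)\notin\{\check u_i,\hat u_i\}$, $\mathrm{dist}(\bar u_i(t),\{\check u_i,\hat u_i\})\ge\delta$. (6) For some $r>n+1$: $y_0,y_{dT}\in W^{1,r}_0(\Omega)\cap W^{2,r}(\Omega)$; $y_d,f\in L^\infty(Q)$; $b\in W^{2,\infty}(\Omega)^{m+1}$. (7) $\bar u$ has left and right limits at each $\tau_k\in(0,T)$. (8) For each $j$, $t\mapsto\int_\Omega c_jf(\cdot,t)\,dx$ is (essentially) continuous at each $\tau_k\in(0,T)$; e.g. $f\in C([0,T];L^2(\Omega))$. **Multipliers.** $\Lambda_1$ is the set of pairs $(p,\mu)$ such that: each $\mu_j$ is nondecreasing and right-continuous on $[0,T]$ with $\mu_j(T)=0$, with associated measure $d\mu_j$ on $(0,T]$; $\int_0^T g_j(\bar y(\cdot,t))\,d\mu_j(t)=0$;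 $p\in L^\infty(0,T;H^1_0(\Omega))$ and, for some $p_0\in H^{-1}(\Omega)$ and all $z\in Y$, $$\int_Q p(\dot z+Az)\,dx\,dt+\langle p_0,z(\cdot,0)\rangle=\sum_{j=1}^q\int_0^T\!\!\int_\Omega c_jz\,dx\,d\mu_j(t)+\int_Q(\bar y-y_d)z\,dx\,dt+\int_\Omega(\bar y(x,T)-y_{dT}(x))z(x,T)\,dx;$$ and $\Psi_i(t)=\alpha_i+\int_\Omega b_i\bar y\,p\,dx$ satisfies $\Psi\in L^\infty(0,T)^m$ and $\sum_{i=1}^m\int_0^T\Psi_i(u_i-\bar u_i)\,dt\ge0$ for all $u\in\mathcal U_{ad}$. **Quadratic forms.** Put $\kappa=1-6\gamma\bar yp$, $S_{ij}(t)=\int_\Omega b_ib_jp\bar y\,dx$ $(1\le i,j\le m)$, $$B^1_i=-fb_i+2\nabla\bar y\cdot\nabla b_i+\bar y\Delta b_i-2\gamma\bar y^3b_i ,$$ $$\mathcal Q[p](z,v)=\int_Q\Big(\kappa z^2+2p\sum_{i=1}^mv_ib_iz\Big)dx\,dt+\int_\Omega z(x,T)^2\,dx ,$$ $$\widehat{\mathcal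 Q}[p,\mu](\zeta,w,h)=\int_0^T\hat q_I\,dt+\hat q_T,$$ $$\hat q_I=\int_\Omega\kappa\Big(\zeta+\bar y\sum_{i=1}^m b_iw_i\Big)^2dx-w^\top\dot Sw+2\sum_{i=1}^m w_i\int_\Omega\Big[\zeta\Big(-\Delta b_i\,p-2\nabla b_i\cdot\nabla p+b_i(\bar y-y_d)+b_i\sum_{j=1}^qc_j\dot\mu_j\Big)-b_i\,p\,B^1\cdot w\Big]dx,$$ $$\hat q_T=\int_\Omega\Big[\Big(\zeta(x,T)+\bar y(x,T)\sum_{i=1}^mh_ib_i(x)\Big)^2+2\sum_{i=1}^mh_ib_i(x)p(x,T)\zeta(x,T)\Big]dx+h^\top S(T)h,$$ where $\dot S$ and $\dot\mu_j$ are the derivatives on the open interval $(0,T)$, $p(\cdot,T)$ is the limit of $p(\cdot,t)$ in $L^2(\Omega)$ as $t\uparrow T$, and $S(T)$ is formed with this $p(\cdot,T)$. **Lemma (Transformed second variation).** Let $(p,\mu)\in\Lambda_1$, $v\in L^2(0,T)^m$ and $w(t)=\int_0^tv(s)\,ds$, and let $\zeta[w]\in Y$ be the solution of $\dot\zeta+A\zeta=B^1\cdot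 w$, $\zeta(\cdot,0)=0$. Then all derivatives, traces and integrals in $\mathcal Q[p](z[v],v)$ and $\widehat{\mathcal Q}[p,\mu](\zeta[w],w,w(T))$ exist ($\mu_j$ and $S_{ij}$ have locally integrable weak derivatives on $(0,T)$, the limit $p(\cdot,T)$ exists), and $$\mathcal Q[p](z[v],v)=\widehat{\mathcal Q}[p,\mu](\zeta[w],w,w(T)).$$ -/

import Mathlib

open MeasureTheory Set Filter Topology
open scoped ENNReal ContDiff

noncomputable section

namespace GohTransform

/-! ### Weak derivatives and Sobolev spaces -/

section WeakDerivatives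

variable {V : Type*} [NormedAddCommGroup V] [NormedSpace ℝ V] [MeasureSpace V]

/-- `φ ∈ 𝒟(U)`: smooth with compact support contained in `U`. -/
def IsTestFunction (U : Set V) (φ : V → ℝ) : Prop :=
  ContDiff ℝ ∞ φ ∧ HasCompactSupport φ ∧ tsupport φ ⊆ U

/-- `g` is the distributional derivative of `u` on the open set `U` in the direction `e`. -/
def HasWeakDeriv (U : Set V) (e : V) (u g : V → ℝ) : Prop :=
  LocallyIntegrableOn u U ∧ LocallyIntegrableOn g U ∧
    ∀ φ : V → ℝ, IsTestFunction U φ →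
      ∫ x in U, u x * fderiv ℝ φ x e = - ∫ x in U, g x * φ x

open Classical in
/-- A version of the distributional derivative of `u` on `U` in the direction `e` (it is unique up
to null sets); by convention `0` if there is no locally integrable one. -/
def wderiv (U : Set V) (e : V) (u : V → ℝ) : V → ℝ :=
  if h : ∃ g, HasWeakDeriv U e u g then h.choose else 0

end WeakDerivatives

/-- Space variables. -/
abbrev Space (n : ℕ) := EuclideanSpace ℝ (Fin n)

/-- The `i`-th unit vector of `ℝⁿ`. -/
abbrev unitVec {n : ℕ} (i : Fin n) : Space n := EuclideanSpace.single i (1 : ℝ)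

section Spaces

variable {n : ℕ}

/-- `Ω` lies, near each of its boundary points, on one side of a smooth hypersurface. -/
def HasSmoothBoundary (Ω : Set (Space n)) : Prop :=
  ∀ x ∈ frontier Ω, ∃ (U : Set (Space n)) (φ : Space n → ℝ),
    IsOpen U ∧ x ∈ U ∧ ContDiffOn ℝ ∞ φ U ∧ fderiv ℝ φ x ≠ 0 ∧ Ω ∩ U = {y ∈ U | φ y < 0}

/-- The Sobolev space `W^{k,r}(Ω)`. -/
def MemW (Ω : Set (Space n)) (r : ℝ≥0∞) : ℕ → (Space n → ℝ) → Prop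
  | 0, u => MemLp u r (volume.restrict Ω)
  | k + 1, u => MemLp u r (volume.restrict Ω) ∧
      ∀ i, ∃ g, HasWeakDeriv Ω (unitVec i) u g ∧ MemW Ω r k g

/-- The space `W^{1,r}_0(Ω)`, the closure of `𝒟(Ω)` in `W^{1,r}(Ω)`. -/
def MemW10 (Ω : Set (Space n)) (r : ℝ≥0∞) (u : Space n → ℝ) : Prop :=
  MemW Ω r 1 u ∧ ∀ ε : ℝ≥0∞, 0 < ε → ∃ φ, IsTestFunction Ω φ ∧
    eLpNorm (fun x => u x - φ x) r (volume.restrict Ω) ≤ ε ∧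
    ∀ i, eLpNorm (fun x => wderiv Ω (unitVec i) u x - fderiv ℝ φ x (unitVec i)) r
      (volume.restrict Ω) ≤ ε

/-- `H^1_0(Ω)`. -/
abbrev MemH10 (Ω : Set (Space n)) (u : Space n → ℝ) : Prop := MemW10 Ω 2 u

/-- `ℓ ∈ H^{-1}(Ω)`: a bounded linear functional on `H^1_0(Ω)`. -/
def IsHMinusOne (Ω : Set (Space n)) (ℓ : (Space n → ℝ) → ℝ) : Prop :=
  (∀ u v, MemH10 Ω u → MemH10 Ω v → ∀ a b : ℝ,
    ℓ (fun x => a * u x + b * v x) = a * ℓ u + b * ℓ v) ∧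
  ∃ C : ℝ, ∀ u, MemH10 Ω u →
    |ℓ u| ≤ C * ((eLpNorm u 2 (volume.restrict Ω)).toReal
      + ∑ i, (eLpNorm (wderiv Ω (unitVec i) u) 2 (volume.restrict Ω)).toReal)

/-- The cylinder `Q = Ω × (0,T)`. -/
def cyl (Ω : Set (Space n)) (T : ℝ) : Set (Space n × ℝ) := Ω ×ˢ Ioo 0 T

/-- Space derivative of a function on `Q`. -/
def dx (Ω : Set (Space n)) (T : ℝ) (i : Fin n) (y : Space n × ℝ → ℝ) : Space n × ℝ → ℝ :=
  wderiv (cyl Ω T) (unitVec i, 0) y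

/-- Time derivative of a function on `Q`. -/
def dt (Ω : Set (Space n)) (T : ℝ) (y : Space n × ℝ → ℝ) : Space n × ℝ → ℝ :=
  wderiv (cyl Ω T) (0, 1) y

/-- Laplacian (in space) of a function on `Q`. -/
def lap (Ω : Set (Space n)) (T : ℝ) (y : Space n × ℝ → ℝ) : Space n × ℝ → ℝ :=
  fun s => ∑ i, dx Ω T i (dx Ω T i y) s

/-- Laplacian of a function on `Ω`. -/
def lapSpace (Ω : Set (Space n)) (u : Space n → ℝ) : Space n → ℝ :=
  fun x => ∑ i, wderiv Ω (unitVec i) (wderiv Ω (unitVec i) u) x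

/-- The state space `Y = {y ∈ H^{2,1}(Q) : y = 0 on Σ}`. An element of `Y` is represented by its
version that is continuous in time with values in `L²(Ω)`, so that `y(·,t)` makes sense for each
`t ∈ [0,T]`; the lateral boundary condition reads `y(·,t) ∈ H^1_0(Ω)` for almost all `t`. -/
structure MemY (Ω : Set (Space n)) (T : ℝ) (y : Space n × ℝ → ℝ) : Prop where
  memLp : MemLp y 2 (volume.restrict (cyl Ω T))
  space_deriv : ∀ i, ∃ g, HasWeakDeriv (cyl Ω T) (unitVec i, 0) y g ∧
    MemLp g 2 (volume.restrict (cyl Ω T)) ∧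
    ∀ j, ∃ g', HasWeakDeriv (cyl Ω T) (unitVec j, 0) g g' ∧
      MemLp g' 2 (volume.restrict (cyl Ω T))
  time_deriv : ∃ g, HasWeakDeriv (cyl Ω T) (0, 1) y g ∧ MemLp g 2 (volume.restrict (cyl Ω T))
  boundary : ∀ᵐ t ∂(volume.restrict (Ioo 0 T)), MemH10 Ω (fun x => y (x, t))
  slice_memLp : ∀ t ∈ Icc 0 T, MemLp (fun x => y (x, t)) 2 (volume.restrict Ω)
  slice_continuous : ∀ t ∈ Icc 0 T,
    Tendsto (fun s => eLpNorm (fun x => y (x, s) - y (x, t)) 2 (volume.restrict Ω))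
      (𝓝[Icc 0 T] t) (𝓝 0)

/-- The space `L^∞(0,T;H^1_0(Ω))`. -/
structure MemLinftyH10 (Ω : Set (Space n)) (T : ℝ) (p : Space n × ℝ → ℝ) : Prop where
  memLp : MemLp p 2 (volume.restrict (cyl Ω T))
  space_deriv : ∀ i, ∃ g, HasWeakDeriv (cyl Ω T) (unitVec i, 0) p g ∧
    MemLp g 2 (volume.restrict (cyl Ω T))
  slice : ∀ᵐ t ∂(volume.restrict (Ioo 0 T)), MemH10 Ω (fun x => p (x, t))
  bounded : ∃ C : ℝ, ∀ᵐ t ∂(volume.restrict (Ioo 0 T)),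
    eLpNorm (fun x => p (x, t)) 2 (volume.restrict Ω) ≤ ENNReal.ofReal C ∧
    ∀ i, eLpNorm (fun x => dx Ω T i p (x, t)) 2 (volume.restrict Ω) ≤ ENNReal.ofReal C

/-- `g = p(·,T)`: the function `p`, defined for almost all times, converges to `g` in `L²(Ω)` as
`t ↑ T` (essential limit). -/
def HasEndTrace (Ω : Set (Space n)) (T : ℝ) (p : Space n × ℝ → ℝ) (g : Space n → ℝ) : Prop :=
  MemLp g 2 (volume.restrict Ω) ∧
    Tendsto (fun t => eLpNorm (fun x => p (x, t) - g x) 2 (volume.restrict Ω))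
      (𝓝[<] T ⊓ ae volume) (𝓝 0)

open Classical in
/-- The trace `p(·,T)` (by convention `0` if there is none). -/
def endTrace (Ω : Set (Space n)) (T : ℝ) (p : Space n × ℝ → ℝ) : Space n → ℝ :=
  if h : ∃ g, HasEndTrace Ω T p g then h.choose else 0

end Spaces

/-! ### The optimal control problem -/

/-- The data of the optimal control problem: `n` space variables, `m` controls, `q` state
constraints. The potential `b 0` is multiplied by `u₀ ≡ 1`, and `b i.succ` by the control `u i`. -/
structure ControlProblem (n m q : ℕ) where
  Ω : Set (Space n)
  T : ℝ
  γ : ℝ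
  f : Space n × ℝ → ℝ
  y0 : Space n → ℝ
  b : Fin (m + 1) → Space n → ℝ
  c : Fin q → Space n → ℝ
  d : Fin q → ℝ
  yd : Space n × ℝ → ℝ
  ydT : Space n → ℝ
  α : Fin m → ℝ
  lo : Fin m → ℝ
  hi : Fin m → ℝ

namespace ControlProblem

variable {n m q : ℕ} (P : ControlProblem n m q)

/-- Lebesgue measure on `(0,T)`. -/
abbrev timeMeasure : Measure ℝ := volume.restrict (Ioo 0 P.T)

/-- Lebesgue measure on `Q`. -/
abbrev cylMeasure : Measure (Space n × ℝ) := volume.restrict (cyl P.Ω P.T)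

/-- The assumptions made on the data throughout. -/
structure Basic : Prop where
  isOpen : IsOpen P.Ω
  smooth : HasSmoothBoundary P.Ω
  T_pos : 0 < P.T
  γ_nonneg : 0 ≤ P.γ
  f_mem : MemLp P.f 2 P.cylMeasure
  y0_mem : MemH10 P.Ω P.y0
  b_mem : ∀ i, MemW P.Ω ∞ 1 (P.b i)
  c_mem : ∀ j, MemW P.Ω 2 2 (P.c j) ∧ MemH10 P.Ω (P.c j)
  yd_mem : MemLp P.yd 2 P.cylMeasure
  ydT_mem : MemH10 P.Ω P.ydT
  lo_lt_hi : ∀ i, P.lo i < P.hi i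

/-- The potential `∑_{i=0}^m u_i(t) b_i(x)` with `u₀ ≡ 1`. -/
def potential (u : Fin m → ℝ → ℝ) (s : Space n × ℝ) : ℝ :=
  P.b 0 s.1 + ∑ i, u i s.2 * P.b i.succ s.1

/-- `y = y[u]`: `y ∈ Y` solves the state equation
`∂_t y - Δy + γ y³ = f + y ∑_{i=0}^m u_i b_i` in `Q`, `y(·,0) = y₀`. -/
def IsState (u : Fin m → ℝ → ℝ) (y : Space n × ℝ → ℝ) : Prop :=
  MemY P.Ω P.T y ∧
  (∀ᵐ s ∂P.cylMeasure, dt P.Ω P.T y s - lap P.Ω P.T y s + P.γ * y s ^ 3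
    = P.f s + y s * P.potential u s) ∧
  ∀ᵐ x ∂(volume.restrict P.Ω), y (x, 0) = P.y0 x

/-- The set `𝒰_ad` of controls in `L²(0,T)^m` that satisfy the bounds. -/
def IsAdmissibleControl (u : Fin m → ℝ → ℝ) : Prop :=
  ∀ i, MemLp (u i) 2 P.timeMeasure ∧ ∀ᵐ t ∂P.timeMeasure, P.lo i ≤ u i t ∧ u i t ≤ P.hi i

/-- `g_j(y(·,t)) = ∫_Ω c_j y(·,t) + d_j`. -/
def g (j : Fin q) (y : Space n × ℝ → ℝ) (t : ℝ) : ℝ :=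
  (∫ x in P.Ω, P.c j x * y (x, t)) + P.d j

/-- `(u,y)` is an admissible trajectory. -/
def IsAdmissibleTrajectory (u : Fin m → ℝ → ℝ) (y : Space n × ℝ → ℝ) : Prop :=
  P.IsAdmissibleControl u ∧ P.IsState u y ∧ ∀ j, ∀ t ∈ Icc 0 P.T, P.g j y t ≤ 0

/-! In what follows `(u,y)` is the nominal trajectory. -/

/-- `A z = -Δz + 3 γ y² z - (∑_{i=0}^m u_i b_i) z`. -/
def opA (u : Fin m → ℝ → ℝ) (y z : Space n × ℝ → ℝ) (s : Space n × ℝ) : ℝ :=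
  - lap P.Ω P.T z s + 3 * P.γ * y s ^ 2 * z s - P.potential u s * z s

/-- `z = z[v]`: `z ∈ Y` solves the linearized state equation
`∂_t z + A z = ∑_{i=1}^m v_i b_i y`, `z(·,0) = 0`. -/
def IsLinearizedState (u : Fin m → ℝ → ℝ) (y : Space n × ℝ → ℝ) (v : Fin m → ℝ → ℝ)
    (z : Space n × ℝ → ℝ) : Prop :=
  MemY P.Ω P.T z ∧
  (∀ᵐ s ∂P.cylMeasure, dt P.Ω P.T z s + P.opA u y z s
    = ∑ i, v i s.2 * P.b i.succ s.1 * y s) ∧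
  ∀ᵐ x ∂(volume.restrict P.Ω), z (x, 0) = 0

/-- `B¹_i = -f b_i + 2 ∇y·∇b_i + y Δb_i - 2 γ y³ b_i`. -/
def B1 (y : Space n × ℝ → ℝ) (i : Fin m) (s : Space n × ℝ) : ℝ :=
  - P.f s * P.b i.succ s.1
    + 2 * ∑ k, dx P.Ω P.T k y s * wderiv P.Ω (unitVec k) (P.b i.succ) s.1
    + y s * lapSpace P.Ω (P.b i.succ) s.1
    - 2 * P.γ * y s ^ 3 * P.b i.succ s.1

/-- `ζ = ζ[w]`: `ζ ∈ Y` solves `∂_t ζ + A ζ = B¹·w`, `ζ(·,0) = 0`. -/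
def IsTransformedState (u : Fin m → ℝ → ℝ) (y : Space n × ℝ → ℝ) (w : Fin m → ℝ → ℝ)
    (ζ : Space n × ℝ → ℝ) : Prop :=
  MemY P.Ω P.T ζ ∧
  (∀ᵐ s ∂P.cylMeasure, dt P.Ω P.T ζ s + P.opA u y ζ s = ∑ i, P.B1 y i s * w i s.2) ∧
  ∀ᵐ x ∂(volume.restrict P.Ω), ζ (x, 0) = 0

/-! ### Multipliers

An element `μ` of `BV(0,T)_{0,+}` (nondecreasing, right-continuous, `μ(T) = 0`) is represented by a
Stieltjes function on `ℝ` that extends it; only its values on `[0,T]` are used, and `dμ` is the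
measure on `(0,T]` with `dμ((s,t]) = μ(t) - μ(s)`. -/

/-- `∫_0^T φ dμ`. -/
def stieltjesIntegral (μ : StieltjesFunction ℝ) (φ : ℝ → ℝ) : ℝ :=
  ∫ t in Ioc 0 P.T, φ t ∂μ.measure

/-- `p` is the costate associated with `(u,y)`, `β = 1` and `μ`: the Lagrangian is stationary with
respect to the state. -/
def IsCostate (u : Fin m → ℝ → ℝ) (y p : Space n × ℝ → ℝ)
    (μ : Fin q → StieltjesFunction ℝ) : Prop :=
  MemLinftyH10 P.Ω P.T p ∧
  ∃ p0 : (Space n → ℝ) → ℝ, IsHMinusOne P.Ω p0 ∧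
    ∀ z : Space n × ℝ → ℝ, MemY P.Ω P.T z →
      (∫ s in cyl P.Ω P.T, p s * (dt P.Ω P.T z s + P.opA u y z s)) + p0 (fun x => z (x, 0))
        = (∑ j, P.stieltjesIntegral (μ j) (fun t => ∫ x in P.Ω, P.c j x * z (x, t)))
          + (∫ s in cyl P.Ω P.T, (y s - P.yd s) * z s)
          + ∫ x in P.Ω, (y (x, P.T) - P.ydT x) * z (x, P.T)

/-- The switching function `Ψ_i = α_i + ∫_Ω b_i y p` (with `β = 1`). -/
def switching (y p : Space n × ℝ → ℝ) (i : Fin m) (t : ℝ) : ℝ :=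
  P.α i + ∫ x in P.Ω, P.b i.succ x * y (x, t) * p (x, t)

/-- `(p,μ) ∈ Λ₁`: `(1,p,μ)` is a generalized Lagrange multiplier associated with `(u,y)`. -/
structure IsMultiplier (u : Fin m → ℝ → ℝ) (y p : Space n × ℝ → ℝ)
    (μ : Fin q → StieltjesFunction ℝ) : Prop where
  end_zero : ∀ j, μ j P.T = 0
  complementarity : ∀ j, P.stieltjesIntegral (μ j) (fun t => P.g j y t) = 0
  costate : P.IsCostate u y p μ
  switching_bounded : ∀ i, MemLp (P.switching y p i) ∞ P.timeMeasure
  stationarity : ∀ u' : Fin m → ℝ → ℝ, P.IsAdmissibleControl u' →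
    0 ≤ ∑ i, ∫ t in Ioo 0 P.T, P.switching y p i t * (u' i t - u i t)

/-! ### Structural hypotheses on the nominal trajectory -/

/-- `M_ij(t) = ∫_Ω b_i c_j y(·,t)`. -/
def M (y : Space n × ℝ → ℝ) (i : Fin m) (j : Fin q) (t : ℝ) : ℝ :=
  ∫ x in P.Ω, P.b i.succ x * P.c j x * y (x, t)

/-- The contact set of the `j`-th state constraint. -/
def contactSet (y : Space n × ℝ → ℝ) (j : Fin q) : Set ℝ :=
  {t ∈ Icc 0 P.T | P.g j y t = 0}

/-- Junction points `0 = τ_0 < ⋯ < τ_N = T`, with constant sets of active lower bounds `lowerAct k`,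
active upper bounds `upperAct k` and active state constraints `stateAct k` on each arc
`(τ_k, τ_{k+1})`. -/
structure IsArcDecomposition (u : Fin m → ℝ → ℝ) (y : Space n × ℝ → ℝ) {N : ℕ}
    (τ : Fin (N + 1) → ℝ) (lowerAct upperAct : Fin N → Finset (Fin m))
    (stateAct : Fin N → Finset (Fin q)) : Prop where
  strictMono : StrictMono τ
  first : τ 0 = 0
  last : τ (Fin.last N) = P.T
  lower : ∀ k i, ∀ᵐ t ∂(volume.restrict (Ioo (τ k.castSucc) (τ k.succ))),
    u i t = P.lo i ↔ i ∈ lowerAct k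
  upper : ∀ k i, ∀ᵐ t ∂(volume.restrict (Ioo (τ k.castSucc) (τ k.succ))),
    u i t = P.hi i ↔ i ∈ upperAct k
  state : ∀ k j, ∀ t ∈ Ioo (τ k.castSucc) (τ k.succ), P.g j y t = 0 ↔ j ∈ stateAct k

/-- The standing hypotheses on the nominal trajectory and the regularity of the data. -/
structure Hypotheses (u : Fin m → ℝ → ℝ) (y : Space n × ℝ → ℝ) : Prop where
  /-- Finite arc structure, local controllability on each arc, and, at each interior junction
  point, one-sided limits of `u` and continuity of `t ↦ ∫_Ω c_j f(·,t)`. -/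
  arcs : ∃ (N : ℕ) (τ : Fin (N + 1) → ℝ) (lowerAct upperAct : Fin N → Finset (Fin m))
      (stateAct : Fin N → Finset (Fin q)),
    P.IsArcDecomposition u y τ lowerAct upperAct stateAct ∧
    (∀ k, (stateAct k).card ≤ ((lowerAct k ∪ upperAct k)ᶜ).card) ∧
    (∃ a : ℝ, 0 < a ∧ ∀ k, ∀ᵐ t ∂(volume.restrict (Ioo (τ k.castSucc) (τ k.succ))),
      ∀ l : Fin q → ℝ,
        a * √(∑ j ∈ stateAct k, l j ^ 2)
          ≤ √(∑ i ∈ (lowerAct k ∪ upperAct k)ᶜ, (∑ j ∈ stateAct k, P.M y i j t * l j) ^ 2)) ∧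
    (∀ k, 0 < τ k → τ k < P.T → ∀ i,
      (∃ l, Tendsto (u i) (𝓝[<] (τ k) ⊓ ae volume) (𝓝 l)) ∧
      (∃ l, Tendsto (u i) (𝓝[>] (τ k) ⊓ ae volume) (𝓝 l))) ∧
    (∀ k, 0 < τ k → τ k < P.T → ∀ j, ∃ l,
      Tendsto (fun t => ∫ x in P.Ω, P.c j x * P.f (x, t)) (𝓝 (τ k) ⊓ ae volume) (𝓝 l))
  /-- Qualification. -/
  qualified : ∀ j, ∃ ε : ℝ, 0 < ε ∧ ∃ (u' : Fin m → ℝ → ℝ) (z : Space n × ℝ → ℝ),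
    P.IsAdmissibleControl u' ∧ P.IsLinearizedState u y (fun i t => u' i t - u i t) z ∧
    ∀ t ∈ Icc 0 P.T, P.g j y t + (∫ x in P.Ω, P.c j x * z (x, t)) < - ε
  /-- Discontinuity of the derivative of the state constraints at junction points. -/
  sharp : ∃ a : ℝ, 0 < a ∧ ∀ j, ∀ t ∈ Icc 0 P.T,
    P.g j y t ≤ - a * Metric.infDist t (P.contactSet y j)
  /-- Uniform distance to the control bounds where they are not active. -/
  away : ∃ δ : ℝ, 0 < δ ∧ ∀ i, ∀ᵐ t ∂P.timeMeasure, u i t ≠ P.lo i → u i t ≠ P.hi i →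
    δ ≤ |u i t - P.lo i| ∧ δ ≤ |u i t - P.hi i|
  /-- Regularity of the data. -/
  initial_regular : ∃ r : ℝ, (n : ℝ) + 1 < r ∧
    MemW10 P.Ω (ENNReal.ofReal r) P.y0 ∧ MemW P.Ω (ENNReal.ofReal r) 2 P.y0 ∧
    MemW10 P.Ω (ENNReal.ofReal r) P.ydT ∧ MemW P.Ω (ENNReal.ofReal r) 2 P.ydT
  yd_bounded : MemLp P.yd ∞ P.cylMeasure
  f_bounded : MemLp P.f ∞ P.cylMeasure
  b_regular : ∀ i, MemW P.Ω ∞ 2 (P.b i)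

/-! ### The quadratic forms -/

/-- `κ = 1 - 6 γ y p`. -/
def kappa (y p : Space n × ℝ → ℝ) (s : Space n × ℝ) : ℝ := 1 - 6 * P.γ * y s * p s

/-- The integrand `κ z² + 2 p ∑_i v_i b_i z` of the second variation. -/
def quadIntegrand (y p z : Space n × ℝ → ℝ) (v : Fin m → ℝ → ℝ) (s : Space n × ℝ) : ℝ :=
  P.kappa y p s * z s ^ 2 + 2 * p s * ∑ i, v i s.2 * P.b i.succ s.1 * z s

/-- The second variation `𝒬[p](z,v)`. -/
def quadForm (y p z : Space n × ℝ → ℝ) (v : Fin m → ℝ → ℝ) : ℝ :=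
  (∫ s in cyl P.Ω P.T, P.quadIntegrand y p z v s) + ∫ x in P.Ω, z (x, P.T) ^ 2

/-- `S_ij(t) = ∫_Ω b_i b_j p(·,t) y(·,t)`. -/
def S (y p : Space n × ℝ → ℝ) (i j : Fin m) (t : ℝ) : ℝ :=
  ∫ x in P.Ω, P.b i.succ x * P.b j.succ x * p (x, t) * y (x, t)

/-- The time derivative of `S_ij` on `(0,T)`. -/
def Sdot (y p : Space n × ℝ → ℝ) (i j : Fin m) : ℝ → ℝ :=
  wderiv (Ioo 0 P.T) (1 : ℝ) (P.S y p i j)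

/-- `S_ij(T)`, with `p(·,T)` the trace of `p`. -/
def Send (y p : Space n × ℝ → ℝ) (i j : Fin m) : ℝ :=
  ∫ x in P.Ω, P.b i.succ x * P.b j.succ x * endTrace P.Ω P.T p x * y (x, P.T)

/-- The time derivative of `μ_j` on `(0,T)`. -/
def muDot (μ : Fin q → StieltjesFunction ℝ) (j : Fin q) : ℝ → ℝ :=
  wderiv (Ioo 0 P.T) (1 : ℝ) (fun t => μ j t)

/-- `κ (ζ + y ∑_i b_i w_i)²`. -/
def hatSquare (y p ζ : Space n × ℝ → ℝ) (w : Fin m → ℝ → ℝ) (s : Space n × ℝ) : ℝ :=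
  P.kappa y p s * (ζ s + y s * ∑ i, P.b i.succ s.1 * w i s.2) ^ 2

/-- `ζ (-Δb_i p - 2 ∇b_i·∇p + b_i (y - y_d) + b_i ∑_j c_j dμ_j/dt) - b_i p B¹·w`. -/
def hatCross (y p : Space n × ℝ → ℝ) (μ : Fin q → StieltjesFunction ℝ)
    (ζ : Space n × ℝ → ℝ) (w : Fin m → ℝ → ℝ) (i : Fin m) (s : Space n × ℝ) : ℝ :=
  ζ s * (- lapSpace P.Ω (P.b i.succ) s.1 * p s
      - 2 * ∑ k, wderiv P.Ω (unitVec k) (P.b i.succ) s.1 * dx P.Ω P.T k p s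
      + P.b i.succ s.1 * (y s - P.yd s)
      + P.b i.succ s.1 * ∑ j, P.c j s.1 * P.muDot μ j s.2)
    - P.b i.succ s.1 * p s * ∑ k, P.B1 y k s * w k s.2

/-- The running part `q̂_I(t)` of the transformed quadratic form. -/
def hatRunning (y p : Space n × ℝ → ℝ) (μ : Fin q → StieltjesFunction ℝ)
    (ζ : Space n × ℝ → ℝ) (w : Fin m → ℝ → ℝ) (t : ℝ) : ℝ :=
  (∫ x in P.Ω, P.hatSquare y p ζ w (x, t))
    - (∑ i, ∑ j, w i t * P.Sdot y p i j t * w j t)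
    + 2 * ∑ i, w i t * ∫ x in P.Ω, P.hatCross y p μ ζ w i (x, t)

/-- The final part `q̂_T` of the transformed quadratic form. -/
def hatFinal (y p ζ : Space n × ℝ → ℝ) (h : Fin m → ℝ) : ℝ :=
  (∫ x in P.Ω, ((ζ (x, P.T) + y (x, P.T) * ∑ i, h i * P.b i.succ x) ^ 2
      + 2 * ∑ i, h i * P.b i.succ x * endTrace P.Ω P.T p x * ζ (x, P.T)))
    + ∑ i, ∑ j, h i * P.Send y p i j * h j

/-- The transformed quadratic form `𝒬̂[p,μ](ζ,w,h) = ∫_0^T q̂_I(t) dt + q̂_T`. -/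
def hatQuadForm (y p : Space n × ℝ → ℝ) (μ : Fin q → StieltjesFunction ℝ)
    (ζ : Space n × ℝ → ℝ) (w : Fin m → ℝ → ℝ) (h : Fin m → ℝ) : ℝ :=
  (∫ t in Ioo 0 P.T, P.hatRunning y p μ ζ w t) + P.hatFinal y p ζ h

/-- All the derivatives, traces and integrals that enter `𝒬[p](z,v)` and `𝒬̂[p,μ](ζ,w,h)` exist. -/
structure FormsWellDefined (y p : Space n × ℝ → ℝ) (μ : Fin q → StieltjesFunction ℝ)
    (z : Space n × ℝ → ℝ) (v : Fin m → ℝ → ℝ) (ζ : Space n × ℝ → ℝ)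
    (w : Fin m → ℝ → ℝ) : Prop where
  mu_deriv : ∀ j, ∃ g, HasWeakDeriv (Ioo 0 P.T) (1 : ℝ) (fun t => μ j t) g
  S_deriv : ∀ i j, ∃ g, HasWeakDeriv (Ioo 0 P.T) (1 : ℝ) (P.S y p i j) g
  trace : ∃ g, HasEndTrace P.Ω P.T p g
  quad : Integrable (P.quadIntegrand y p z v) P.cylMeasure
  square : Integrable (P.hatSquare y p ζ w) P.cylMeasure
  wSw : ∀ i j, Integrable (fun t => w i t * P.Sdot y p i j t * w j t) P.timeMeasure
  cross : ∀ i, Integrable (fun s => w i s.2 * P.hatCross y p μ ζ w i s) P.cylMeasure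

end ControlProblem

/-- The Goh primitive `w(t) = ∫_0^t v(s) ds`. -/
def primitive {m : ℕ} (v : Fin m → ℝ → ℝ) (i : Fin m) (t : ℝ) : ℝ := ∫ s in (0 : ℝ)..t, v i s

end GohTransform

end

open MeasureTheory Set Filter Topology
open scoped ENNReal ContDiff

set_option linter.unusedSectionVars false

noncomputable section

/-! Let w be the primitive of v. The Goh substitution z = ζ + y ∑ w_i b_i trades the control v,
which is merely square integrable, for its primitive. Applying ∂_t + A to b_i y gives -B¹_i
(`operator_mul_state`), so both sides of the substitution solve the same linear parabolic problem
with zero initial value, and an energy estimate makes them equal (`goh_transform`).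

After the substitution the κ-term of the second variation is already the square in the transformed
form. The mixed term 2 ∫ p v_i b_i z splits into pairings of v_i with ∫_Ω p b_i ζ and of v_i w_j
with S_ij, and both are integrated by parts in time. This needs t ↦ ∫_Ω p Z to be absolutely
continuous on (0,T) for Z = b_i ζ and Z = b_i b_j y. Testing the adjoint equation with η(t) Z
(`costate_weak`, `costate_pairing_ae`) writes that function as an absolutely continuous one plus the
tails over [s,T] of ∫_Ω c_j Z dμ_j. Everything therefore rests on dμ_j having a density on (0,T); an
atom at T only enters the end value (`isTail_pairing`). Integration by parts in space turns the
derivative of ∫_Ω p b_i ζ into the bracket of the transformed form (`integral_hatCross`), and the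
symmetry of S makes the sum of the v_i w_j S_ij accessible to integration by parts
(`two_mul_sum_S`).

The density (`IsMultiplier.absolutelyContinuous`) has two sources. Inside an arc, Ψ_i vanishes for
the controls off their bounds, so the adjoint equation tested with b_i y shows that ∑_j M_ij dμ_j
has an integrable density; injectivity of M then leaves no room for a singular part
(`absolutelyContinuous_of_combination`). At an interior junction point, the atoms times the jumps of
the derivatives of the constraints sum to the jumps of Ψ times the jumps of u. The first sum is
nonnegative because g_j has a maximum at a charged point, the second is nonpositive by stationarity;
so all terms vanish, and sharpness of the constraints together with injectivity of M kills the atoms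
(`jumps_eq_zero`).

The trace p(·,T) exists because p is bounded in H^1_0 and of bounded variation as a functional on
H^1_0: pairing p(s) - p(t) with itself bounds its squared L²-norm by the variation between s and t
(`costate_sub_le`). The embedding of H^1_0 into L⁶ for n ≤ 3 handles the cubic term. -/

namespace GohTransform

/-! ### Test functions and the calculus of weak derivatives. -/

section WeakDerivativeCalculus

variable {V : Type*} [NormedAddCommGroup V] [NormedSpace ℝ V]

namespace IsTestFunction

variable {U : Set V} {φ ψ : V → ℝ}

lemma continuous (h : IsTestFunction U φ) : Continuous φ := h.1.continuous

lemma differentiable (h : IsTestFunction U φ) : Differentiable ℝ φ := h.1.differentiable (by simp)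

lemma mono {U' : Set V} (h : IsTestFunction U φ) (hU : U ⊆ U') : IsTestFunction U' φ :=
  ⟨h.1, h.2.1, h.2.2.trans hU⟩

lemma zero : IsTestFunction U (fun _ : V => (0 : ℝ)) := by
  refine ⟨contDiff_const, HasCompactSupport.zero, ?_⟩
  simp [tsupport, Function.support]

lemma smooth_mul (h : IsTestFunction U φ) {f : V → ℝ} (hf : ContDiff ℝ ∞ f) :
    IsTestFunction U (fun x => f x * φ x) :=
  ⟨hf.mul h.1, h.2.1.mul_left (f := f), (tsupport_mul_subset_right (f := f)).trans h.2.2⟩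

lemma const_mul (h : IsTestFunction U φ) (a : ℝ) : IsTestFunction U (fun x => a * φ x) :=
  h.smooth_mul contDiff_const

lemma add (h : IsTestFunction U φ) (h' : IsTestFunction U ψ) :
    IsTestFunction U (fun x => φ x + ψ x) :=
  ⟨h.1.add h'.1, h.2.1.add h'.2.1,
    (tsupport_add φ ψ).trans (union_subset h.2.2 h'.2.2)⟩

lemma sub (h : IsTestFunction U φ) (h' : IsTestFunction U ψ) :
    IsTestFunction U (fun x => φ x - ψ x) := by
  simpa [sub_eq_add_neg] using h.add (h'.const_mul (-1))

lemma fderiv_apply (h : IsTestFunction U φ) (e : V) :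
    IsTestFunction U (fun x => fderiv ℝ φ x e) := by
  refine ⟨(h.1.fderiv_right (m := ∞) (by simp)).clm_apply contDiff_const,
    h.2.1.fderiv_apply ℝ e, ?_⟩
  exact (tsupport_fderiv_apply_subset ℝ e).trans h.2.2

lemma eq_zero_of_notMem (_h : IsTestFunction U φ) {x : V} (hx : x ∉ tsupport φ) : φ x = 0 :=
  image_eq_zero_of_notMem_tsupport hx

lemma exists_bound (h : IsTestFunction U φ) : ∃ C, ∀ x, |φ x| ≤ C := by
  obtain ⟨C, hC⟩ := h.2.1.exists_bound_of_continuous h.continuous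
  exact ⟨C, hC⟩

end IsTestFunction

lemma fderiv_mul_apply {f g : V → ℝ} (hf : Differentiable ℝ f) (hg : Differentiable ℝ g)
    (x e : V) :
    fderiv ℝ (fun y => f y * g y) x e = f x * fderiv ℝ g x e + fderiv ℝ f x e * g x := by
  rw [fderiv_fun_mul (hf x) (hg x)]
  simp [mul_comm]

variable [MeasureSpace V] [BorelSpace V]

lemma locallyIntegrableOn_congr {U : Set V} {u u' : V → ℝ}
    (h : LocallyIntegrableOn u U) (he : u =ᵐ[volume.restrict U] u') :
    LocallyIntegrableOn u' U := by
  intro x hx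
  obtain ⟨s, hs, hi⟩ := h x hx
  refine ⟨s ∩ U, inter_mem hs self_mem_nhdsWithin, ?_⟩
  refine (hi.mono_set inter_subset_left).congr ?_
  exact ae_restrict_of_ae_restrict_of_subset inter_subset_right he

lemma IsTestFunction.integrable_mul {U : Set V} {φ u : V → ℝ}
    (hφ : IsTestFunction U φ) (hu : LocallyIntegrableOn u U) :
    Integrable (fun x => u x * φ x) (volume.restrict U) := by
  have h1 : IntegrableOn u (tsupport φ) := hu.integrableOn_compact_subset hφ.2.2 hφ.2.1
  have h2 : IntegrableOn (fun x => u x * φ x) (tsupport φ) :=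
    h1.mul_continuousOn hφ.continuous.continuousOn hφ.2.1
  have h3 : Integrable (fun x => u x * φ x) := by
    rw [← integrableOn_iff_integrable_of_support_subset (s := tsupport φ)]
    · exact h2
    · intro x hx
      by_contra hx'
      exact hx (by simp [hφ.eq_zero_of_notMem hx'])
  exact h3.integrableOn

lemma setIntegral_mul_test {U : Set V} {φ u : V → ℝ} (hφ : IsTestFunction U φ) :
    ∫ x in U, u x * φ x = ∫ x, u x * φ x := by
  apply setIntegral_eq_integral_of_forall_compl_eq_zero
  intro x hx
  rw [hφ.eq_zero_of_notMem (fun h => hx (hφ.2.2 h)), mul_zero]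

/-- The fundamental lemma of the calculus of variations; nearly every almost-everywhere identity
below is obtained by testing. -/
lemma ae_eq_zero_of_forall_test [FiniteDimensional ℝ V] {U : Set V} (hU : IsOpen U) {u : V → ℝ}
    (hu : LocallyIntegrableOn u U)
    (h : ∀ φ, IsTestFunction U φ → ∫ x in U, u x * φ x = 0) :
    u =ᵐ[volume.restrict U] 0 := by
  have := hU.ae_eq_zero_of_integral_contDiff_smul_eq_zero hu (fun g h1 h2 h3 => by
    have h4 := h g ⟨h1, h2, h3⟩
    rw [setIntegral_mul_test ⟨h1, h2, h3⟩] at h4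
    simpa [mul_comm] using h4)
  rw [EventuallyEq, ae_restrict_iff' hU.measurableSet]
  exact this

lemma ae_eq_of_forall_test [FiniteDimensional ℝ V] {U : Set V} (hU : IsOpen U) {u u' : V → ℝ}
    (hu : LocallyIntegrableOn u U) (hu' : LocallyIntegrableOn u' U)
    (h : ∀ φ, IsTestFunction U φ → ∫ x in U, u x * φ x = ∫ x in U, u' x * φ x) :
    u =ᵐ[volume.restrict U] u' := by
  have := ae_eq_zero_of_forall_test hU (hu.sub hu') (fun φ hφ => by
    have : ∀ x, (u - u') x * φ x = u x * φ x - u' x * φ x := fun x => by simp [sub_mul]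
    simp_rw [this]
    rw [integral_sub (hφ.integrable_mul hu) (hφ.integrable_mul hu'), h φ hφ, sub_self])
  filter_upwards [this] with x hx
  simpa [sub_eq_zero] using hx

namespace HasWeakDeriv

variable {U : Set V} {e : V} {u g u' g' : V → ℝ}

lemma congr (h : HasWeakDeriv U e u g)
    (hu : u =ᵐ[volume.restrict U] u') (hg : g =ᵐ[volume.restrict U] g') :
    HasWeakDeriv U e u' g' := by
  refine ⟨locallyIntegrableOn_congr h.1 hu, locallyIntegrableOn_congr h.2.1 hg,
    fun φ hφ => ?_⟩
  have h1 := integral_congr_ae (hu.mul (ae_eq_refl (fun x => fderiv ℝ φ x e)))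
  have h2 := integral_congr_ae (hg.mul (ae_eq_refl φ))
  simp only [Pi.mul_apply] at h1 h2
  rw [← h1, ← h2]
  exact h.2.2 φ hφ

lemma unique [FiniteDimensional ℝ V] (hU : IsOpen U) (h : HasWeakDeriv U e u g)
    (h' : HasWeakDeriv U e u g') : g =ᵐ[volume.restrict U] g' := by
  refine ae_eq_of_forall_test hU h.2.1 h'.2.1 (fun φ hφ => ?_)
  have h1 := h.2.2 φ hφ
  rw [h'.2.2 φ hφ] at h1
  linarith

lemma wderiv_spec (h : HasWeakDeriv U e u g) : HasWeakDeriv U e u (wderiv U e u) := by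
  have h' : ∃ g, HasWeakDeriv U e u g := ⟨g, h⟩
  rw [wderiv, dif_pos h']
  exact h'.choose_spec

lemma wderiv_ae_eq [FiniteDimensional ℝ V] (hU : IsOpen U) (h : HasWeakDeriv U e u g) :
    wderiv U e u =ᵐ[volume.restrict U] g :=
  h.wderiv_spec.unique hU h

lemma add (h : HasWeakDeriv U e u g) (h' : HasWeakDeriv U e u' g') :
    HasWeakDeriv U e (fun x => u x + u' x) (fun x => g x + g' x) := by
  refine ⟨h.1.add h'.1, h.2.1.add h'.2.1, fun φ hφ => ?_⟩
  have hφ' := hφ.fderiv_apply e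
  simp_rw [add_mul]
  rw [integral_add (hφ'.integrable_mul h.1) (hφ'.integrable_mul h'.1),
    integral_add (hφ.integrable_mul h.2.1) (hφ.integrable_mul h'.2.1), h.2.2 φ hφ, h'.2.2 φ hφ]
  ring

lemma const_mul (h : HasWeakDeriv U e u g) (a : ℝ) :
    HasWeakDeriv U e (fun x => a * u x) (fun x => a * g x) := by
  refine ⟨h.1.smul a, h.2.1.smul a, fun φ hφ => ?_⟩
  simp_rw [mul_assoc]
  rw [integral_const_mul, integral_const_mul, h.2.2 φ hφ]
  ring

lemma zero : HasWeakDeriv U e (fun _ => 0) (fun _ => 0) := by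
  refine ⟨?_, ?_, ?_⟩
  · exact locallyIntegrableOn_zero
  · exact locallyIntegrableOn_zero
  · simp

/-- A `C¹` function has its classical derivative as weak derivative. -/
lemma of_contDiff [FiniteDimensional ℝ V] [(volume : Measure V).IsAddHaarMeasure]
    {u : V → ℝ} (hu : ContDiff ℝ 1 u) (U : Set V) (e : V) :
    HasWeakDeriv U e u (fun x => fderiv ℝ u x e) := by
  have hc : Continuous (fun x => fderiv ℝ u x e) :=
    (hu.continuous_fderiv (by simp)).clm_apply continuous_const
  have l1 : LocallyIntegrable u := hu.continuous.locallyIntegrable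
  have l2 : LocallyIntegrable (fun x => fderiv ℝ u x e) := hc.locallyIntegrable
  refine ⟨l1.locallyIntegrableOn U, l2.locallyIntegrableOn U, fun φ hφ => ?_⟩
  rw [setIntegral_mul_test hφ, setIntegral_mul_test (hφ.fderiv_apply e)]
  have key : ∀ {f ψ : V → ℝ}, LocallyIntegrable f → IsTestFunction U ψ →
      Integrable (fun x => f x * ψ x) := fun {f ψ} hf hψ => by
    have := (hψ.mono (subset_univ U)).integrable_mul (hf.locallyIntegrableOn univ)
    simpa using this
  exact integral_mul_fderiv_eq_neg_fderiv_mul_of_integrable (key l2 hφ)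
    (key l1 (hφ.fderiv_apply e)) (key l1 hφ) (fun x _ => hu.differentiable (by simp) x)
    (fun x _ => hφ.differentiable x)

end HasWeakDeriv

lemma wderiv_congr [FiniteDimensional ℝ V] {U : Set V} (hU : IsOpen U) {e : V} {u u' : V → ℝ}
    (hu : u =ᵐ[volume.restrict U] u') :
    wderiv U e u =ᵐ[volume.restrict U] wderiv U e u' := by
  by_cases h : ∃ g, HasWeakDeriv U e u g
  · obtain ⟨g, hg⟩ := h
    exact (hg.wderiv_ae_eq hU).trans
      ((hg.congr hu (ae_eq_refl g)).wderiv_ae_eq hU).symm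
  -- Existence of a weak derivative is invariant under changes on null sets, so here both sides take
  -- the default value 0.
  · have h' : ¬ ∃ g, HasWeakDeriv U e u' g := fun ⟨g, hg⟩ =>
      h ⟨g, hg.congr hu.symm (ae_eq_refl g)⟩
    rw [wderiv, wderiv, dif_neg h, dif_neg h']

end WeakDerivativeCalculus

/-! ### Mollification, and the Leibniz rule with a factor in W^{1,∞}. -/

section Mollification

variable {V : Type*} [NormedAddCommGroup V] [NormedSpace ℝ V] [MeasureSpace V] [BorelSpace V]
  [FiniteDimensional ℝ V]

/-- A sequence of bump functions whose supports shrink to the origin. -/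
def shrinkingBump (k : ℕ) : ContDiffBump (0 : V) where
  -- The ratio of the radii stays equal to 2: convergence at Lebesgue points, used in
  -- `ae_tendsto_mollify`, needs it bounded.
  rIn := 1 / (2 * ((k : ℝ) + 1))
  rOut := 1 / ((k : ℝ) + 1)
  rIn_pos := by positivity
  rIn_lt_rOut := by
    apply one_div_lt_one_div_of_lt (by positivity)
    have : (0 : ℝ) < (k : ℝ) + 1 := by positivity
    linarith

lemma tendsto_shrinkingBump_rOut :
    Tendsto (fun k => (shrinkingBump (V := V) k).rOut) atTop (𝓝 0) :=
  tendsto_one_div_add_atTop_nhds_zero_nat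

open scoped Convolution in
/-- Regularization of a function on `U`, extended by zero. -/
def mollify (U : Set V) (k : ℕ) (b : V → ℝ) : V → ℝ :=
  ((shrinkingBump (V := V) k).normed volume) ⋆[ContinuousLinearMap.lsmul ℝ ℝ, volume] U.indicator b

variable [(volume : Measure V).IsAddHaarMeasure]

lemma locallyIntegrable_indicator {U : Set V} (hU : MeasurableSet U) {b : V → ℝ}
    (hb : MemLp b ∞ (volume.restrict U)) : LocallyIntegrable (U.indicator b) :=
  ((memLp_indicator_iff_restrict hU).2 hb).locallyIntegrable (by simp)

lemma contDiff_mollify {U : Set V} (hU : MeasurableSet U) {b : V → ℝ}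
    (hb : MemLp b ∞ (volume.restrict U)) (k : ℕ) : ContDiff ℝ ∞ (mollify U k b) :=
  (shrinkingBump k).hasCompactSupport_normed.contDiff_convolution_left _
    (shrinkingBump k).contDiff_normed (locallyIntegrable_indicator hU hb)

lemma ae_tendsto_mollify {U : Set V} (hU : MeasurableSet U) {b : V → ℝ}
    (hb : MemLp b ∞ (volume.restrict U)) :
    ∀ᵐ x ∂(volume.restrict U), Tendsto (fun k => mollify U k b x) atTop (𝓝 (b x)) := by
  have := ContDiffBump.ae_convolution_tendsto_right_of_locallyIntegrable (K := 2)
    (φ := fun k : ℕ => shrinkingBump (V := V) k) (l := atTop) tendsto_shrinkingBump_rOut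
    (Eventually.of_forall fun k => by
      simp only [shrinkingBump]
      have : (0 : ℝ) < (k : ℝ) + 1 := by positivity
      apply le_of_eq
      field_simp)
    (locallyIntegrable_indicator hU hb)
  rw [ae_restrict_iff' hU]
  filter_upwards [this] with x hx hxU
  rw [indicator_of_mem hxU] at hx
  exact hx

lemma mollify_apply (U : Set V) (k : ℕ) (b : V → ℝ) (x : V) :
    mollify U k b x
      = ∫ y, U.indicator b y * (shrinkingBump (V := V) k).normed volume (x - y) := by
  rw [mollify, convolution_eq_swap]
  simp [mul_comm]

/-- The kernel is nonnegative with integral one, so averaging does not increase the essential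
supremum. -/
lemma abs_mollify_le {U : Set V} (hU : MeasurableSet U) {b : V → ℝ}
    (hb : MemLp b ∞ (volume.restrict U)) (k : ℕ) (x : V) :
    |mollify U k b x| ≤ (eLpNorm b ∞ (volume.restrict U)).toReal := by
  set C := (eLpNorm b ∞ (volume.restrict U)).toReal
  have hae : ∀ᵐ y, ‖U.indicator b y‖ ≤ C := by
    have h1 : ∀ᵐ y ∂(volume.restrict U), ‖b y‖ ≤ C := by
      simp only [C, eLpNorm_exponent_top]
      filter_upwards [ae_le_eLpNormEssSup (f := b) (μ := volume.restrict U)] with y hy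
      have := ENNReal.toReal_mono (by simpa using hb.eLpNorm_ne_top) hy
      simpa using this
    rw [ae_restrict_iff' hU] at h1
    filter_upwards [h1] with y hy
    by_cases hyU : y ∈ U
    · simpa [hyU] using hy hyU
    · simp [hyU, C]
  set ρ := (shrinkingBump (V := V) k).normed volume
  have hi : Integrable (fun y => ρ (x - y)) := by
    have : Integrable ρ := (shrinkingBump (V := V) k).integrable_normed
    exact this.comp_sub_left x
  have h1 : ∫ y, ρ (x - y) = 1 := by
    rw [integral_sub_left_eq_self (fun y => ρ y) volume x]
    exact (shrinkingBump (V := V) k).integral_normed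
  rw [mollify_apply, ← Real.norm_eq_abs]
  calc ‖∫ y, U.indicator b y * ρ (x - y)‖ ≤ ∫ y, C * ρ (x - y) := by
        apply norm_integral_le_of_norm_le (hi.const_mul C)
        filter_upwards [hae] with y hy
        rw [norm_mul, Real.norm_of_nonneg ((shrinkingBump (V := V) k).nonneg_normed (x - y))]
        gcongr
        exact (shrinkingBump (V := V) k).nonneg_normed (x - y)
    _ = C := by rw [integral_const_mul, h1, mul_one]

/-- As long as the ball of radius `rOut` around x stays in U, the reflected kernel y ↦ ρ(x - y) is
itself a test function on U, and the definition of the weak derivative applies to it. Near the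
boundary the extension by zero would spoil the formula. -/
lemma fderiv_mollify {U : Set V} (hU : MeasurableSet U) {b g : V → ℝ} {e : V}
    (hb : MemLp b ∞ (volume.restrict U)) (h : HasWeakDeriv U e b g) (k : ℕ) {x : V}
    (hx : Metric.closedBall x (shrinkingBump (V := V) k).rOut ⊆ U) :
    fderiv ℝ (mollify U k b) x e = mollify U k g x := by
  set ρ := (shrinkingBump (V := V) k).normed volume with hρ
  have hρs : ContDiff ℝ ∞ ρ := (shrinkingBump (V := V) k).contDiff_normed
  have hρc : HasCompactSupport ρ := (shrinkingBump (V := V) k).hasCompactSupport_normed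
  have h1 := hρc.hasFDerivAt_convolution_left (ContinuousLinearMap.lsmul ℝ ℝ)
    (hρs.of_le (by simp)) (locallyIntegrable_indicator hU hb) x
  have hdiff : fderiv ℝ (mollify U k b) x = _ := h1.fderiv
  have h3 : HasCompactSupport (fderiv ℝ ρ) := hρc.fderiv (𝕜 := ℝ)
  have hint : Integrable (fun y => U.indicator b y • fderiv ℝ ρ (x - y)) := by
    have h4 := (h3.convolutionExists_right (ContinuousLinearMap.lsmul ℝ ℝ)
      (locallyIntegrable_indicator hU hb) (hρs.continuous_fderiv (by simp)) x).integrable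
    exact h4
  have h2 : fderiv ℝ (mollify U k b) x e
      = ∫ y, U.indicator b y * fderiv ℝ ρ (x - y) e := by
    have h5 : (fun y => (ContinuousLinearMap.precompL V (ContinuousLinearMap.lsmul ℝ ℝ))
        (fderiv ℝ ρ (x - y)) (U.indicator b y)) = fun y => U.indicator b y • fderiv ℝ ρ (x - y) := by
      ext y v
      simp [mul_comm]
    rw [hdiff, convolution_eq_swap, h5, ContinuousLinearMap.integral_apply hint]
    simp
  have htest : IsTestFunction U (fun y => ρ (x - y)) := by
    have hsupp : tsupport (fun y => ρ (x - y)) ⊆ Metric.closedBall x (shrinkingBump (V := V) k).rOut := by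
      apply closure_minimal _ Metric.isClosed_closedBall
      intro y hy
      have : x - y ∈ Function.support ρ := hy
      rw [hρ, ContDiffBump.support_normed_eq] at this
      simp only [Metric.mem_ball, dist_zero_right] at this
      rw [Metric.mem_closedBall, dist_comm, dist_eq_norm]
      exact this.le
    refine ⟨hρs.comp (contDiff_const.sub contDiff_id), ?_, hsupp.trans hx⟩
    exact HasCompactSupport.of_support_subset_isCompact (isCompact_closedBall x _)
      ((subset_tsupport _).trans hsupp)
  have hder : ∀ y, fderiv ℝ (fun y => ρ (x - y)) y e = - fderiv ℝ ρ (x - y) e := by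
    intro y
    have : HasFDerivAt (fun y => ρ (x - y)) ((fderiv ℝ ρ (x - y)).comp (-(ContinuousLinearMap.id ℝ V))) y := by
      apply HasFDerivAt.comp y ((hρs.differentiable (by simp)) (x - y)).hasFDerivAt
      simpa using (hasFDerivAt_id (𝕜 := ℝ) y).const_sub x
    rw [this.fderiv]
    simp
  have hkey := h.2.2 _ htest
  simp_rw [hder] at hkey
  rw [h2, mollify_apply]
  have ind : ∀ (b : V → ℝ) (f : V → ℝ), ∫ y, U.indicator b y * f y = ∫ y in U, b y * f y := by
    intro b f
    rw [← integral_indicator hU]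
    congr 1
    ext y
    by_cases hy : y ∈ U <;> simp [hy]
  rw [ind, ind]
  simp only [mul_neg, integral_neg] at hkey
  linarith

lemma eventually_fderiv_mollify {U : Set V} (hU : IsOpen U) {b g : V → ℝ} {e : V}
    (hb : MemLp b ∞ (volume.restrict U)) (h : HasWeakDeriv U e b g)
    {K : Set V} (hK : IsCompact K) (hKU : K ⊆ U) :
    ∀ᶠ k in atTop, ∀ x ∈ K, fderiv ℝ (mollify U k b) x e = mollify U k g x := by
  obtain ⟨δ, hδ, hδU⟩ := hK.exists_cthickening_subset_open hU hKU
  have := (tendsto_shrinkingBump_rOut (V := V)).eventually (gt_mem_nhds hδ)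
  filter_upwards [this] with k hk x hx
  refine fderiv_mollify hU.measurableSet hb h k ?_
  exact (Metric.closedBall_subset_closedBall hk.le).trans
    ((Metric.closedBall_subset_cthickening hx δ).trans hδU)

/-- Leibniz rule for the product with a bounded function with bounded weak derivative. -/
lemma HasWeakDeriv.mul_of_bounded {U : Set V} (hU : IsOpen U) {e : V} {b g u u' : V → ℝ}
    (hb : MemLp b ∞ (volume.restrict U)) (hg : MemLp g ∞ (volume.restrict U))
    (h : HasWeakDeriv U e b g) (hu : HasWeakDeriv U e u u') :
    HasWeakDeriv U e (fun x => b x * u x) (fun x => b x * u' x + g x * u x) := by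
  have hUm := hU.measurableSet
  have lmul : ∀ {b u : V → ℝ}, MemLp b ∞ (volume.restrict U) → LocallyIntegrableOn u U →
      LocallyIntegrableOn (fun x => b x * u x) U := by
    intro b u hb hu x hx
    obtain ⟨s, hs, hi⟩ := hu x hx
    refine ⟨s ∩ U, inter_mem hs self_mem_nhdsWithin, ?_⟩
    have h1 : Integrable u (volume.restrict (s ∩ U)) := hi.mono_set inter_subset_left
    have h2 : MemLp b ∞ (volume.restrict (s ∩ U)) :=
      hb.mono_measure (Measure.restrict_mono inter_subset_right le_rfl)
    exact (memLp_one_iff_integrable.1 ((memLp_one_iff_integrable.2 h1).mul h2))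
  refine ⟨lmul hb hu.1, (lmul hb hu.2.1).add (lmul hg hu.1), fun φ hφ => ?_⟩
  have hφ' := hφ.fderiv_apply e
  have iu := hφ.integrable_mul hu.1
  have iu' := hφ.integrable_mul hu.2.1
  have iue := hφ'.integrable_mul hu.1
  -- For b in L^∞ the mollifications converge only almost everywhere, with a uniform bound;
  -- dominated convergence against a fixed integrable w suffices.
  have key : ∀ {b w : V → ℝ}, MemLp b ∞ (volume.restrict U) → Integrable w (volume.restrict U) →
      Tendsto (fun k => ∫ x in U, mollify U k b x * w x) atTop (𝓝 (∫ x in U, b x * w x)) := by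
    intro b w hb hw
    refine tendsto_integral_of_dominated_convergence
      (fun x => (eLpNorm b ∞ (volume.restrict U)).toReal * ‖w x‖) ?_ (hw.norm.const_mul _) ?_ ?_
    · intro k
      exact (contDiff_mollify hUm hb k).continuous.aestronglyMeasurable.mul hw.aestronglyMeasurable
    · intro k
      refine Eventually.of_forall fun x => ?_
      rw [norm_mul]
      gcongr
      exact abs_mollify_le hUm hb k x
    · filter_upwards [ae_tendsto_mollify hUm hb] with x hx
      exact hx.mul_const _
  have imol : ∀ {b w : V → ℝ}, MemLp b ∞ (volume.restrict U) → Integrable w (volume.restrict U) →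
      ∀ k, Integrable (fun x => mollify U k b x * w x) (volume.restrict U) := by
    intro b w hb hw k
    refine hw.bdd_mul (c := (eLpNorm b ∞ (volume.restrict U)).toReal)
      (contDiff_mollify hUm hb k).continuous.aestronglyMeasurable
      (Eventually.of_forall fun x => ?_)
    exact abs_mollify_le hUm hb k x
  have hlim := ((key hb iue).add (key hg iu)).add (key hb iu')
  -- Once b is replaced by its smooth mollification, its product with φ is a test function for u. On
  -- the support of φ the gradient of the mollification is eventually the mollification of g, and
  -- off the support every term vanishes.
  have hzero : ∀ᶠ k in atTop, (∫ x in U, mollify U k b x * (u x * fderiv ℝ φ x e))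
      + (∫ x in U, mollify U k g x * (u x * φ x))
      + (∫ x in U, mollify U k b x * (u' x * φ x)) = 0 := by
    filter_upwards [eventually_fderiv_mollify hU hb h hφ.2.1 hφ.2.2] with k hk
    have h1 := hu.2.2 _ (hφ.smooth_mul (contDiff_mollify hUm hb k))
    have h2 : ∀ x, u x * fderiv ℝ (fun x => mollify U k b x * φ x) x e
        = mollify U k b x * (u x * fderiv ℝ φ x e) + mollify U k g x * (u x * φ x) := by
      intro x
      rw [fderiv_mul_apply ((contDiff_mollify hUm hb k).differentiable (by simp)) hφ.differentiable]
      by_cases hx : x ∈ tsupport φ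
      · rw [hk x hx]; ring
      · rw [hφ.eq_zero_of_notMem hx]; ring
    simp_rw [h2] at h1
    rw [integral_add (imol hb iue k) (imol hg iu k)] at h1
    rw [h1]
    have : ∀ x, u' x * (mollify U k b x * φ x) = mollify U k b x * (u' x * φ x) := by
      intro x; ring
    simp_rw [this]
    ring
  have h0 := tendsto_nhds_unique hlim (tendsto_const_nhds.congr' (hzero.mono fun k hk => hk.symm))
  have ib : ∀ {b w : V → ℝ}, MemLp b ∞ (volume.restrict U) → Integrable w (volume.restrict U) →
      Integrable (fun x => b x * w x) (volume.restrict U) := fun hb hw =>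
    memLp_one_iff_integrable.1 ((memLp_one_iff_integrable.2 hw).mul hb)
  have e1 : ∀ x, b x * u x * fderiv ℝ φ x e = b x * (u x * fderiv ℝ φ x e) := fun x => by ring
  have e2 : ∀ x, (b x * u' x + g x * u x) * φ x = g x * (u x * φ x) + b x * (u' x * φ x) :=
    fun x => by ring
  simp_rw [e1, e2]
  rw [integral_add (ib hg iu) (ib hb iu')]
  linarith

end Mollification

/-! ### Pairings of square integrable functions. -/

section SquareIntegrable

variable {X : Type*} [MeasurableSpace X] {ν : Measure X}

lemma integrable_mul_of_memLp_two {f g : X → ℝ} (hf : MemLp f 2 ν) (hg : MemLp g 2 ν) :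
    Integrable (fun x => f x * g x) ν :=
  memLp_one_iff_integrable.1 (hg.mul hf)

lemma abs_integral_mul_le {f g : X → ℝ} (hf : MemLp f 2 ν) (hg : MemLp g 2 ν) :
    |∫ x, f x * g x ∂ν| ≤ (eLpNorm f 2 ν).toReal * (eLpNorm g 2 ν).toReal := by
  have h1 : ‖∫ x, f x * g x ∂ν‖ₑ ≤ eLpNorm f 2 ν * eLpNorm g 2 ν := by
    calc ‖∫ x, f x * g x ∂ν‖ₑ ≤ ∫⁻ x, ‖f x * g x‖ₑ ∂ν := enorm_integral_le_lintegral_enorm _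
      _ = eLpNorm (f • g) 1 ν := by rw [eLpNorm_one_eq_lintegral_enorm]; rfl
      _ ≤ _ := eLpNorm_smul_le_mul_eLpNorm hg.1 hf.1
  have := ENNReal.toReal_mono (ENNReal.mul_ne_top hf.eLpNorm_ne_top hg.eLpNorm_ne_top) h1
  simpa [ENNReal.toReal_mul] using this

lemma memLp_bounded_mul {b u : X → ℝ} {r : ℝ≥0∞} (hb : MemLp b ∞ ν) (hu : MemLp u r ν) :
    MemLp (fun x => b x * u x) r ν :=
  hu.mul hb

lemma eLpNorm_bounded_mul_le {b u : X → ℝ} {r : ℝ≥0∞} (hb : MemLp b ∞ ν) (hu : MemLp u r ν) :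
    eLpNorm (fun x => b x * u x) r ν ≤ eLpNorm b ∞ ν * eLpNorm u r ν := by
  have := eLpNorm_smul_le_mul_eLpNorm (p := ∞) (q := r) (r := r) hu.1 hb.1
  exact this

lemma memLp_top_ae_bound {b : X → ℝ} (hb : MemLp b ∞ ν) :
    ∀ᵐ x ∂ν, |b x| ≤ (eLpNorm b ∞ ν).toReal := by
  simp only [eLpNorm_exponent_top]
  filter_upwards [ae_le_eLpNormEssSup (f := b) (μ := ν)] with y hy
  have := ENNReal.toReal_mono (by simpa using hb.eLpNorm_ne_top) hy
  simpa using this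

lemma tendsto_integral_mul {ι : Type*} {l : Filter ι} {f g : ι → X → ℝ} {f0 g0 : X → ℝ}
    (hf : ∀ᶠ i in l, MemLp (f i) 2 ν) (hg : ∀ᶠ i in l, MemLp (g i) 2 ν)
    (hf0 : MemLp f0 2 ν) (hg0 : MemLp g0 2 ν)
    (hfl : Tendsto (fun i => eLpNorm (fun x => f i x - f0 x) 2 ν) l (𝓝 0))
    (hgl : Tendsto (fun i => eLpNorm (fun x => g i x - g0 x) 2 ν) l (𝓝 0)) :
    Tendsto (fun i => ∫ x, f i x * g i x ∂ν) l (𝓝 (∫ x, f0 x * g0 x ∂ν)) := by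
  have tf := (ENNReal.tendsto_toReal ENNReal.zero_ne_top).comp hfl
  have tg := (ENNReal.tendsto_toReal ENNReal.zero_ne_top).comp hgl
  simp only [ENNReal.toReal_zero] at tf tg
  rw [← tendsto_sub_nhds_zero_iff]
  have hb : Tendsto (fun i => (eLpNorm (fun x => f i x - f0 x) 2 ν).toReal *
      (eLpNorm (fun x => g i x - g0 x) 2 ν).toReal
      + (eLpNorm (fun x => f i x - f0 x) 2 ν).toReal * (eLpNorm g0 2 ν).toReal
      + (eLpNorm f0 2 ν).toReal * (eLpNorm (fun x => g i x - g0 x) 2 ν).toReal) l (𝓝 0) := by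
    have := ((tf.mul tg).add (tf.mul_const (eLpNorm g0 2 ν).toReal)).add
      (tg.const_mul (eLpNorm f0 2 ν).toReal)
    simpa using this
  refine squeeze_zero_norm' ?_ hb
  filter_upwards [hf, hg] with i hfi hgi
  have hdf := hfi.sub hf0
  have hdg := hgi.sub hg0
  -- Expanding around the limits makes every term contain a difference, so no uniform bound on the
  -- norms of f_i or g_i is required.
  have e : ∫ x, f i x * g i x ∂ν - ∫ x, f0 x * g0 x ∂ν
      = ∫ x, (f i x - f0 x) * (g i x - g0 x) ∂ν + ∫ x, (f i x - f0 x) * g0 x ∂ν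
        + ∫ x, f0 x * (g i x - g0 x) ∂ν := by
    have i1 := integrable_mul_of_memLp_two hdf hdg
    have i2 := integrable_mul_of_memLp_two hdf hg0
    have i3 := integrable_mul_of_memLp_two hf0 hdg
    simp only [Pi.sub_apply] at i1 i2 i3
    rw [← integral_sub (integrable_mul_of_memLp_two hfi hgi) (integrable_mul_of_memLp_two hf0 hg0),
      ← integral_add i1 i2, ← integral_add (by exact i1.add i2) i3]
    congr 1
    ext x
    ring
  rw [e, Real.norm_eq_abs]
  refine (abs_add_three _ _ _).trans ?_
  exact add_le_add_three (abs_integral_mul_le hdf hdg) (abs_integral_mul_le hdf hg0)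
    (abs_integral_mul_le hf0 hdg)

lemma tendsto_integral_const_mul {ι : Type*} {l : Filter ι} {f0 : X → ℝ} {g : ι → X → ℝ} {g0 : X → ℝ}
    (hg : ∀ᶠ i in l, MemLp (g i) 2 ν) (hf0 : MemLp f0 2 ν) (hg0 : MemLp g0 2 ν)
    (hgl : Tendsto (fun i => eLpNorm (fun x => g i x - g0 x) 2 ν) l (𝓝 0)) :
    Tendsto (fun i => ∫ x, f0 x * g i x ∂ν) l (𝓝 (∫ x, f0 x * g0 x ∂ν)) :=
  tendsto_integral_mul (f := fun _ => f0) (Eventually.of_forall fun _ => hf0) hg hf0 hg0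
    (by simpa using tendsto_const_nhds) hgl

/-- Dominated convergence in `L²`. -/
lemma tendsto_eLpNorm_bounded_mul {b : ℕ → X → ℝ} {w : X → ℝ} {C : ℝ}
    (hb : ∀ k, AEStronglyMeasurable (b k) ν) (hC : ∀ k, ∀ᵐ x ∂ν, |b k x| ≤ C)
    (hlim : ∀ᵐ x ∂ν, Tendsto (fun k => b k x) atTop (𝓝 0)) (hw : MemLp w 2 ν) :
    Tendsto (fun k => eLpNorm (fun x => b k x * w x) 2 ν) atTop (𝓝 0) := by
  simp_rw [eLpNorm_eq_lintegral_rpow_enorm_toReal (p := 2) (by simp) (by simp)]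
  have h1 : Tendsto (fun k => ∫⁻ x, ‖b k x * w x‖ₑ ^ (2 : ℝ≥0∞).toReal ∂ν) atTop (𝓝 0) := by
    have := tendsto_lintegral_of_dominated_convergence' (μ := ν)
      (F := fun k x => ‖b k x * w x‖ₑ ^ (2 : ℝ≥0∞).toReal) (f := fun _ => 0)
      (fun x => ‖C * w x‖ₑ ^ (2 : ℝ≥0∞).toReal)
      (fun k => (((hb k).mul hw.1).enorm).pow_const _) ?_ ?_ ?_
    · simpa using this
    · intro k
      filter_upwards [hC k] with x hx
      gcongr
      rw [enorm_mul, enorm_mul]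
      gcongr
      rw [enorm_le_iff_norm_le]
      exact hx.trans (le_abs_self C)
    · have := lintegral_rpow_enorm_lt_top_of_eLpNorm_lt_top (by simp) (by simp) (hw.const_mul C).2
      exact this.ne
    · filter_upwards [hlim] with x hx
      have h2 : Tendsto (fun k => ‖b k x * w x‖ₑ) atTop (𝓝 0) := by
        have := (hx.mul_const (w x)).enorm
        simpa using this
      have := (ENNReal.continuous_rpow_const (y := (2 : ℝ≥0∞).toReal)).continuousAt.tendsto.comp h2
      simpa [Function.comp_def] using this
  have := (ENNReal.continuous_rpow_const (y := 1 / (2 : ℝ≥0∞).toReal)).continuousAt.tendsto.comp h1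
  simpa [Function.comp_def] using this

end SquareIntegrable

/-! ### The space H^1_0(Ω): closedness, products, integration by parts, separability. -/

section SobolevSpaces

variable {n : ℕ} {Ω : Set (Space n)}

lemma MemW.memLp {r : ℝ≥0∞} {k : ℕ} {u : Space n → ℝ} (h : MemW Ω r k u) :
    MemLp u r (volume.restrict Ω) := by
  cases k with
  | zero => exact h
  | succ k => exact h.1

lemma MemW.congr {r : ℝ≥0∞} {k : ℕ} {u u' : Space n → ℝ} (h : MemW Ω r k u)
    (he : u =ᵐ[volume.restrict Ω] u') : MemW Ω r k u' := by
  cases k with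
  | zero => exact (memLp_congr_ae he).1 h
  | succ k =>
    refine ⟨(memLp_congr_ae he).1 h.1, fun i => ?_⟩
    obtain ⟨g, hg, hg'⟩ := h.2 i
    exact ⟨g, hg.congr he (ae_eq_refl g), hg'⟩

lemma MemW.hasWeakDeriv {r : ℝ≥0∞} {k : ℕ} {u : Space n → ℝ} (h : MemW Ω r (k + 1) u)
    (i : Fin n) : HasWeakDeriv Ω (unitVec i) u (wderiv Ω (unitVec i) u) := by
  obtain ⟨g, hg, -⟩ := h.2 i
  exact hg.wderiv_spec

lemma MemW.wderiv (hΩ : IsOpen Ω) {r : ℝ≥0∞} {k : ℕ} {u : Space n → ℝ} (h : MemW Ω r (k + 1) u)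
    (i : Fin n) : MemW Ω r k (wderiv Ω (unitVec i) u) := by
  obtain ⟨g, hg, hg'⟩ := h.2 i
  exact hg'.congr (hg.wderiv_ae_eq hΩ).symm

/-- `g i` are the weak derivatives of `u`, which is the limit of test functions in the
corresponding Sobolev norm. -/
structure IsH10Pair (Ω : Set (Space n)) (u : Space n → ℝ) (g : Fin n → Space n → ℝ) : Prop where
  memLp : MemLp u 2 (volume.restrict Ω)
  hasWeakDeriv : ∀ i, HasWeakDeriv Ω (unitVec i) u (g i)
  memLp_deriv : ∀ i, MemLp (g i) 2 (volume.restrict Ω)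
  approx : ∀ ε : ℝ≥0∞, 0 < ε → ∃ φ, IsTestFunction Ω φ ∧
    eLpNorm (fun x => u x - φ x) 2 (volume.restrict Ω) ≤ ε ∧
    ∀ i, eLpNorm (fun x => g i x - fderiv ℝ φ x (unitVec i)) 2 (volume.restrict Ω) ≤ ε

lemma MemH10.pair (hΩ : IsOpen Ω) {u : Space n → ℝ} (h : MemH10 Ω u) :
    IsH10Pair Ω u (fun i => wderiv Ω (unitVec i) u) :=
  ⟨h.1.memLp, h.1.hasWeakDeriv, fun i => (h.1.wderiv hΩ i).memLp, h.2⟩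

namespace IsH10Pair

variable {u u' : Space n → ℝ} {g g' : Fin n → Space n → ℝ}

lemma memH10 (hΩ : IsOpen Ω) (h : IsH10Pair Ω u g) : MemH10 Ω u := by
  refine ⟨⟨h.memLp, fun i => ⟨g i, h.hasWeakDeriv i, h.memLp_deriv i⟩⟩, fun ε hε => ?_⟩
  obtain ⟨φ, h1, h2, h3⟩ := h.approx ε hε
  refine ⟨φ, h1, h2, fun i => ?_⟩
  refine le_of_eq_of_le (eLpNorm_congr_ae ?_) (h3 i)
  filter_upwards [(h.hasWeakDeriv i).wderiv_ae_eq hΩ] with x hx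
  rw [hx]

lemma congr (h : IsH10Pair Ω u g) (hu : u =ᵐ[volume.restrict Ω] u')
    (hg : ∀ i, g i =ᵐ[volume.restrict Ω] g' i) : IsH10Pair Ω u' g' := by
  refine ⟨(memLp_congr_ae hu).1 h.memLp, fun i => (h.hasWeakDeriv i).congr hu (hg i),
    fun i => (memLp_congr_ae (hg i)).1 (h.memLp_deriv i), fun ε hε => ?_⟩
  obtain ⟨φ, h1, h2, h3⟩ := h.approx ε hε
  refine ⟨φ, h1, le_of_eq_of_le (eLpNorm_congr_ae ?_) h2,
    fun i => le_of_eq_of_le (eLpNorm_congr_ae ?_) (h3 i)⟩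
  · filter_upwards [hu] with x hx
    rw [hx]
  · filter_upwards [hg i] with x hx
    rw [hx]

lemma of_test {φ : Space n → ℝ} (h : IsTestFunction Ω φ) :
    IsH10Pair Ω φ (fun i x => fderiv ℝ φ x (unitVec i)) := by
  refine ⟨(h.continuous.memLp_of_hasCompactSupport h.2.1).restrict Ω,
    fun i => HasWeakDeriv.of_contDiff (h.1.of_le (by simp)) Ω _,
    fun i => ?_, fun ε hε => ⟨φ, h, by simp, by simp⟩⟩
  have := h.fderiv_apply (unitVec i)
  exact (this.continuous.memLp_of_hasCompactSupport this.2.1).restrict Ω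

lemma exists_seq (h : IsH10Pair Ω u g) : ∃ φ : ℕ → Space n → ℝ, (∀ k, IsTestFunction Ω (φ k)) ∧
    Tendsto (fun k => eLpNorm (fun x => φ k x - u x) 2 (volume.restrict Ω)) atTop (𝓝 0) ∧
    ∀ i, Tendsto (fun k => eLpNorm (fun x => fderiv ℝ (φ k) x (unitVec i) - g i x) 2
      (volume.restrict Ω)) atTop (𝓝 0) := by
  choose φ h1 h2 h3 using fun k : ℕ => h.approx ((k : ℝ≥0∞) + 1)⁻¹ (by simp)
  have ht : Tendsto (fun k : ℕ => ((k : ℝ≥0∞) + 1)⁻¹) atTop (𝓝 0) := by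
    have := (ENNReal.tendsto_inv_nat_nhds_zero).comp (tendsto_add_atTop_nat 1)
    simpa [Function.comp_def] using this
  have hsymm : ∀ (a b : Space n → ℝ), eLpNorm (fun x => a x - b x) 2 (volume.restrict Ω)
      = eLpNorm (fun x => b x - a x) 2 (volume.restrict Ω) := fun a b => eLpNorm_sub_comm a b _ _
  refine ⟨φ, h1, ?_, fun i => ?_⟩
  · exact tendsto_of_tendsto_of_tendsto_of_le_of_le tendsto_const_nhds ht (fun _ => zero_le)
      (fun k => by rw [hsymm]; exact h2 k)
  · exact tendsto_of_tendsto_of_tendsto_of_le_of_le tendsto_const_nhds ht (fun _ => zero_le)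
      (fun k => by rw [hsymm]; exact h3 k i)

/-- Closedness of H^1_0 in H^1: membership of products and multiples is obtained by approximation.
-/
lemma of_tendsto (hu : MemLp u 2 (volume.restrict Ω))
    (hg : ∀ i, HasWeakDeriv Ω (unitVec i) u (g i)) (hg2 : ∀ i, MemLp (g i) 2 (volume.restrict Ω))
    {w : ℕ → Space n → ℝ} {wg : ℕ → Fin n → Space n → ℝ}
    (hw : ∀ k, IsH10Pair Ω (w k) (wg k))
    (h1 : Tendsto (fun k => eLpNorm (fun x => w k x - u x) 2 (volume.restrict Ω)) atTop (𝓝 0))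
    (h2 : ∀ i, Tendsto (fun k => eLpNorm (fun x => wg k i x - g i x) 2 (volume.restrict Ω))
      atTop (𝓝 0)) : IsH10Pair Ω u g := by
  refine ⟨hu, hg, hg2, fun ε hε => ?_⟩
  have hε2 : 0 < ε / 2 := ENNReal.half_pos hε.ne'
  have e1 := h1.eventually (ge_mem_nhds hε2)
  have e2 := eventually_all.2 fun i => (h2 i).eventually (ge_mem_nhds hε2)
  obtain ⟨k, hk1, hk2⟩ := (e1.and e2).exists
  obtain ⟨φ, p1, p2, p3⟩ := (hw k).approx _ hε2
  have tri : ∀ {a b c : Space n → ℝ}, MemLp a 2 (volume.restrict Ω) → MemLp b 2 (volume.restrict Ω) →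
      MemLp c 2 (volume.restrict Ω) →
      eLpNorm (fun x => b x - a x) 2 (volume.restrict Ω) ≤ ε / 2 →
      eLpNorm (fun x => b x - c x) 2 (volume.restrict Ω) ≤ ε / 2 →
      eLpNorm (fun x => a x - c x) 2 (volume.restrict Ω) ≤ ε := by
    intro a b c ha hb hc hab hbc
    have h3 : (fun x => a x - c x) = (fun x => b x - c x) - (fun x => b x - a x) := by
      ext x; simp
    rw [h3]
    refine (eLpNorm_sub_le (hb.sub hc).1 (hb.sub ha).1 (by simp)).trans ?_
    calc _ ≤ ε / 2 + ε / 2 := add_le_add hbc hab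
      _ = ε := ENNReal.add_halves ε
  have hφ := of_test p1
  exact ⟨φ, p1, tri hu (hw k).memLp hφ.memLp hk1 p2, fun i =>
    tri (hg2 i) ((hw k).memLp_deriv i) (hφ.memLp_deriv i) (hk2 i) (p3 i)⟩

lemma add (h : IsH10Pair Ω u g) (h' : IsH10Pair Ω u' g') :
    IsH10Pair Ω (fun x => u x + u' x) (fun i x => g i x + g' i x) := by
  refine ⟨h.memLp.add h'.memLp, fun i => (h.hasWeakDeriv i).add (h'.hasWeakDeriv i),
    fun i => (h.memLp_deriv i).add (h'.memLp_deriv i), fun ε hε => ?_⟩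
  have hε2 : 0 < ε / 2 := ENNReal.half_pos hε.ne'
  obtain ⟨φ, p1, p2, p3⟩ := h.approx _ hε2
  obtain ⟨ψ, q1, q2, q3⟩ := h'.approx _ hε2
  have tri : ∀ {a b c d : Space n → ℝ}, MemLp a 2 (volume.restrict Ω) →
      MemLp b 2 (volume.restrict Ω) → MemLp c 2 (volume.restrict Ω) →
      MemLp d 2 (volume.restrict Ω) →
      eLpNorm (fun x => a x - c x) 2 (volume.restrict Ω) ≤ ε / 2 →
      eLpNorm (fun x => b x - d x) 2 (volume.restrict Ω) ≤ ε / 2 →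
      eLpNorm (fun x => (a x + b x) - (c x + d x)) 2 (volume.restrict Ω) ≤ ε := by
    intro a b c d ha hb hc hd h1 h2
    have h3 : (fun x => (a x + b x) - (c x + d x))
      = (fun x => a x - c x) + (fun x => b x - d x) := by ext x; simp; ring
    rw [h3]
    refine (eLpNorm_add_le (ha.sub hc).1 (hb.sub hd).1 (by simp)).trans ?_
    calc _ ≤ ε / 2 + ε / 2 := add_le_add h1 h2
      _ = ε := ENNReal.add_halves ε
  have hφ := of_test p1
  have hψ := of_test q1
  refine ⟨_, p1.add q1, tri h.memLp h'.memLp hφ.memLp hψ.memLp p2 q2, fun i => ?_⟩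
  have : ∀ x, fderiv ℝ (fun x => φ x + ψ x) x (unitVec i)
      = fderiv ℝ φ x (unitVec i) + fderiv ℝ ψ x (unitVec i) := by
    intro x
    rw [fderiv_fun_add (p1.differentiable x) (q1.differentiable x)]
    rfl
  simp_rw [this]
  exact tri (h.memLp_deriv i) (h'.memLp_deriv i) (hφ.memLp_deriv i) (hψ.memLp_deriv i) (p3 i) (q3 i)

/-- Products with functions in `W^{1,∞}`. -/
lemma bounded_mul (hΩ : IsOpen Ω) {b : Space n → ℝ} {d : Fin n → Space n → ℝ}
    (hb : MemLp b ∞ (volume.restrict Ω)) (hd : ∀ i, MemLp (d i) ∞ (volume.restrict Ω))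
    (hbd : ∀ i, HasWeakDeriv Ω (unitVec i) b (d i)) (h : IsH10Pair Ω u g) :
    IsH10Pair Ω (fun x => b x * u x) (fun i x => b x * g i x + d i x * u x) := by
  have hΩm := hΩ.measurableSet
  have formula : ∀ {u : Space n → ℝ} {g : Fin n → Space n → ℝ}, IsH10Pair Ω u g →
      MemLp (fun x => b x * u x) 2 (volume.restrict Ω) ∧
      (∀ i, HasWeakDeriv Ω (unitVec i) (fun x => b x * u x) (fun x => b x * g i x + d i x * u x)) ∧
      (∀ i, MemLp (fun x => b x * g i x + d i x * u x) 2 (volume.restrict Ω)) := fun h =>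
    ⟨memLp_bounded_mul hb h.memLp,
      fun i => HasWeakDeriv.mul_of_bounded hΩ hb (hd i) (hbd i) (h.hasWeakDeriv i),
      fun i => (memLp_bounded_mul hb (h.memLp_deriv i)).add (memLp_bounded_mul (hd i) h.memLp)⟩
  have conv : ∀ {b w : Space n → ℝ}, MemLp b ∞ (volume.restrict Ω) →
      MemLp w 2 (volume.restrict Ω) →
      Tendsto (fun k => eLpNorm (fun x => (mollify Ω k b x - b x) * w x) 2 (volume.restrict Ω))
        atTop (𝓝 0) := by
    intro b w hb hw
    refine tendsto_eLpNorm_bounded_mul (C := 2 * (eLpNorm b ∞ (volume.restrict Ω)).toReal)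
      (fun k => (contDiff_mollify hΩm hb k).continuous.aestronglyMeasurable.sub hb.1)
      (fun k => ?_) ?_ hw
    · filter_upwards [memLp_top_ae_bound hb] with x hx
      have := abs_mollify_le hΩm hb k x
      calc _ ≤ |mollify Ω k b x| + |b x| := abs_sub _ _
        _ ≤ _ := by linarith
    · filter_upwards [ae_tendsto_mollify hΩm hb] with x hx
      simpa using hx.sub_const (b x)
  -- For a test function φ, the mollified b times φ is a test function whose gradient has the right
  -- form once the mollification radius is small against the distance of the support to the
  -- boundary; hence the index shift by N.
  have step1 : ∀ {φ : Space n → ℝ}, IsTestFunction Ω φ →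
      IsH10Pair Ω (fun x => b x * φ x)
        (fun i x => b x * fderiv ℝ φ x (unitVec i) + d i x * φ x) := by
    intro φ hφ
    have hφp := of_test hφ
    obtain ⟨f1, f2, f3⟩ := formula hφp
    have hev := eventually_all.2 fun i =>
      eventually_fderiv_mollify hΩ hb (hbd i) hφ.2.1 hφ.2.2
    obtain ⟨N, hN⟩ := eventually_atTop.1 hev
    refine of_tendsto f1 f2 f3
      (fun k => of_test (hφ.smooth_mul (contDiff_mollify hΩm hb (k + N)))) ?_ fun i => ?_
    · have := (conv hb hφp.memLp).comp (tendsto_add_atTop_nat N)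
      refine this.congr fun k => ?_
      exact congrArg (fun f => eLpNorm f 2 (volume.restrict Ω)) (funext fun x => sub_mul _ _ _)
    · have t1 := (conv hb (hφp.memLp_deriv i)).comp (tendsto_add_atTop_nat N)
      have t2 := (conv (hd i) hφp.memLp).comp (tendsto_add_atTop_nat N)
      have t3 := t1.add t2
      rw [add_zero] at t3
      refine tendsto_of_tendsto_of_tendsto_of_le_of_le tendsto_const_nhds t3 (fun _ => zero_le)
        (fun k => ?_)
      refine le_trans (le_of_eq ?_) (eLpNorm_add_le ?_ ?_ (by simp))
      · congr 1
        ext x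
        rw [fderiv_mul_apply ((contDiff_mollify hΩm hb _).differentiable (by simp))
          hφ.differentiable]
        by_cases hx : x ∈ tsupport φ
        · rw [hN (k + N) (by simp) i x hx]
          simp only [Pi.add_apply]
          ring
        · simp only [Pi.add_apply, hφ.eq_zero_of_notMem hx]
          ring
      · exact ((contDiff_mollify hΩm hb _).continuous.aestronglyMeasurable.sub hb.1).mul
          (hφp.memLp_deriv i).1
      · exact ((contDiff_mollify hΩm (hd i) _).continuous.aestronglyMeasurable.sub (hd i).1).mul
          hφp.memLp.1
  obtain ⟨f1, f2, f3⟩ := formula h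
  obtain ⟨φ, hφ, h1, h2⟩ := h.exists_seq
  -- A general u is approximated by test functions: multiplication by b and by its derivatives is
  -- bounded on L², so the convergence survives.
  have small : ∀ {b w : Space n → ℝ} {ψ : ℕ → Space n → ℝ}, MemLp b ∞ (volume.restrict Ω) →
      (∀ k, MemLp (ψ k) 2 (volume.restrict Ω)) → MemLp w 2 (volume.restrict Ω) →
      Tendsto (fun k => eLpNorm (fun x => ψ k x - w x) 2 (volume.restrict Ω)) atTop (𝓝 0) →
      Tendsto (fun k => eLpNorm (fun x => b x * (ψ k x - w x)) 2 (volume.restrict Ω))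
        atTop (𝓝 0) := by
    intro b w ψ hb hψ hw ht
    have := ENNReal.Tendsto.const_mul (a := eLpNorm b ∞ (volume.restrict Ω)) ht
      (Or.inr hb.eLpNorm_ne_top)
    rw [mul_zero] at this
    exact tendsto_of_tendsto_of_tendsto_of_le_of_le tendsto_const_nhds this (fun _ => zero_le)
      (fun k => eLpNorm_bounded_mul_le hb ((hψ k).sub hw))
  have hφp := fun k => of_test (hφ k)
  refine of_tendsto f1 f2 f3 (fun k => step1 (hφ k)) ?_ fun i => ?_
  · refine (small hb (fun k => (hφp k).memLp) h.memLp h1).congr fun k => ?_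
    exact congrArg (fun f => eLpNorm f 2 (volume.restrict Ω)) (funext fun x => mul_sub _ _ _)
  · have t1 := small hb (fun k => (hφp k).memLp_deriv i) (h.memLp_deriv i) (h2 i)
    have t2 := small (hd i) (fun k => (hφp k).memLp) h.memLp h1
    have t3 := t1.add t2
    rw [add_zero] at t3
    refine tendsto_of_tendsto_of_tendsto_of_le_of_le tendsto_const_nhds t3 (fun _ => zero_le)
        (fun k => ?_)
    refine le_trans (le_of_eq ?_) (eLpNorm_add_le ?_ ?_ (by simp))
    · congr 1
      ext x
      simp only [Pi.add_apply]
      ring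
    · exact hb.1.mul (((hφp k).memLp_deriv i).sub (h.memLp_deriv i)).1
    · exact (hd i).1.mul ((hφp k).memLp.sub h.memLp).1

lemma const_mul (h : IsH10Pair Ω u g) (a : ℝ) :
    IsH10Pair Ω (fun x => a * u x) (fun i x => a * g i x) := by
  obtain ⟨φ, hφ, h1, h2⟩ := h.exists_seq
  have small : ∀ {w : Space n → ℝ} {ψ : ℕ → Space n → ℝ},
      Tendsto (fun k => eLpNorm (fun x => ψ k x - w x) 2 (volume.restrict Ω)) atTop (𝓝 0) →
      Tendsto (fun k => eLpNorm (fun x => a * ψ k x - a * w x) 2 (volume.restrict Ω))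
        atTop (𝓝 0) := by
    intro w ψ ht
    have := ENNReal.Tendsto.const_mul (a := ‖a‖ₑ) ht (Or.inr (by simp))
    rw [mul_zero] at this
    refine this.congr fun k => ?_
    rw [← eLpNorm_const_smul]
    congr 1
    ext x
    simp [mul_sub]
  refine of_tendsto (h.memLp.const_mul a) (fun i => (h.hasWeakDeriv i).const_mul a)
    (fun i => (h.memLp_deriv i).const_mul a) (fun k => of_test ((hφ k).const_mul a)) (small h1)
    fun i => (small (h2 i)).congr fun k => ?_
  congr 1
  ext x
  rw [fderiv_const_mul ((hφ k).differentiable x)]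
  simp

lemma zero : IsH10Pair Ω (fun _ => (0 : ℝ)) (fun _ _ => 0) := by
  simpa using of_test (Ω := Ω) IsTestFunction.zero

lemma sub (h : IsH10Pair Ω u g) (h' : IsH10Pair Ω u' g') :
    IsH10Pair Ω (fun x => u x - u' x) (fun i x => g i x - g' i x) := by
  simpa [sub_eq_add_neg] using h.add (h'.const_mul (-1))

/-- Integration by parts against a function that vanishes on the boundary. -/
lemma integral_by_parts (h : IsH10Pair Ω u g) {F G : Space n → ℝ} {i : Fin n}
    (hF : MemLp F 2 (volume.restrict Ω)) (hG : MemLp G 2 (volume.restrict Ω))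
    (hFG : ∀ φ, IsTestFunction Ω φ →
      ∫ x in Ω, F x * fderiv ℝ φ x (unitVec i) = - ∫ x in Ω, G x * φ x) :
    ∫ x in Ω, F x * g i x = - ∫ x in Ω, G x * u x := by
  obtain ⟨φ, hφ, h1, h2⟩ := h.exists_seq
  have hφp := fun k => of_test (hφ k)
  have t1 := tendsto_integral_const_mul (Eventually.of_forall fun k => (hφp k).memLp_deriv i) hF
    (h.memLp_deriv i) (h2 i)
  have t2 := (tendsto_integral_const_mul (Eventually.of_forall fun k => (hφp k).memLp) hG
    h.memLp h1).neg
  refine tendsto_nhds_unique t1 (t2.congr fun k => ?_)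
  rw [hFG _ (hφ k)]

end IsH10Pair

/-- There is a countable set of test functions that is dense in the Sobolev norm. -/
lemma exists_countable_dense_test (Ω : Set (Space n)) : ∃ D : Set (Space n → ℝ), D.Countable ∧
    (∀ φ ∈ D, IsTestFunction Ω φ) ∧ ∀ φ, IsTestFunction Ω φ → ∀ ε : ℝ≥0∞, 0 < ε →
      ∃ ψ ∈ D, eLpNorm (fun x => ψ x - φ x) 2 (volume.restrict Ω) ≤ ε ∧
        ∀ i, eLpNorm (fun x => fderiv ℝ ψ x (unitVec i) - fderiv ℝ φ x (unitVec i)) 2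
          (volume.restrict Ω) ≤ ε := by
  let ν : Measure (Space n) := volume.restrict Ω
  let Test := {φ : Space n → ℝ // IsTestFunction Ω φ}
  -- The map φ ↦ (φ, ∇φ) places the test functions in a separable metric space, so its image has a
  -- countable dense subset. Countability matters because an exceptional null set of times has to
  -- serve all test functions at once.
  let Φ : Test → Lp ℝ 2 ν × (Fin n → Lp ℝ 2 ν) := fun φ =>
    ((IsH10Pair.of_test φ.2).memLp.toLp _,
      fun i => ((IsH10Pair.of_test φ.2).memLp_deriv i).toLp _)
  have hne : Fact ((2 : ℝ≥0∞) ≠ ⊤) := ⟨by simp⟩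
  have : SFinite ν := inferInstanceAs (SFinite (volume.restrict Ω))
  have : SecondCountableTopology (Lp ℝ 2 ν) := inferInstance
  obtain ⟨t, hts, htc, hst⟩ :=
    (TopologicalSpace.IsSeparable.of_separableSpace (range Φ)).exists_countable_dense_subset
  have : Nonempty Test := ⟨⟨_, IsTestFunction.zero⟩⟩
  choose! f hf using fun a (ha : a ∈ t) => hts ha
  refine ⟨(fun a => (f a : Space n → ℝ)) '' t, htc.image _, ?_, ?_⟩
  · rintro _ ⟨a, -, rfl⟩
    exact (f a).2
  · intro φ hφ ε hε
    have h1 : Φ ⟨φ, hφ⟩ ∈ closure t := hst (mem_range_self _)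
    obtain ⟨a, hat, ha⟩ := EMetric.mem_closure_iff.1 h1 ε hε
    refine ⟨f a, mem_image_of_mem _ hat, ?_⟩
    rw [← hf a hat, edist_comm, Prod.edist_eq, max_lt_iff] at ha
    obtain ⟨ha1, ha2⟩ := ha
    constructor
    · rw [Lp.edist_def] at ha1
      refine le_of_eq_of_le (eLpNorm_congr_ae ?_) ha1.le
      filter_upwards [(IsH10Pair.of_test (f a).2).memLp.coeFn_toLp,
        (IsH10Pair.of_test hφ).memLp.coeFn_toLp] with x h2 h3
      simp [Φ, h2, h3]
    · intro i
      have ha3 := (edist_le_pi_edist _ _ i).trans ha2.le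
      rw [Lp.edist_def] at ha3
      refine le_of_eq_of_le (eLpNorm_congr_ae ?_) ha3
      filter_upwards [((IsH10Pair.of_test (f a).2).memLp_deriv i).coeFn_toLp,
        ((IsH10Pair.of_test hφ).memLp_deriv i).coeFn_toLp] with x h2 h3
      simp [Φ, h2, h3]

end SobolevSpaces

/-! ### Primitives and weak derivatives on (0,T). -/

section OneVariable

lemma setIntegral_Ioo_eq_intervalIntegral {a b : ℝ} (h : a ≤ b) (f : ℝ → ℝ) :
    ∫ t in Ioo a b, f t = ∫ t in a..b, f t := by
  rw [intervalIntegral.integral_of_le h, integral_Ioc_eq_integral_Ioo]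

lemma intervalIntegrable_of_Ioo {T : ℝ} {f : ℝ → ℝ} (hf : IntegrableOn f (Ioo 0 T)) {s t : ℝ}
    (hs : s ∈ Icc 0 T) (ht : t ∈ Icc 0 T) : IntervalIntegrable f volume s t := by
  have h1 : IntegrableOn f (Icc 0 T) := by
    rwa [integrableOn_Icc_iff_integrableOn_Ioo]
  rw [intervalIntegrable_iff']
  exact h1.mono_set ((uIcc_subset_Icc hs ht))

lemma continuousOn_primitive_Ioo {T : ℝ} {f : ℝ → ℝ} (hT : 0 ≤ T) (hf : IntegrableOn f (Ioo 0 T)) :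
    ContinuousOn (fun t => ∫ s in (0 : ℝ)..t, f s) (Icc 0 T) := by
  have h1 : IntegrableOn f (uIcc 0 T) := by
    rw [uIcc_of_le hT]
    rwa [integrableOn_Icc_iff_integrableOn_Ioo]
  have := intervalIntegral.continuousOn_primitive_interval h1
  rwa [uIcc_of_le hT] at this

/-- Fubini's theorem for a primitive integrated against a measure. -/
lemma integral_primitive_mul {T : ℝ} {ν : Measure ℝ} [SFinite ν] {m ψ : ℝ → ℝ}
    (hm : IntegrableOn m (Ioc 0 T) ν) (hψ : IntegrableOn ψ (Ioo 0 T)) :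
    ∫ t in Ioc 0 T, (∫ s in (0 : ℝ)..t, ψ s) * m t ∂ν
      = ∫ s in Ioo 0 T, ψ s * ∫ t in Icc s T, m t ∂ν := by
  have hmeas : MeasurableSet {x : ℝ × ℝ | x.1 ≤ x.2} := measurableSet_le measurable_fst measurable_snd
  -- The triangle contains its diagonal, so the tail over `Icc s T` includes an atom of ν at s; for
  -- Stieltjes measures this decides which one-sided limit sees the atom.
  have hF : Integrable ({x : ℝ × ℝ | x.1 ≤ x.2}.indicator (fun x => ψ x.1 * m x.2))
      ((volume.restrict (Ioo 0 T)).prod (ν.restrict (Ioc 0 T))) :=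
    (Integrable.mul_prod hψ hm).indicator hmeas
  have hsw := integral_integral_swap (μ := volume.restrict (Ioo 0 T)) (ν := ν.restrict (Ioc 0 T))
    (f := fun s t => ({x : ℝ × ℝ | x.1 ≤ x.2}.indicator (fun x => ψ x.1 * m x.2)) (s, t)) hF
  have h1 : ∀ t ∈ Ioc 0 T, ∫ s in Ioo 0 T,
      ({x : ℝ × ℝ | x.1 ≤ x.2}.indicator (fun x => ψ x.1 * m x.2)) (s, t)
      = (∫ s in (0 : ℝ)..t, ψ s) * m t := by
    intro t ht
    have : ∀ s, ({x : ℝ × ℝ | x.1 ≤ x.2}.indicator (fun x => ψ x.1 * m x.2)) (s, t)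
        = (Iic t).indicator ψ s * m t := by
      intro s
      by_cases hst : s ≤ t <;> simp [indicator, hst]
    simp_rw [this]
    rw [integral_mul_const, intervalIntegral.integral_of_le ht.1.le, setIntegral_indicator measurableSet_Iic,
      ← integral_Icc_eq_integral_Ioc]
    congr 1
    apply setIntegral_congr_set
    have e1 : (Ioo 0 T ∩ Iic t : Set ℝ) =ᵐ[volume] (Icc 0 T ∩ Iic t : Set ℝ) :=
      Ioo_ae_eq_Icc.inter (ae_eq_refl _)
    refine e1.trans ?_
    refine Eq.eventuallyEq (show (Icc 0 T ∩ Iic t : Set ℝ) = Icc 0 t by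
      ext s; simp only [mem_inter_iff, mem_Icc, mem_Iic]
      exact ⟨fun h => ⟨h.1.1, h.2⟩, fun h => ⟨⟨h.1, h.2.trans ht.2⟩, h.2⟩⟩)
  have h2 : ∀ s ∈ Ioo 0 T, ∫ t in Ioc 0 T,
      ({x : ℝ × ℝ | x.1 ≤ x.2}.indicator (fun x => ψ x.1 * m x.2)) (s, t) ∂ν
      = ψ s * ∫ t in Icc s T, m t ∂ν := by
    intro s hs
    have : ∀ t, ({x : ℝ × ℝ | x.1 ≤ x.2}.indicator (fun x => ψ x.1 * m x.2)) (s, t)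
        = ψ s * (Ici s).indicator m t := by
      intro t
      by_cases hst : s ≤ t <;> simp [indicator, hst]
    simp_rw [this]
    rw [integral_const_mul, setIntegral_indicator measurableSet_Ici]
    congr 3
    ext t
    simp only [mem_inter_iff, mem_Ioc, mem_Ici, mem_Icc]
    exact ⟨fun h => ⟨h.2, h.1.2⟩, fun h => ⟨⟨hs.1.trans_le h.1, h.2⟩, h.1⟩⟩
  rw [← setIntegral_congr_fun measurableSet_Ioc h1, ← setIntegral_congr_fun measurableSet_Ioo h2]
  exact hsw.symm

lemma integral_primitive_mul_volume {T : ℝ} {m ψ : ℝ → ℝ}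
    (hm : IntegrableOn m (Ioo 0 T)) (hψ : IntegrableOn ψ (Ioo 0 T)) :
    ∫ t in Ioo 0 T, (∫ s in (0 : ℝ)..t, ψ s) * m t
      = ∫ s in Ioo 0 T, ψ s * ∫ t in s..T, m t := by
  have := integral_primitive_mul (ν := volume) (by rwa [integrableOn_Ioc_iff_integrableOn_Ioo]) hψ
  rw [integral_Ioc_eq_integral_Ioo] at this
  rw [this]
  refine setIntegral_congr_fun measurableSet_Ioo fun s hs => ?_
  rw [intervalIntegral.integral_of_le hs.2.le, integral_Icc_eq_integral_Ioc]

lemma deriv_primitive_ae {T : ℝ} (hT : 0 ≤ T) {f : ℝ → ℝ} (hf : IntegrableOn f (Ioo 0 T)) (a : ℝ) :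
    ∀ᵐ t, t ∈ uIcc 0 T → deriv (fun t => a + ∫ s in (0 : ℝ)..t, f s) t = f t := by
  have hi := intervalIntegrable_of_Ioo hf (left_mem_Icc.2 hT) (right_mem_Icc.2 hT)
  have := hi.ae_hasDerivAt_integral
  filter_upwards [this] with t ht hm
  exact ((ht hm 0 (by simp)).const_add a).deriv

/-- Leibniz rule for primitives. -/
lemma primitive_mul_primitive {T : ℝ} (hT : 0 ≤ T) {f g : ℝ → ℝ} (hf : IntegrableOn f (Ioo 0 T))
    (hg : IntegrableOn g (Ioo 0 T)) (a b : ℝ) {t : ℝ} (ht : t ∈ Icc 0 T) :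
    (a + ∫ s in (0 : ℝ)..t, f s) * (b + ∫ s in (0 : ℝ)..t, g s)
      = a * b + ∫ r in (0 : ℝ)..t, (f r * (b + ∫ s in (0 : ℝ)..r, g s)
        + (a + ∫ s in (0 : ℝ)..r, f s) * g r) := by
  have hsub : Ioo 0 t ⊆ Ioo 0 T := Ioo_subset_Ioo_right ht.2
  -- With f and g merely integrable the primitives are only absolutely continuous, which is enough
  -- for the fundamental theorem applied to their product.
  have ac : ∀ {f : ℝ → ℝ} (a : ℝ), IntegrableOn f (Ioo 0 T) →
      AbsolutelyContinuousOnInterval (fun t => a + ∫ s in (0 : ℝ)..t, f s) 0 t := by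
    intro f a hf
    have hi := intervalIntegrable_of_Ioo hf (left_mem_Icc.2 hT) ht
    have h1 := hi.absolutelyContinuousOnInterval_intervalIntegral (c := 0) (by simp)
    have h2 : AbsolutelyContinuousOnInterval (fun _ : ℝ => a) 0 t :=
      (contDiff_const (n := 1)).contDiffOn.absolutelyContinuousOnInterval
    exact h2.add h1
  have h := (ac a hf).integral_deriv_mul_eq_sub (ac b hg)
  have d1 := deriv_primitive_ae ht.1 (hf.mono_set hsub) a
  have d2 := deriv_primitive_ae ht.1 (hg.mono_set hsub) b
  rw [intervalIntegral.integral_congr_ae (g := fun r => f r * (b + ∫ s in (0 : ℝ)..r, g s)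
        + (a + ∫ s in (0 : ℝ)..r, f s) * g r)] at h
  · rw [h]; simp
  · filter_upwards [d1, d2] with r h1 h2 hr
    rw [h1 (uIoc_subset_uIcc hr), h2 (uIoc_subset_uIcc hr)]

lemma integrableOn_primitive_mul {T : ℝ} (hT : 0 ≤ T) {f g : ℝ → ℝ} (hf : IntegrableOn f (Ioo 0 T))
    (hg : IntegrableOn g (Ioo 0 T)) (a : ℝ) :
    IntegrableOn (fun r => (a + ∫ s in (0 : ℝ)..r, f s) * g r) (Ioo 0 T) := by
  have h1 : IntegrableOn g (Icc 0 T) := by rwa [integrableOn_Icc_iff_integrableOn_Ioo]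
  exact (h1.continuousOn_mul (continuousOn_const.add (continuousOn_primitive_Ioo hT hf))
    isCompact_Icc).mono_set Ioo_subset_Icc_self

lemma IsTestFunction.exists_Icc {T : ℝ} {ψ : ℝ → ℝ} (hT : 0 < T) (h : IsTestFunction (Ioo 0 T) ψ) :
    ∃ a b, 0 < a ∧ a ≤ b ∧ b < T ∧ ∀ t, t ∉ Icc a b → ψ t = 0 := by
  obtain hK | hK := (tsupport ψ).eq_empty_or_nonempty
  · refine ⟨T / 2, T / 2, by linarith, le_rfl, by linarith, fun t _ => ?_⟩
    exact h.eq_zero_of_notMem (by simp [hK])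
  · obtain ⟨a, ha⟩ := IsCompact.exists_isLeast h.2.1 hK
    obtain ⟨b, hb⟩ := IsCompact.exists_isGreatest h.2.1 hK
    refine ⟨a, b, (h.2.2 ha.1).1, ha.2 hb.1, (h.2.2 hb.1).2, fun t ht => ?_⟩
    exact h.eq_zero_of_notMem fun hm => ht ⟨ha.2 hm, hb.2 hm⟩

lemma hasDerivAt_primitive {ψ : ℝ → ℝ} (h : Continuous ψ) (t : ℝ) :
    HasDerivAt (fun t => ∫ s in (0 : ℝ)..t, ψ s) (ψ t) t :=
  intervalIntegral.integral_hasDerivAt_right (h.intervalIntegrable _ _)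
    h.stronglyMeasurable.stronglyMeasurableAtFilter h.continuousAt

lemma contDiff_primitive {ψ : ℝ → ℝ} (h : ContDiff ℝ ∞ ψ) :
    ContDiff ℝ ∞ (fun t => ∫ s in (0 : ℝ)..t, ψ s) := by
  rw [contDiff_infty_iff_deriv]
  refine ⟨fun t => (hasDerivAt_primitive h.continuous t).differentiableAt, ?_⟩
  have : deriv (fun t => ∫ s in (0 : ℝ)..t, ψ s) = ψ :=
    funext fun t => (hasDerivAt_primitive h.continuous t).deriv
  rwa [this]

/-- Mean value zero is what makes the primitive vanish again to the right of the support. -/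
lemma isTestFunction_primitive {T : ℝ} {ψ : ℝ → ℝ} (hT : 0 < T) (h : IsTestFunction (Ioo 0 T) ψ)
    (h0 : ∫ s in (0 : ℝ)..T, ψ s = 0) :
    IsTestFunction (Ioo 0 T) (fun t => ∫ s in (0 : ℝ)..t, ψ s) := by
  obtain ⟨a, b, ha, hab, hb, hz⟩ := h.exists_Icc hT
  have hsupp : tsupport (fun t => ∫ s in (0 : ℝ)..t, ψ s) ⊆ Icc a b := by
    apply closure_minimal _ isClosed_Icc
    intro t ht
    by_contra hn
    apply ht
    have hi : ∀ s t : ℝ, IntervalIntegrable ψ volume s t := fun s t =>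
      h.continuous.intervalIntegrable _ _
    by_cases hta : t < a
    · show ∫ s in (0 : ℝ)..t, ψ s = 0
      apply intervalIntegral.integral_zero_ae
      refine Eventually.of_forall fun s hs => hz s fun hm => ?_
      have := hs.2
      have h3 : max 0 t < a := max_lt ha hta
      linarith [hm.1]
    · have htb : b < t := by
        by_contra hb'
        exact hn ⟨not_lt.1 hta, not_lt.1 hb'⟩
      show ∫ s in (0 : ℝ)..t, ψ s = 0
      rw [← intervalIntegral.integral_add_adjacent_intervals (hi 0 T) (hi T t), h0, zero_add]
      apply intervalIntegral.integral_zero_ae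
      refine Eventually.of_forall fun s hs => hz s fun hm => ?_
      have := hs.1
      have h3 : b < min T t := lt_min hb htb
      linarith [hm.2]
  refine ⟨contDiff_primitive h.1, ?_, hsupp.trans fun t ht => ⟨ha.trans_le ht.1, ht.2.trans_lt hb⟩⟩
  exact HasCompactSupport.of_support_subset_isCompact isCompact_Icc
    ((subset_tsupport _).trans hsupp)

lemma integral_test_eq_sub {ψ : ℝ → ℝ} (h : ContDiff ℝ ∞ ψ) (s t : ℝ) :
    ∫ r in s..t, fderiv ℝ ψ r 1 = ψ t - ψ s := by
  have : ∀ r, fderiv ℝ ψ r 1 = deriv ψ r := fun r => rfl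
  simp_rw [this]
  apply intervalIntegral.integral_deriv_eq_sub
  · exact fun r _ => h.differentiable (by simp) r
  · exact (h.continuous_deriv (by simp)).intervalIntegrable _ _

lemma IsTestFunction.integrableOn {ψ : ℝ → ℝ} {U : Set ℝ} (h : IsTestFunction U ψ) (s : Set ℝ) :
    IntegrableOn ψ s :=
  (h.continuous.integrable_of_hasCompactSupport h.2.1).integrableOn

lemma exists_test_integral_one {T : ℝ} (hT : 0 < T) :
    ∃ ρ, IsTestFunction (Ioo 0 T) ρ ∧ ∫ s in Ioo 0 T, ρ s = 1 := by
  let f : ContDiffBump (T / 2) := ⟨T / 8, T / 4, by linarith, by linarith⟩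
  have hs : tsupport (f.normed volume) ⊆ Ioo 0 T := by
    rw [f.tsupport_normed_eq]
    intro x hx
    rw [Real.closedBall_eq_Icc] at hx
    have : f.rOut = T / 4 := rfl
    rw [this] at hx
    exact ⟨by linarith [hx.1], by linarith [hx.2]⟩
  have ht : IsTestFunction (Ioo 0 T) (f.normed volume) :=
    ⟨f.contDiff_normed, f.hasCompactSupport_normed, hs⟩
  refine ⟨_, ht, ?_⟩
  have := setIntegral_mul_test (u := fun _ => 1) ht
  simp only [one_mul] at this
  rw [this, f.integral_normed]

/-- A function with integrable weak derivative is almost everywhere equal to a primitive. -/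
lemma HasWeakDeriv.exists_ae_eq_primitive {T : ℝ} (hT : 0 < T) {h k : ℝ → ℝ}
    (hk : IntegrableOn k (Ioo 0 T)) (hw : HasWeakDeriv (Ioo 0 T) (1 : ℝ) h k) :
    ∃ c, ∀ᵐ t ∂(volume.restrict (Ioo 0 T)), h t = c + ∫ s in (0 : ℝ)..t, k s := by
  set H : ℝ → ℝ := fun t => ∫ s in (0 : ℝ)..t, k s with hH
  have hHi : IntegrableOn H (Ioo 0 T) :=
    ((continuousOn_primitive_Ioo hT.le hk).integrableOn_Icc).mono_set Ioo_subset_Icc_self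
  have hHl : LocallyIntegrableOn H (Ioo 0 T) := hHi.locallyIntegrableOn
  have hHd : ∀ ψ, IsTestFunction (Ioo 0 T) ψ →
      ∫ t in Ioo 0 T, H t * fderiv ℝ ψ t 1 = - ∫ t in Ioo 0 T, k t * ψ t := by
    intro ψ hψ
    rw [integral_primitive_mul_volume ((hψ.fderiv_apply 1).integrableOn _) hk, ← integral_neg]
    refine setIntegral_congr_fun measurableSet_Ioo fun s hs => ?_
    rw [integral_test_eq_sub hψ.1, hψ.eq_zero_of_notMem (x := T) (fun hm => lt_irrefl _ (hψ.2.2 hm).2)]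
    ring
  have hul : LocallyIntegrableOn (fun t => h t - H t) (Ioo 0 T) := hw.1.sub hHl
  have hu0 : ∀ ψ, IsTestFunction (Ioo 0 T) ψ →
      ∫ t in Ioo 0 T, (h t - H t) * fderiv ℝ ψ t 1 = 0 := by
    intro ψ hψ
    simp_rw [sub_mul]
    rw [integral_sub ((hψ.fderiv_apply 1).integrable_mul hw.1)
      ((hψ.fderiv_apply 1).integrable_mul hHl), hw.2.2 ψ hψ, hHd ψ hψ, sub_self]
  obtain ⟨ρ, hρ, hρ1⟩ := exists_test_integral_one hT
  set c := ∫ t in Ioo 0 T, (h t - H t) * ρ t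
  refine ⟨c, ?_⟩
  have := ae_eq_of_forall_test (V := ℝ) isOpen_Ioo hul
    (locallyIntegrableOn_const c) (fun ψ hψ => by
      set I := ∫ s in Ioo 0 T, ψ s with hI
      -- The du Bois-Reymond argument: subtracting a multiple of ρ gives mean zero, hence a
      -- derivative of a test function, which h - H annihilates. So h - H acts on ψ as the constant
      -- ∫ (h - H) ρ.
      have hd : IsTestFunction (Ioo 0 T) (fun t => ψ t - I * ρ t) := hψ.sub (hρ.const_mul I)
      have hz : ∫ s in (0 : ℝ)..T, (ψ s - I * ρ s) = 0 := by
        rw [← setIntegral_Ioo_eq_intervalIntegral hT.le, integral_sub (hψ.integrableOn _)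
          ((hρ.const_mul I).integrableOn _), integral_const_mul, hρ1]
        ring
      have h1 := hu0 _ (isTestFunction_primitive hT hd hz)
      have h2 : ∀ t, fderiv ℝ (fun t => ∫ s in (0 : ℝ)..t, (ψ s - I * ρ s)) t 1
          = ψ t - I * ρ t := fun t => (hasDerivAt_primitive hd.continuous t).deriv
      simp_rw [h2] at h1
      have h3 : ∀ t, (h t - H t) * (ψ t - I * ρ t)
          = (h t - H t) * ψ t - I * ((h t - H t) * ρ t) := fun t => by ring
      simp_rw [h3] at h1
      rw [integral_sub (hψ.integrable_mul hul) ((hρ.integrable_mul hul).const_mul I),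
        integral_const_mul] at h1
      rw [integral_const_mul]
      linarith)
  filter_upwards [this] with t ht
  linarith

lemma eqOn_Icc_of_ae_eq {T : ℝ} (hT : 0 < T) {f g : ℝ → ℝ} (hf : ContinuousOn f (Icc 0 T))
    (hg : ContinuousOn g (Icc 0 T)) (h : ∀ᵐ t ∂(volume.restrict (Ioo 0 T)), f t = g t) :
    EqOn f g (Icc 0 T) := by
  have h1 : f =ᵐ[volume.restrict (Icc 0 T)] g := by
    rw [restrict_Ioo_eq_restrict_Icc] at h
    exact h
  exact Measure.eqOn_Icc_of_ae_eq volume hT.ne h1 hf hg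

/-- Continuity selects the version of h that is a primitive, which turns the almost-everywhere
formula into one at every time, endpoints included. -/
lemma HasWeakDeriv.sub_eq_integral {T : ℝ} (hT : 0 < T) {h k : ℝ → ℝ}
    (hk : IntegrableOn k (Ioo 0 T)) (hw : HasWeakDeriv (Ioo 0 T) (1 : ℝ) h k)
    (hc : ContinuousOn h (Icc 0 T)) {s t : ℝ} (hs : s ∈ Icc 0 T) (ht : t ∈ Icc 0 T) :
    h t - h s = ∫ r in s..t, k r := by
  obtain ⟨c, hc'⟩ := hw.exists_ae_eq_primitive hT hk
  have := eqOn_Icc_of_ae_eq hT hc (continuousOn_const.add (continuousOn_primitive_Ioo hT.le hk)) hc'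
  rw [this hs, this ht]
  have h0 : (0 : ℝ) ∈ Icc 0 T := left_mem_Icc.2 hT.le
  rw [← intervalIntegral.integral_interval_sub_left (intervalIntegrable_of_Ioo hk h0 ht)
    (intervalIntegrable_of_Ioo hk h0 hs)]
  simp

end OneVariable

instance prodVolume_isAddHaarMeasure {n : ℕ} :
    (volume : Measure (Space n × ℝ)).IsAddHaarMeasure :=
  inferInstanceAs (Measure.IsAddHaarMeasure ((volume : Measure (Space n)).prod (volume : Measure ℝ)))

section SquareNorm

variable {X : Type*} [MeasurableSpace X] {ν : Measure X}

lemma eLpNorm_two_sq {f : X → ℝ} (hf : MemLp f 2 ν) :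
    (eLpNorm f 2 ν).toReal ^ 2 = ∫ x, f x ^ 2 ∂ν := by
  rw [eLpNorm_eq_lintegral_rpow_enorm_toReal (by simp) (by simp), ← ENNReal.toReal_pow,
    ← ENNReal.rpow_natCast, ← ENNReal.rpow_mul]
  simp only [ENNReal.toReal_ofNat, Nat.cast_ofNat, one_div, ENNReal.rpow_ofNat, ne_eq,
    OfNat.ofNat_ne_zero, not_false_eq_true, inv_mul_cancel₀, ENNReal.rpow_one]
  rw [integral_eq_lintegral_of_nonneg_ae (Eventually.of_forall fun x => sq_nonneg _)
    (hf.1.pow 2)]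
  congr 2
  ext x
  rw [← enorm_pow, Real.enorm_eq_ofReal (sq_nonneg _)]

lemma eLpNorm_two_toReal {f : X → ℝ} (hf : MemLp f 2 ν) :
    (eLpNorm f 2 ν).toReal = √(∫ x, f x ^ 2 ∂ν) := by
  rw [← eLpNorm_two_sq hf, Real.sqrt_sq ENNReal.toReal_nonneg]

end SquareNorm

lemma locallyIntegrableOn_of_memLp {V : Type*} [NormedAddCommGroup V] [NormedSpace ℝ V]
    [MeasurableSpace V] [BorelSpace V] [FiniteDimensional ℝ V] {ν : Measure V}
    [IsLocallyFiniteMeasure ν] {U : Set V} {u : V → ℝ} {r : ℝ≥0∞} (hr : 1 ≤ r)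
    (h : MemLp u r (ν.restrict U)) : LocallyIntegrableOn u U ν :=
  locallyIntegrableOn_of_locallyIntegrable_restrict (h.locallyIntegrable hr)

/-! ### Slicing functions and weak derivatives on the cylinder Q. -/

section Cylinder

variable {n : ℕ} {Ω : Set (Space n)} {T : ℝ}

lemma cyl_measure (Ω : Set (Space n)) (T : ℝ) : (volume : Measure (Space n × ℝ)).restrict (cyl Ω T)
    = (volume.restrict Ω).prod (volume.restrict (Ioo 0 T)) := by
  rw [Measure.prod_restrict, cyl, Measure.volume_eq_prod]

lemma isOpen_cyl (hΩ : IsOpen Ω) : IsOpen (cyl Ω T) := hΩ.prod isOpen_Ioo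

lemma ae_slice_time {p : Space n × ℝ → Prop} (h : ∀ᵐ s ∂(volume.restrict (cyl Ω T)), p s) :
    ∀ᵐ t ∂(volume.restrict (Ioo 0 T)), ∀ᵐ x ∂(volume.restrict Ω), p (x, t) := by
  rw [cyl_measure] at h
  have := (Measure.measurePreserving_swap (μ := volume.restrict (Ioo 0 T))
    (ν := volume.restrict Ω)).quasiMeasurePreserving.ae h
  exact Measure.ae_ae_of_ae_prod this

lemma ae_slice_space {p : Space n × ℝ → Prop} (h : ∀ᵐ s ∂(volume.restrict (cyl Ω T)), p s) :
    ∀ᵐ x ∂(volume.restrict Ω), ∀ᵐ t ∂(volume.restrict (Ioo 0 T)), p (x, t) := by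
  rw [cyl_measure] at h
  exact Measure.ae_ae_of_ae_prod h

lemma ae_cyl_of_fst {p : Space n → Prop} (h : ∀ᵐ x ∂(volume.restrict Ω), p x) :
    ∀ᵐ s ∂(volume.restrict (cyl Ω T)), p s.1 := by
  rw [cyl_measure]
  exact Measure.quasiMeasurePreserving_fst.ae h

lemma ae_cyl_of_snd {p : ℝ → Prop} (h : ∀ᵐ t ∂(volume.restrict (Ioo 0 T)), p t) :
    ∀ᵐ s ∂(volume.restrict (cyl Ω T)), p s.2 := by
  rw [cyl_measure]
  exact Measure.quasiMeasurePreserving_snd.ae h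

lemma integrable_slice_time {F : Space n × ℝ → ℝ} (h : Integrable F (volume.restrict (cyl Ω T))) :
    ∀ᵐ t ∂(volume.restrict (Ioo 0 T)), Integrable (fun x => F (x, t)) (volume.restrict Ω) := by
  rw [cyl_measure] at h
  exact h.prod_left_ae

lemma integrable_slice_space {F : Space n × ℝ → ℝ} (h : Integrable F (volume.restrict (cyl Ω T))) :
    ∀ᵐ x ∂(volume.restrict Ω), IntegrableOn (fun t => F (x, t)) (Ioo 0 T) := by
  rw [cyl_measure] at h
  exact h.prod_right_ae

lemma integrable_integral_slice {F : Space n × ℝ → ℝ}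
    (h : Integrable F (volume.restrict (cyl Ω T))) :
    IntegrableOn (fun t => ∫ x in Ω, F (x, t)) (Ioo 0 T) := by
  rw [cyl_measure] at h
  exact h.integral_prod_right

lemma integral_cyl {F : Space n × ℝ → ℝ} (h : Integrable F (volume.restrict (cyl Ω T))) :
    ∫ s in cyl Ω T, F s = ∫ t in Ioo 0 T, ∫ x in Ω, F (x, t) := by
  rw [cyl_measure] at h ⊢
  exact integral_prod_symm _ h

lemma integral_cyl' {F : Space n × ℝ → ℝ} (h : Integrable F (volume.restrict (cyl Ω T))) :
    ∫ s in cyl Ω T, F s = ∫ x in Ω, ∫ t in Ioo 0 T, F (x, t) := by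
  rw [cyl_measure] at h ⊢
  exact integral_prod _ h

lemma aestronglyMeasurable_slice_time {F : Space n × ℝ → ℝ}
    (h : AEStronglyMeasurable F (volume.restrict (cyl Ω T))) :
    ∀ᵐ t ∂(volume.restrict (Ioo 0 T)),
      AEStronglyMeasurable (fun x => F (x, t)) (volume.restrict Ω) := by
  rw [cyl_measure] at h
  exact h.prod_swap.prodMk_left

lemma aestronglyMeasurable_fst {b : Space n → ℝ}
    (h : AEStronglyMeasurable b (volume.restrict Ω)) :
    AEStronglyMeasurable (fun s : Space n × ℝ => b s.1) (volume.restrict (cyl Ω T)) := by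
  rw [cyl_measure]
  exact h.comp_fst

lemma aestronglyMeasurable_snd {b : ℝ → ℝ}
    (h : AEStronglyMeasurable b (volume.restrict (Ioo 0 T))) :
    AEStronglyMeasurable (fun s : Space n × ℝ => b s.2) (volume.restrict (cyl Ω T)) := by
  rw [cyl_measure]
  exact h.comp_snd

lemma memLp_top_fst {b : Space n → ℝ} (h : MemLp b ∞ (volume.restrict Ω)) :
    MemLp (fun s : Space n × ℝ => b s.1) ∞ (volume.restrict (cyl Ω T)) :=
  memLp_top_of_bound (aestronglyMeasurable_fst h.1) _ (ae_cyl_of_fst (memLp_top_ae_bound h))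

lemma memLp_top_snd {b : ℝ → ℝ} (h : MemLp b ∞ (volume.restrict (Ioo 0 T))) :
    MemLp (fun s : Space n × ℝ => b s.2) ∞ (volume.restrict (cyl Ω T)) :=
  memLp_top_of_bound (aestronglyMeasurable_snd h.1) _ (ae_cyl_of_snd (memLp_top_ae_bound h))

lemma memLp_two_tensor {φ : Space n → ℝ} {ψ : ℝ → ℝ} (hφ : MemLp φ 2 (volume.restrict Ω))
    (hψ : MemLp ψ 2 (volume.restrict (Ioo 0 T))) :
    MemLp (fun s : Space n × ℝ => φ s.1 * ψ s.2) 2 (volume.restrict (cyl Ω T)) := by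
  rw [cyl_measure]
  rw [memLp_two_iff_integrable_sq (by exact hφ.1.comp_fst.mul hψ.1.comp_snd)]
  have := (hφ.integrable_sq).mul_prod (hψ.integrable_sq)
  exact this.congr (Eventually.of_forall fun s => by simp [mul_pow])

lemma memLp_two_fst {φ : Space n → ℝ} (hφ : MemLp φ 2 (volume.restrict Ω)) :
    MemLp (fun s : Space n × ℝ => φ s.1) 2 (volume.restrict (cyl Ω T)) := by
  simpa using memLp_two_tensor (T := T) hφ (memLp_const (1 : ℝ))

lemma memLp_slice_time {F : Space n × ℝ → ℝ} (h : MemLp F 2 (volume.restrict (cyl Ω T))) :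
    ∀ᵐ t ∂(volume.restrict (Ioo 0 T)), MemLp (fun x => F (x, t)) 2 (volume.restrict Ω) := by
  filter_upwards [integrable_slice_time h.integrable_sq, aestronglyMeasurable_slice_time h.1]
    with t ht hm
  exact (memLp_two_iff_integrable_sq hm).2 ht

lemma memLp_slice_space {F : Space n × ℝ → ℝ} (h : MemLp F 2 (volume.restrict (cyl Ω T))) :
    ∀ᵐ x ∂(volume.restrict Ω), MemLp (fun t => F (x, t)) 2 (volume.restrict (Ioo 0 T)) := by
  have hm : ∀ᵐ x ∂(volume.restrict Ω),
      AEStronglyMeasurable (fun t => F (x, t)) (volume.restrict (Ioo 0 T)) := by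
    have := h.1
    rw [cyl_measure] at this
    exact this.prodMk_left
  filter_upwards [integrable_slice_space h.integrable_sq, hm] with t ht hm
  exact (memLp_two_iff_integrable_sq hm).2 ht

lemma memLp_norm_slice {F : Space n × ℝ → ℝ} (h : MemLp F 2 (volume.restrict (cyl Ω T))) :
    MemLp (fun t => (eLpNorm (fun x => F (x, t)) 2 (volume.restrict Ω)).toReal) 2
      (volume.restrict (Ioo 0 T)) := by
  have h1 := integrable_integral_slice h.integrable_sq
  have h2 : (fun t => (eLpNorm (fun x => F (x, t)) 2 (volume.restrict Ω)).toReal)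
      =ᵐ[volume.restrict (Ioo 0 T)] fun t => √(∫ x in Ω, F (x, t) ^ 2) := by
    filter_upwards [memLp_slice_time h] with t ht
    exact eLpNorm_two_toReal ht
  rw [memLp_congr_ae h2, memLp_two_iff_integrable_sq]
  · refine h1.congr (Eventually.of_forall fun t => ?_)
    simp only
    rw [Real.sq_sqrt (integral_nonneg fun x => sq_nonneg _)]
  · exact Real.continuous_sqrt.comp_aestronglyMeasurable h1.1

lemma IsTestFunction.tensor {φ : Space n → ℝ} {ψ : ℝ → ℝ} (hφ : IsTestFunction Ω φ)
    (hψ : IsTestFunction (Ioo 0 T) ψ) :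
    IsTestFunction (cyl Ω T) (fun s => φ s.1 * ψ s.2) := by
  have hs : tsupport (fun s : Space n × ℝ => φ s.1 * ψ s.2) ⊆ tsupport φ ×ˢ tsupport ψ := by
    apply closure_minimal _ ((isClosed_tsupport φ).prod (isClosed_tsupport ψ))
    intro s hs
    have : φ s.1 * ψ s.2 ≠ 0 := hs
    exact ⟨subset_tsupport _ (left_ne_zero_of_mul this), subset_tsupport _ (right_ne_zero_of_mul this)⟩
  refine ⟨(hφ.1.comp contDiff_fst).mul (hψ.1.comp contDiff_snd), ?_,
    hs.trans (prod_mono hφ.2.2 hψ.2.2)⟩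
  exact HasCompactSupport.of_support_subset_isCompact (hφ.2.1.prod hψ.2.1)
    ((subset_tsupport _).trans hs)

lemma IsTestFunction.slice_time {φ : Space n × ℝ → ℝ} (h : IsTestFunction (cyl Ω T) φ) (t : ℝ) :
    IsTestFunction Ω (fun x => φ (x, t)) := by
  have hs : tsupport (fun x => φ (x, t)) ⊆ {x | (x, t) ∈ tsupport φ} := by
    refine closure_minimal (fun x hx => subset_tsupport (f := φ) hx) ?_
    exact (isClosed_tsupport φ).preimage (by fun_prop : Continuous fun x : Space n => (x, t))
  refine ⟨h.1.comp (contDiff_id.prodMk contDiff_const), ?_, fun x hx => (h.2.2 (hs hx)).1⟩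
  refine HasCompactSupport.of_support_subset_isCompact (h.2.1.image continuous_fst) ?_
  exact fun x hx => ⟨(x, t), hs (subset_tsupport _ hx), rfl⟩

lemma IsTestFunction.slice_space {φ : Space n × ℝ → ℝ} (h : IsTestFunction (cyl Ω T) φ)
    (x : Space n) : IsTestFunction (Ioo 0 T) (fun t => φ (x, t)) := by
  have hs : tsupport (fun t => φ (x, t)) ⊆ {t | (x, t) ∈ tsupport φ} := by
    refine closure_minimal (fun x hx => subset_tsupport (f := φ) hx) ?_
    exact (isClosed_tsupport φ).preimage (by fun_prop : Continuous fun t : ℝ => (x, t))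
  refine ⟨h.1.comp (contDiff_const.prodMk contDiff_id), ?_, fun t ht => (h.2.2 (hs ht)).2⟩
  refine HasCompactSupport.of_support_subset_isCompact (h.2.1.image continuous_snd) ?_
  exact fun t ht => ⟨(x, t), hs (subset_tsupport _ ht), rfl⟩

lemma fderiv_comp_fst {b : Space n → ℝ} (hb : Differentiable ℝ b) (s : Space n × ℝ) (e : Space n)
    (r : ℝ) : fderiv ℝ (fun s : Space n × ℝ => b s.1) s (e, r) = fderiv ℝ b s.1 e := by
  have := (hb s.1).hasFDerivAt.comp s (hasFDerivAt_fst (𝕜 := ℝ) (p := s))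
  have h2 : fderiv ℝ (fun s : Space n × ℝ => b s.1) s = _ := this.fderiv
  rw [h2]
  simp

lemma fderiv_comp_snd {b : ℝ → ℝ} (hb : Differentiable ℝ b) (s : Space n × ℝ) (e : Space n)
    (r : ℝ) : fderiv ℝ (fun s : Space n × ℝ => b s.2) s (e, r) = fderiv ℝ b s.2 r := by
  have := (hb s.2).hasFDerivAt.comp s (hasFDerivAt_snd (𝕜 := ℝ) (p := s))
  have h2 : fderiv ℝ (fun s : Space n × ℝ => b s.2) s = _ := this.fderiv
  rw [h2]
  simp

lemma fderiv_tensor {φ : Space n → ℝ} {ψ : ℝ → ℝ} (hφ : Differentiable ℝ φ)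
    (hψ : Differentiable ℝ ψ) (s : Space n × ℝ) (e : Space n) (r : ℝ) :
    fderiv ℝ (fun s : Space n × ℝ => φ s.1 * ψ s.2) s (e, r)
      = φ s.1 * fderiv ℝ ψ s.2 r + fderiv ℝ φ s.1 e * ψ s.2 := by
  rw [fderiv_mul_apply (f := fun s : Space n × ℝ => φ s.1) (g := fun s : Space n × ℝ => ψ s.2)
    (hφ.comp differentiable_fst) (hψ.comp differentiable_snd),
    fderiv_comp_fst hφ, fderiv_comp_snd hψ]

lemma IsTestFunction.memLp {V : Type*} [NormedAddCommGroup V] [NormedSpace ℝ V] [MeasurableSpace V]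
    [BorelSpace V] {ν : Measure V} [IsFiniteMeasureOnCompacts ν]
    {U : Set V} {φ : V → ℝ} (h : IsTestFunction U φ) (r : ℝ≥0∞) : MemLp φ r ν :=
  h.continuous.memLp_of_hasCompactSupport h.2.1

/-- Spatial weak derivatives on the cylinder restrict to weak derivatives on almost every time
slice. -/
lemma HasWeakDeriv.ae_slice {F G : Space n × ℝ → ℝ} {i : Fin n}
    (h : HasWeakDeriv (cyl Ω T) (unitVec i, 0) F G)
    (hF : MemLp F 2 (volume.restrict (cyl Ω T))) (hG : MemLp G 2 (volume.restrict (cyl Ω T))) :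
    ∀ᵐ t ∂(volume.restrict (Ioo 0 T)), ∀ φ, IsTestFunction Ω φ →
      ∫ x in Ω, F (x, t) * fderiv ℝ φ x (unitVec i) = - ∫ x in Ω, G (x, t) * φ x := by
  obtain ⟨D, hDc, hDt, hDd⟩ := exists_countable_dense_test Ω
  -- For a fixed φ, testing with the tensor products of φ and ψ gives an identity of functions of
  -- time off a null set depending on φ; restricting to the countable family D keeps the union of
  -- these sets null.
  have h1 : ∀ φ ∈ D, ∀ᵐ t ∂(volume.restrict (Ioo 0 T)),
      ∫ x in Ω, F (x, t) * fderiv ℝ φ x (unitVec i) = - ∫ x in Ω, G (x, t) * φ x := by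
    intro φ hφD
    have hφ := hDt φ hφD
    have hφ2 : MemLp (fun s : Space n × ℝ => φ s.1) 2 (volume.restrict (cyl Ω T)) :=
      memLp_two_fst (hφ.memLp 2)
    have hφ2' : MemLp (fun s : Space n × ℝ => fderiv ℝ φ s.1 (unitVec i)) 2
        (volume.restrict (cyl Ω T)) := memLp_two_fst ((hφ.fderiv_apply _).memLp 2)
    have i1 := integrable_mul_of_memLp_two hF hφ2'
    have i2 := integrable_mul_of_memLp_two hG hφ2
    have j1 := integrable_integral_slice i1
    have j2 := integrable_integral_slice i2
    refine ae_eq_of_forall_test (V := ℝ) (u := fun t => ∫ x in Ω, F (x, t) * fderiv ℝ φ x (unitVec i))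
      (u' := fun t => - ∫ x in Ω, G (x, t) * φ x) isOpen_Ioo j1.locallyIntegrableOn
      j2.neg.locallyIntegrableOn (fun ψ hψ => ?_)
    have h2 := h.2.2 _ (hφ.tensor hψ)
    have hψb : MemLp (fun s : Space n × ℝ => ψ s.2) ∞ (volume.restrict (cyl Ω T)) :=
      memLp_top_snd (hψ.memLp ∞)
    have bi : ∀ {K : Space n × ℝ → ℝ}, Integrable K (volume.restrict (cyl Ω T)) →
        Integrable (fun s => ψ s.2 * K s) (volume.restrict (cyl Ω T)) := fun hK =>
      memLp_one_iff_integrable.1 (memLp_bounded_mul hψb (memLp_one_iff_integrable.2 hK))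
    have e1 : ∀ s : Space n × ℝ, F s * fderiv ℝ (fun s : Space n × ℝ => φ s.1 * ψ s.2) s (unitVec i, 0)
        = ψ s.2 * (F s * fderiv ℝ φ s.1 (unitVec i)) := by
      intro s
      rw [fderiv_tensor hφ.differentiable hψ.differentiable]
      simp only [map_zero, mul_zero, zero_add]
      ring
    have e2 : ∀ s : Space n × ℝ, G s * (φ s.1 * ψ s.2) = ψ s.2 * (G s * φ s.1) := fun s => by ring
    simp_rw [e1, e2] at h2
    rw [integral_cyl (bi i1), integral_cyl (bi i2)] at h2
    simp only [integral_const_mul] at h2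
    rw [← integral_neg] at h2
    simp only [mul_comm _ (ψ _), mul_neg] at h2 ⊢
    exact h2
  have h2 := (ae_ball_iff hDc).2 h1
  filter_upwards [h2, memLp_slice_time hF, memLp_slice_time hG] with t ht hFt hGt φ hφ
  -- At a good time both sides are continuous in φ for the H^1-norm, so density of D gives every
  -- test function.
  choose ψ hψD hψ1 hψ2 using fun k : ℕ => hDd φ hφ ((k : ℝ≥0∞) + 1)⁻¹ (by simp)
  have hlim : Tendsto (fun k : ℕ => ((k : ℝ≥0∞) + 1)⁻¹) atTop (𝓝 0) := by
    have := (ENNReal.tendsto_inv_nat_nhds_zero).comp (tendsto_add_atTop_nat 1)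
    simpa [Function.comp_def] using this
  have hφp := IsH10Pair.of_test hφ
  have hψp := fun k => IsH10Pair.of_test (hDt _ (hψD k))
  have t1 := tendsto_integral_const_mul (Eventually.of_forall fun k => (hψp k).memLp_deriv i) hFt
    (hφp.memLp_deriv i) (tendsto_of_tendsto_of_tendsto_of_le_of_le tendsto_const_nhds hlim
      (fun _ => zero_le) (fun k => hψ2 k i))
  have t2 := (tendsto_integral_const_mul (Eventually.of_forall fun k => (hψp k).memLp) hGt
    hφp.memLp (tendsto_of_tendsto_of_tendsto_of_le_of_le tendsto_const_nhds hlim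
      (fun _ => zero_le) hψ1)).neg
  refine tendsto_nhds_unique t1 (t2.congr fun k => ?_)
  rw [ht _ (hψD k)]

/-- A weak derivative on almost every slice is a weak derivative on the cylinder. -/
lemma hasWeakDeriv_of_ae_slice {F G : Space n × ℝ → ℝ} {i : Fin n}
    (hF : MemLp F 2 (volume.restrict (cyl Ω T))) (hG : MemLp G 2 (volume.restrict (cyl Ω T)))
    (h : ∀ᵐ t ∂(volume.restrict (Ioo 0 T)), ∀ φ, IsTestFunction Ω φ →
      ∫ x in Ω, F (x, t) * fderiv ℝ φ x (unitVec i) = - ∫ x in Ω, G (x, t) * φ x) :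
    HasWeakDeriv (cyl Ω T) (unitVec i, 0) F G := by
  have hF' : LocallyIntegrableOn F (cyl Ω T) :=
    locallyIntegrableOn_of_memLp (by simp) hF
  have hG' : LocallyIntegrableOn G (cyl Ω T) :=
    locallyIntegrableOn_of_memLp (by simp) hG
  refine ⟨hF', hG', fun φ hφ => ?_⟩
  rw [integral_cyl ((hφ.fderiv_apply _).integrable_mul hF'), integral_cyl (hφ.integrable_mul hG'),
    ← integral_neg]
  refine integral_congr_ae ?_
  filter_upwards [h] with t ht
  have hφt : IsTestFunction Ω (fun x => φ (x, t)) := hφ.slice_time t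
  have hd : ∀ x, fderiv ℝ (fun x => φ (x, t)) x (unitVec i) = fderiv ℝ φ (x, t) (unitVec i, 0) := by
    intro x
    have h1 : HasFDerivAt (fun x : Space n => (x, t)) (ContinuousLinearMap.inl ℝ (Space n) ℝ) x :=
      hasFDerivAt_prodMk_left x t
    have := (hφ.differentiable (x, t)).hasFDerivAt.comp x h1
    have h2 : fderiv ℝ (fun x => φ (x, t)) x = _ := this.fderiv
    rw [h2]
    simp
  have := ht _ hφt
  simp_rw [hd] at this
  exact this

end Cylinder

lemma primitive_weak {T : ℝ} {k : ℝ → ℝ} (hk : IntegrableOn k (Ioo 0 T)) (c : ℝ) {ψ : ℝ → ℝ}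
    (hT : 0 ≤ T) (hψ : IsTestFunction (Ioo 0 T) ψ) :
    ∫ t in Ioo 0 T, (c + ∫ s in (0 : ℝ)..t, k s) * fderiv ℝ ψ t 1
      = - ∫ t in Ioo 0 T, k t * ψ t := by
  have hψ' : IntegrableOn (fun t => fderiv ℝ ψ t 1) (Ioo 0 T) := (hψ.fderiv_apply 1).integrableOn _
  have z : ∀ t, t ∉ Ioo 0 T → ψ t = 0 := fun t ht =>
    hψ.eq_zero_of_notMem fun hm => ht (hψ.2.2 hm)
  have h0 : ∫ t in Ioo 0 T, c * fderiv ℝ ψ t 1 = 0 := by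
    rw [integral_const_mul, setIntegral_Ioo_eq_intervalIntegral hT, integral_test_eq_sub hψ.1,
      z T (by simp), z 0 (by simp)]
    simp
  have h1 : ∫ t in Ioo 0 T, (∫ s in (0 : ℝ)..t, k s) * fderiv ℝ ψ t 1
      = - ∫ t in Ioo 0 T, k t * ψ t := by
    rw [integral_primitive_mul_volume hψ' hk, ← integral_neg]
    refine setIntegral_congr_fun measurableSet_Ioo fun s hs => ?_
    rw [integral_test_eq_sub hψ.1, z T (by simp)]
    ring
  have h2 := integrableOn_primitive_mul hT hk hψ' 0
  simp only [zero_add] at h2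
  simp_rw [add_mul]
  rw [integral_add (hψ'.const_mul c) h2, h0, h1, zero_add]

lemma intervalIntegral_eq_setIntegral_indicator {T : ℝ} {f : ℝ → ℝ} {t : ℝ} (ht : t ∈ Icc 0 T) :
    ∫ r in (0 : ℝ)..t, f r = ∫ r in Ioo 0 T, (Iic t).indicator f r := by
  rw [intervalIntegral.integral_of_le ht.1, setIntegral_indicator measurableSet_Iic]
  apply setIntegral_congr_set
  have e1 : (Ioo 0 T ∩ Iic t : Set ℝ) =ᵐ[volume] (Ioc 0 T ∩ Iic t : Set ℝ) :=
    Ioo_ae_eq_Ioc.inter (ae_eq_refl _)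
  have e2 : (Ioc 0 T ∩ Iic t : Set ℝ) = Ioc 0 t := by
    ext s
    simp only [mem_inter_iff, mem_Ioc, mem_Iic]
    exact ⟨fun h => ⟨h.1.1, h.2⟩, fun h => ⟨⟨h.1, h.2.trans ht.2⟩, h.2⟩⟩
  rw [e2] at e1
  exact e1.symm

/-! ### Elements of Y as primitives in time. -/

section Cylinder

variable {n : ℕ} {Ω : Set (Space n)} {T : ℝ}

/-- Nullity of almost all slices gives nullity on Q only for measurable functions, hence the
measurability hypothesis. It transfers identities known at each fixed time to Q. -/
lemma ae_cyl_of_ae_slice_time {D : Space n × ℝ → ℝ}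
    (hD : AEStronglyMeasurable D (volume.restrict (cyl Ω T)))
    (h : ∀ᵐ t ∂(volume.restrict (Ioo 0 T)), ∀ᵐ x ∂(volume.restrict Ω), D (x, t) = 0) :
    ∀ᵐ s ∂(volume.restrict (cyl Ω T)), D s = 0 := by
  obtain ⟨D', hD'm, hDD'⟩ := hD
  have h1 : ∫⁻ s in cyl Ω T, ‖D' s‖ₑ = 0 := by
    rw [cyl_measure, lintegral_prod_symm' _ hD'm.measurable.enorm]
    rw [lintegral_congr_ae (g := fun _ => 0)]
    · simp
    · filter_upwards [h, ae_slice_time hDD'] with t h1 h2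
      rw [lintegral_congr_ae (g := fun _ => 0)]
      · simp
      · filter_upwards [h1, h2] with x h3 h4
        rw [← h4, h3]
        simp
  rw [lintegral_eq_zero_iff hD'm.measurable.enorm] at h1
  filter_upwards [h1, hDD'] with s h2 h3
  rw [h3]
  simpa using h2

lemma aestronglyMeasurable_primitive {k : Space n × ℝ → ℝ}
    (hk : AEStronglyMeasurable k (volume.restrict (cyl Ω T))) :
    AEStronglyMeasurable (fun s => ∫ r in (0 : ℝ)..s.2, k (s.1, r))
      (volume.restrict (cyl Ω T)) := by
  set k' := hk.mk k
  have hk' : StronglyMeasurable k' := hk.stronglyMeasurable_mk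
  have hm : StronglyMeasurable (fun s : Space n × ℝ =>
      ∫ r in Ioo 0 T, ({q : (Space n × ℝ) × ℝ | q.2 ≤ q.1.2}.indicator
        (fun q => k' (q.1.1, q.2))) (s, r)) := by
    refine StronglyMeasurable.integral_prod_right' (f := {q : (Space n × ℝ) × ℝ | q.2 ≤ q.1.2}.indicator
        (fun q => k' (q.1.1, q.2))) ?_
    refine StronglyMeasurable.indicator (hk'.comp_measurable (by fun_prop)) ?_
    exact measurableSet_le (by fun_prop) (by fun_prop)
  refine ⟨_, hm, ?_⟩
  have h1 := ae_cyl_of_fst (T := T) (ae_slice_space hk.ae_eq_mk)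
  have h2 : ∀ᵐ s ∂(volume.restrict (cyl Ω T)), s.2 ∈ Ioo 0 T :=
    ae_cyl_of_snd (ae_restrict_mem measurableSet_Ioo)
  filter_upwards [h1, h2] with s hs ht
  rw [intervalIntegral_eq_setIntegral_indicator ⟨ht.1.le, ht.2.le⟩]
  refine integral_congr_ae ?_
  filter_upwards [hs] with r hr
  by_cases h : r ≤ s.2
  · simp [indicator, h, k', hr]
  · simp [indicator, h]

/-- Neither factor is bounded on Q: v is square integrable in time and Z is bounded in time with
values in L²(Ω), so the time integral of |v|² ‖Z‖² is finite. -/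
lemma memLp_time_mul {Z : Space n × ℝ → ℝ} {v : ℝ → ℝ} {C : ℝ}
    (hZ : MemLp Z 2 (volume.restrict (cyl Ω T))) (hv : MemLp v 2 (volume.restrict (Ioo 0 T)))
    (hC : ∀ᵐ t ∂(volume.restrict (Ioo 0 T)), (eLpNorm (fun x => Z (x, t)) 2 (volume.restrict Ω)).toReal ≤ C) :
    MemLp (fun s => v s.2 * Z s) 2 (volume.restrict (cyl Ω T)) := by
  have hm : AEStronglyMeasurable (fun s => v s.2 * Z s) (volume.restrict (cyl Ω T)) :=
    (aestronglyMeasurable_snd hv.1).mul hZ.1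
  rw [memLp_two_iff_integrable_sq hm]
  have hm2 := hm.pow 2
  rw [cyl_measure] at hm2 ⊢
  have hi : Integrable ((fun s : Space n × ℝ => v s.2 * Z s) ^ 2)
      ((volume.restrict Ω).prod (volume.restrict (Ioo 0 T))) := by
    rw [integrable_prod_iff' hm2]
    constructor
    · filter_upwards [memLp_slice_time hZ] with t ht
      have := (ht.const_mul (v t)).integrable_sq
      exact this
    · have h1 := integrable_integral_slice hZ.integrable_sq
      have h2 : Integrable (fun t => v t ^ 2 * ∫ x in Ω, Z (x, t) ^ 2) (volume.restrict (Ioo 0 T)) := by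
        have hb : MemLp (fun t => ∫ x in Ω, Z (x, t) ^ 2) ∞ (volume.restrict (Ioo 0 T)) := by
          refine memLp_top_of_bound h1.1 (C ^ 2) ?_
          filter_upwards [hC, memLp_slice_time hZ] with t ht ht2
          rw [Real.norm_of_nonneg (integral_nonneg fun x => sq_nonneg _), ← eLpNorm_two_sq ht2]
          gcongr
        have := memLp_bounded_mul hb (memLp_one_iff_integrable.2 hv.integrable_sq)
        refine (memLp_one_iff_integrable.1 this).congr (Eventually.of_forall fun t => ?_)
        simp only
        ring
      refine h2.congr (Eventually.of_forall fun t => ?_)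
      simp only [Pi.pow_apply, mul_pow]
      rw [← integral_const_mul]
      congr 1
      ext x
      rw [Real.norm_of_nonneg (by positivity)]
  exact hi

namespace MemY

variable {Z Z' : Space n × ℝ → ℝ}

lemma hasWeakDeriv_dx (h : MemY Ω T Z) (i : Fin n) :
    HasWeakDeriv (cyl Ω T) (unitVec i, 0) Z (dx Ω T i Z) := by
  obtain ⟨g, hg, -⟩ := h.space_deriv i
  exact hg.wderiv_spec

lemma memLp_dx (hΩ : IsOpen Ω) (h : MemY Ω T Z) (i : Fin n) :
    MemLp (dx Ω T i Z) 2 (volume.restrict (cyl Ω T)) := by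
  obtain ⟨g, hg, hg2, -⟩ := h.space_deriv i
  exact (memLp_congr_ae (hg.wderiv_ae_eq (isOpen_cyl hΩ))).2 hg2

lemma hasWeakDeriv_dx_dx (hΩ : IsOpen Ω) (h : MemY Ω T Z) (i j : Fin n) :
    HasWeakDeriv (cyl Ω T) (unitVec j, 0) (dx Ω T i Z) (dx Ω T j (dx Ω T i Z)) := by
  obtain ⟨g, hg, hg2, hg3⟩ := h.space_deriv i
  obtain ⟨g', hg', -⟩ := hg3 j
  exact (hg'.congr (hg.wderiv_ae_eq (isOpen_cyl hΩ)).symm (ae_eq_refl _)).wderiv_spec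

lemma memLp_dx_dx (hΩ : IsOpen Ω) (h : MemY Ω T Z) (i j : Fin n) :
    MemLp (dx Ω T j (dx Ω T i Z)) 2 (volume.restrict (cyl Ω T)) := by
  obtain ⟨g, hg, hg2, hg3⟩ := h.space_deriv i
  obtain ⟨g', hg', hg'2⟩ := hg3 j
  have := (hg'.congr (hg.wderiv_ae_eq (isOpen_cyl hΩ)).symm (ae_eq_refl _)).wderiv_ae_eq
    (isOpen_cyl hΩ)
  exact (memLp_congr_ae this).2 hg'2

lemma hasWeakDeriv_dt (h : MemY Ω T Z) : HasWeakDeriv (cyl Ω T) (0, 1) Z (dt Ω T Z) := by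
  obtain ⟨g, hg, -⟩ := h.time_deriv
  exact hg.wderiv_spec

lemma memLp_dt (hΩ : IsOpen Ω) (h : MemY Ω T Z) :
    MemLp (dt Ω T Z) 2 (volume.restrict (cyl Ω T)) := by
  obtain ⟨g, hg, hg2⟩ := h.time_deriv
  exact (memLp_congr_ae (hg.wderiv_ae_eq (isOpen_cyl hΩ))).2 hg2

lemma memLp_lap (hΩ : IsOpen Ω) (h : MemY Ω T Z) :
    MemLp (lap Ω T Z) 2 (volume.restrict (cyl Ω T)) :=
  memLp_finsetSum _ fun i _ => h.memLp_dx_dx hΩ i i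

/-- Reconciles two gradients: almost every slice of the weak gradient on Q is the weak gradient of
the slice, which the boundary condition places in H^1_0. -/
lemma ae_pair (hΩ : IsOpen Ω) (h : MemY Ω T Z) : ∀ᵐ t ∂(volume.restrict (Ioo 0 T)),
    IsH10Pair Ω (fun x => Z (x, t)) (fun i x => dx Ω T i Z (x, t)) := by
  have h1 : ∀ i, ∀ᵐ t ∂(volume.restrict (Ioo 0 T)), ∀ φ, IsTestFunction Ω φ →
      ∫ x in Ω, Z (x, t) * fderiv ℝ φ x (unitVec i) = - ∫ x in Ω, dx Ω T i Z (x, t) * φ x :=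
    fun i => (h.hasWeakDeriv_dx i).ae_slice h.memLp (h.memLp_dx hΩ i)
  have h2 : ∀ i, ∀ᵐ t ∂(volume.restrict (Ioo 0 T)),
      MemLp (fun x => dx Ω T i Z (x, t)) 2 (volume.restrict Ω) :=
    fun i => memLp_slice_time (h.memLp_dx hΩ i)
  filter_upwards [ae_all_iff.2 h1, ae_all_iff.2 h2, memLp_slice_time h.memLp, h.boundary]
    with t h1 h2 h3 h4
  have hw : ∀ i, HasWeakDeriv Ω (unitVec i) (fun x => Z (x, t)) (fun x => dx Ω T i Z (x, t)) :=
    fun i => ⟨locallyIntegrableOn_of_memLp (by simp) h3, locallyIntegrableOn_of_memLp (by simp) (h2 i),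
      h1 i⟩
  exact (h4.pair hΩ).congr (ae_eq_refl _) fun i => (hw i).wderiv_ae_eq hΩ

lemma slice_eLpNorm_toReal_continuousOn (h : MemY Ω T Z) :
    ContinuousOn (fun t => (eLpNorm (fun x => Z (x, t)) 2 (volume.restrict Ω)).toReal) (Icc 0 T) := by
  intro t ht
  have h1 := (ENNReal.tendsto_toReal ENNReal.zero_ne_top).comp (h.slice_continuous t ht)
  simp only [ENNReal.toReal_zero] at h1
  rw [ContinuousWithinAt, tendsto_iff_dist_tendsto_zero]
  refine squeeze_zero' (Eventually.of_forall fun _ => dist_nonneg) ?_ h1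
  filter_upwards [self_mem_nhdsWithin] with s hs
  have e1 := h.slice_memLp s hs
  have e2 := h.slice_memLp t ht
  rw [Real.dist_eq]
  have key : ∀ {a b : Space n → ℝ}, MemLp a 2 (volume.restrict Ω) → MemLp b 2 (volume.restrict Ω) →
      (eLpNorm a 2 (volume.restrict Ω)).toReal - (eLpNorm b 2 (volume.restrict Ω)).toReal
        ≤ (eLpNorm (fun x => a x - b x) 2 (volume.restrict Ω)).toReal := by
    intro a b ha hb
    have h2 : eLpNorm a 2 (volume.restrict Ω) ≤ eLpNorm (fun x => a x - b x) 2 (volume.restrict Ω)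
        + eLpNorm b 2 (volume.restrict Ω) := by
      refine le_trans (le_of_eq ?_) (eLpNorm_add_le (ha.sub hb).1 hb.1 (by simp))
      congr 1
      ext x
      simp
    have h3 := ENNReal.toReal_mono (ENNReal.add_ne_top.2 ⟨(ha.sub hb).eLpNorm_ne_top,
      hb.eLpNorm_ne_top⟩) h2
    rw [ENNReal.toReal_add (by exact (ha.sub hb).eLpNorm_ne_top) hb.eLpNorm_ne_top] at h3
    exact sub_le_iff_le_add.2 h3
  rw [abs_le]
  have k1 := key e1 e2
  have k2 := key e2 e1
  have hc : eLpNorm (fun x => Z (x, t) - Z (x, s)) 2 (volume.restrict Ω)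
      = eLpNorm (fun x => Z (x, s) - Z (x, t)) 2 (volume.restrict Ω) := eLpNorm_sub_comm _ _ _ _
  rw [hc] at k2
  simp only [Function.comp]
  constructor <;> linarith

lemma exists_slice_bound (h : MemY Ω T Z) : ∃ C, ∀ t ∈ Icc 0 T,
    (eLpNorm (fun x => Z (x, t)) 2 (volume.restrict Ω)).toReal ≤ C := by
  obtain ⟨C, hC⟩ := isCompact_Icc.exists_bound_of_continuousOn h.slice_eLpNorm_toReal_continuousOn
  exact ⟨C, fun t ht => (le_abs_self _).trans (hC t ht)⟩

lemma ae_slice_bound (h : MemY Ω T Z) : ∃ C, ∀ᵐ t ∂(volume.restrict (Ioo 0 T)),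
    (eLpNorm (fun x => Z (x, t)) 2 (volume.restrict Ω)).toReal ≤ C := by
  obtain ⟨C, hC⟩ := h.exists_slice_bound
  refine ⟨C, ?_⟩
  filter_upwards [ae_restrict_mem measurableSet_Ioo] with t ht
  exact hC t ⟨ht.1.le, ht.2.le⟩

lemma continuousOn_pairing (h : MemY Ω T Z) {c : Space n → ℝ} (hc : MemLp c 2 (volume.restrict Ω)) :
    ContinuousOn (fun t => ∫ x in Ω, c x * Z (x, t)) (Icc 0 T) := by
  intro t ht
  refine tendsto_integral_const_mul ?_ hc (h.slice_memLp t ht) (h.slice_continuous t ht)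
  filter_upwards [self_mem_nhdsWithin] with s hs using h.slice_memLp s hs

/-- The pairing with a test function is a primitive. -/
lemma pairing_hasWeakDeriv (hΩ : IsOpen Ω) (h : MemY Ω T Z) {φ : Space n → ℝ}
    (hφ : IsTestFunction Ω φ) :
    IntegrableOn (fun t => ∫ x in Ω, φ x * dt Ω T Z (x, t)) (Ioo 0 T) ∧
    HasWeakDeriv (Ioo 0 T) (1 : ℝ) (fun t => ∫ x in Ω, φ x * Z (x, t))
      (fun t => ∫ x in Ω, φ x * dt Ω T Z (x, t)) := by
  have hφ2 : MemLp (fun s : Space n × ℝ => φ s.1) 2 (volume.restrict (cyl Ω T)) :=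
    memLp_two_fst (hφ.memLp 2)
  have i1 := integrable_mul_of_memLp_two hφ2 h.memLp
  have i2 := integrable_mul_of_memLp_two hφ2 (h.memLp_dt hΩ)
  have j1 := integrable_integral_slice i1
  have j2 := integrable_integral_slice i2
  refine ⟨j2, j1.locallyIntegrableOn, j2.locallyIntegrableOn, fun ψ hψ => ?_⟩
  have h2 := h.hasWeakDeriv_dt.2.2 _ (hφ.tensor hψ)
  have bi : ∀ {K : Space n × ℝ → ℝ} {ψ : ℝ → ℝ}, IsTestFunction (Ioo 0 T) ψ →
      Integrable K (volume.restrict (cyl Ω T)) →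
      Integrable (fun s => ψ s.2 * K s) (volume.restrict (cyl Ω T)) := fun hψ hK =>
    memLp_one_iff_integrable.1 (memLp_bounded_mul (memLp_top_snd (hψ.memLp ∞))
      (memLp_one_iff_integrable.2 hK))
  have e1 : ∀ s : Space n × ℝ, Z s * fderiv ℝ (fun s : Space n × ℝ => φ s.1 * ψ s.2) s (0, 1)
      = fderiv ℝ ψ s.2 1 * (φ s.1 * Z s) := by
    intro s
    rw [fderiv_tensor hφ.differentiable hψ.differentiable]
    simp only [map_zero, zero_mul, add_zero]
    ring
  have e2 : ∀ s : Space n × ℝ, dt Ω T Z s * (φ s.1 * ψ s.2) = ψ s.2 * (φ s.1 * dt Ω T Z s) :=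
    fun s => by ring
  simp_rw [e1, e2] at h2
  rw [integral_cyl (bi (hψ.fderiv_apply 1) i1), integral_cyl (bi hψ i2)] at h2
  simp only [integral_const_mul] at h2
  simp only [mul_comm _ (ψ _), mul_comm _ (fderiv ℝ ψ _ 1)]
  exact h2

lemma locallyIntegrableOn_primitive {F : Space n × ℝ → ℝ}
    (hF : MemLp F 2 (volume.restrict (cyl Ω T))) {s t : ℝ} (hst : s ≤ t)
    (hs : 0 ≤ s) (ht : t ≤ T) :
    LocallyIntegrableOn (fun x => ∫ r in s..t, F (x, r)) Ω := by
  intro x hx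
  refine ⟨Metric.closedBall x 1 ∩ Ω, inter_mem (mem_nhdsWithin_of_mem_nhds
    (Metric.closedBall_mem_nhds x one_pos)) self_mem_nhdsWithin, ?_⟩
  -- Ω may have infinite measure, so F in L² is integrable only over bounded pieces of the cylinder.
  set K := Metric.closedBall x 1 ∩ Ω
  have hK : volume K < ⊤ := (measure_mono inter_subset_left).trans_lt
    (isCompact_closedBall x 1).measure_lt_top
  have hsub : K ×ˢ Ioo s t ⊆ cyl Ω T := prod_mono inter_subset_right
    (Ioo_subset_Ioo hs ht)
  have h1 : MemLp F 2 (volume.restrict (K ×ˢ Ioo s t)) :=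
    hF.mono_measure (Measure.restrict_mono hsub le_rfl)
  have : IsFiniteMeasure ((volume : Measure (Space n × ℝ)).restrict (K ×ˢ Ioo s t)) := by
    refine ⟨?_⟩
    rw [Measure.restrict_apply_univ, Measure.volume_eq_prod, Measure.prod_prod]
    exact ENNReal.mul_lt_top hK (by simp)
  have h2 : Integrable F (volume.restrict (K ×ˢ Ioo s t)) := h1.integrable (by simp)
  rw [Measure.volume_eq_prod, ← Measure.prod_restrict] at h2
  have h3 := h2.integral_prod_left
  refine h3.congr (Eventually.of_forall fun x => ?_)
  simp only
  rw [setIntegral_Ioo_eq_intervalIntegral hst]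

/-- An element of `Y` is, as a function of time, a primitive of its weak derivative. -/
lemma sub_eq_integral_dt (hΩ : IsOpen Ω) (hT : 0 < T) (h : MemY Ω T Z) {s t : ℝ} (hs : 0 ≤ s)
    (hst : s ≤ t) (ht : t ≤ T) :
    ∀ᵐ x ∂(volume.restrict Ω), Z (x, t) - Z (x, s) = ∫ r in s..t, dt Ω T Z (x, r) := by
  have hsm : s ∈ Icc 0 T := ⟨hs, hst.trans ht⟩
  have htm : t ∈ Icc 0 T := ⟨hs.trans hst, ht⟩
  refine ae_eq_of_forall_test hΩ
    (locallyIntegrableOn_of_memLp (by simp) ((h.slice_memLp t htm).sub (h.slice_memLp s hsm)))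
    (locallyIntegrableOn_primitive (h.memLp_dt hΩ) hst hs ht) (fun φ hφ => ?_)
  -- Paired with a test function, Z becomes a continuous function of time with an integrable weak
  -- derivative, and the one-variable result applies at all times.
  obtain ⟨h1, h2⟩ := h.pairing_hasWeakDeriv hΩ hφ
  have h3 := h2.sub_eq_integral hT h1 (h.continuousOn_pairing (hφ.memLp 2)) hsm htm
  simp_rw [sub_mul]
  have hφL : MemLp φ 2 (volume.restrict Ω) := hφ.memLp 2
  rw [integral_sub (integrable_mul_of_memLp_two (h.slice_memLp t htm) hφL)
    (integrable_mul_of_memLp_two (h.slice_memLp s hsm) hφL)]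
  simp only [mul_comm _ (φ _)]
  rw [h3]
  have hφ2 : MemLp (fun s : Space n × ℝ => φ s.1) 2 (volume.restrict (cyl Ω T)) :=
    memLp_two_fst (hφ.memLp 2)
  have i2 := integrable_mul_of_memLp_two hφ2 (h.memLp_dt hΩ)
  rw [cyl_measure] at i2
  have i3 : Integrable (fun q : Space n × ℝ => φ q.1 * dt Ω T Z q)
      ((volume.restrict Ω).prod (volume.restrict (Ioo s t))) := by
    refine i2.mono_measure (Measure.prod_mono le_rfl ?_)
    exact Measure.restrict_mono (Ioo_subset_Ioo hs ht) le_rfl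
  have h4 := integral_integral_swap (f := fun x r => φ x * dt Ω T Z (x, r)) i3
  simp only [integral_const_mul] at h4
  simp_rw [setIntegral_Ioo_eq_intervalIntegral hst] at h4
  exact h4.symm

/-- Exchanges the quantifiers of `sub_eq_integral_dt`: the exceptional set of points depends on the
time there, and Fubini turns this into a formula along almost every time line, where one-variable
calculus can be used. -/
lemma ae_eq_primitive (hΩ : IsOpen Ω) (hT : 0 < T) (h : MemY Ω T Z) :
    ∀ᵐ x ∂(volume.restrict Ω), ∀ᵐ t ∂(volume.restrict (Ioo 0 T)),
      Z (x, t) = Z (x, 0) + ∫ r in (0 : ℝ)..t, dt Ω T Z (x, r) := by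
  have hD : AEStronglyMeasurable (fun s : Space n × ℝ =>
      Z s - Z (s.1, 0) - ∫ r in (0 : ℝ)..s.2, dt Ω T Z (s.1, r)) (volume.restrict (cyl Ω T)) :=
    (h.memLp.1.sub (aestronglyMeasurable_fst (h.slice_memLp 0 ⟨le_rfl, hT.le⟩).1)).sub
      (aestronglyMeasurable_primitive (h.memLp_dt hΩ).1)
  have := ae_slice_space (ae_cyl_of_ae_slice_time hD (by
    filter_upwards [ae_restrict_mem measurableSet_Ioo] with t ht
    filter_upwards [h.sub_eq_integral_dt hΩ hT le_rfl ht.1.le ht.2.le] with x hx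
    rw [hx, sub_self]))
  filter_upwards [this] with x hx
  filter_upwards [hx] with t ht
  linarith

lemma ae_integrableOn_dt (hΩ : IsOpen Ω) (h : MemY Ω T Z) :
    ∀ᵐ x ∂(volume.restrict Ω), IntegrableOn (fun t => dt Ω T Z (x, t)) (Ioo 0 T) := by
  filter_upwards [memLp_slice_space (h.memLp_dt hΩ)] with x hx
  exact hx.integrable (by simp)

end MemY

end Cylinder

/-! ### Algebra of the state space: sums and products with functions of x or of t. -/

section StateSpace

variable {n : ℕ} {Ω : Set (Space n)} {T : ℝ}

lemma HasWeakDeriv.comp_fst {b g : Space n → ℝ} {i : Fin n}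
    (hb : MemLp b ∞ (volume.restrict Ω)) (hg : MemLp g ∞ (volume.restrict Ω))
    (h : HasWeakDeriv Ω (unitVec i) b g) :
    HasWeakDeriv (cyl Ω T) (unitVec i, 0) (fun s => b s.1) (fun s => g s.1) := by
  have l1 : LocallyIntegrableOn (fun s : Space n × ℝ => b s.1) (cyl Ω T) :=
    locallyIntegrableOn_of_memLp (by simp) (memLp_top_fst hb)
  have l2 : LocallyIntegrableOn (fun s : Space n × ℝ => g s.1) (cyl Ω T) :=
    locallyIntegrableOn_of_memLp (by simp) (memLp_top_fst hg)
  refine ⟨l1, l2, fun φ hφ => ?_⟩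
  rw [integral_cyl ((hφ.fderiv_apply _).integrable_mul l1), integral_cyl (hφ.integrable_mul l2),
    ← integral_neg]
  congr 1
  ext t
  rw [← h.2.2 _ (hφ.slice_time t)]
  congr 1
  ext x
  congr 1
  have h1 : HasFDerivAt (fun x : Space n => (x, t)) (ContinuousLinearMap.inl ℝ (Space n) ℝ) x :=
    hasFDerivAt_prodMk_left x t
  have := (hφ.differentiable (x, t)).hasFDerivAt.comp x h1
  have h2 : fderiv ℝ (fun x => φ (x, t)) x = _ := this.fderiv
  rw [h2]
  simp

lemma fderiv_slice_space {φ : Space n × ℝ → ℝ} (hφ : Differentiable ℝ φ) (x : Space n) (t : ℝ) :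
    fderiv ℝ (fun t => φ (x, t)) t 1 = fderiv ℝ φ (x, t) (0, 1) := by
  have h1 : HasFDerivAt (fun t : ℝ => (x, t)) (ContinuousLinearMap.inr ℝ (Space n) ℝ) t :=
    hasFDerivAt_prodMk_right x t
  have := (hφ (x, t)).hasFDerivAt.comp t h1
  have h2 : fderiv ℝ (fun t => φ (x, t)) t = _ := this.fderiv
  rw [h2]
  simp

/-- A weak time derivative on the cylinder from primitives on almost every line. -/
lemma hasWeakDeriv_time_of_primitive (hT : 0 ≤ T) {F K : Space n × ℝ → ℝ} {F0 : Space n → ℝ}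
    (hF : LocallyIntegrableOn F (cyl Ω T)) (hK : LocallyIntegrableOn K (cyl Ω T))
    (hKi : ∀ᵐ x ∂(volume.restrict Ω), IntegrableOn (fun t => K (x, t)) (Ioo 0 T))
    (h : ∀ᵐ x ∂(volume.restrict Ω), ∀ᵐ t ∂(volume.restrict (Ioo 0 T)),
      F (x, t) = F0 x + ∫ r in (0 : ℝ)..t, K (x, r)) :
    HasWeakDeriv (cyl Ω T) (0, 1) F K := by
  refine ⟨hF, hK, fun φ hφ => ?_⟩
  rw [integral_cyl' ((hφ.fderiv_apply _).integrable_mul hF), integral_cyl' (hφ.integrable_mul hK),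
    ← integral_neg]
  refine integral_congr_ae ?_
  filter_upwards [hKi, h] with x hi hx
  rw [← primitive_weak hi (F0 x) hT (hφ.slice_space x)]
  refine integral_congr_ae ?_
  filter_upwards [hx] with t ht
  rw [ht, fderiv_slice_space hφ.differentiable]

lemma hasWeakDeriv_time_fst (hT : 0 ≤ T) {b : Space n → ℝ}
    (hb : LocallyIntegrableOn (fun s : Space n × ℝ => b s.1) (cyl Ω T)) :
    HasWeakDeriv (cyl Ω T) (0, 1) (fun s => b s.1) (fun _ => 0) := by
  refine hasWeakDeriv_time_of_primitive (F0 := b) hT hb locallyIntegrableOn_zero ?_ ?_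
  · exact Eventually.of_forall fun x => integrableOn_zero
  · exact Eventually.of_forall fun x => Eventually.of_forall fun t => by simp

/-- `Z ∈ Y`, with spatial gradient `G`, Hessian `H` and time derivative `K`. -/
structure IsYRep (Ω : Set (Space n)) (T : ℝ) (Z : Space n × ℝ → ℝ)
    (G : Fin n → Space n × ℝ → ℝ) (H : Fin n → Fin n → Space n × ℝ → ℝ)
    (K : Space n × ℝ → ℝ) : Prop where
  memLp : MemLp Z 2 (volume.restrict (cyl Ω T))
  grad : ∀ i, HasWeakDeriv (cyl Ω T) (unitVec i, 0) Z (G i)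
  grad_memLp : ∀ i, MemLp (G i) 2 (volume.restrict (cyl Ω T))
  hess : ∀ i j, HasWeakDeriv (cyl Ω T) (unitVec j, 0) (G i) (H i j)
  hess_memLp : ∀ i j, MemLp (H i j) 2 (volume.restrict (cyl Ω T))
  time : HasWeakDeriv (cyl Ω T) (0, 1) Z K
  time_memLp : MemLp K 2 (volume.restrict (cyl Ω T))
  boundary : ∀ᵐ t ∂(volume.restrict (Ioo 0 T)), MemH10 Ω (fun x => Z (x, t))
  slice_memLp : ∀ t ∈ Icc 0 T, MemLp (fun x => Z (x, t)) 2 (volume.restrict Ω)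
  slice_continuous : ∀ t ∈ Icc 0 T,
    Tendsto (fun s => eLpNorm (fun x => Z (x, s) - Z (x, t)) 2 (volume.restrict Ω))
      (𝓝[Icc 0 T] t) (𝓝 0)

lemma MemY.rep (hΩ : IsOpen Ω) {Z : Space n × ℝ → ℝ} (h : MemY Ω T Z) :
    IsYRep Ω T Z (fun i => dx Ω T i Z) (fun i j => dx Ω T j (dx Ω T i Z)) (dt Ω T Z) :=
  ⟨h.memLp, h.hasWeakDeriv_dx, h.memLp_dx hΩ, h.hasWeakDeriv_dx_dx hΩ, h.memLp_dx_dx hΩ,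
    h.hasWeakDeriv_dt, h.memLp_dt hΩ, h.boundary, h.slice_memLp, h.slice_continuous⟩

namespace IsYRep

variable {Z Z' : Space n × ℝ → ℝ} {G G' : Fin n → Space n × ℝ → ℝ}
  {H H' : Fin n → Fin n → Space n × ℝ → ℝ} {K K' : Space n × ℝ → ℝ}

lemma memY (h : IsYRep Ω T Z G H K) : MemY Ω T Z :=
  ⟨h.memLp, fun i => ⟨G i, h.grad i, h.grad_memLp i, fun j => ⟨H i j, h.hess i j, h.hess_memLp i j⟩⟩,
    ⟨K, h.time, h.time_memLp⟩, h.boundary, h.slice_memLp, h.slice_continuous⟩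

lemma dx_ae (hΩ : IsOpen Ω) (h : IsYRep Ω T Z G H K) (i : Fin n) :
    dx Ω T i Z =ᵐ[volume.restrict (cyl Ω T)] G i :=
  (h.grad i).wderiv_ae_eq (isOpen_cyl hΩ)

lemma dt_ae (hΩ : IsOpen Ω) (h : IsYRep Ω T Z G H K) :
    dt Ω T Z =ᵐ[volume.restrict (cyl Ω T)] K :=
  h.time.wderiv_ae_eq (isOpen_cyl hΩ)

lemma lap_ae (hΩ : IsOpen Ω) (h : IsYRep Ω T Z G H K) :
    lap Ω T Z =ᵐ[volume.restrict (cyl Ω T)] fun s => ∑ i, H i i s := by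
  have h1 : ∀ i, dx Ω T i (dx Ω T i Z) =ᵐ[volume.restrict (cyl Ω T)] H i i := fun i =>
    (wderiv_congr (isOpen_cyl hΩ) (h.dx_ae hΩ i)).trans ((h.hess i i).wderiv_ae_eq (isOpen_cyl hΩ))
  filter_upwards [ae_all_iff.2 h1] with s hs
  simp [lap, hs]

/-- Linear combinations. -/
lemma lin (hΩ : IsOpen Ω) (h : IsYRep Ω T Z G H K) (h' : IsYRep Ω T Z' G' H' K') (a b : ℝ) :
    IsYRep Ω T (fun s => a * Z s + b * Z' s) (fun i s => a * G i s + b * G' i s)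
      (fun i j s => a * H i j s + b * H' i j s) (fun s => a * K s + b * K' s) := by
  refine ⟨(h.memLp.const_mul a).add (h'.memLp.const_mul b),
    fun i => ((h.grad i).const_mul a).add ((h'.grad i).const_mul b),
    fun i => ((h.grad_memLp i).const_mul a).add ((h'.grad_memLp i).const_mul b),
    fun i j => ((h.hess i j).const_mul a).add ((h'.hess i j).const_mul b),
    fun i j => ((h.hess_memLp i j).const_mul a).add ((h'.hess_memLp i j).const_mul b),
    (h.time.const_mul a).add (h'.time.const_mul b),
    (h.time_memLp.const_mul a).add (h'.time_memLp.const_mul b), ?_,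
    fun t ht => ((h.slice_memLp t ht).const_mul a).add ((h'.slice_memLp t ht).const_mul b),
    fun t ht => ?_⟩
  · filter_upwards [h.boundary, h'.boundary] with t h1 h2
    exact (((h1.pair hΩ).const_mul a).add ((h2.pair hΩ).const_mul b)).memH10 hΩ
  · have key : ∀ (a : ℝ) {Z : Space n × ℝ → ℝ}, Tendsto (fun s => eLpNorm (fun x => Z (x, s) - Z (x, t)) 2 (volume.restrict Ω))
      (𝓝[Icc 0 T] t) (𝓝 0) → Tendsto (fun s => eLpNorm (fun x => a * (Z (x, s) - Z (x, t))) 2 (volume.restrict Ω))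
      (𝓝[Icc 0 T] t) (𝓝 0) := by
      intro a Z h
      have := ENNReal.Tendsto.const_mul (a := ‖a‖ₑ) h (Or.inr (by simp))
      rw [mul_zero] at this
      refine this.congr fun s => ?_
      rw [← eLpNorm_const_smul]
      rfl
    have h1 := (key a (h.slice_continuous t ht)).add (key b (h'.slice_continuous t ht))
    rw [add_zero] at h1
    refine tendsto_of_tendsto_of_tendsto_of_le_of_le' tendsto_const_nhds h1
      (Eventually.of_forall fun _ => zero_le) ?_
    filter_upwards [self_mem_nhdsWithin] with s hs
    refine le_trans (le_of_eq ?_) (eLpNorm_add_le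
      (((h.slice_memLp s hs).sub (h.slice_memLp t ht)).const_mul a).1
      (((h'.slice_memLp s hs).sub (h'.slice_memLp t ht)).const_mul b).1 (by simp))
    congr 1
    ext x
    simp only [Pi.add_apply]
    ring

lemma zero (hΩ : IsOpen Ω) (T : ℝ) :
    IsYRep Ω T (fun _ => 0) (fun _ _ => 0) (fun _ _ _ => 0) (fun _ => 0) := by
  refine ⟨MemLp.zero', fun _ => HasWeakDeriv.zero, fun _ => MemLp.zero',
    fun _ _ => HasWeakDeriv.zero, fun _ _ => MemLp.zero', HasWeakDeriv.zero, MemLp.zero',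
    Eventually.of_forall fun t => IsH10Pair.zero.memH10 hΩ, fun _ _ => MemLp.zero', fun t _ => ?_⟩
  simpa using tendsto_const_nhds

lemma sum (hΩ : IsOpen Ω) {ι : Type*} (s : Finset ι) {Z : ι → Space n × ℝ → ℝ}
    {G : ι → Fin n → Space n × ℝ → ℝ} {H : ι → Fin n → Fin n → Space n × ℝ → ℝ}
    {K : ι → Space n × ℝ → ℝ} (h : ∀ l ∈ s, IsYRep Ω T (Z l) (G l) (H l) (K l)) :
    IsYRep Ω T (fun x => ∑ l ∈ s, Z l x) (fun i x => ∑ l ∈ s, G l i x)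
      (fun i j x => ∑ l ∈ s, H l i j x) (fun x => ∑ l ∈ s, K l x) := by
  classical
  induction s using Finset.induction_on with
  | empty => simpa using zero hΩ T
  | insert a s ha ih =>
    simp_rw [Finset.sum_insert ha]
    have := (h a (Finset.mem_insert_self a s)).lin hΩ
      (ih fun i hi => h i (Finset.mem_insert_of_mem hi)) 1 1
    simpa only [one_mul] using this

/-- Products with functions of space in `W^{2,∞}`. -/
lemma mul_fst (hΩ : IsOpen Ω) (hT : 0 ≤ T) (h : IsYRep Ω T Z G H K) {b : Space n → ℝ}
    (hb : MemW Ω ∞ 2 b) :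
    IsYRep Ω T (fun s => b s.1 * Z s)
      (fun i s => b s.1 * G i s + wderiv Ω (unitVec i) b s.1 * Z s)
      (fun i j s => (b s.1 * H i j s + wderiv Ω (unitVec j) b s.1 * G i s)
        + (wderiv Ω (unitVec i) b s.1 * G j s
          + wderiv Ω (unitVec j) (wderiv Ω (unitVec i) b) s.1 * Z s))
      (fun s => b s.1 * K s) := by
  have m0 : MemLp (fun s : Space n × ℝ => b s.1) ∞ (volume.restrict (cyl Ω T)) :=
    memLp_top_fst hb.memLp
  have m1 : ∀ i, MemLp (fun s : Space n × ℝ => wderiv Ω (unitVec i) b s.1) ∞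
      (volume.restrict (cyl Ω T)) := fun i => memLp_top_fst (hb.wderiv hΩ i).memLp
  have m2 : ∀ i j, MemLp (fun s : Space n × ℝ => wderiv Ω (unitVec j) (wderiv Ω (unitVec i) b) s.1) ∞
      (volume.restrict (cyl Ω T)) := fun i j => memLp_top_fst ((hb.wderiv hΩ i).wderiv hΩ j).memLp
  have d1 : ∀ i, HasWeakDeriv (cyl Ω T) (unitVec i, 0) (fun s => b s.1)
      (fun s => wderiv Ω (unitVec i) b s.1) := fun i =>
    (hb.hasWeakDeriv i).comp_fst hb.memLp (hb.wderiv hΩ i).memLp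
  have d2 : ∀ i j, HasWeakDeriv (cyl Ω T) (unitVec j, 0) (fun s => wderiv Ω (unitVec i) b s.1)
      (fun s => wderiv Ω (unitVec j) (wderiv Ω (unitVec i) b) s.1) := fun i j =>
    ((hb.wderiv hΩ i).hasWeakDeriv j).comp_fst (hb.wderiv hΩ i).memLp
      ((hb.wderiv hΩ i).wderiv hΩ j).memLp
  have dT : HasWeakDeriv (cyl Ω T) (0, 1) (fun s => b s.1) (fun _ => 0) :=
    hasWeakDeriv_time_fst hT (locallyIntegrableOn_of_memLp (by simp) m0)
  have hQ := isOpen_cyl (T := T) hΩ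
  refine ⟨memLp_bounded_mul m0 h.memLp,
    fun i => HasWeakDeriv.mul_of_bounded hQ m0 (m1 i) (d1 i) (h.grad i),
    fun i => (memLp_bounded_mul m0 (h.grad_memLp i)).add (memLp_bounded_mul (m1 i) h.memLp),
    fun i j => (HasWeakDeriv.mul_of_bounded hQ m0 (m1 j) (d1 j) (h.hess i j)).add
      (HasWeakDeriv.mul_of_bounded hQ (m1 i) (m2 i j) (d2 i j) (h.grad j)),
    fun i j => ((memLp_bounded_mul m0 (h.hess_memLp i j)).add
      (memLp_bounded_mul (m1 j) (h.grad_memLp i))).add ((memLp_bounded_mul (m1 i) (h.grad_memLp j)).add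
      (memLp_bounded_mul (m2 i j) h.memLp)), ?_, memLp_bounded_mul m0 h.time_memLp, ?_,
    fun t ht => memLp_bounded_mul hb.memLp (h.slice_memLp t ht), fun t ht => ?_⟩
  · have := HasWeakDeriv.mul_of_bounded hQ m0 MemLp.zero' dT h.time
    simpa using this
  · filter_upwards [h.boundary] with t h1
    exact ((h1.pair hΩ).bounded_mul hΩ hb.memLp (fun i => (hb.wderiv hΩ i).memLp)
      hb.hasWeakDeriv).memH10 hΩ
  · have := ENNReal.Tendsto.const_mul (a := eLpNorm b ∞ (volume.restrict Ω))
      (h.slice_continuous t ht) (Or.inr hb.memLp.eLpNorm_ne_top)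
    rw [mul_zero] at this
    refine tendsto_of_tendsto_of_tendsto_of_le_of_le' tendsto_const_nhds this
      (Eventually.of_forall fun _ => zero_le) ?_
    filter_upwards [self_mem_nhdsWithin] with s hs
    refine le_trans (le_of_eq ?_)
      (eLpNorm_bounded_mul_le hb.memLp ((h.slice_memLp s hs).sub (h.slice_memLp t ht)))
    congr 1
    ext x
    ring

/-- Products with functions of time in `H¹(0,T)` vanishing at `0`. -/
lemma primitive_mul (hΩ : IsOpen Ω) (hT : 0 < T) (h : IsYRep Ω T Z G H K) {v : ℝ → ℝ}
    (hv : MemLp v 2 (volume.restrict (Ioo 0 T))) :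
    IsYRep Ω T (fun s => (∫ r in (0 : ℝ)..s.2, v r) * Z s)
      (fun i s => (∫ r in (0 : ℝ)..s.2, v r) * G i s)
      (fun i j s => (∫ r in (0 : ℝ)..s.2, v r) * H i j s)
      (fun s => v s.2 * Z s + (∫ r in (0 : ℝ)..s.2, v r) * K s) := by
  have hvi : IntegrableOn v (Ioo 0 T) := hv.integrable (by simp)
  set w : ℝ → ℝ := fun t => ∫ r in (0 : ℝ)..t, v r with hw
  have hwc : ContinuousOn w (Icc 0 T) := continuousOn_primitive_Ioo hT.le hvi
  obtain ⟨C, hC⟩ := isCompact_Icc.exists_bound_of_continuousOn hwc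
  have hwm : AEStronglyMeasurable w (volume.restrict (Ioo 0 T)) :=
    (hwc.mono Ioo_subset_Icc_self).aestronglyMeasurable measurableSet_Ioo
  have hwb : MemLp w ∞ (volume.restrict (Ioo 0 T)) := by
    refine memLp_top_of_bound hwm C ?_
    filter_upwards [ae_restrict_mem measurableSet_Ioo] with t ht using hC t ⟨ht.1.le, ht.2.le⟩
  have hwQ : MemLp (fun s : Space n × ℝ => w s.2) ∞ (volume.restrict (cyl Ω T)) :=
    memLp_top_snd hwb
  -- On a time slice w is a constant, so spatial weak derivatives can be multiplied slice by slice
  -- without any smoothness of w.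
  have sp : ∀ {F F' : Space n × ℝ → ℝ} {i : Fin n}, MemLp F 2 (volume.restrict (cyl Ω T)) →
      MemLp F' 2 (volume.restrict (cyl Ω T)) → HasWeakDeriv (cyl Ω T) (unitVec i, 0) F F' →
      HasWeakDeriv (cyl Ω T) (unitVec i, 0) (fun s => w s.2 * F s) (fun s => w s.2 * F' s) := by
    intro F F' i hF hF' hd
    refine hasWeakDeriv_of_ae_slice (memLp_bounded_mul hwQ hF) (memLp_bounded_mul hwQ hF') ?_
    filter_upwards [hd.ae_slice hF hF'] with t ht φ hφ
    simp_rw [mul_assoc]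
    rw [integral_const_mul, integral_const_mul, ht φ hφ]
    ring
  obtain ⟨B, hB⟩ := h.memY.ae_slice_bound
  have hKL : MemLp (fun s : Space n × ℝ => v s.2 * Z s + w s.2 * K s) 2
      (volume.restrict (cyl Ω T)) :=
    (memLp_time_mul h.memLp hv hB).add (memLp_bounded_mul hwQ h.time_memLp)
  refine ⟨memLp_bounded_mul hwQ h.memLp, fun i => sp h.memLp (h.grad_memLp i) (h.grad i),
    fun i => memLp_bounded_mul hwQ (h.grad_memLp i),
    fun i j => sp (h.grad_memLp i) (h.hess_memLp i j) (h.hess i j),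
    fun i j => memLp_bounded_mul hwQ (h.hess_memLp i j), ?_, hKL, ?_,
    fun t ht => (h.slice_memLp t ht).const_mul (w t), fun t ht => ?_⟩
  -- Along almost every time line both factors are primitives, so the one-variable Leibniz rule
  -- applies; the initial value is zero since w(0) = 0.
  · refine hasWeakDeriv_time_of_primitive (F0 := fun _ => 0) hT.le
      (locallyIntegrableOn_of_memLp (by simp) (memLp_bounded_mul hwQ h.memLp))
      (locallyIntegrableOn_of_memLp (by simp) hKL) ?_ ?_
    · filter_upwards [memLp_slice_space hKL] with x hx
      exact hx.integrable (by simp)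
    · filter_upwards [h.memY.ae_eq_primitive hΩ hT, h.memY.ae_integrableOn_dt hΩ,
        ae_slice_space (h.dt_ae hΩ)] with x hx hxi hxK
      filter_upwards [hx, ae_restrict_mem measurableSet_Ioo] with t ht htm
      have htm' : t ∈ Icc 0 T := ⟨htm.1.le, htm.2.le⟩
      have := primitive_mul_primitive hT.le hvi hxi 0 (Z (x, 0)) htm'
      simp only [zero_add, zero_mul] at this
      rw [ht, zero_add, this, intervalIntegral.integral_of_le htm.1.le, intervalIntegral.integral_of_le htm.1.le]
      refine integral_congr_ae ?_
      have hsub : Ioc 0 t ⊆ Ioo 0 T := fun r hr => ⟨hr.1, hr.2.trans_lt htm.2⟩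
      have e1 := ae_restrict_of_ae_restrict_of_subset hsub hx
      have e2 := ae_restrict_of_ae_restrict_of_subset hsub hxK
      filter_upwards [e1, e2] with r h1 h2
      rw [← h1, h2]
  · filter_upwards [h.boundary] with t h1
    exact ((h1.pair hΩ).const_mul (w t)).memH10 hΩ
  · have t1 := ENNReal.Tendsto.const_mul (a := ENNReal.ofReal C)
      (h.slice_continuous t ht) (Or.inr (by simp))
    rw [mul_zero] at t1
    -- Continuity in L² is split as w(s)(Z(s) - Z(t)) + (w(s) - w(t)) Z(t).
    have t2 : Tendsto (fun s => ‖w s - w t‖ₑ * eLpNorm (fun x => Z (x, t)) 2 (volume.restrict Ω))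
        (𝓝[Icc 0 T] t) (𝓝 0) := by
      have h1 : Tendsto (fun s => ‖w s - w t‖ₑ) (𝓝[Icc 0 T] t) (𝓝 0) := by
        have := ((hwc t ht).sub_const (w t)).enorm
        simpa using this
      have := ENNReal.Tendsto.mul_const (b := eLpNorm (fun x => Z (x, t)) 2 (volume.restrict Ω)) h1
        (Or.inr (h.slice_memLp t ht).eLpNorm_ne_top)
      simpa using this
    have t3 := t1.add t2
    rw [add_zero] at t3
    refine tendsto_of_tendsto_of_tendsto_of_le_of_le' tendsto_const_nhds t3
      (Eventually.of_forall fun _ => zero_le) ?_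
    filter_upwards [self_mem_nhdsWithin] with s hs
    have i1 : eLpNorm (w s • fun x => Z (x, s) - Z (x, t)) 2 (volume.restrict Ω)
        ≤ ENNReal.ofReal C * eLpNorm (fun x => Z (x, s) - Z (x, t)) 2 (volume.restrict Ω) := by
      rw [eLpNorm_const_smul]
      gcongr
      rw [← ofReal_norm]
      exact ENNReal.ofReal_le_ofReal (hC s hs)
    have i2 : eLpNorm ((w s - w t) • fun x => Z (x, t)) 2 (volume.restrict Ω)
        = ‖w s - w t‖ₑ * eLpNorm (fun x => Z (x, t)) 2 (volume.restrict Ω) := eLpNorm_const_smul _ _ _ _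
    refine le_trans ?_ (add_le_add i1 i2.le)
    refine le_trans (le_of_eq ?_) (eLpNorm_add_le
      (((h.slice_memLp s hs).sub (h.slice_memLp t ht)).const_mul (w s)).1
      ((h.slice_memLp t ht).const_mul (w s - w t)).1 (by simp))
    congr 1
    ext x
    show w s * Z (x, s) - w t * Z (x, t)
      = w s * (Z (x, s) - Z (x, t)) + (w s - w t) * Z (x, t)
    ring

/-- Functions of space only. -/
lemma of_test (hΩ : IsOpen Ω) (hT : 0 ≤ T) {φ : Space n → ℝ} (hφ : IsTestFunction Ω φ) :
    IsYRep Ω T (fun s => φ s.1) (fun i s => fderiv ℝ φ s.1 (unitVec i))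
      (fun i j s => fderiv ℝ (fun x => fderiv ℝ φ x (unitVec i)) s.1 (unitVec j)) (fun _ => 0) := by
  have m : ∀ {φ : Space n → ℝ}, IsTestFunction Ω φ →
      MemLp (fun s : Space n × ℝ => φ s.1) 2 (volume.restrict (cyl Ω T)) := fun hφ =>
    memLp_two_fst (hφ.memLp 2)
  have d : ∀ {φ : Space n → ℝ} (i : Fin n), IsTestFunction Ω φ →
      HasWeakDeriv (cyl Ω T) (unitVec i, 0) (fun s : Space n × ℝ => φ s.1)
        (fun s => fderiv ℝ φ s.1 (unitVec i)) := fun i hφ =>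
    (HasWeakDeriv.of_contDiff (hφ.1.of_le (by simp)) Ω (unitVec i)).comp_fst (hφ.memLp ∞)
      ((hφ.fderiv_apply _).memLp ∞)
  refine ⟨m hφ, fun i => d i hφ, fun i => m (hφ.fderiv_apply _),
    fun i j => d j (hφ.fderiv_apply _), fun i j => m ((hφ.fderiv_apply _).fderiv_apply _),
    hasWeakDeriv_time_fst hT (locallyIntegrableOn_of_memLp (by simp) (m hφ)), MemLp.zero',
    Eventually.of_forall fun t => (IsH10Pair.of_test hφ).memH10 hΩ, fun t _ => hφ.memLp 2,
    fun t _ => ?_⟩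
  simpa using tendsto_const_nhds

end IsYRep

end StateSpace

/-! ### The energy estimate and uniqueness. -/

section Energy

variable {n : ℕ} {Ω : Set (Space n)} {T : ℝ} {e : Space n × ℝ → ℝ}

/-- The identity for the derivative of the squared L²-norm is derived pointwise in x: on almost
every line e is the primitive of its weak time derivative, the Leibniz rule gives its square, and
Fubini integrates over Ω. -/
lemma MemY.integral_sq_eq (hΩ : IsOpen Ω) (hT : 0 < T) (h : MemY Ω T e)
    (h0 : ∀ᵐ x ∂(volume.restrict Ω), e (x, 0) = 0) {t : ℝ} (ht : t ∈ Icc 0 T) :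
    ∫ x in Ω, e (x, t) ^ 2 = 2 * ∫ r in (0 : ℝ)..t, ∫ x in Ω, e (x, r) * dt Ω T e (x, r) := by
  have hi := integrable_mul_of_memLp_two h.memLp (h.memLp_dt hΩ)
  have hsub : Ioo 0 t ⊆ Ioo 0 T := Ioo_subset_Ioo_right ht.2
  have hpt : ∀ᵐ x ∂(volume.restrict Ω),
      e (x, t) ^ 2 = 2 * ∫ r in Ioo 0 t, e (x, r) * dt Ω T e (x, r) := by
    filter_upwards [h0, h.sub_eq_integral_dt hΩ hT le_rfl ht.1 ht.2, h.ae_eq_primitive hΩ hT,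
      h.ae_integrableOn_dt hΩ] with x h1 h2 h3 h4
    have h5 := primitive_mul_primitive hT.le h4 h4 0 0 ht
    simp only [zero_add, zero_mul] at h5
    rw [h1, sub_zero] at h2
    rw [sq, h2, h5, ← setIntegral_Ioo_eq_intervalIntegral ht.1, ← integral_const_mul]
    refine integral_congr_ae ?_
    filter_upwards [ae_restrict_of_ae_restrict_of_subset hsub h3] with r hr
    rw [hr, h1]
    ring
  rw [integral_congr_ae hpt, integral_const_mul]
  congr 1
  rw [cyl_measure] at hi
  have hi' : Integrable (fun s : Space n × ℝ => e s * dt Ω T e s)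
      ((volume.restrict Ω).prod (volume.restrict (Ioo 0 t))) :=
    hi.mono_measure (Measure.prod_mono le_rfl (Measure.restrict_mono hsub le_rfl))
  have := integral_integral_swap (f := fun x r => e (x, r) * dt Ω T e (x, r)) hi'
  rw [this, setIntegral_Ioo_eq_intervalIntegral ht.1]

/-- Green's formula ∫ e Δe = -∫ |∇e|²; there is no boundary term because e(·,t) lies in H^1_0. -/
lemma MemY.integral_lap_mul_nonpos (hΩ : IsOpen Ω) (h : MemY Ω T e) :
    ∀ᵐ t ∂(volume.restrict (Ioo 0 T)), ∫ x in Ω, e (x, t) * lap Ω T e (x, t) ≤ 0 := by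
  have h1 : ∀ i, ∀ᵐ t ∂(volume.restrict (Ioo 0 T)), ∀ φ, IsTestFunction Ω φ →
      ∫ x in Ω, dx Ω T i e (x, t) * fderiv ℝ φ x (unitVec i)
        = - ∫ x in Ω, dx Ω T i (dx Ω T i e) (x, t) * φ x :=
    fun i => (h.hasWeakDeriv_dx_dx hΩ i i).ae_slice (h.memLp_dx hΩ i) (h.memLp_dx_dx hΩ i i)
  have h2 : ∀ i, ∀ᵐ t ∂(volume.restrict (Ioo 0 T)),
      MemLp (fun x => dx Ω T i (dx Ω T i e) (x, t)) 2 (volume.restrict Ω) :=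
    fun i => memLp_slice_time (h.memLp_dx_dx hΩ i i)
  filter_upwards [ae_all_iff.2 h1, ae_all_iff.2 h2, h.ae_pair hΩ] with t h1 h2 h3
  have h4 : ∀ i, ∫ x in Ω, dx Ω T i (dx Ω T i e) (x, t) * e (x, t)
      = - ∫ x in Ω, dx Ω T i e (x, t) * dx Ω T i e (x, t) := fun i => by
    rw [h3.integral_by_parts (h3.memLp_deriv i) (h2 i) (h1 i), neg_neg]
  have h5 : ∀ x, e (x, t) * lap Ω T e (x, t) = ∑ i, dx Ω T i (dx Ω T i e) (x, t) * e (x, t) := by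
    intro x
    rw [lap, Finset.mul_sum]
    exact Finset.sum_congr rfl fun i _ => mul_comm _ _
  simp_rw [h5]
  rw [integral_finsetSum _ fun i _ => integrable_mul_of_memLp_two (h2 i) h3.memLp]
  refine Finset.sum_nonpos fun i _ => ?_
  rw [h4, neg_nonpos]
  exact integral_nonneg fun x => mul_self_nonneg _

/-- Grönwall's inequality is applied to the primitive of N, which is differentiable from the right,
since N itself is only continuous. -/
lemma eq_zero_of_le_integral {T C : ℝ} (hT : 0 < T) {N : ℝ → ℝ} (hN : ContinuousOn N (Icc 0 T))
    (hN0 : ∀ t ∈ Icc 0 T, 0 ≤ N t) (h : ∀ t ∈ Icc 0 T, N t ≤ C * ∫ r in (0 : ℝ)..t, N r) :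
    ∀ t ∈ Icc 0 T, N t = 0 := by
  have hi : IntegrableOn N (Ioo 0 T) := hN.integrableOn_Icc.mono_set Ioo_subset_Icc_self
  have hnn : ∀ t ∈ Icc 0 T, 0 ≤ ∫ r in (0 : ℝ)..t, N r := fun t ht =>
    intervalIntegral.integral_nonneg ht.1 fun r hr => hN0 r ⟨hr.1, hr.2.trans ht.2⟩
  have hg := norm_le_gronwallBound_of_norm_deriv_right_le (f := fun t => ∫ r in (0 : ℝ)..t, N r)
    (f' := N) (δ := 0) (K := C) (ε := 0) (a := 0) (b := T)
    (continuousOn_primitive_Ioo hT.le hi) (fun t ht => by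
      have h0 : (0 : ℝ) ∈ Icc 0 T := ⟨le_rfl, hT.le⟩
      have htm : t ∈ Icc 0 T := ⟨ht.1, ht.2.le⟩
      refine intervalIntegral.integral_hasDerivWithinAt_right (t := Ioi t)
        (intervalIntegrable_of_Ioo hi h0 htm) ?_ ?_
      · refine ⟨Icc 0 T, ?_, hN.aestronglyMeasurable measurableSet_Icc⟩
        exact mem_nhdsWithin.2 ⟨Iio T, isOpen_Iio, ht.2, fun r hr => ⟨ht.1.trans (le_of_lt hr.2), le_of_lt hr.1⟩⟩
      · refine ((hN t htm).mono_left ?_)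
        refine nhdsWithin_le_iff.2 ?_
        exact mem_nhdsWithin.2 ⟨Iio T, isOpen_Iio, ht.2, fun r hr => ⟨ht.1.trans (le_of_lt hr.2), le_of_lt hr.1⟩⟩)
    (by simp) (fun t ht => by
      have htm : t ∈ Icc 0 T := ⟨ht.1, ht.2.le⟩
      rw [Real.norm_of_nonneg (hN0 t htm), Real.norm_of_nonneg (hnn t htm), add_zero]
      exact h t htm)
  intro t ht
  have h1 := hg t ht
  rw [gronwallBound_ε0_δ0, norm_le_zero_iff] at h1
  have h2 := h t ht
  rw [h1, mul_zero] at h2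
  exact le_antisymm h2 (hN0 t ht)

/-- Energy estimate: a function in `Y` with zero initial value that satisfies a parabolic
inequality vanishes. -/
lemma MemY.eq_zero_of_energy (hΩ : IsOpen Ω) (hT : 0 < T) (h : MemY Ω T e)
    (h0 : ∀ᵐ x ∂(volume.restrict Ω), e (x, 0) = 0) {C : ℝ}
    (hle : ∀ᵐ s ∂(volume.restrict (cyl Ω T)), e s * dt Ω T e s ≤ e s * lap Ω T e s + C * e s ^ 2) :
    ∀ t ∈ Icc 0 T, ∀ᵐ x ∂(volume.restrict Ω), e (x, t) = 0 := by
  have hN : ContinuousOn (fun t => ∫ x in Ω, e (x, t) ^ 2) (Icc 0 T) := by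
    refine (h.slice_eLpNorm_toReal_continuousOn.pow 2).congr fun t ht => ?_
    exact (eLpNorm_two_sq (h.slice_memLp t ht)).symm
  have hNi : IntegrableOn (fun t => ∫ x in Ω, e (x, t) ^ 2) (Ioo 0 T) :=
    hN.integrableOn_Icc.mono_set Ioo_subset_Icc_self
  have i1 := integrable_mul_of_memLp_two h.memLp (h.memLp_dt hΩ)
  have i2 := integrable_mul_of_memLp_two h.memLp (h.memLp_lap hΩ)
  have hslice : ∀ᵐ t ∂(volume.restrict (Ioo 0 T)),
      ∫ x in Ω, e (x, t) * dt Ω T e (x, t) ≤ C * ∫ x in Ω, e (x, t) ^ 2 := by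
    filter_upwards [ae_slice_time hle, integrable_slice_time i1, integrable_slice_time i2,
      memLp_slice_time h.memLp, h.integral_lap_mul_nonpos hΩ] with t h1 h2 h3 h4 h5
    have h6 := integral_mono_ae h2 (h3.add (h4.integrable_sq.const_mul C)) h1
    have h7 : ∫ x in Ω, (e (x, t) * lap Ω T e (x, t) + C * e (x, t) ^ 2)
        = (∫ x in Ω, e (x, t) * lap Ω T e (x, t)) + C * ∫ x in Ω, e (x, t) ^ 2 := by
      rw [integral_add h3 (h4.integrable_sq.const_mul C), integral_const_mul]
    have h8 : ∫ x in Ω, e (x, t) * dt Ω T e (x, t)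
      ≤ ∫ x in Ω, (e (x, t) * lap Ω T e (x, t) + C * e (x, t) ^ 2) := h6
    linarith
  have hz := eq_zero_of_le_integral hT (C := 2 * C) hN
    (fun t _ => integral_nonneg fun x => sq_nonneg _) (fun t ht => by
      rw [h.integral_sq_eq hΩ hT h0 ht, mul_assoc]
      refine mul_le_mul_of_nonneg_left ?_ zero_le_two
      have hsub : Ioo 0 t ⊆ Ioo 0 T := Ioo_subset_Ioo_right ht.2
      rw [← intervalIntegral.integral_const_mul, ← setIntegral_Ioo_eq_intervalIntegral ht.1,
        ← setIntegral_Ioo_eq_intervalIntegral ht.1]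
      refine integral_mono_ae ((integrable_integral_slice i1).mono_set hsub)
        ((hNi.mono_set hsub).const_mul C) ?_
      exact ae_restrict_of_ae_restrict_of_subset hsub hslice)
  intro t ht
  have h1 := hz t ht
  rw [integral_eq_zero_iff_of_nonneg (fun x => sq_nonneg _) (h.slice_memLp t ht).integrable_sq] at h1
  filter_upwards [h1] with x hx
  simpa using hx

end Energy

/-! ### The linearized operator and the Goh transform. -/

namespace ControlProblem

variable {n m q : ℕ} {P : ControlProblem n m q} {u : Fin m → ℝ → ℝ} {y : Space n × ℝ → ℝ}

lemma memLp_control_top (hu : P.IsAdmissibleControl u) (i : Fin m) :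
    MemLp (u i) ∞ P.timeMeasure := by
  refine memLp_top_of_bound (hu i).1.1 (max |P.lo i| |P.hi i|) ?_
  filter_upwards [(hu i).2] with t ht
  exact abs_le_max_abs_abs ht.1 ht.2

lemma memLp_potential_top (hP : P.Basic) (hu : P.IsAdmissibleControl u) :
    MemLp (P.potential u) ∞ P.cylMeasure := by
  have hb : ∀ i, MemLp (fun s : Space n × ℝ => P.b i s.1) ∞ P.cylMeasure := fun i =>
    memLp_top_fst (hP.b_mem i).memLp
  exact (hb 0).add (memLp_finsetSum _ fun i _ =>
    memLp_bounded_mul (memLp_top_snd (memLp_control_top hu i)) (hb i.succ))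

/-- The operator is built from chosen versions of the weak derivatives; here it is evaluated on
explicit ones, so that product rules become algebra. -/
lemma IsYRep.opA_ae {Z : Space n × ℝ → ℝ} {G : Fin n → Space n × ℝ → ℝ}
    {H : Fin n → Fin n → Space n × ℝ → ℝ} {K : Space n × ℝ → ℝ} (hΩ : IsOpen P.Ω)
    (h : IsYRep P.Ω P.T Z G H K) :
    ∀ᵐ s ∂P.cylMeasure, dt P.Ω P.T Z s + P.opA u y Z s
      = K s - (∑ i, H i i s) + 3 * P.γ * y s ^ 2 * Z s - P.potential u s * Z s := by
  filter_upwards [h.dt_ae hΩ, h.lap_ae hΩ] with s h1 h2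
  rw [opA, h1, h2]
  ring

/-- Leibniz rule for the linearized operator and a function of space. -/
lemma operator_mul_fst (hΩ : IsOpen P.Ω) (hT : 0 ≤ P.T) {Z : Space n × ℝ → ℝ}
    (hZ : MemY P.Ω P.T Z) {b : Space n → ℝ} (hb : MemW P.Ω ∞ 2 b) :
    ∀ᵐ s ∂P.cylMeasure,
      dt P.Ω P.T (fun s => b s.1 * Z s) s + P.opA u y (fun s => b s.1 * Z s) s
        = b s.1 * (dt P.Ω P.T Z s + P.opA u y Z s)
          - 2 * ∑ k, wderiv P.Ω (unitVec k) b s.1 * dx P.Ω P.T k Z s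
          - lapSpace P.Ω b s.1 * Z s := by
  filter_upwards [IsYRep.opA_ae (u := u) (y := y) hΩ ((hZ.rep hΩ).mul_fst hΩ hT hb)] with s hs
  rw [hs, opA, lapSpace, lap]
  simp only [Finset.sum_add_distrib, ← Finset.mul_sum, ← Finset.sum_mul]
  ring

/-- The state equation contains γ y³ while A y contains 3 γ y³; the surplus 2 γ y³ is the source of
the last term of `B1`. -/
lemma state_operator (hst : P.IsState u y) : ∀ᵐ s ∂P.cylMeasure,
    dt P.Ω P.T y s + P.opA u y y s = P.f s + 2 * P.γ * y s ^ 3 := by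
  filter_upwards [hst.2.1] with s hs
  rw [opA]
  linear_combination hs

/-- The origin of `B1`: for a primitive w of v, the operator applied to w b_i y gives v b_i y - w
B¹_i. The first term drives the equation of z, and the equation of ζ compensates the second. -/
lemma operator_mul_state (hΩ : IsOpen P.Ω) (hT : 0 ≤ P.T) (hst : P.IsState u y) (i : Fin m)
    (hb : MemW P.Ω ∞ 2 (P.b i.succ)) : ∀ᵐ s ∂P.cylMeasure,
      dt P.Ω P.T (fun s => P.b i.succ s.1 * y s) s + P.opA u y (fun s => P.b i.succ s.1 * y s) s
        = - P.B1 y i s := by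
  filter_upwards [operator_mul_fst (u := u) (y := y) hΩ hT hst.1 hb, state_operator hst] with s h1 h2
  rw [h1, h2, B1]
  simp only [mul_comm (dx P.Ω P.T _ y s)]
  ring

/-- The Goh transform: `z = ζ + y ∑ᵢ wᵢ bᵢ`. -/
lemma goh_transform (hP : P.Basic) (hu : P.IsAdmissibleControl u) (hst : P.IsState u y)
    (hb : ∀ i, MemW P.Ω ∞ 2 (P.b i)) {v : Fin m → ℝ → ℝ} (hv : ∀ i, MemLp (v i) 2 P.timeMeasure)
    {z ζ : Space n × ℝ → ℝ} (hz : P.IsLinearizedState u y v z)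
    (hζ : P.IsTransformedState u y (primitive v) ζ) :
    ∀ t ∈ Icc 0 P.T, ∀ᵐ x ∂(volume.restrict P.Ω),
      z (x, t) = ζ (x, t) + y (x, t) * ∑ i, P.b i.succ x * primitive v i t := by
  have hΩ := hP.isOpen
  have hT := hP.T_pos
  have hby := fun i : Fin m => (hst.1.rep hΩ).mul_fst hΩ hT.le (hb i.succ)
  have hwby := IsYRep.sum hΩ Finset.univ fun i _ => (hby i).primitive_mul hΩ hT (hv i)
  have he := ((hζ.1.rep hΩ).lin hΩ hwby 1 1).lin hΩ (hz.1.rep hΩ) 1 (-1)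
  -- The difference of the two sides of the transform, with the coefficients 1 and -1 kept so that
  -- it has the shape produced by `IsYRep.lin`.
  set e : Space n × ℝ → ℝ := fun s =>
    1 * (1 * ζ s + 1 * ∑ i, (∫ r in (0 : ℝ)..s.2, v i r) * (P.b i.succ s.1 * y s)) + -1 * z s
    with hedef
  have hLe : ∀ᵐ s ∂P.cylMeasure, dt P.Ω P.T e s + P.opA u y e s = 0 := by
    have hB : ∀ᵐ s ∂P.cylMeasure, ∀ i : Fin m,
        P.b i.succ s.1 * dt P.Ω P.T y s
          - (∑ k, ((P.b i.succ s.1 * dx P.Ω P.T k (dx P.Ω P.T k y) s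
            + wderiv P.Ω (unitVec k) (P.b i.succ) s.1 * dx P.Ω P.T k y s)
            + (wderiv P.Ω (unitVec k) (P.b i.succ) s.1 * dx P.Ω P.T k y s
            + wderiv P.Ω (unitVec k) (wderiv P.Ω (unitVec k) (P.b i.succ)) s.1 * y s)))
          + 3 * P.γ * y s ^ 2 * (P.b i.succ s.1 * y s)
          - P.potential u s * (P.b i.succ s.1 * y s) = - P.B1 y i s := by
      refine ae_all_iff.2 fun i => ?_
      filter_upwards [operator_mul_state hΩ hT.le hst i (hb i.succ),
        IsYRep.opA_ae (u := u) (y := y) hΩ (hby i)] with s h1 h2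
      rw [← h1, h2]
    filter_upwards [IsYRep.opA_ae (u := u) (y := y) hΩ he, hB, hζ.2.1, hz.2.1] with s h1 h2 h3 h4
    rw [h1]
    rw [opA, lap] at h3 h4
    have h5 : ∑ i : Fin m, (v i s.2 * (P.b i.succ s.1 * y s)
        + (∫ r in (0 : ℝ)..s.2, v i r) * (P.b i.succ s.1 * dt P.Ω P.T y s
          - (∑ k, ((P.b i.succ s.1 * dx P.Ω P.T k (dx P.Ω P.T k y) s
            + wderiv P.Ω (unitVec k) (P.b i.succ) s.1 * dx P.Ω P.T k y s)
            + (wderiv P.Ω (unitVec k) (P.b i.succ) s.1 * dx P.Ω P.T k y s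
            + wderiv P.Ω (unitVec k) (wderiv P.Ω (unitVec k) (P.b i.succ)) s.1 * y s)))
          + 3 * P.γ * y s ^ 2 * (P.b i.succ s.1 * y s)
          - P.potential u s * (P.b i.succ s.1 * y s)))
        = (∑ i, v i s.2 * P.b i.succ s.1 * y s) - ∑ i, P.B1 y i s * primitive v i s.2 := by
      rw [← Finset.sum_sub_distrib]
      refine Finset.sum_congr rfl fun i _ => ?_
      rw [h2 i, primitive]
      ring
    have h6 : (∑ k, (1 * (1 * dx P.Ω P.T k (dx P.Ω P.T k ζ) s
        + 1 * ∑ i : Fin m, (∫ r in (0 : ℝ)..s.2, v i r) *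
          ((P.b i.succ s.1 * dx P.Ω P.T k (dx P.Ω P.T k y) s
            + wderiv P.Ω (unitVec k) (P.b i.succ) s.1 * dx P.Ω P.T k y s)
            + (wderiv P.Ω (unitVec k) (P.b i.succ) s.1 * dx P.Ω P.T k y s
            + wderiv P.Ω (unitVec k) (wderiv P.Ω (unitVec k) (P.b i.succ)) s.1 * y s)))
        + -1 * dx P.Ω P.T k (dx P.Ω P.T k z) s))
        = (∑ k, dx P.Ω P.T k (dx P.Ω P.T k ζ) s)
          + (∑ i : Fin m, (∫ r in (0 : ℝ)..s.2, v i r) * ∑ k,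
          ((P.b i.succ s.1 * dx P.Ω P.T k (dx P.Ω P.T k y) s
            + wderiv P.Ω (unitVec k) (P.b i.succ) s.1 * dx P.Ω P.T k y s)
            + (wderiv P.Ω (unitVec k) (P.b i.succ) s.1 * dx P.Ω P.T k y s
            + wderiv P.Ω (unitVec k) (wderiv P.Ω (unitVec k) (P.b i.succ)) s.1 * y s)))
          - ∑ k, dx P.Ω P.T k (dx P.Ω P.T k z) s := by
      simp only [Finset.mul_sum]
      rw [Finset.sum_comm (s := (Finset.univ : Finset (Fin m))), ← Finset.sum_add_distrib,
        ← Finset.sum_sub_distrib]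
      refine Finset.sum_congr rfl fun k _ => ?_
      simp only [one_mul, neg_one_mul, sub_eq_add_neg]
    rw [h6]
    have h8 : ∀ a : ℝ, a * ∑ i : Fin m, (∫ r in (0 : ℝ)..s.2, v i r) * (P.b i.succ s.1 * y s)
        = ∑ i : Fin m, (∫ r in (0 : ℝ)..s.2, v i r) * (a * (P.b i.succ s.1 * y s)) := fun a => by
      rw [Finset.mul_sum]
      exact Finset.sum_congr rfl fun i _ => by ring
    have h9 := h8 (3 * P.γ * y s ^ 2)
    have h10 := h8 (P.potential u s)
    simp only [mul_add (∫ r in (0 : ℝ).._, v _ r), mul_sub (∫ r in (0 : ℝ).._, v _ r),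
      Finset.sum_add_distrib, Finset.sum_sub_distrib] at h5 h9 h10 ⊢
    simp only [hedef, one_mul, neg_one_mul, mul_add, mul_neg]
    linear_combination h3 - h4 + h5 + h9 - h10
  have hC := memLp_top_ae_bound (memLp_potential_top hP hu)
  have he0 : ∀ᵐ x ∂(volume.restrict P.Ω), e (x, 0) = 0 := by
    filter_upwards [hζ.2.2, hz.2.2] with x h1 h2
    simp [hedef, h1, h2]
  -- The term 3 γ y² e² has the favourable sign and is dropped, so y need not be bounded; only the
  -- potential enters the constant.
  have hez := he.memY.eq_zero_of_energy hΩ hT he0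
    (C := (eLpNorm (P.potential u) ∞ P.cylMeasure).toReal) (by
    filter_upwards [hLe, hC] with s h1 h2
    rw [opA] at h1
    have h3 : dt P.Ω P.T e s = lap P.Ω P.T e s - 3 * P.γ * y s ^ 2 * e s + P.potential u s * e s := by
      linear_combination h1
    rw [h3]
    have h4 : 0 ≤ 3 * P.γ * y s ^ 2 * e s ^ 2 := by
      have := hP.γ_nonneg
      positivity
    have h5 : P.potential u s * e s ^ 2
        ≤ (eLpNorm (P.potential u) ∞ P.cylMeasure).toReal * e s ^ 2 :=
      mul_le_mul_of_nonneg_right ((le_abs_self _).trans h2) (sq_nonneg _)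
    linarith [show e s * (lap P.Ω P.T e s - 3 * P.γ * y s ^ 2 * e s + P.potential u s * e s)
      = e s * lap P.Ω P.T e s - 3 * P.γ * y s ^ 2 * e s ^ 2 + P.potential u s * e s ^ 2 by ring])
  intro t ht
  filter_upwards [hez t ht] with x hx
  simp only [hedef] at hx
  have h1 : y (x, t) * ∑ i, P.b i.succ x * primitive v i t
      = ∑ i, (∫ r in (0 : ℝ)..t, v i r) * (P.b i.succ x * y (x, t)) := by
    rw [Finset.mul_sum]
    refine Finset.sum_congr rfl fun i _ => ?_
    rw [primitive]
    ring
  rw [h1]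
  linarith

end ControlProblem

/-! ### The adjoint equation, integrated in time. -/

lemma integrableOn_tail_integral {T : ℝ} {ν : Measure ℝ} [SFinite ν] {m : ℝ → ℝ}
    (hm : IntegrableOn m (Ioc 0 T) ν) :
    IntegrableOn (fun s => ∫ t in Icc s T, m t ∂ν) (Ioo 0 T) := by
  have hmeas : MeasurableSet {x : ℝ × ℝ | x.1 ≤ x.2} := measurableSet_le measurable_fst measurable_snd
  have hF : Integrable ({x : ℝ × ℝ | x.1 ≤ x.2}.indicator (fun x => (1 : ℝ) * m x.2))
      ((volume.restrict (Ioo 0 T)).prod (ν.restrict (Ioc 0 T))) :=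
    (Integrable.mul_prod (integrable_const (1 : ℝ)) hm).indicator hmeas
  refine hF.integral_prod_left.congr ?_
  refine (ae_restrict_iff' measurableSet_Ioo).2 (Eventually.of_forall fun s hs => ?_)
  have : ∀ t, ({x : ℝ × ℝ | x.1 ≤ x.2}.indicator (fun x => (1 : ℝ) * m x.2)) (s, t)
      = (Ici s).indicator m t := by
    intro t
    by_cases hst : s ≤ t <;> simp [indicator, hst]
  simp_rw [this]
  rw [setIntegral_indicator measurableSet_Ici]
  congr 2
  ext t
  simp only [mem_inter_iff, mem_Ioc, mem_Ici, mem_Icc]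
  exact ⟨fun h => ⟨h.2, h.1.2⟩, fun h => ⟨⟨hs.1.trans_le h.1, h.2⟩, h.1⟩⟩

lemma memLp_top_primitive {T : ℝ} (hT : 0 ≤ T) {ψ : ℝ → ℝ} (hψ : IntegrableOn ψ (Ioo 0 T)) :
    MemLp (fun t => ∫ s in (0 : ℝ)..t, ψ s) ∞ (volume.restrict (Ioo 0 T)) := by
  have hc := continuousOn_primitive_Ioo hT hψ
  obtain ⟨C, hC⟩ := isCompact_Icc.exists_bound_of_continuousOn hc
  refine memLp_top_of_bound
    ((hc.mono Ioo_subset_Icc_self).aestronglyMeasurable measurableSet_Ioo) C ?_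
  exact (ae_restrict_iff' measurableSet_Ioo).2
    (Eventually.of_forall fun t ht => hC t (Ioo_subset_Icc_self ht))

lemma StieltjesFunction.integrableOn_of_continuousOn (μ : StieltjesFunction ℝ) {T : ℝ} {m : ℝ → ℝ}
    (hm : ContinuousOn m (Icc 0 T)) : IntegrableOn m (Ioc 0 T) μ.measure :=
  (hm.integrableOn_compact isCompact_Icc).mono_set Ioc_subset_Icc_self

namespace ControlProblem

variable {n m q : ℕ} {P : ControlProblem n m q} {u : Fin m → ℝ → ℝ} {y p Z : Space n × ℝ → ℝ}
  {μ : Fin q → StieltjesFunction ℝ}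

/-- Elements of `Y` on which the linearized operator takes values in `L²(Q)`. -/
structure IsDirection (P : ControlProblem n m q) (y Z : Space n × ℝ → ℝ) : Prop where
  memY : MemY P.Ω P.T Z
  memLp_sq_mul : MemLp (fun s => P.γ * y s ^ 2 * Z s) 2 P.cylMeasure

/-- The density paired with `Z` in the adjoint equation. -/
def adjointDensity (P : ControlProblem n m q) (u : Fin m → ℝ → ℝ) (y p Z : Space n × ℝ → ℝ)
    (s : Space n × ℝ) : ℝ :=
  (y s - P.yd s) * Z s - p s * (dt P.Ω P.T Z s + P.opA u y Z s)

/-- The final cost paired with `Z(·,T)`. -/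
def finalPairing (P : ControlProblem n m q) (y Z : Space n × ℝ → ℝ) : ℝ :=
  ∫ x in P.Ω, (y (x, P.T) - P.ydT x) * Z (x, P.T)

lemma IsDirection.memLp_operator (hP : P.Basic) (hu : P.IsAdmissibleControl u)
    (h : P.IsDirection y Z) :
    MemLp (fun s => dt P.Ω P.T Z s + P.opA u y Z s) 2 P.cylMeasure := by
  have h1 := h.memY.memLp_dt hP.isOpen
  have h2 := h.memY.memLp_lap hP.isOpen
  have h3 := memLp_bounded_mul (memLp_potential_top hP hu) h.memY.memLp
  refine (((h1.sub h2).add (h.memLp_sq_mul.const_mul 3)).sub h3).ae_eq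
    (Eventually.of_forall fun s => ?_)
  simp only [Pi.add_apply, Pi.sub_apply, opA]
  ring

lemma IsDirection.mul_fst (hP : P.Basic) (h : P.IsDirection y Z) {b : Space n → ℝ}
    (hb : MemW P.Ω ∞ 2 b) : P.IsDirection y (fun s => b s.1 * Z s) := by
  refine ⟨((h.memY.rep hP.isOpen).mul_fst hP.isOpen hP.T_pos.le hb).memY, ?_⟩
  refine (memLp_bounded_mul (memLp_top_fst hb.memLp) h.memLp_sq_mul).ae_eq
    (Eventually.of_forall fun s => ?_)
  simp only
  ring

/-- Read off from the state equation, in which every other term is square integrable; no embedding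
of Y is needed. -/
lemma memLp_cube (hP : P.Basic) (hu : P.IsAdmissibleControl u) (hst : P.IsState u y) :
    MemLp (fun s => P.γ * y s ^ 3) 2 P.cylMeasure := by
  have h1 := hst.1.memLp_dt hP.isOpen
  have h2 := hst.1.memLp_lap hP.isOpen
  have h3 := memLp_bounded_mul (memLp_potential_top hP hu) hst.1.memLp
  refine (((hP.f_mem.add h3).sub h1).add h2).ae_eq ?_
  filter_upwards [hst.2.1] with s hs
  simp only [Pi.add_apply, Pi.sub_apply]
  linear_combination -hs

lemma isDirection_state (hP : P.Basic) (hu : P.IsAdmissibleControl u) (hst : P.IsState u y) :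
    P.IsDirection y y := by
  refine ⟨hst.1, (memLp_cube hP hu hst).ae_eq (Eventually.of_forall fun s => ?_)⟩
  simp only
  ring

/-- If the operator maps Z into L²(Q), the equation itself bounds γ y² Z, since the time derivative,
the Laplacian and the potential term are square integrable. The factor 1/3 undoes the 3 in `opA`. -/
lemma isDirection_of_operator (hP : P.Basic) (hu : P.IsAdmissibleControl u)
    (hZ : MemY P.Ω P.T Z) {F : Space n × ℝ → ℝ} (hF : MemLp F 2 P.cylMeasure)
    (h : ∀ᵐ s ∂P.cylMeasure, dt P.Ω P.T Z s + P.opA u y Z s = F s) : P.IsDirection y Z := by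
  have h1 := hZ.memLp_dt hP.isOpen
  have h2 := hZ.memLp_lap hP.isOpen
  have h3 := memLp_bounded_mul (memLp_potential_top hP hu) hZ.memLp
  refine ⟨hZ, ((((hF.add h3).sub h1).add h2).const_mul (1 / 3)).ae_eq ?_⟩
  filter_upwards [h] with s hs
  rw [opA] at hs
  simp only [Pi.add_apply, Pi.sub_apply]
  linear_combination (-1 / 3) * hs

lemma memLp_cube_top_mul {b : Space n → ℝ} (hP : P.Basic) (hu : P.IsAdmissibleControl u)
    (hst : P.IsState u y) (hb : MemLp b ∞ (volume.restrict P.Ω)) :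
    MemLp (fun s => b s.1 * (P.γ * y s ^ 3)) 2 P.cylMeasure :=
  memLp_bounded_mul (memLp_top_fst hb) (memLp_cube hP hu hst)

lemma memLp_B1 (hP : P.Basic) (hu : P.IsAdmissibleControl u) (hst : P.IsState u y)
    (hb : ∀ i, MemW P.Ω ∞ 2 (P.b i)) (i : Fin m) : MemLp (P.B1 y i) 2 P.cylMeasure := by
  have hΩ := hP.isOpen
  have h1 : MemLp (fun s => P.b i.succ s.1 * P.f s) 2 P.cylMeasure :=
    memLp_bounded_mul (memLp_top_fst (hb i.succ).memLp) hP.f_mem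
  have h2 : ∀ k, MemLp (fun s : Space n × ℝ => wderiv P.Ω (unitVec k) (P.b i.succ) s.1
      * dx P.Ω P.T k y s) 2 P.cylMeasure := fun k =>
    memLp_bounded_mul (memLp_top_fst ((hb i.succ).wderiv hΩ k).memLp) (hst.1.memLp_dx hΩ k)
  have h3 : ∀ k, MemLp (fun s : Space n × ℝ => wderiv P.Ω (unitVec k)
      (wderiv P.Ω (unitVec k) (P.b i.succ)) s.1 * y s) 2 P.cylMeasure := fun k =>
    memLp_bounded_mul (memLp_top_fst (((hb i.succ).wderiv hΩ k).wderiv hΩ k).memLp) hst.1.memLp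
  have h4 := memLp_cube_top_mul hP hu hst (hb i.succ).memLp
  have h5 := (((memLp_finsetSum Finset.univ fun k _ => h2 k).const_mul 2).sub h1).add
    ((memLp_finsetSum Finset.univ fun k _ => h3 k).sub (h4.const_mul 2))
  refine h5.ae_eq (Eventually.of_forall fun s => ?_)
  simp only [Pi.add_apply, Pi.sub_apply, B1, lapSpace, ← Finset.sum_mul,
    mul_comm (dx P.Ω P.T _ y s)]
  ring

lemma integrable_adjointDensity (hP : P.Basic) (hu : P.IsAdmissibleControl u)
    (hst : P.IsState u y) (hp : MemLp p 2 P.cylMeasure) (h : P.IsDirection y Z) :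
    Integrable (P.adjointDensity u y p Z) P.cylMeasure :=
  (integrable_mul_of_memLp_two (hst.1.memLp.sub hP.yd_mem) h.memY.memLp).sub
    (integrable_mul_of_memLp_two hp (h.memLp_operator hP hu))

/-- The adjoint equation tested with `(∫_0^t ψ) Z`. -/
lemma costate_weak (hP : P.Basic) (hu : P.IsAdmissibleControl u) (hst : P.IsState u y)
    (hc : P.IsCostate u y p μ) (h : P.IsDirection y Z) {ψ : ℝ → ℝ}
    (hψ : MemLp ψ 2 P.timeMeasure) :
    ∫ t in Ioo 0 P.T, ψ t * ∫ x in P.Ω, p (x, t) * Z (x, t)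
      = (∑ j, ∫ t in Ioc 0 P.T, (∫ r in (0 : ℝ)..t, ψ r) * (∫ x in P.Ω, P.c j x * Z (x, t))
          ∂(μ j).measure)
        + (∫ t in Ioo 0 P.T, (∫ r in (0 : ℝ)..t, ψ r) * ∫ x in P.Ω, P.adjointDensity u y p Z (x, t))
        + (∫ r in (0 : ℝ)..P.T, ψ r) * P.finalPairing y Z := by
  have hΩ := hP.isOpen
  have hT := hP.T_pos
  obtain ⟨hp, p0, hp0, heq⟩ := hc
  have hψi : IntegrableOn ψ (Ioo 0 P.T) := hψ.integrable one_le_two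
  have hrep := (h.memY.rep hΩ).primitive_mul hΩ hT hψ
  have hZrep := h.memY.rep hΩ
  -- The test function is η Z with η the primitive of ψ. As η(0) = 0 it vanishes at time 0, and the
  -- unknown functional `p0` disappears by linearity.
  have h0 : p0 (fun _ => 0) = 0 := by
    have hz : MemH10 P.Ω (fun _ => (0 : ℝ)) := IsH10Pair.zero.memH10 hΩ
    have := hp0.1 _ _ hz hz 0 0
    simpa using this
  have hEQ := heq _ hrep.memY
  simp only [intervalIntegral.integral_same, zero_mul, h0, add_zero] at hEQ
  have hηtop := memLp_top_snd (Ω := P.Ω) (memLp_top_primitive hT.le hψi)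
  have hLp := h.memLp_operator hP hu
  obtain ⟨C, hC⟩ := h.memY.ae_slice_bound
  have hψZ := memLp_time_mul h.memY.memLp hψ hC
  have i1 : Integrable (fun s => ψ s.2 * (p s * Z s)) P.cylMeasure :=
    (integrable_mul_of_memLp_two hp.memLp hψZ).congr (Eventually.of_forall fun s => by
      simp only; ring)
  have i2 : Integrable (fun s : Space n × ℝ => (∫ r in (0 : ℝ)..s.2, ψ r)
      * (p s * (dt P.Ω P.T Z s + P.opA u y Z s))) P.cylMeasure :=
    (integrable_mul_of_memLp_two hp.memLp (memLp_bounded_mul hηtop hLp)).congr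
      (Eventually.of_forall fun s => by simp only; ring)
  have i3 : Integrable (fun s : Space n × ℝ => (∫ r in (0 : ℝ)..s.2, ψ r)
      * ((y s - P.yd s) * Z s)) P.cylMeasure :=
    (integrable_mul_of_memLp_two (hst.1.memLp.sub hP.yd_mem)
      (memLp_bounded_mul hηtop h.memY.memLp)).congr
      (Eventually.of_forall fun s => by simp only [Pi.sub_apply]; ring)
  -- Only the time derivative sees η, so the operator applied to η Z is ψ Z plus η times the
  -- operator applied to Z.
  have e1 : ∫ s in cyl P.Ω P.T, p s * (dt P.Ω P.T (fun s => (∫ r in (0 : ℝ)..s.2, ψ r) * Z s) s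
        + P.opA u y (fun s => (∫ r in (0 : ℝ)..s.2, ψ r) * Z s) s)
      = (∫ s in cyl P.Ω P.T, ψ s.2 * (p s * Z s))
        + ∫ s in cyl P.Ω P.T, (∫ r in (0 : ℝ)..s.2, ψ r)
          * (p s * (dt P.Ω P.T Z s + P.opA u y Z s)) := by
    rw [← integral_add i1 i2]
    refine integral_congr_ae ?_
    filter_upwards [IsYRep.opA_ae (u := u) (y := y) hΩ hrep,
      IsYRep.opA_ae (u := u) (y := y) hΩ hZrep] with s h1 h2
    rw [h1, h2, ← Finset.mul_sum]
    ring
  have e2 : ∫ s in cyl P.Ω P.T, ψ s.2 * (p s * Z s)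
      = ∫ t in Ioo 0 P.T, ψ t * ∫ x in P.Ω, p (x, t) * Z (x, t) := by
    rw [integral_cyl i1]
    simp only [integral_const_mul]
  have e3 : (∫ s in cyl P.Ω P.T, (y s - P.yd s) * ((∫ r in (0 : ℝ)..s.2, ψ r) * Z s))
      - ∫ s in cyl P.Ω P.T, (∫ r in (0 : ℝ)..s.2, ψ r)
          * (p s * (dt P.Ω P.T Z s + P.opA u y Z s))
      = ∫ t in Ioo 0 P.T, (∫ r in (0 : ℝ)..t, ψ r)
          * ∫ x in P.Ω, P.adjointDensity u y p Z (x, t) := by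
    have i4 : Integrable (fun s : Space n × ℝ => (y s - P.yd s)
        * ((∫ r in (0 : ℝ)..s.2, ψ r) * Z s)) P.cylMeasure :=
      i3.congr (Eventually.of_forall fun s => by simp only; ring)
    rw [← integral_sub i4 i2]
    have : (fun s : Space n × ℝ => (y s - P.yd s) * ((∫ r in (0 : ℝ)..s.2, ψ r) * Z s)
        - (∫ r in (0 : ℝ)..s.2, ψ r) * (p s * (dt P.Ω P.T Z s + P.opA u y Z s)))
        = fun s => (∫ r in (0 : ℝ)..s.2, ψ r) * P.adjointDensity u y p Z s := by
      funext s
      rw [adjointDensity]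
      ring
    rw [this, integral_cyl (this ▸ i4.sub i2)]
    simp only [integral_const_mul]
  have e4 : ∫ x in P.Ω, (y (x, P.T) - P.ydT x) * ((∫ r in (0 : ℝ)..P.T, ψ r) * Z (x, P.T))
      = (∫ r in (0 : ℝ)..P.T, ψ r) * P.finalPairing y Z := by
    rw [finalPairing, ← integral_const_mul]
    exact integral_congr_ae (Eventually.of_forall fun x => by simp only; ring)
  have e5 : ∀ j, P.stieltjesIntegral (μ j)
        (fun t => ∫ x in P.Ω, P.c j x * ((∫ r in (0 : ℝ)..t, ψ r) * Z (x, t)))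
      = ∫ t in Ioc 0 P.T, (∫ r in (0 : ℝ)..t, ψ r) * (∫ x in P.Ω, P.c j x * Z (x, t))
          ∂(μ j).measure := by
    intro j
    rw [stieltjesIntegral]
    refine integral_congr_ae (Eventually.of_forall fun t => ?_)
    simp only
    rw [← integral_const_mul]
    exact integral_congr_ae (Eventually.of_forall fun x => by simp only; ring)
  simp only [e5] at hEQ
  rw [e1, e2, e4] at hEQ
  linear_combination hEQ + e3

lemma integrableOn_constraintPairing (hP : P.Basic) (hZ : MemY P.Ω P.T Z) (j : Fin q) :
    IntegrableOn (fun t => ∫ x in P.Ω, P.c j x * Z (x, t)) (Ioc 0 P.T) (μ j).measure :=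
  StieltjesFunction.integrableOn_of_continuousOn _
    (hZ.continuousOn_pairing (hP.c_mem j).1.memLp)

/-- Integrated form of the adjoint equation. -/
lemma costate_pairing_ae (hP : P.Basic) (hu : P.IsAdmissibleControl u) (hst : P.IsState u y)
    (hc : P.IsCostate u y p μ) (h : P.IsDirection y Z) :
    ∀ᵐ s ∂P.timeMeasure, ∫ x in P.Ω, p (x, s) * Z (x, s)
      = P.finalPairing y Z
        + (∑ j, ∫ t in Icc s P.T, (∫ x in P.Ω, P.c j x * Z (x, t)) ∂(μ j).measure)
        + ∫ t in s..P.T, ∫ x in P.Ω, P.adjointDensity u y p Z (x, t) := by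
  have hT := hP.T_pos
  have hG := integrable_integral_slice (integrable_adjointDensity hP hu hst hc.1.memLp h)
  have hpZ := integrable_integral_slice (integrable_mul_of_memLp_two hc.1.memLp h.memY.memLp)
  have hm := fun j => integrableOn_constraintPairing (μ := μ) hP h.memY j
  have htail := fun j => integrableOn_tail_integral (hm j)
  have hGt : IntegrableOn (fun s => ∫ t in s..P.T, ∫ x in P.Ω, P.adjointDensity u y p Z (x, t))
      (Ioo 0 P.T) := by
    refine ((integrable_const (∫ t in (0 : ℝ)..P.T, ∫ x in P.Ω,
      P.adjointDensity u y p Z (x, t))).sub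
      ((continuousOn_primitive_Ioo hT.le hG).integrableOn_Icc.mono_set Ioo_subset_Icc_self)).congr ?_
    refine (ae_restrict_iff' measurableSet_Ioo).2 (Eventually.of_forall fun s hs => ?_)
    have hs' := Ioo_subset_Icc_self hs
    have h0 : (0 : ℝ) ∈ Icc 0 P.T := ⟨le_rfl, hT.le⟩
    have hTm : P.T ∈ Icc 0 P.T := ⟨hT.le, le_rfl⟩
    simp only [Pi.sub_apply]
    rw [sub_eq_iff_eq_add', intervalIntegral.integral_add_adjacent_intervals
      (intervalIntegrable_of_Ioo hG h0 hs') (intervalIntegrable_of_Ioo hG hs' hTm)]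
  have hR : IntegrableOn (fun s => P.finalPairing y Z
        + (∑ j, ∫ t in Icc s P.T, (∫ x in P.Ω, P.c j x * Z (x, t)) ∂(μ j).measure)
        + ∫ t in s..P.T, ∫ x in P.Ω, P.adjointDensity u y p Z (x, t)) (Ioo 0 P.T) :=
    ((integrable_const _).add (integrable_finsetSum _ fun j _ => htail j)).add hGt
  refine ae_eq_of_forall_test isOpen_Ioo hpZ.locallyIntegrableOn hR.locallyIntegrableOn
    fun ψ hψ => ?_
  have hψ2 : MemLp ψ 2 P.timeMeasure := hψ.memLp 2
  have hψi : IntegrableOn ψ (Ioo 0 P.T) := hψ2.integrable one_le_two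
  obtain ⟨C, hC⟩ := hψ.exists_bound
  have hbd : ∀ {f : ℝ → ℝ}, IntegrableOn f (Ioo 0 P.T) →
      Integrable (fun s => ψ s * f s) P.timeMeasure := fun hf =>
    hf.bdd_mul hψ2.1 (c := C) (Eventually.of_forall hC)
  have hw := costate_weak hP hu hst hc h hψ2
  -- Fubini moves the primitive of ψ onto the other factors as tails, after which ψ is an arbitrary
  -- test function and the identity holds almost everywhere.
  simp_rw [integral_primitive_mul (hm _) hψi, integral_primitive_mul_volume hG hψi] at hw
  have hexp : ∀ s, (P.finalPairing y Z
        + (∑ j, ∫ t in Icc s P.T, (∫ x in P.Ω, P.c j x * Z (x, t)) ∂(μ j).measure)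
        + ∫ t in s..P.T, ∫ x in P.Ω, P.adjointDensity u y p Z (x, t)) * ψ s
      = (∑ j, ψ s * ∫ t in Icc s P.T, (∫ x in P.Ω, P.c j x * Z (x, t)) ∂(μ j).measure)
        + ψ s * (∫ t in s..P.T, ∫ x in P.Ω, P.adjointDensity u y p Z (x, t))
        + ψ s * P.finalPairing y Z := by
    intro s
    rw [← Finset.mul_sum]
    ring
  simp_rw [hexp, mul_comm _ (ψ _)]
  rw [hw, integral_add _ (hbd (integrable_const _)), integral_add _ (hbd hGt), integral_finsetSum,
    integral_mul_const, setIntegral_Ioo_eq_intervalIntegral hT.le ψ]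
  · exact fun j _ => hbd (htail j)
  · exact integrable_finsetSum _ fun j _ => hbd (htail j)
  · exact (integrable_finsetSum _ fun j _ => hbd (htail j)).add (hbd hGt)

end ControlProblem

/-! ### The embedding of H^1_0 into L⁶ for n ≤ 3, and products in L². -/

section Sobolev

instance prodSpaceVolume_isAddHaarMeasure {n k : ℕ} :
    (volume : Measure (Space n × Space k)).IsAddHaarMeasure :=
  inferInstanceAs (Measure.IsAddHaarMeasure ((volume : Measure (Space n)).prod
    (volume : Measure (Space k))))

lemma eLpNorm_tensor {X Y : Type*} [MeasurableSpace X] [MeasurableSpace Y] {μ : Measure X}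
    {ν : Measure Y} [SFinite μ] [SFinite ν] {f : X → ℝ} {g : Y → ℝ} (hf : AEStronglyMeasurable f μ)
    (hg : AEStronglyMeasurable g ν) {r : ℝ≥0∞} (h0 : r ≠ 0) (h1 : r ≠ ⊤) :
    eLpNorm (fun s : X × Y => f s.1 * g s.2) r (μ.prod ν) = eLpNorm f r μ * eLpNorm g r ν := by
  have hr : 0 < r.toReal := ENNReal.toReal_pos h0 h1
  simp only [eLpNorm_eq_lintegral_rpow_enorm_toReal h0 h1, enorm_mul]
  simp_rw [ENNReal.mul_rpow_of_nonneg _ _ hr.le]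
  rw [lintegral_prod_mul (hf.enorm.pow_const _) (hg.enorm.pow_const _),
    ENNReal.mul_rpow_of_nonneg _ _ (by positivity)]

lemma norm_fderiv_le_sum {n : ℕ} (L : Space n →L[ℝ] ℝ) : ‖L‖ ≤ ∑ i, |L (unitVec i)| := by
  refine L.opNorm_le_bound (Finset.sum_nonneg fun i _ => abs_nonneg _) fun x => ?_
  have hx : x = ∑ i, x i • unitVec i := by
    ext j
    simp [unitVec, Finset.sum_apply, Pi.single_apply]
  have h1 : L x = ∑ i, x i * L (unitVec i) := by
    conv_lhs => rw [hx]
    simp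
  rw [h1, Finset.sum_mul]
  refine (norm_sum_le _ _).trans (Finset.sum_le_sum fun i _ => ?_)
  rw [norm_mul, mul_comm]
  exact mul_le_mul_of_nonneg_left (PiLp.norm_apply_le x i) (abs_nonneg _)

lemma eLpNorm_fderiv_tensor_le {n k : ℕ} {φ : Space n → ℝ} {χ : Space k → ℝ}
    (hφ : ContDiff ℝ 1 φ) (hχd : ContDiff ℝ 1 χ) :
    eLpNorm (fderiv ℝ (fun s : Space n × Space k => φ s.1 * χ s.2)) 2 volume
      ≤ eLpNorm φ 2 volume * eLpNorm (fun x => ‖fderiv ℝ χ x‖) 2 volume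
        + eLpNorm (fderiv ℝ φ) 2 volume * eLpNorm χ 2 volume := by
  have hχc := hχd.continuous
  have hφ' : Continuous (fun x => ‖fderiv ℝ φ x‖) := (hφ.continuous_fderiv one_ne_zero).norm
  have hχ' : Continuous (fun x => ‖fderiv ℝ χ x‖) := (hχd.continuous_fderiv one_ne_zero).norm
  have hfd : ∀ s : Space n × Space k, ‖fderiv ℝ (fun s => φ s.1 * χ s.2) s‖
      ≤ |φ s.1| * ‖fderiv ℝ χ s.2‖ + ‖fderiv ℝ φ s.1‖ * |χ s.2| := by
    intro s
    have e1 : HasFDerivAt (fun s : Space n × Space k => φ s.1)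
        ((fderiv ℝ φ s.1).comp (ContinuousLinearMap.fst ℝ _ _)) s :=
      ((hφ.differentiable one_ne_zero s.1).hasFDerivAt).comp s hasFDerivAt_fst
    have e2 : HasFDerivAt (fun s : Space n × Space k => χ s.2)
        ((fderiv ℝ χ s.2).comp (ContinuousLinearMap.snd ℝ _ _)) s :=
      ((hχd.differentiable one_ne_zero s.2).hasFDerivAt).comp s hasFDerivAt_snd
    rw [show fderiv ℝ (fun s : Space n × Space k => φ s.1 * χ s.2) s = _ from (e1.mul e2).fderiv]
    refine (norm_add_le _ _).trans (add_le_add ?_ ?_)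
    · rw [norm_smul, Real.norm_eq_abs]
      refine mul_le_mul_of_nonneg_left ?_ (abs_nonneg _)
      exact (ContinuousLinearMap.opNorm_comp_le _ _).trans
        (mul_le_of_le_one_right (norm_nonneg _) (ContinuousLinearMap.norm_snd_le ..))
    · rw [norm_smul, Real.norm_eq_abs, mul_comm]
      refine mul_le_mul_of_nonneg_right ?_ (abs_nonneg _)
      exact (ContinuousLinearMap.opNorm_comp_le _ _).trans
        (mul_le_of_le_one_right (norm_nonneg _) (ContinuousLinearMap.norm_fst_le ..))
  have hc1 : Continuous (fun x => |φ x|) := hφ.continuous.abs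
  have hc2 : Continuous (fun x => |χ x|) := hχc.abs
  have m1 : AEStronglyMeasurable (fun s : Space n × Space k => |φ s.1| * ‖fderiv ℝ χ s.2‖)
      volume := by
    refine Continuous.aestronglyMeasurable ?_
    exact (hc1.comp continuous_fst).mul (hχ'.comp continuous_snd)
  have m2 : AEStronglyMeasurable (fun s : Space n × Space k => ‖fderiv ℝ φ s.1‖ * |χ s.2|)
      volume := by
    refine Continuous.aestronglyMeasurable ?_
    exact (hφ'.comp continuous_fst).mul (hc2.comp continuous_snd)
  refine (eLpNorm_mono_real hfd).trans ((eLpNorm_add_le m1 m2 one_le_two).trans ?_)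
  rw [Measure.volume_eq_prod, eLpNorm_tensor hc1.aestronglyMeasurable hχ'.aestronglyMeasurable
    two_ne_zero (by norm_num), eLpNorm_tensor hφ'.aestronglyMeasurable hc2.aestronglyMeasurable
    two_ne_zero (by norm_num), eLpNorm_norm (fderiv ℝ φ)]
  exact (congrArg₂ (· + ·) (congrArg (· * _) (eLpNorm_norm φ))
    (congrArg (_ * ·) (eLpNorm_norm χ))).le

/-- The Gagliardo–Nirenberg–Sobolev inequality in dimension at most three, reduced to dimension
three by tensoring with a bump function. -/
lemma exists_eLpNorm_six_le {n : ℕ} (hn3 : n ≤ 3) : ∃ C : ℝ≥0∞, C ≠ ⊤ ∧ ∀ φ : Space n → ℝ,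
    ContDiff ℝ 1 φ → HasCompactSupport φ →
      eLpNorm φ 6 volume ≤ C * (eLpNorm φ 2 volume + eLpNorm (fderiv ℝ φ) 2 volume) := by
  -- χ lives in the missing variables, so φ ⊗ χ is a function of exactly three variables; for n = 3
  -- the extra factor space is a point.
  obtain ⟨χ, hχd, hχs, hχ0⟩ : ∃ χ : Space (3 - n) → ℝ, ContDiff ℝ 1 χ ∧ HasCompactSupport χ
      ∧ χ 0 = 1 := by
    let f : ContDiffBump (0 : Space (3 - n)) := ⟨1, 2, one_pos, one_lt_two⟩
    exact ⟨f, f.contDiff, f.hasCompactSupport,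
      f.one_of_mem_closedBall (Metric.mem_closedBall_self zero_le_one)⟩
  have hχc : Continuous χ := hχd.continuous
  have hχ6 : eLpNorm χ 6 volume ≠ 0 := by
    rw [Ne, eLpNorm_eq_zero_iff hχc.aestronglyMeasurable (by norm_num)]
    intro h0
    rw [congrFun ((hχc.ae_eq_iff_eq volume continuous_const).1 h0) 0] at hχ0
    exact zero_ne_one hχ0
  have hχ6' : eLpNorm χ 6 volume ≠ ⊤ := (hχc.memLp_of_hasCompactSupport hχs).2.ne
  have hχ2 : eLpNorm χ 2 volume ≠ ⊤ := (hχc.memLp_of_hasCompactSupport hχs).2.ne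
  have hχ' : Continuous (fun x => ‖fderiv ℝ χ x‖) := (hχd.continuous_fderiv one_ne_zero).norm
  have hχ2' : eLpNorm (fun x => ‖fderiv ℝ χ x‖) 2 volume ≠ ⊤ :=
    (hχ'.memLp_of_hasCompactSupport (hχs.fderiv ℝ).norm).2.ne
  set K : ℝ≥0∞ := ((SNormLESNormFDerivOfEqConst ℝ
    (volume : Measure (Space n × Space (3 - n))) ((2 : NNReal) : ℝ) : NNReal) : ℝ≥0∞) with hK
  have hKt : K ≠ ⊤ := ENNReal.coe_ne_top
  refine ⟨K * (eLpNorm (fun x => ‖fderiv ℝ χ x‖) 2 volume + eLpNorm χ 2 volume)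
    * (eLpNorm χ 6 volume)⁻¹, ?_, fun φ hφ hφc => ?_⟩
  · exact ENNReal.mul_ne_top (ENNReal.mul_ne_top hKt (ENNReal.add_ne_top.2 ⟨hχ2', hχ2⟩))
      (ENNReal.inv_ne_top.2 hχ6)
  have hU : ContDiff ℝ 1 (fun s : Space n × Space (3 - n) => φ s.1 * χ s.2) :=
    (hφ.comp contDiff_fst).mul (hχd.comp contDiff_snd)
  have hUc : HasCompactSupport (fun s : Space n × Space (3 - n) => φ s.1 * χ s.2) := by
    refine HasCompactSupport.intro (K := tsupport φ ×ˢ tsupport χ)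
      (IsCompact.prod hφc hχs) fun s hs => ?_
    rw [mem_prod, not_and_or] at hs
    rcases hs with hs | hs
    · rw [image_eq_zero_of_notMem_tsupport hs, zero_mul]
    · rw [image_eq_zero_of_notMem_tsupport hs, mul_zero]
  have hfin : Module.finrank ℝ (Space n × Space (3 - n)) = 3 := by
    rw [Module.finrank_prod, finrank_euclideanSpace_fin, finrank_euclideanSpace_fin]
    omega
  -- In dimension three the exponents fit: 1/6 = 1/2 - 1/3.
  have hmain := eLpNorm_le_eLpNorm_fderiv_of_eq (volume : Measure (Space n × Space (3 - n)))
    hU hUc (p := 2) (p' := 6) one_le_two (by rw [hfin]; norm_num) (by rw [hfin]; norm_num)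
  have hle := eLpNorm_fderiv_tensor_le hφ hχd
  have h6 : eLpNorm (fun s : Space n × Space (3 - n) => φ s.1 * χ s.2) 6 volume
      = eLpNorm φ 6 volume * eLpNorm χ 6 volume := by
    rw [Measure.volume_eq_prod]
    exact eLpNorm_tensor hφ.continuous.aestronglyMeasurable hχc.aestronglyMeasurable
      (by norm_num) (by norm_num)
  have h7 : eLpNorm φ 6 volume * eLpNorm χ 6 volume
      ≤ K * (eLpNorm (fun x => ‖fderiv ℝ χ x‖) 2 volume + eLpNorm χ 2 volume)
        * (eLpNorm φ 2 volume + eLpNorm (fderiv ℝ φ) 2 volume) := by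
    rw [← h6]
    refine hmain.trans ?_
    rw [mul_assoc]
    refine mul_le_mul_right (hle.trans ?_) _
    rw [mul_add, add_mul, add_mul, mul_comm (eLpNorm φ 2 volume),
      mul_comm (eLpNorm (fderiv ℝ φ) 2 volume)]
    exact add_le_add le_self_add le_add_self
  rw [mul_right_comm, ← div_eq_mul_inv]
  exact (ENNReal.le_div_iff_mul_le (Or.inl hχ6) (Or.inl hχ6')).2 h7

variable {n : ℕ} {Ω : Set (Space n)}

lemma IsTestFunction.eLpNorm_restrict {φ : Space n → ℝ} (h : IsTestFunction Ω φ) (r : ℝ≥0∞) :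
    eLpNorm φ r (volume.restrict Ω) = eLpNorm φ r volume :=
  eLpNorm_restrict_eq_of_support_subset ((subset_tsupport φ).trans h.2.2)

lemma IsTestFunction.eLpNorm_fderiv_le {φ : Space n → ℝ} (h : IsTestFunction Ω φ) :
    eLpNorm (fderiv ℝ φ) 2 volume
      ≤ ∑ i, eLpNorm (fun x => fderiv ℝ φ x (unitVec i)) 2 (volume.restrict Ω) := by
  have hs := eLpNorm_sum_le (μ := (volume : Measure (Space n))) (p := 2) (s := Finset.univ)
    (f := fun i x => |fderiv ℝ φ x (unitVec i)|)
    (fun i _ => (h.fderiv_apply (unitVec i)).continuous.abs.aestronglyMeasurable) one_le_two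
  have h1 : eLpNorm (fderiv ℝ φ) 2 volume
      ≤ eLpNorm (∑ i, fun x => |fderiv ℝ φ x (unitVec i)|) 2 volume := by
    refine eLpNorm_mono_real fun x => ?_
    rw [Finset.sum_apply]
    exact norm_fderiv_le_sum _
  refine h1.trans (hs.trans (Finset.sum_le_sum fun i _ => ?_))
  rw [(h.fderiv_apply (unitVec i)).eLpNorm_restrict]
  exact (eLpNorm_norm (fun x => fderiv ℝ φ x (unitVec i))).le

/-- The embedding of `H^1_0(Ω)` into `L^6(Ω)` in dimension at most three. -/
lemma exists_embedding_six (hn3 : n ≤ 3) (Ω : Set (Space n)) : ∃ C : ℝ≥0∞, C ≠ ⊤ ∧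
    ∀ u g, IsH10Pair Ω u g → eLpNorm u 6 (volume.restrict Ω)
      ≤ C * (eLpNorm u 2 (volume.restrict Ω) + ∑ i, eLpNorm (g i) 2 (volume.restrict Ω)) := by
  obtain ⟨C, hC, hle⟩ := exists_eLpNorm_six_le hn3
  have htest : ∀ φ, IsTestFunction Ω φ → eLpNorm φ 6 (volume.restrict Ω)
      ≤ C * (eLpNorm φ 2 (volume.restrict Ω)
        + ∑ i, eLpNorm (fun x => fderiv ℝ φ x (unitVec i)) 2 (volume.restrict Ω)) := by
    intro φ hφ
    rw [hφ.eLpNorm_restrict, hφ.eLpNorm_restrict]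
    exact (hle φ (hφ.1.of_le (by exact_mod_cast le_top)) hφ.2.1).trans
      (mul_le_mul_right (add_le_add_right hφ.eLpNorm_fderiv_le _) _)
  refine ⟨C, hC, fun u g h => ?_⟩
  obtain ⟨φ, hφ, h1, h2⟩ := h.exists_seq
  have hφm : ∀ k, MemLp (φ k) 2 (volume.restrict Ω) := fun k => (hφ k).memLp 2
  -- The approximating test functions converge only in H^1; along an almost everywhere convergent
  -- subsequence Fatou's lemma carries the L⁶ bound to the limit.
  obtain ⟨ns, hns, hae⟩ := (tendstoInMeasure_of_tendsto_eLpNorm two_ne_zero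
    (fun k => (hφm k).1) h.memLp.1 h1).exists_seq_tendsto_ae
  have hbound : ∀ k, eLpNorm (φ k) 6 (volume.restrict Ω)
      ≤ C * ((eLpNorm (fun x => φ k x - u x) 2 (volume.restrict Ω) + eLpNorm u 2 (volume.restrict Ω))
        + ∑ i, (eLpNorm (fun x => fderiv ℝ (φ k) x (unitVec i) - g i x) 2 (volume.restrict Ω)
          + eLpNorm (g i) 2 (volume.restrict Ω))) := by
    intro k
    refine (htest _ (hφ k)).trans ?_
    gcongr with i
    · have := eLpNorm_add_le ((hφm k).sub h.memLp).1 h.memLp.1 one_le_two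
      rwa [sub_add_cancel] at this
    · have := eLpNorm_add_le ((((hφ k).fderiv_apply (unitVec i)).memLp (ν := volume.restrict Ω)
        2).sub (h.memLp_deriv i)).1 (h.memLp_deriv i).1 one_le_two
      rwa [sub_add_cancel] at this
  have hlim : Tendsto (fun k => C * ((eLpNorm (fun x => φ k x - u x) 2 (volume.restrict Ω)
        + eLpNorm u 2 (volume.restrict Ω))
        + ∑ i, (eLpNorm (fun x => fderiv ℝ (φ k) x (unitVec i) - g i x) 2 (volume.restrict Ω)
          + eLpNorm (g i) 2 (volume.restrict Ω)))) atTop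
      (𝓝 (C * ((0 + eLpNorm u 2 (volume.restrict Ω))
        + ∑ i, (0 + eLpNorm (g i) 2 (volume.restrict Ω))))) := by
    refine ENNReal.Tendsto.const_mul ?_ (Or.inr hC)
    exact (h1.add_const _).add (tendsto_finsetSum _ fun i _ => (h2 i).add_const _)
  simp only [zero_add] at hlim
  refine (Lp.eLpNorm_lim_le_liminf_eLpNorm (fun k => (hφm (ns k)).1) u hae).trans ?_
  rw [← (hlim.comp hns.tendsto_atTop).liminf_eq]
  exact liminf_le_liminf (Eventually.of_forall fun k => hbound (ns k))

/-- The norm of `H^1(Ω)` for a function with gradient `g`. -/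
def sobolevNorm (Ω : Set (Space n)) (u : Space n → ℝ) (g : Fin n → Space n → ℝ) : ℝ :=
  (eLpNorm u 2 (volume.restrict Ω)).toReal + ∑ i, (eLpNorm (g i) 2 (volume.restrict Ω)).toReal

lemma sobolevNorm_nonneg (u : Space n → ℝ) (g : Fin n → Space n → ℝ) : 0 ≤ sobolevNorm Ω u g :=
  add_nonneg ENNReal.toReal_nonneg (Finset.sum_nonneg fun _ _ => ENNReal.toReal_nonneg)

lemma IsH10Pair.memLp_six (hn3 : n ≤ 3) {u : Space n → ℝ} {g : Fin n → Space n → ℝ}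
    (h : IsH10Pair Ω u g) : MemLp u 6 (volume.restrict Ω) := by
  obtain ⟨C, hC, hle⟩ := exists_embedding_six hn3 Ω
  refine ⟨h.memLp.1, (hle u g h).trans_lt (ENNReal.mul_lt_top hC.lt_top ?_)⟩
  exact ENNReal.add_lt_top.2 ⟨h.memLp.2, ENNReal.sum_lt_top.2 fun i _ => (h.memLp_deriv i).2⟩

lemma MemLp.cube_of_six {X : Type*} [MeasurableSpace X] {ν : Measure X} {u : X → ℝ}
    (h : MemLp u 6 ν) : MemLp (fun x => u x ^ 3) 2 ν := by
  refine (memLp_two_iff_integrable_sq (h.1.pow 3)).2 ?_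
  refine (h.integrable_norm_pow (p := 6) (by norm_num)).congr (Eventually.of_forall fun x => ?_)
  simp only [Real.norm_eq_abs, Pi.pow_apply]
  rw [← sq_abs (u x ^ 3), abs_pow, ← pow_mul]

lemma MemLp.sq_of_two_six {X : Type*} [MeasurableSpace X] {ν : Measure X} {u : X → ℝ}
    (h2 : MemLp u 2 ν) (h6 : MemLp u 6 ν) : MemLp (fun x => u x ^ 2) 2 ν := by
  refine (memLp_two_iff_integrable_sq (h2.1.pow 2)).2 ?_
  refine (integrable_mul_of_memLp_two h2 (MemLp.cube_of_six h6)).congr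
    (Eventually.of_forall fun x => ?_)
  simp only [Pi.pow_apply]
  ring

/-- Products of functions in `H^1_0(Ω)` are in `L²(Ω)` in dimension at most three. -/
lemma exists_mul_bound (hn3 : n ≤ 3) (Ω : Set (Space n)) : ∃ K : ℝ, 0 ≤ K ∧
    ∀ u g v k, IsH10Pair Ω u g → IsH10Pair Ω v k →
      MemLp (fun x => u x * v x) 2 (volume.restrict Ω) ∧
      (eLpNorm (fun x => u x * v x) 2 (volume.restrict Ω)).toReal
        ≤ K * sobolevNorm Ω u g * sobolevNorm Ω v k := by
  obtain ⟨C, hC, hle⟩ := exists_embedding_six hn3 Ω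
  have h4 : ∀ u g, IsH10Pair Ω u g →
      MemLp (fun x => u x ^ 2) 2 (volume.restrict Ω) ∧
      (eLpNorm (fun x => u x ^ 2) 2 (volume.restrict Ω)).toReal ^ 2
        ≤ C.toReal ^ 3 * sobolevNorm Ω u g ^ 4 := by
    intro u g h
    have hm6 := h.memLp_six hn3
    have h3 := MemLp.cube_of_six hm6
    have h2 := MemLp.sq_of_two_six h.memLp hm6
    refine ⟨h2, ?_⟩
    rw [eLpNorm_two_sq h2]
    -- Interpolation of L⁴ between L² and L⁶: Cauchy–Schwarz for u · u³ uses one L²-norm and three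
    -- L⁶-norms.
    have e1 : ∫ x in Ω, (u x ^ 2) ^ 2 = ∫ x in Ω, u x * u x ^ 3 :=
      integral_congr_ae (Eventually.of_forall fun x => by simp only; ring)
    have e2 := (le_abs_self _).trans (abs_integral_mul_le h.memLp h3)
    have e3 : (eLpNorm (fun x => u x ^ 3) 2 (volume.restrict Ω)).toReal
        = (eLpNorm u 6 (volume.restrict Ω)).toReal ^ 3 := by
      have := eLpNorm_norm_rpow (μ := volume.restrict Ω) (p := 2) u (q := 3) (by norm_num)
      rw [← ENNReal.toReal_pow]
      congr 1
      have e4 : (2 : ℝ≥0∞) * ENNReal.ofReal 3 = 6 := by norm_num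
      rw [e4] at this
      have e5 : eLpNorm (fun x => u x ^ 3) 2 (volume.restrict Ω)
          = eLpNorm (fun x => ‖u x‖ ^ (3 : ℝ)) 2 (volume.restrict Ω) := by
        refine eLpNorm_congr_norm_ae (Eventually.of_forall fun x => ?_)
        rw [Real.norm_rpow_of_nonneg (norm_nonneg _), norm_norm, norm_pow]
        exact (Real.rpow_natCast _ 3).symm
      rw [e5, this]
      norm_cast
    have e6 : (eLpNorm u 6 (volume.restrict Ω)).toReal ≤ C.toReal * sobolevNorm Ω u g := by
      have hfin : C * (eLpNorm u 2 (volume.restrict Ω)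
          + ∑ i, eLpNorm (g i) 2 (volume.restrict Ω)) ≠ ⊤ :=
        ENNReal.mul_ne_top hC (ENNReal.add_ne_top.2 ⟨h.memLp.2.ne,
          ENNReal.sum_ne_top.2 fun i _ => (h.memLp_deriv i).2.ne⟩)
      refine (ENNReal.toReal_mono hfin (hle u g h)).trans_eq ?_
      rw [ENNReal.toReal_mul, ENNReal.toReal_add h.memLp.2.ne
        (ENNReal.sum_ne_top.2 fun i _ => (h.memLp_deriv i).2.ne),
        ENNReal.toReal_sum fun i _ => (h.memLp_deriv i).2.ne, sobolevNorm]
    have e7 : (eLpNorm u 2 (volume.restrict Ω)).toReal ≤ sobolevNorm Ω u g :=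
      le_add_of_nonneg_right (Finset.sum_nonneg fun _ _ => ENNReal.toReal_nonneg)
    rw [e1]
    refine e2.trans ?_
    rw [e3]
    calc _ ≤ sobolevNorm Ω u g * (C.toReal * sobolevNorm Ω u g) ^ 3 := by
          gcongr
          exact sobolevNorm_nonneg u g
      _ = _ := by ring
  -- The squared L²-norm of uv is at most the product of the L²-norms of u² and v², each bounded by
  -- C^{3/2} times a squared H^1-norm; a square root gives the constant C^{3/2}.
  refine ⟨√(C.toReal ^ 3), Real.sqrt_nonneg _, fun u g v k hu hv => ?_⟩
  obtain ⟨hu2, hub⟩ := h4 u g hu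
  obtain ⟨hv2, hvb⟩ := h4 v k hv
  have hm : MemLp (fun x => u x * v x) 2 (volume.restrict Ω) := by
    refine (memLp_two_iff_integrable_sq (hu.memLp.1.mul hv.memLp.1)).2 ?_
    refine (integrable_mul_of_memLp_two hu2 hv2).congr (Eventually.of_forall fun x => ?_)
    simp only [Pi.mul_apply]
    ring
  refine ⟨hm, ?_⟩
  have hn1 := sobolevNorm_nonneg (Ω := Ω) u g
  have hn2 := sobolevNorm_nonneg (Ω := Ω) v k
  refine (pow_le_pow_iff_left₀ (by positivity) (by positivity) two_ne_zero).1 ?_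
  rw [eLpNorm_two_sq hm]
  have e1 : ∫ x in Ω, (u x * v x) ^ 2 = ∫ x in Ω, u x ^ 2 * v x ^ 2 :=
    integral_congr_ae (Eventually.of_forall fun x => by simp only; ring)
  rw [e1]
  refine ((le_abs_self _).trans (abs_integral_mul_le hu2 hv2)).trans ?_
  rw [mul_pow, mul_pow, Real.sq_sqrt (by positivity)]
  refine (pow_le_pow_iff_left₀ (by positivity) (by positivity) two_ne_zero).1 ?_
  rw [mul_pow]
  calc _ ≤ (C.toReal ^ 3 * sobolevNorm Ω u g ^ 4) * (C.toReal ^ 3 * sobolevNorm Ω v k ^ 4) := by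
        gcongr
    _ = _ := by ring

end Sobolev

/-! ### One-sided limits of tails, and slices of functions bounded in H^1_0. -/

section Limits

lemma toReal_eLpNorm_sub_le {X : Type*} [MeasurableSpace X] {ν : Measure X} {a b : X → ℝ}
    (ha : MemLp a 2 ν) (hb : MemLp b 2 ν) :
    (eLpNorm a 2 ν).toReal
      ≤ (eLpNorm (fun x => a x - b x) 2 ν).toReal + (eLpNorm b 2 ν).toReal := by
  have h2 : eLpNorm a 2 ν ≤ eLpNorm (fun x => a x - b x) 2 ν + eLpNorm b 2 ν := by
    have := eLpNorm_add_le (ha.sub hb).1 hb.1 one_le_two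
    rwa [sub_add_cancel] at this
  exact (ENNReal.toReal_mono (ENNReal.add_ne_top.2 ⟨(ha.sub hb).eLpNorm_ne_top,
    hb.eLpNorm_ne_top⟩) h2).trans
    (ENNReal.toReal_add (ha.sub hb).eLpNorm_ne_top hb.eLpNorm_ne_top).le

/-- The intervals [s,T] decrease to [τ,T] as s increases to τ, so the left limit keeps the atom at
τ. From the right they increase to (τ,T], and the atom is lost in `tendsto_tail_right`. The
difference produces the jumps of the switching functions. -/
lemma tendsto_tail_left {T τ : ℝ} {ν : Measure ℝ} {m : ℝ → ℝ} (hm : IntegrableOn m (Ioc 0 T) ν)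
    (hτ : 0 < τ) :
    Tendsto (fun s => ∫ t in Icc s T, m t ∂ν) (𝓝[<] τ) (𝓝 (∫ t in Icc τ T, m t ∂ν)) := by
  have hrw : ∀ s, 0 < s → ∫ t in Icc s T, m t ∂ν = ∫ t in Ioc 0 T, (Ici s).indicator m t ∂ν := by
    intro s hs
    rw [setIntegral_indicator measurableSet_Ici]
    congr 2
    ext t
    simp only [mem_inter_iff, mem_Ioc, mem_Ici, mem_Icc]
    exact ⟨fun h => ⟨⟨hs.trans_le h.1, h.2⟩, h.1⟩, fun h => ⟨h.2, h.1.2⟩⟩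
  rw [hrw τ hτ]
  have hev : ∀ᶠ s in 𝓝[<] τ, 0 < s := mem_nhdsWithin_of_mem_nhds (lt_mem_nhds hτ)
  refine Tendsto.congr' (hev.mono fun s hs => (hrw s hs).symm) ?_
  refine tendsto_integral_filter_of_dominated_convergence (fun t => ‖m t‖)
    (Eventually.of_forall fun s => hm.1.indicator measurableSet_Ici)
    (Eventually.of_forall fun s => Eventually.of_forall fun t => norm_indicator_le_norm_self _ _)
    hm.norm (Eventually.of_forall fun t => ?_)
  refine tendsto_const_nhds.congr' ?_
  rcases le_or_gt τ t with h | h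
  · filter_upwards [self_mem_nhdsWithin] with s hs
    rw [indicator_of_mem (mem_Ici.2 h), indicator_of_mem (mem_Ici.2 ((le_of_lt hs).trans h))]
  · filter_upwards [mem_nhdsWithin_of_mem_nhds (lt_mem_nhds h)] with s hs
    rw [indicator_of_notMem (fun h' => absurd (mem_Ici.1 h') (not_le.2 h)),
      indicator_of_notMem (fun h' => absurd (mem_Ici.1 h') (not_le.2 hs))]

lemma tendsto_tail_right {T τ : ℝ} {ν : Measure ℝ} {m : ℝ → ℝ} (hm : IntegrableOn m (Ioc 0 T) ν)
    (hτ : 0 ≤ τ) :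
    Tendsto (fun s => ∫ t in Icc s T, m t ∂ν) (𝓝[>] τ) (𝓝 (∫ t in Ioc τ T, m t ∂ν)) := by
  have hrw : ∀ s, 0 < s → ∫ t in Icc s T, m t ∂ν = ∫ t in Ioc 0 T, (Ici s).indicator m t ∂ν := by
    intro s hs
    rw [setIntegral_indicator measurableSet_Ici]
    congr 2
    ext t
    simp only [mem_inter_iff, mem_Ioc, mem_Ici, mem_Icc]
    exact ⟨fun h => ⟨⟨hs.trans_le h.1, h.2⟩, h.1⟩, fun h => ⟨h.2, h.1.2⟩⟩
  have hrw' : ∫ t in Ioc τ T, m t ∂ν = ∫ t in Ioc 0 T, (Ioi τ).indicator m t ∂ν := by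
    rw [setIntegral_indicator measurableSet_Ioi]
    congr 2
    ext t
    simp only [mem_inter_iff, mem_Ioc, mem_Ioi]
    exact ⟨fun h => ⟨⟨hτ.trans_lt h.1, h.2⟩, h.1⟩, fun h => ⟨h.2, h.1.2⟩⟩
  rw [hrw']
  have hev : ∀ᶠ s in 𝓝[>] τ, 0 < s := by
    filter_upwards [self_mem_nhdsWithin] with s hs using hτ.trans_lt hs
  refine Tendsto.congr' (hev.mono fun s hs => (hrw s hs).symm) ?_
  refine tendsto_integral_filter_of_dominated_convergence (fun t => ‖m t‖)
    (Eventually.of_forall fun s => hm.1.indicator measurableSet_Ici)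
    (Eventually.of_forall fun s => Eventually.of_forall fun t => norm_indicator_le_norm_self _ _)
    hm.norm (Eventually.of_forall fun t => ?_)
  refine tendsto_const_nhds.congr' ?_
  rcases lt_or_ge τ t with h | h
  · filter_upwards [mem_nhdsWithin_of_mem_nhds (gt_mem_nhds h)] with s hs
    rw [indicator_of_mem (mem_Ioi.2 h), indicator_of_mem (mem_Ici.2 (le_of_lt hs))]
  · filter_upwards [self_mem_nhdsWithin] with s hs
    rw [indicator_of_notMem (fun h' => absurd (mem_Ioi.1 h') (not_lt.2 h)),
      indicator_of_notMem (fun h' => absurd (mem_Ici.1 h') (not_le.2 (h.trans_lt hs)))]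

variable {n : ℕ} {Ω : Set (Space n)} {T : ℝ} {p : Space n × ℝ → ℝ}

/-- Approximants can be drawn from the countable family for which the adjoint equation holds outside
one common null set of times. -/
lemma IsH10Pair.exists_seq_mem {D : Set (Space n → ℝ)}
    (hD : ∀ φ, IsTestFunction Ω φ → ∀ ε : ℝ≥0∞, 0 < ε →
      ∃ ψ ∈ D, eLpNorm (fun x => ψ x - φ x) 2 (volume.restrict Ω) ≤ ε ∧
        ∀ i, eLpNorm (fun x => fderiv ℝ ψ x (unitVec i) - fderiv ℝ φ x (unitVec i)) 2
          (volume.restrict Ω) ≤ ε) (hDt : ∀ φ ∈ D, IsTestFunction Ω φ)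
    {u : Space n → ℝ} {g : Fin n → Space n → ℝ} (h : IsH10Pair Ω u g) :
    ∃ φ : ℕ → Space n → ℝ, (∀ k, φ k ∈ D) ∧
      Tendsto (fun k => eLpNorm (fun x => φ k x - u x) 2 (volume.restrict Ω)) atTop (𝓝 0) ∧
      ∀ i, Tendsto (fun k => eLpNorm (fun x => fderiv ℝ (φ k) x (unitVec i) - g i x) 2
        (volume.restrict Ω)) atTop (𝓝 0) := by
  obtain ⟨ψ, hψ, h1, h2⟩ := h.exists_seq
  have hpos : ∀ k : ℕ, (0 : ℝ≥0∞) < ((k : ℝ≥0∞) + 1)⁻¹ := fun k =>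
    ENNReal.inv_pos.2 (ENNReal.add_ne_top.2 ⟨ENNReal.natCast_ne_top k, ENNReal.one_ne_top⟩)
  have hlim : Tendsto (fun k : ℕ => ((k : ℝ≥0∞) + 1)⁻¹) atTop (𝓝 0) := by
    have := (tendsto_add_atTop_iff_nat 1).2 ENNReal.tendsto_inv_nat_nhds_zero
    simpa using this
  choose φ hφD hφ1 hφ2 using fun k => hD (ψ k) (hψ k) _ (hpos k)
  refine ⟨φ, hφD, ?_, fun i => ?_⟩
  · have := hlim.add h1
    rw [add_zero] at this
    refine tendsto_of_tendsto_of_tendsto_of_le_of_le tendsto_const_nhds this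
      (fun _ => zero_le) fun k => ?_
    have a1 : MemLp (fun x => φ k x - ψ k x) 2 (volume.restrict Ω) :=
      ((hDt _ (hφD k)).sub (hψ k)).memLp 2
    have a2 : MemLp (fun x => ψ k x - u x) 2 (volume.restrict Ω) := ((hψ k).memLp 2).sub h.memLp
    refine le_trans (le_of_eq ?_) ((eLpNorm_add_le a1.1 a2.1 one_le_two).trans
      (add_le_add_left (hφ1 k) _))
    congr 1
    ext x
    simp
  · have := hlim.add (h2 i)
    rw [add_zero] at this
    refine tendsto_of_tendsto_of_tendsto_of_le_of_le tendsto_const_nhds this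
      (fun _ => zero_le) fun k => ?_
    have a1 : MemLp (fun x => fderiv ℝ (φ k) x (unitVec i) - fderiv ℝ (ψ k) x (unitVec i)) 2
      (volume.restrict Ω) :=
        (((hDt _ (hφD k)).fderiv_apply _).sub ((hψ k).fderiv_apply _)).memLp 2
    have a2 : MemLp (fun x => fderiv ℝ (ψ k) x (unitVec i) - g i x) 2 (volume.restrict Ω) :=
      (((hψ k).fderiv_apply _).memLp 2).sub (h.memLp_deriv i)
    refine le_trans (le_of_eq ?_) ((eLpNorm_add_le a1.1 a2.1 one_le_two).trans
      (add_le_add_left (hφ2 k i) _))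
    congr 1
    ext x
    simp

lemma sobolevNorm_sub_le {u u' : Space n → ℝ} {g g' : Fin n → Space n → ℝ}
    (h : IsH10Pair Ω u g) (h' : IsH10Pair Ω u' g') :
    sobolevNorm Ω (fun x => u x - u' x) (fun i x => g i x - g' i x)
      ≤ sobolevNorm Ω u g + sobolevNorm Ω u' g' := by
  have key : ∀ {a b : Space n → ℝ}, MemLp a 2 (volume.restrict Ω) → MemLp b 2 (volume.restrict Ω) →
      (eLpNorm (fun x => a x - b x) 2 (volume.restrict Ω)).toReal
        ≤ (eLpNorm a 2 (volume.restrict Ω)).toReal + (eLpNorm b 2 (volume.restrict Ω)).toReal := by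
    intro a b ha hb
    rw [← ENNReal.toReal_add ha.eLpNorm_ne_top hb.eLpNorm_ne_top]
    exact ENNReal.toReal_mono (ENNReal.add_ne_top.2 ⟨ha.eLpNorm_ne_top, hb.eLpNorm_ne_top⟩)
      (eLpNorm_sub_le ha.1 hb.1 one_le_two)
  have h1 := key h.memLp h'.memLp
  have h2 := Finset.sum_le_sum fun i (_ : i ∈ Finset.univ) => key (h.memLp_deriv i) (h'.memLp_deriv i)
  rw [Finset.sum_add_distrib] at h2
  simp only [sobolevNorm]
  linarith

namespace MemLinftyH10

lemma hasWeakDeriv_dx (h : MemLinftyH10 Ω T p) (i : Fin n) :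
    HasWeakDeriv (cyl Ω T) (unitVec i, 0) p (dx Ω T i p) := by
  obtain ⟨g, hg, -⟩ := h.space_deriv i
  exact hg.wderiv_spec

lemma memLp_dx (hΩ : IsOpen Ω) (h : MemLinftyH10 Ω T p) (i : Fin n) :
    MemLp (dx Ω T i p) 2 (volume.restrict (cyl Ω T)) := by
  obtain ⟨g, hg, hg2⟩ := h.space_deriv i
  exact hg2.ae_eq (hg.wderiv_ae_eq (isOpen_cyl hΩ)).symm

lemma ae_pair (hΩ : IsOpen Ω) (h : MemLinftyH10 Ω T p) : ∀ᵐ t ∂(volume.restrict (Ioo 0 T)),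
    IsH10Pair Ω (fun x => p (x, t)) (fun i x => dx Ω T i p (x, t)) := by
  have h1 : ∀ i, ∀ᵐ t ∂(volume.restrict (Ioo 0 T)), ∀ φ, IsTestFunction Ω φ →
      ∫ x in Ω, p (x, t) * fderiv ℝ φ x (unitVec i) = - ∫ x in Ω, dx Ω T i p (x, t) * φ x :=
    fun i => (h.hasWeakDeriv_dx i).ae_slice h.memLp (h.memLp_dx hΩ i)
  have h2 : ∀ i, ∀ᵐ t ∂(volume.restrict (Ioo 0 T)),
      MemLp (fun x => dx Ω T i p (x, t)) 2 (volume.restrict Ω) :=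
    fun i => memLp_slice_time (h.memLp_dx hΩ i)
  filter_upwards [ae_all_iff.2 h1, ae_all_iff.2 h2, memLp_slice_time h.memLp, h.slice]
    with t h1 h2 h3 h4
  have hw : ∀ i, HasWeakDeriv Ω (unitVec i) (fun x => p (x, t)) (fun x => dx Ω T i p (x, t)) :=
    fun i => ⟨locallyIntegrableOn_of_memLp (by simp) h3, locallyIntegrableOn_of_memLp (by simp) (h2 i),
      h1 i⟩
  exact (h4.pair hΩ).congr (ae_eq_refl _) fun i => (hw i).wderiv_ae_eq hΩ

lemma exists_sobolevNorm_le (h : MemLinftyH10 Ω T p) : ∃ C : ℝ, 0 ≤ C ∧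
    ∀ᵐ t ∂(volume.restrict (Ioo 0 T)),
      sobolevNorm Ω (fun x => p (x, t)) (fun i x => dx Ω T i p (x, t)) ≤ C := by
  obtain ⟨C, hC⟩ := h.bounded
  refine ⟨max C 0 + ∑ _i : Fin n, max C 0, by positivity, ?_⟩
  filter_upwards [hC] with t ht
  have key : ∀ {a : ℝ≥0∞}, a ≤ ENNReal.ofReal C → a.toReal ≤ max C 0 := fun ha =>
    (ENNReal.toReal_mono ENNReal.ofReal_ne_top ha).trans_eq (ENNReal.toReal_ofReal')
  exact add_le_add (key ht.1) (Finset.sum_le_sum fun i _ => key (ht.2 i))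

end MemLinftyH10

end Limits

/-! ### Bounded variation of the costate and its trace at time T. -/

namespace ControlProblem

variable {n m q : ℕ} {P : ControlProblem n m q} {u : Fin m → ℝ → ℝ} {y p Z : Space n × ℝ → ℝ}
  {μ : Fin q → StieltjesFunction ℝ}

/-- The square of γ y² is γ times y times γ y³, and both y and γ y³ are square integrable. -/
lemma memLp_sq (hP : P.Basic) (hu : P.IsAdmissibleControl u) (hst : P.IsState u y) :
    MemLp (fun s => P.γ * y s ^ 2) 2 P.cylMeasure := by
  refine (memLp_two_iff_integrable_sq ((hst.1.memLp.1.pow 2).const_mul P.γ)).2 ?_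
  refine ((integrable_mul_of_memLp_two hst.1.memLp (memLp_cube hP hu hst)).const_mul P.γ).congr
    (Eventually.of_forall fun s => ?_)
  simp only [Pi.pow_apply]
  ring

lemma isDirection_test (hP : P.Basic) (hu : P.IsAdmissibleControl u) (hst : P.IsState u y)
    {φ : Space n → ℝ} (hφ : IsTestFunction P.Ω φ) : P.IsDirection y (fun s => φ s.1) := by
  refine ⟨(IsYRep.of_test hP.isOpen hP.T_pos.le hφ).memY, ?_⟩
  refine (memLp_bounded_mul (memLp_top_fst (hφ.memLp ⊤)) (memLp_sq hP hu hst)).ae_eq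
    (Eventually.of_forall fun s => ?_)
  simp only
  ring

/-- The adjoint density paired with a test function is bounded by the `H^1`-norm. -/
lemma adjointDensity_test_bound (hn3 : n ≤ 3) (hP : P.Basic) (hu : P.IsAdmissibleControl u)
    (hst : P.IsState u y) (hp : MemLinftyH10 P.Ω P.T p) :
    ∃ R : ℝ → ℝ, IntegrableOn R (Ioo 0 P.T) ∧ ∀ φ, IsTestFunction P.Ω φ →
      ∀ᵐ t ∂P.timeMeasure, |∫ x in P.Ω, P.adjointDensity u y p (fun s => φ s.1) (x, t)|
        ≤ R t * sobolevNorm P.Ω φ (fun i x => fderiv ℝ φ x (unitVec i)) := by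
  have hΩ := hP.isOpen
  obtain ⟨C, hC0, hC⟩ := hp.exists_sobolevNorm_le
  obtain ⟨K, hK0, hK⟩ := exists_mul_bound hn3 P.Ω
  have m1 : MemLp (fun s => y s - P.yd s) 2 P.cylMeasure := hst.1.memLp.sub hP.yd_mem
  have m2 := memLp_sq hP hu hst
  have m3 := memLp_bounded_mul (memLp_potential_top hP hu) hp.memLp
  -- The four summands of R bound, in order, the tracking term, the Dirichlet form of p and φ, the
  -- term from the derivative of the cubic, and the potential.
  refine ⟨fun t => (eLpNorm (fun x => y (x, t) - P.yd (x, t)) 2 (volume.restrict P.Ω)).toReal + C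
    + 3 * (eLpNorm (fun x => P.γ * y (x, t) ^ 2) 2 (volume.restrict P.Ω)).toReal * (K * C)
    + (eLpNorm (fun x => P.potential u (x, t) * p (x, t)) 2 (volume.restrict P.Ω)).toReal, ?_, ?_⟩
  · exact ((((memLp_norm_slice m1).integrable one_le_two).add (integrable_const C)).add
      ((((memLp_norm_slice m2).integrable one_le_two).const_mul 3).mul_const (K * C))).add
      ((memLp_norm_slice m3).integrable one_le_two)
  intro φ hφ
  have hrep := IsYRep.of_test (T := P.T) hΩ hP.T_pos.le hφ
  filter_upwards [ae_slice_time (IsYRep.opA_ae (u := u) (y := y) hΩ hrep), hC, hp.ae_pair hΩ,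
    memLp_slice_time m1, memLp_slice_time m2, memLp_slice_time m3] with t h1 hCt hpt n1 n2 n3
  set N := sobolevNorm P.Ω φ (fun i x => fderiv ℝ φ x (unitVec i)) with hN
  have hN0 : 0 ≤ N := sobolevNorm_nonneg _ _
  have hφ2 : MemLp φ 2 (volume.restrict P.Ω) := hφ.memLp 2
  have hφN : (eLpNorm φ 2 (volume.restrict P.Ω)).toReal ≤ N :=
    le_add_of_nonneg_right (Finset.sum_nonneg fun _ _ => ENNReal.toReal_nonneg)
  -- γ y² is only square integrable, so the product p φ has to be in L²; this is where the dimension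
  -- restriction enters.
  obtain ⟨k1, k2⟩ := hK _ _ _ _ hpt (IsH10Pair.of_test hφ)
  have i1 := integrable_mul_of_memLp_two n1 hφ2
  have i2 := integrable_mul_of_memLp_two n2 k1
  have i3 := integrable_mul_of_memLp_two n3 hφ2
  have hd2 : ∀ i, MemLp (fun x => fderiv ℝ (fun x => fderiv ℝ φ x (unitVec i)) x (unitVec i)) 2
      (volume.restrict P.Ω) := fun i =>
    ((hφ.fderiv_apply (unitVec i)).fderiv_apply (unitVec i)).memLp 2
  have hd1 : ∀ i, MemLp (fun x => fderiv ℝ φ x (unitVec i)) 2 (volume.restrict P.Ω) := fun i =>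
    (hφ.fderiv_apply (unitVec i)).memLp 2
  have i4 : ∀ i, Integrable (fun x => fderiv ℝ (fun x => fderiv ℝ φ x (unitVec i)) x (unitVec i)
      * p (x, t)) (volume.restrict P.Ω) := fun i => integrable_mul_of_memLp_two (hd2 i) hpt.memLp
  -- One derivative is moved from Δφ to p, so that the bound involves only the H^1-norm of φ.
  have ibp : ∀ i, ∫ x in P.Ω, fderiv ℝ (fun x => fderiv ℝ φ x (unitVec i)) x (unitVec i) * p (x, t)
      = - ∫ x in P.Ω, fderiv ℝ φ x (unitVec i) * dx P.Ω P.T i p (x, t) := fun i => by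
    rw [hpt.integral_by_parts (hd1 i) (hd2 i)
      ((HasWeakDeriv.of_contDiff ((hφ.fderiv_apply (unitVec i)).1.of_le (by exact_mod_cast le_top))
        P.Ω (unitVec i)).2.2), neg_neg]
  have hint : ∫ x in P.Ω, P.adjointDensity u y p (fun s => φ s.1) (x, t)
      = (∫ x in P.Ω, (y (x, t) - P.yd (x, t)) * φ x)
        + (∑ i, ∫ x in P.Ω, fderiv ℝ (fun x => fderiv ℝ φ x (unitVec i)) x (unitVec i) * p (x, t))
        - 3 * (∫ x in P.Ω, P.γ * y (x, t) ^ 2 * (p (x, t) * φ x))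
        + ∫ x in P.Ω, P.potential u (x, t) * p (x, t) * φ x := by
    have j1 := integrable_finsetSum Finset.univ fun i _ => i4 i
    have j2 : Integrable (fun x => (y (x, t) - P.yd (x, t)) * φ x
        + ∑ i, fderiv ℝ (fun x => fderiv ℝ φ x (unitVec i)) x (unitVec i) * p (x, t))
        (volume.restrict P.Ω) := i1.add j1
    have j3 : Integrable (fun x => (y (x, t) - P.yd (x, t)) * φ x
        + ∑ i, fderiv ℝ (fun x => fderiv ℝ φ x (unitVec i)) x (unitVec i) * p (x, t)
        - 3 * (P.γ * y (x, t) ^ 2 * (p (x, t) * φ x))) (volume.restrict P.Ω) :=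
      j2.sub (i2.const_mul 3)
    rw [← integral_finsetSum _ fun i _ => i4 i, ← integral_const_mul, ← integral_add i1 j1,
      ← integral_sub j2 (i2.const_mul 3), ← integral_add j3 i3]
    refine integral_congr_ae ?_
    filter_upwards [h1] with x hx
    rw [adjointDensity, hx, ← Finset.sum_mul]
    ring
  rw [hint]
  simp only [ibp]
  have b1 := abs_integral_mul_le n1 hφ2
  have b2 := abs_integral_mul_le n2 k1
  have b3 := abs_integral_mul_le n3 hφ2
  have b4 : |∑ i, -∫ x in P.Ω, fderiv ℝ φ x (unitVec i) * dx P.Ω P.T i p (x, t)| ≤ C * N := by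
    refine (Finset.abs_sum_le_sum_abs _ _).trans ?_
    have h5 : ∀ i ∈ (Finset.univ : Finset (Fin n)),
        |-∫ x in P.Ω, fderiv ℝ φ x (unitVec i) * dx P.Ω P.T i p (x, t)|
        ≤ C * (eLpNorm (fun x => fderiv ℝ φ x (unitVec i)) 2 (volume.restrict P.Ω)).toReal := by
      intro i _
      rw [abs_neg, mul_comm C]
      refine (abs_integral_mul_le (hd1 i) (hpt.memLp_deriv i)).trans
        (mul_le_mul_of_nonneg_left (le_trans ?_ hCt) ENNReal.toReal_nonneg)
      exact (Finset.single_le_sum (f := fun i => (eLpNorm (fun x => dx P.Ω P.T i p (x, t)) 2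
        (volume.restrict P.Ω)).toReal) (fun _ _ => ENNReal.toReal_nonneg) (Finset.mem_univ i)).trans
        (le_add_of_nonneg_left ENNReal.toReal_nonneg)
    refine (Finset.sum_le_sum h5).trans ?_
    rw [← Finset.mul_sum]
    exact mul_le_mul_of_nonneg_left (le_add_of_nonneg_left ENNReal.toReal_nonneg) hC0
  have b2' := b2.trans (mul_le_mul_of_nonneg_left (k2.trans (mul_le_mul_of_nonneg_right
    (mul_le_mul_of_nonneg_left hCt hK0) hN0)) ENNReal.toReal_nonneg)
  have b1' := b1.trans (mul_le_mul_of_nonneg_left hφN ENNReal.toReal_nonneg)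
  have b3' := b3.trans (mul_le_mul_of_nonneg_left hφN ENNReal.toReal_nonneg)
  refine (abs_add_le _ _).trans ?_
  refine (add_le_add ((abs_sub _ _).trans (add_le_add (abs_add_le _ _) le_rfl)) le_rfl).trans ?_
  rw [abs_mul, abs_of_pos (by norm_num : (0 : ℝ) < 3)]
  nlinarith

end ControlProblem

/-- Left neighbourhoods have positive measure; hence essential one-sided limits are unique. -/
lemma neBot_nhdsLT_inf_ae (τ : ℝ) : (𝓝[<] τ ⊓ ae volume).NeBot := by
  refine inf_neBot_iff.2 fun s hs s' hs' => ?_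
  obtain ⟨a, ha, has⟩ := mem_nhdsLT_iff_exists_Ioo_subset.1 hs
  by_contra hcon
  have h0 : volume (Ioo a τ) = 0 :=
    measure_mono_null (fun x hx hx' => hcon ⟨x, has hx, hx'⟩) (mem_ae_iff.1 hs')
  rw [Real.volume_Ioo, ENNReal.ofReal_eq_zero] at h0
  have := mem_Iio.1 ha
  linarith

lemma eventually_left_of_ae {a τ : ℝ} (ha : a < τ) {Q : ℝ → Prop}
    (h : ∀ᵐ t ∂(volume.restrict (Ioo a τ)), Q t) : ∀ᶠ t in 𝓝[<] τ ⊓ ae volume, Q t := by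
  have h1 : ∀ᶠ s in ae (volume : Measure ℝ), s ∈ Ioo a τ → Q s :=
    (ae_restrict_iff' measurableSet_Ioo).1 h
  have h2 : ∀ᶠ s in 𝓝[<] τ, s ∈ Ioo a τ := Ioo_mem_nhdsLT ha
  filter_upwards [h1.filter_mono inf_le_right, h2.filter_mono inf_le_left] with s a b using a b

lemma intervalIntegral_tail_sub {T : ℝ} {f : ℝ → ℝ} (hf : IntegrableOn f (Ioo 0 T)) {s t : ℝ}
    (hs : s ∈ Icc 0 T) (ht : t ∈ Icc 0 T) :
    (∫ r in s..T, f r) - ∫ r in t..T, f r = ∫ r in s..t, f r := by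
  have hT : T ∈ Icc 0 T := ⟨hs.1.trans hs.2, le_rfl⟩
  rw [sub_eq_iff_eq_add, intervalIntegral.integral_add_adjacent_intervals
    (intervalIntegrable_of_Ioo hf hs ht) (intervalIntegrable_of_Ioo hf ht hT)]

lemma continuousOn_tail_interval {T : ℝ} (hT : 0 ≤ T) {f : ℝ → ℝ} (hf : IntegrableOn f (Ioo 0 T)) :
    ContinuousOn (fun s => ∫ r in s..T, f r) (Icc 0 T) := by
  have h0 : (0 : ℝ) ∈ Icc 0 T := ⟨le_rfl, hT⟩
  refine (continuousOn_const.sub (continuousOn_primitive_Ioo hT hf)).congr (f := fun s =>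
    (∫ r in (0 : ℝ)..T, f r) - ∫ r in (0 : ℝ)..s, f r) fun s hs => ?_
  have := intervalIntegral_tail_sub hf h0 hs
  simp only
  linarith

lemma sobolevNorm_test_le {n : ℕ} {Ω : Set (Space n)} {φ w : Space n → ℝ}
    {g : Fin n → Space n → ℝ} (hφ : IsTestFunction Ω φ) (hw : IsH10Pair Ω w g) :
    sobolevNorm Ω φ (fun i x => fderiv ℝ φ x (unitVec i))
      ≤ ((eLpNorm (fun x => φ x - w x) 2 (volume.restrict Ω)).toReal
        + ∑ i, (eLpNorm (fun x => fderiv ℝ φ x (unitVec i) - g i x) 2 (volume.restrict Ω)).toReal)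
        + sobolevNorm Ω w g := by
  have h1 := toReal_eLpNorm_sub_le (hφ.memLp (ν := volume.restrict Ω) 2) hw.memLp
  have h2 := Finset.sum_le_sum fun i (_ : i ∈ Finset.univ) => toReal_eLpNorm_sub_le
    ((hφ.fderiv_apply (unitVec i)).memLp (ν := volume.restrict Ω) 2) (hw.memLp_deriv i)
  rw [Finset.sum_add_distrib] at h2
  simp only [sobolevNorm]
  linarith

namespace ControlProblem

variable {n m q : ℕ} {P : ControlProblem n m q} {u : Fin m → ℝ → ℝ} {y p Z : Space n × ℝ → ℝ}
  {μ : Fin q → StieltjesFunction ℝ}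

/-- The costate is a function of bounded variation in time, with values in `L²(Ω)`, up to a
square root. -/
lemma costate_sub_le (hn3 : n ≤ 3) (hP : P.Basic) (hu : P.IsAdmissibleControl u)
    (hst : P.IsState u y) (hc : P.IsCostate u y p μ) :
    ∃ W : ℝ → ℝ, (∃ l, Tendsto W (𝓝[<] P.T) (𝓝 l)) ∧ ∃ S : Set ℝ,
      (∀ᵐ s ∂P.timeMeasure, s ∈ S) ∧
      (∀ s ∈ S, MemLp (fun x => p (x, s)) 2 (volume.restrict P.Ω)) ∧
      ∀ s ∈ S, ∀ t ∈ S, s < t →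
        (eLpNorm (fun x => p (x, s) - p (x, t)) 2 (volume.restrict P.Ω)).toReal ^ 2
          ≤ W s - W t := by
  have hΩ := hP.isOpen
  have hT := hP.T_pos
  obtain ⟨D, hDc, hDt, hDd⟩ := exists_countable_dense_test P.Ω
  obtain ⟨C, hC0, hC⟩ := hc.1.exists_sobolevNorm_le
  obtain ⟨R, hR, hRb⟩ := adjointDensity_test_bound hn3 hP hu hst hc.1
  have hRa : IntegrableOn (fun t => |R t|) (Ioo 0 P.T) := hR.abs
  have hform : ∀ᵐ s ∂P.timeMeasure, ∀ φ ∈ D, ∫ x in P.Ω, p (x, s) * φ x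
      = P.finalPairing y (fun s => φ s.1)
        + (∑ j, ∫ t in Icc s P.T, (∫ x in P.Ω, P.c j x * φ x) ∂(μ j).measure)
        + ∫ t in s..P.T, ∫ x in P.Ω, P.adjointDensity u y p (fun s => φ s.1) (x, t) :=
    (ae_ball_iff hDc).2 fun φ hφ =>
      costate_pairing_ae hP hu hst hc (isDirection_test hP hu hst (hDt φ hφ))
  -- V is nonincreasing and its increments dominate those of p in the dual of H^1_0: the masses of
  -- the μ_j account for the constraints, and |R| for the adjoint density.
  set V : ℝ → ℝ := fun s => (∑ j, (eLpNorm (P.c j) 2 (volume.restrict P.Ω)).toReal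
    * ∫ _t in Icc s P.T, (1 : ℝ) ∂(μ j).measure) + ∫ t in s..P.T, |R t| with hV
  -- The factor 2C bounds the H^1-norm of a difference of two slices of p. The good times are those
  -- at which the integrated adjoint equation holds for the whole family D.
  refine ⟨fun s => 2 * C * V s, ?_, {s | s ∈ Ioo 0 P.T ∧
    IsH10Pair P.Ω (fun x => p (x, s)) (fun i x => dx P.Ω P.T i p (x, s)) ∧
    sobolevNorm P.Ω (fun x => p (x, s)) (fun i x => dx P.Ω P.T i p (x, s)) ≤ C ∧
    ∀ φ ∈ D, ∫ x in P.Ω, p (x, s) * φ x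
      = P.finalPairing y (fun s => φ s.1)
        + (∑ j, ∫ t in Icc s P.T, (∫ x in P.Ω, P.c j x * φ x) ∂(μ j).measure)
        + ∫ t in s..P.T, ∫ x in P.Ω, P.adjointDensity u y p (fun s => φ s.1) (x, t)}, ?_, ?_, ?_⟩
  · refine ⟨_, Tendsto.const_mul _ (Tendsto.add (tendsto_finsetSum _ fun j _ =>
      Tendsto.const_mul _ (tendsto_tail_left (integrableOn_const measure_Ioc_lt_top.ne) hT))
      (((continuousOn_tail_interval hT.le hRa P.T ⟨hT.le, le_rfl⟩).mono_left ?_)))⟩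
    rw [← nhdsWithin_Ioo_eq_nhdsLT hT]
    exact nhdsWithin_mono _ Ioo_subset_Icc_self
  · filter_upwards [ae_restrict_mem measurableSet_Ioo, hc.1.ae_pair hΩ, hC, hform]
      with s h1 h2 h3 h4 using ⟨h1, h2, h3, h4⟩
  · exact fun s hs => hs.2.1.memLp
  rintro s ⟨hs, hsp, hsC, hsφ⟩ t ⟨ht, htp, htC, htφ⟩ hst'
  have hsm := Ioo_subset_Icc_self hs
  have htm := Ioo_subset_Icc_self ht
  have hpair := hsp.sub htp
  have hA : ∀ j, 0 ≤ (∫ _r in Icc s P.T, (1 : ℝ) ∂(μ j).measure)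
      - ∫ _r in Icc t P.T, (1 : ℝ) ∂(μ j).measure := by
    intro j
    rw [sub_nonneg]
    exact setIntegral_mono_set (integrableOn_const measure_Icc_lt_top.ne)
      (Eventually.of_forall fun _ => zero_le_one)
      (Icc_subset_Icc_left hst'.le).eventuallyLE
  have hω : V s - V t = (∑ j, (eLpNorm (P.c j) 2 (volume.restrict P.Ω)).toReal
      * ((∫ _r in Icc s P.T, (1 : ℝ) ∂(μ j).measure) - ∫ _r in Icc t P.T, (1 : ℝ) ∂(μ j).measure))
      + ∫ r in s..t, |R r| := by
    rw [← intervalIntegral_tail_sub hRa hsm htm]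
    simp only [hV, mul_sub, Finset.sum_sub_distrib]
    ring
  have hω0 : 0 ≤ V s - V t := by
    rw [hω]
    exact add_nonneg (Finset.sum_nonneg fun j _ => mul_nonneg ENNReal.toReal_nonneg (hA j))
      (intervalIntegral.integral_nonneg hst'.le fun _ _ => abs_nonneg _)
  have key : ∀ φ ∈ D, ∫ x in P.Ω, (p (x, s) - p (x, t)) * φ x
      ≤ sobolevNorm P.Ω φ (fun i x => fderiv ℝ φ x (unitVec i)) * (V s - V t) := by
    intro φ hφ
    have hφt := hDt φ hφ
    have hφ2 : MemLp φ 2 (volume.restrict P.Ω) := hφt.memLp 2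
    set N := sobolevNorm P.Ω φ (fun i x => fderiv ℝ φ x (unitVec i)) with hN
    have hφN : (eLpNorm φ 2 (volume.restrict P.Ω)).toReal ≤ N :=
      le_add_of_nonneg_right (Finset.sum_nonneg fun _ _ => ENNReal.toReal_nonneg)
    have hG := integrable_integral_slice (integrable_adjointDensity hP hu hst hc.1.memLp
      (isDirection_test hP hu hst hφt))
    have e1 : ∫ x in P.Ω, (p (x, s) - p (x, t)) * φ x
        = (∫ x in P.Ω, p (x, s) * φ x) - ∫ x in P.Ω, p (x, t) * φ x := by
      rw [← integral_sub (integrable_mul_of_memLp_two hsp.memLp hφ2)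
        (integrable_mul_of_memLp_two htp.memLp hφ2)]
      simp only [sub_mul]
    have e2 : ∀ r j, ∫ _t in Icc r P.T, (∫ x in P.Ω, P.c j x * φ x) ∂(μ j).measure
        = (∫ x in P.Ω, P.c j x * φ x) * ∫ _t in Icc r P.T, (1 : ℝ) ∂(μ j).measure := by
      intro r j
      rw [← integral_const_mul]
      simp only [mul_one]
    have e3 := intervalIntegral_tail_sub hG hsm htm
    have b1 : ∀ j, (∫ x in P.Ω, P.c j x * φ x) * ((∫ _r in Icc s P.T, (1 : ℝ) ∂(μ j).measure)
        - ∫ _r in Icc t P.T, (1 : ℝ) ∂(μ j).measure)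
        ≤ N * ((eLpNorm (P.c j) 2 (volume.restrict P.Ω)).toReal
          * ((∫ _r in Icc s P.T, (1 : ℝ) ∂(μ j).measure)
            - ∫ _r in Icc t P.T, (1 : ℝ) ∂(μ j).measure)) := by
      intro j
      rw [← mul_assoc, mul_comm N]
      refine mul_le_mul_of_nonneg_right ?_ (hA j)
      exact ((le_abs_self _).trans (abs_integral_mul_le (hP.c_mem j).1.memLp hφ2)).trans
        (mul_le_mul_of_nonneg_left hφN ENNReal.toReal_nonneg)
    have b2 : ∫ r in s..t, (∫ x in P.Ω, P.adjointDensity u y p (fun s => φ s.1) (x, r))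
        ≤ N * ∫ r in s..t, |R r| := by
      rw [← intervalIntegral.integral_const_mul, ← setIntegral_Ioo_eq_intervalIntegral hst'.le,
        ← setIntegral_Ioo_eq_intervalIntegral hst'.le]
      have hsub : Ioo s t ⊆ Ioo 0 P.T := Ioo_subset_Ioo hs.1.le ht.2.le
      refine integral_mono_ae (hG.mono_set hsub) ((hRa.mono_set hsub).const_mul N) ?_
      filter_upwards [ae_restrict_of_ae_restrict_of_subset hsub (hRb φ hφt)] with r hr
      rw [mul_comm N]
      exact (le_abs_self _).trans (hr.trans (mul_le_mul_of_nonneg_right (le_abs_self _)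
        (sobolevNorm_nonneg _ _)))
    have b3 := Finset.sum_le_sum fun j (_ : j ∈ Finset.univ) => b1 j
    rw [← Finset.mul_sum] at b3
    rw [e1, hsφ φ hφ, htφ φ hφ, hω, mul_add]
    simp only [e2]
    simp only [mul_sub, Finset.sum_sub_distrib] at b3 ⊢
    linarith
  -- The estimate by duality is applied with φ tending to p(s) - p(t) in H^1: the pairing becomes
  -- the squared L²-norm, and the factor in front the H^1-norm of that difference.
  obtain ⟨φ, hφD, hφ1, hφ2⟩ := hpair.exists_seq_mem hDd hDt
  have hl : Tendsto (fun k => ∫ x in P.Ω, (p (x, s) - p (x, t)) * φ k x) atTop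
      (𝓝 (∫ x in P.Ω, (p (x, s) - p (x, t)) * (p (x, s) - p (x, t)))) :=
    tendsto_integral_const_mul (Eventually.of_forall fun k => (hDt _ (hφD k)).memLp 2)
      hpair.memLp hpair.memLp hφ1
  have t1 := (ENNReal.tendsto_toReal ENNReal.zero_ne_top).comp hφ1
  have t2 := fun i => (ENNReal.tendsto_toReal ENNReal.zero_ne_top).comp (hφ2 i)
  have hr := (((t1.add (tendsto_finsetSum Finset.univ fun i _ => t2 i)).add_const
    (sobolevNorm P.Ω (fun x => p (x, s) - p (x, t))
      (fun i x => dx P.Ω P.T i p (x, s) - dx P.Ω P.T i p (x, t)))).mul_const (V s - V t))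
  have hfin := le_of_tendsto_of_tendsto' hl hr fun k => (key _ (hφD k)).trans
    (mul_le_mul_of_nonneg_right (sobolevNorm_test_le (hDt _ (hφD k)) hpair) hω0)
  simp only [ENNReal.toReal_zero, Finset.sum_const_zero, zero_add] at hfin
  have hsq := eLpNorm_two_sq hpair.memLp
  rw [hsq]
  have e4 : ∫ x in P.Ω, (p (x, s) - p (x, t)) ^ 2
      = ∫ x in P.Ω, (p (x, s) - p (x, t)) * (p (x, s) - p (x, t)) := by simp only [sq]
  rw [e4]
  refine hfin.trans ?_
  simp only [← mul_sub]
  refine mul_le_mul_of_nonneg_right ?_ hω0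
  refine (sobolevNorm_sub_le hsp htp).trans ?_
  linarith

/-- W has a left limit at T, so the slices of p at good times form a Cauchy family in L²(Ω) as time
increases to T, and completeness supplies the trace. -/
lemma exists_hasEndTrace (hn3 : n ≤ 3) (hP : P.Basic) (hu : P.IsAdmissibleControl u)
    (hst : P.IsState u y) (hc : P.IsCostate u y p μ) :
    ∃ g, HasEndTrace P.Ω P.T p g := by
  classical
  have hT := hP.T_pos
  obtain ⟨W, ⟨l, hl⟩, S, hS, hSm, hSW⟩ := costate_sub_le hn3 hP hu hst hc
  set L : Filter ℝ := 𝓝[<] P.T ⊓ ae volume with hL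
  have hLS : ∀ᶠ s in L, s ∈ S := eventually_left_of_ae hT hS
  have hne : L.NeBot := neBot_nhdsLT_inf_ae P.T
  have hWL : Tendsto W L (𝓝 l) := hl.mono_left inf_le_left
  let F : ℝ → Lp ℝ 2 (volume.restrict P.Ω) := fun s =>
    if h : MemLp (fun x => p (x, s)) 2 (volume.restrict P.Ω) then h.toLp _ else 0
  have hF : ∀ s (hs : s ∈ S), F s = (hSm s hs).toLp _ := fun s hs => dif_pos (hSm s hs)
  have hdist : ∀ s (_ : s ∈ S) t (_ : t ∈ S), dist (F s) (F t) ^ 2 ≤ |W s - W t| := by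
    have hlt : ∀ s (_ : s ∈ S) t (_ : t ∈ S), s < t → dist (F s) (F t) ^ 2 ≤ |W s - W t| := by
      intro s hs t ht hst'
      rw [hF s hs, hF t ht, Lp.dist_def]
      refine le_trans (le_of_eq ?_) ((hSW s hs t ht hst').trans (le_abs_self _))
      congr 2
      refine eLpNorm_congr_ae ?_
      filter_upwards [(hSm s hs).coeFn_toLp, (hSm t ht).coeFn_toLp] with x h1 h2
      simp only [Pi.sub_apply]
      rw [h1, h2]
    intro s hs t ht
    rcases lt_trichotomy s t with h | h | h
    · exact hlt s hs t ht h
    · rw [h]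
      simp
    · rw [dist_comm, abs_sub_comm]
      exact hlt t ht s hs h
  have hcau : Cauchy (map F L) := by
    refine Metric.cauchy_iff.2 ⟨hne.map F, fun ε hε => ?_⟩
    have hW2 : ∀ᶠ s in L, |W s - l| < ε ^ 2 / 2 := by
      have := Metric.tendsto_nhds.1 hWL (ε ^ 2 / 2) (by positivity)
      simpa [Real.dist_eq] using this
    refine ⟨F '' {s | s ∈ S ∧ |W s - l| < ε ^ 2 / 2}, image_mem_map (hLS.and hW2), ?_⟩
    rintro _ ⟨s, ⟨hs, hs'⟩, rfl⟩ _ ⟨t, ⟨ht, ht'⟩, rfl⟩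
    refine lt_of_pow_lt_pow_left₀ 2 hε.le ((hdist s hs t ht).trans_lt ?_)
    have : |W s - W t| ≤ |W s - l| + |W t - l| := by
      rw [abs_sub_comm (W t) l]
      exact abs_sub_le _ _ _
    linarith
  obtain ⟨g, hg⟩ := CompleteSpace.complete hcau
  refine ⟨g, Lp.memLp g, ?_⟩
  have hg' : Tendsto F L (𝓝 g) := hg
  have hgd := tendsto_iff_edist_tendsto_0.1 hg'
  refine hgd.congr' ?_
  filter_upwards [hLS] with s hs
  rw [hF s hs, Lp.edist_def]
  refine eLpNorm_congr_ae ?_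
  filter_upwards [(hSm s hs).coeFn_toLp] with x h1
  simp only [Pi.sub_apply]
  rw [h1]

end ControlProblem

lemma hasEndTrace_endTrace {n : ℕ} {Ω : Set (Space n)} {T : ℝ} {p : Space n × ℝ → ℝ}
    (h : ∃ g, HasEndTrace Ω T p g) : HasEndTrace Ω T p (endTrace Ω T p) := by
  rw [endTrace, dif_pos h]
  exact h.choose_spec

/-! ### The multipliers have no singular part inside an arc. -/

/-- If the measures `ν j`, weighted by the entries of a matrix with trivial kernel, have combinations
with an integrable density, then they have no singular part. -/
lemma absolutelyContinuous_of_combination {ι κ : Type*} {a b : ℝ} (C : Finset κ) (I : Finset ι)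
    (ν : κ → Measure ℝ) [∀ j, IsFiniteMeasure ((ν j).restrict (Ioo a b))] {M : ι → κ → ℝ → ℝ}
    {G : ι → ℝ → ℝ}
    (hM : ∀ i ∈ I, ∀ j ∈ C, IntegrableOn (M i j) (Ioo a b) (ν j))
    (hG : ∀ i ∈ I, IntegrableOn (G i) (Ioo a b))
    (hw : ∀ i ∈ I, ∀ η, IsTestFunction (Ioo a b) η →
      (∑ j ∈ C, ∫ t in Ioo a b, η t * M i j t ∂(ν j)) + ∫ t in Ioo a b, η t * G i t = 0)
    (hinj : ∀ t ∈ Ioo a b, ∀ l : κ → ℝ, (∀ i ∈ I, ∑ j ∈ C, M i j t * l j = 0) → ∀ j ∈ C, l j = 0) :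
    ∀ j ∈ C, (ν j).restrict (Ioo a b) ≪ volume := by
  classical
  set ν' : κ → Measure ℝ := fun j => (ν j).restrict (Ioo a b) with hν'
  have : ∀ j, IsFiniteMeasure (ν' j) := fun j => by rw [hν']; infer_instance
  set V : Measure ℝ := volume.restrict (Ioo a b) with hV
  -- A finite measure dominating Lebesgue measure and all ν_j, so that the distributional identity
  -- becomes a pointwise one between densities.
  set σ : Measure ℝ := V + ∑ j ∈ C, ν' j with hσ
  have hVσ : V ≪ σ := Measure.absolutelyContinuous_of_le (Measure.le_add_right le_rfl)
  have hle : ∀ j ∈ C, ν' j ≤ ∑ j ∈ C, ν' j := fun j hj => by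
    intro s
    rw [Measure.finsetSum_apply]
    exact Finset.single_le_sum (f := fun j => ν' j s) (fun _ _ => zero_le) hj
  have hνσ : ∀ j ∈ C, ν' j ≪ σ := fun j hj =>
    Measure.absolutelyContinuous_of_le (Measure.le_add_left (hle j hj))
  have hfin : IsFiniteMeasure σ := by
    rw [hσ]
    infer_instance
  have hσU : ∀ᵐ t ∂σ, t ∈ Ioo a b := by
    rw [hσ, ae_add_measure_iff]
    refine ⟨ae_restrict_mem measurableSet_Ioo, ?_⟩
    rw [ae_iff, Measure.finsetSum_apply]
    exact Finset.sum_eq_zero fun j _ => ae_iff.1 (ae_restrict_mem measurableSet_Ioo)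
  set H : ι → ℝ → ℝ := fun i t => (∑ j ∈ C, ((ν' j).rnDeriv σ t).toReal * M i j t)
    + (V.rnDeriv σ t).toReal * G i t with hH
  have i1 : ∀ i ∈ I, ∀ j ∈ C, Integrable (fun t => ((ν' j).rnDeriv σ t).toReal * M i j t) σ :=
    fun i hi j hj => (integrable_rnDeriv_smul_iff (hνσ j hj)).2 (hM i hi j hj)
  have i2 : ∀ i ∈ I, Integrable (fun t => (V.rnDeriv σ t).toReal * G i t) σ :=
    fun i hi => (integrable_rnDeriv_smul_iff hVσ).2 (hG i hi)
  have hHi : ∀ i ∈ I, Integrable (H i) σ := fun i hi =>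
    (integrable_finsetSum _ fun j hj => i1 i hi j hj).add (i2 i hi)
  have hH0 : ∀ i ∈ I, ∀ᵐ t ∂σ, H i t = 0 := by
    intro i hi
    have h1 := isOpen_Ioo.ae_eq_zero_of_integral_contDiff_smul_eq_zero (U := Ioo a b) (μ := σ)
      ((hHi i hi).locallyIntegrable.locallyIntegrableOn _) fun η hη1 hη2 hη3 => by
        have hη : IsTestFunction (Ioo a b) η := ⟨hη1, hη2, hη3⟩
        obtain ⟨K, hK⟩ := hη.exists_bound
        have hbd : ∀ {f : ℝ → ℝ}, Integrable f σ → Integrable (fun s => η s * f s) σ := fun hf =>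
          hf.bdd_mul hη.continuous.aestronglyMeasurable (c := K) (Eventually.of_forall hK)
        have e1 : ∀ t, η t • H i t = (∑ j ∈ C, η t * (((ν' j).rnDeriv σ t).toReal * M i j t))
            + η t * ((V.rnDeriv σ t).toReal * G i t) := by
          intro t
          rw [smul_eq_mul, ← Finset.mul_sum, ← mul_add]
        simp only [e1]
        rw [integral_add (integrable_finsetSum _ fun j hj => hbd (i1 i hi j hj)) (hbd (i2 i hi)),
          integral_finsetSum _ fun j hj => hbd (i1 i hi j hj)]
        rw [← hw i hi η hη]
        congr 1
        · refine Finset.sum_congr rfl fun j hj => ?_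
          rw [← integral_rnDeriv_smul (hνσ j hj)]
          exact integral_congr_ae (Eventually.of_forall fun t => by simp only [smul_eq_mul]; ring)
        · rw [← integral_rnDeriv_smul hVσ]
          exact integral_congr_ae (Eventually.of_forall fun t => by simp only [smul_eq_mul]; ring)
    filter_upwards [h1, hσU] with t h1 h2 using h1 h2
  have hHall : ∀ᵐ t ∂σ, ∀ i ∈ I, H i t = 0 := (ae_ball_iff I.countable_toSet).2 hH0
  intro j hj
  refine Measure.AbsolutelyContinuous.mk fun N hN hN0 => ?_
  have hVN : V N = 0 := measure_mono_null (le_refl N) (by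
    exact le_antisymm ((Measure.restrict_apply_le _ _).trans hN0.le) zero_le)
  -- On a Lebesgue null set the density of Lebesgue measure vanishes, the identity reads M ·
  -- (densities of the ν_j) = 0, and injectivity makes those densities vanish as well.
  have h1 : ∀ᵐ t ∂(σ.restrict N), V.rnDeriv σ t = 0 := by
    have h2 := Measure.setLIntegral_rnDeriv' hVσ hN
    rw [hVN, lintegral_eq_zero_iff (Measure.measurable_rnDeriv _ _)] at h2
    exact h2
  have h3 : ∀ᵐ t ∂(σ.restrict N), (ν' j).rnDeriv σ t = 0 := by
    filter_upwards [h1, ae_restrict_of_ae hHall, ae_restrict_of_ae hσU,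
      ae_restrict_of_ae (Measure.rnDeriv_lt_top (ν' j) σ)] with t g1 g2 g3 g4
    have g5 := hinj t g3 (fun j => ((ν' j).rnDeriv σ t).toReal) (fun i hi => by
      have := g2 i hi
      simp only [hH, g1, ENNReal.toReal_zero, zero_mul, add_zero] at this
      rw [← this]
      exact Finset.sum_congr rfl fun j _ => mul_comm _ _) j hj
    exact ((ENNReal.toReal_eq_zero_iff _).1 g5).resolve_right g4.ne
  rw [← Measure.setLIntegral_rnDeriv' (hνσ j hj) hN, lintegral_eq_zero_iff
    (Measure.measurable_rnDeriv _ _)]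
  exact h3

/-- Continuity extends the lower bound on M from almost every time of an open arc to its closure,
hence to the junction points. -/
lemma le_on_Icc_of_ae {a b : ℝ} (hab : a < b) {f g : ℝ → ℝ} (hf : ContinuousOn f (Icc a b))
    (hg : ContinuousOn g (Icc a b)) (h : ∀ᵐ t ∂(volume.restrict (Ioo a b)), f t ≤ g t) :
    ∀ t ∈ Icc a b, f t ≤ g t := by
  have hd : Dense {t | t ∈ Ioo a b → f t ≤ g t} :=
    Measure.dense_of_ae ((ae_restrict_iff' measurableSet_Ioo).1 h)
  have hcl : closure (Ioo a b ∩ {t | t ∈ Ioo a b → f t ≤ g t}) = Icc a b := by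
    refine Subset.antisymm ?_ ?_
    · rw [← closure_Ioo hab.ne]
      exact closure_mono inter_subset_left
    · rw [← closure_Ioo hab.ne]
      exact closure_minimal (hd.open_subset_closure_inter isOpen_Ioo) isClosed_closure
  intro t ht
  refine le_on_closure (s := Ioo a b ∩ {t | t ∈ Ioo a b → f t ≤ g t}) (fun x hx => hx.2 hx.1)
    (by rwa [hcl]) (by rwa [hcl]) (by rwa [hcl])

namespace ControlProblem

variable {n m q : ℕ} {P : ControlProblem n m q} {u : Fin m → ℝ → ℝ} {y p Z : Space n × ℝ → ℝ}
  {μ : Fin q → StieltjesFunction ℝ}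

/-- Pointwise form of the stationarity condition. -/
lemma IsMultiplier.switching_mul_nonneg (hP : P.Basic) (hu : P.IsAdmissibleControl u)
    (hΛ : P.IsMultiplier u y p μ) (i : Fin m) :
    ∀ᵐ t ∂P.timeMeasure, ∀ r ∈ Icc (P.lo i) (P.hi i), 0 ≤ P.switching y p i t * (r - u i t) := by
  classical
  have hint : ∀ e : ℝ, Integrable (fun t => P.switching y p i t * (e - u i t)) P.timeMeasure :=
    fun e => integrable_mul_of_memLp_two ((hΛ.switching_bounded i).mono_exponent le_top)
      ((memLp_const e).sub (hu i).1)
  -- The i-th control is replaced by the constant e on an arbitrary measurable set A and left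
  -- unchanged elsewhere. Afterwards the two bounds suffice as values of e, because the inequality
  -- is affine in r.
  have key : ∀ e ∈ Icc (P.lo i) (P.hi i),
      ∀ᵐ t ∂P.timeMeasure, 0 ≤ P.switching y p i t * (e - u i t) := by
    intro e he
    refine ae_nonneg_of_forall_setIntegral_nonneg (hint e) fun A hA _ => ?_
    have hadm : P.IsAdmissibleControl (fun k t => if k = i ∧ t ∈ A then e else u k t) := by
      intro k
      by_cases hk : k = i
      · subst hk
        refine ⟨?_, ?_⟩
        · have h1 : MemLp (A.piecewise (fun _ => e) (u k)) 2 P.timeMeasure :=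
            MemLp.piecewise hA (memLp_const e) ((hu k).1.mono_measure Measure.restrict_le_self)
          refine h1.ae_eq (Eventually.of_forall fun t => ?_)
          by_cases ht : t ∈ A <;> simp [ht]
        · filter_upwards [(hu k).2] with t ht
          by_cases htA : t ∈ A
          · simpa [htA] using he
          · simpa [htA] using ht
      · simpa [hk] using hu k
    have h2 := hΛ.stationarity _ hadm
    rw [Finset.sum_eq_single i (fun k _ hk => by simp [hk]) (by simp)] at h2
    rw [← integral_indicator hA]
    refine h2.trans_eq (integral_congr_ae (Eventually.of_forall fun t => ?_))
    by_cases ht : t ∈ A <;> simp [ht]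
  filter_upwards [key (P.lo i) ⟨le_rfl, (hP.lo_lt_hi i).le⟩,
    key (P.hi i) ⟨(hP.lo_lt_hi i).le, le_rfl⟩] with t h1 h2 r hr
  rcases le_total 0 (P.switching y p i t) with h | h
  · exact h1.trans (mul_le_mul_of_nonneg_left (by linarith [hr.1]) h)
  · exact h2.trans (mul_le_mul_of_nonpos_left (by linarith [hr.2]) h)

lemma IsMultiplier.switching_eq_zero (hP : P.Basic) (hu : P.IsAdmissibleControl u)
    (hΛ : P.IsMultiplier u y p μ) (i : Fin m) :
    ∀ᵐ t ∂P.timeMeasure, u i t ≠ P.lo i → u i t ≠ P.hi i → P.switching y p i t = 0 := by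
  filter_upwards [hΛ.switching_mul_nonneg hP hu i, (hu i).2] with t h1 h2 h3 h4
  have h5 : P.lo i < u i t := lt_of_le_of_ne h2.1 (Ne.symm h3)
  have h6 : u i t < P.hi i := lt_of_le_of_ne h2.2 h4
  have h7 := h1 (P.lo i) ⟨le_rfl, (hP.lo_lt_hi i).le⟩
  have h8 := h1 (P.hi i) ⟨(hP.lo_lt_hi i).le, le_rfl⟩
  refine le_antisymm ?_ ?_
  · by_contra h
    push Not at h
    nlinarith
  · by_contra h
    push Not at h
    nlinarith

lemma M_eq (i : Fin m) (j : Fin q) (t : ℝ) :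
    P.M y i j t = ∫ x in P.Ω, P.c j x * (P.b i.succ x * y (x, t)) :=
  integral_congr_ae (Eventually.of_forall fun x => by simp only; ring)

lemma continuousOn_M (hP : P.Basic) (hst : P.IsState u y) (hb : ∀ i, MemW P.Ω ∞ 2 (P.b i))
    (i : Fin m) (j : Fin q) : ContinuousOn (P.M y i j) (Icc 0 P.T) :=
  (((hst.1.rep hP.isOpen).mul_fst hP.isOpen hP.T_pos.le (hb i.succ)).memY.continuousOn_pairing
    (hP.c_mem j).1.memLp).congr fun t _ => M_eq i j t

lemma continuousOn_g (hP : P.Basic) (hst : P.IsState u y) (j : Fin q) :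
    ContinuousOn (P.g j y) (Icc 0 P.T) :=
  (hst.1.continuousOn_pairing (hP.c_mem j).1.memLp).add continuousOn_const

/-- A multiplier only charges the contact set. -/
lemma IsMultiplier.measure_eq_zero (hP : P.Basic) (huy : P.IsAdmissibleTrajectory u y)
    (hΛ : P.IsMultiplier u y p μ) (j : Fin q) {A : Set ℝ} (hA : A ⊆ Ioc 0 P.T)
    (h : ∀ t ∈ A, P.g j y t ≠ 0) : (μ j).measure A = 0 := by
  have hi : IntegrableOn (P.g j y) (Ioc 0 P.T) (μ j).measure :=
    StieltjesFunction.integrableOn_of_continuousOn _ (continuousOn_g hP huy.2.1 j)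
  have h1 : ∫ t in Ioc 0 P.T, - P.g j y t ∂(μ j).measure = 0 := by
    rw [integral_neg, neg_eq_zero]
    exact hΛ.complementarity j
  rw [setIntegral_eq_zero_iff_of_nonneg_ae ((ae_restrict_iff' measurableSet_Ioc).2
    (Eventually.of_forall fun t ht => neg_nonneg.2 (huy.2.2 j t (Ioc_subset_Icc_self ht))))
    hi.neg] at h1
  have h2 := (ae_restrict_iff' measurableSet_Ioc).1 h1
  refine measure_mono_null (fun t ht => ?_) (ae_iff.1 h2)
  simp only [mem_ofPred_eq, Pi.zero_apply, neg_eq_zero, Classical.not_imp]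
  exact ⟨hA ht, h t ht⟩

/-- On an arc the multipliers of the active state constraints have no singular part. -/
lemma IsMultiplier.arc_absolutelyContinuous (hP : P.Basic) (huy : P.IsAdmissibleTrajectory u y)
    (hb : ∀ i, MemW P.Ω ∞ 2 (P.b i)) (hΛ : P.IsMultiplier u y p μ) {a b : ℝ} (ha : 0 ≤ a)
    (hb' : b ≤ P.T) {C : Finset (Fin q)} {I : Finset (Fin m)}
    (hI : ∀ i ∈ I, ∀ᵐ t ∂(volume.restrict (Ioo a b)), P.switching y p i t = 0)
    (hC : ∀ j, ∀ t ∈ Ioo a b, P.g j y t = 0 ↔ j ∈ C)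
    (hinj : ∀ t ∈ Ioo a b, ∀ l : Fin q → ℝ,
      (∀ i ∈ I, ∑ j ∈ C, P.M y i j t * l j = 0) → ∀ j ∈ C, l j = 0) (j : Fin q) :
    ((μ j).measure.restrict (Ioo a b)) ≪ volume := by
  have hu := huy.1
  have hst := huy.2.1
  have hsub : Ioo a b ⊆ Ioo 0 P.T := Ioo_subset_Ioo ha hb'
  have hsub' : Ioo a b ⊆ Ioc 0 P.T := hsub.trans Ioo_subset_Ioc_self
  have hfinI : ∀ j, IsFiniteMeasure ((μ j).measure.restrict (Ioo a b)) := fun j =>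
    ⟨by rw [Measure.restrict_apply_univ]; exact measure_Ioo_lt_top⟩
  have hz : ∀ j, j ∉ C → (μ j).measure (Ioo a b) = 0 := fun j hj =>
    hΛ.measure_eq_zero hP huy j hsub' fun t ht h0 => hj ((hC j t ht).1 h0)
  by_cases hjC : j ∈ C
  swap
  · rw [Measure.restrict_eq_zero.2 (hz j hjC)]
    exact Measure.AbsolutelyContinuous.zero _
  have hdir : ∀ i : Fin m, P.IsDirection y (fun s => P.b i.succ s.1 * y s) := fun i =>
    (isDirection_state hP hu hst).mul_fst hP (hb i.succ)
  have hG := fun i => integrable_integral_slice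
    (integrable_adjointDensity hP hu hst hΛ.costate.1.memLp (hdir i))
  refine absolutelyContinuous_of_combination (a := a) (b := b) C I (fun j => (μ j).measure)
    (M := fun i j => P.M y i j) (G := fun i t => ∫ x in P.Ω,
      P.adjointDensity u y p (fun s => P.b i.succ s.1 * y s) (x, t))
    (fun i _ j _ => ?_) (fun i _ => (hG i).mono_set hsub) (fun i hi η hη => ?_) hinj j hjC
  · exact (StieltjesFunction.integrableOn_of_continuousOn (μ j)
      (continuousOn_M hP hst hb i j)).mono_set hsub'
  have hη0 : IsTestFunction (Ioo 0 P.T) η := hη.mono hsub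
  have hout : ∀ t, t ∉ Ioo a b → η t = 0 := fun t ht =>
    hη.eq_zero_of_notMem fun h' => ht (hη.2.2 h')
  have hout' : ∀ t, t ∉ Ioo a b → fderiv ℝ η t 1 = 0 := fun t ht =>
    (hη.fderiv_apply 1).eq_zero_of_notMem fun h' => ht ((hη.fderiv_apply 1).2.2 h')
  have hprim : ∀ t, ∫ r in (0 : ℝ)..t, fderiv ℝ η r 1 = η t := fun t => by
    rw [integral_test_eq_sub hη.1, hout 0 (fun h' => absurd h'.1 (not_lt.2 ha)), sub_zero]
  -- The choice ψ = η' makes the primitive equal to η, and the final term drops out since η(T) = 0.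
  have hw := costate_weak hP hu hst hΛ.costate (hdir i)
    (ψ := fun t => fderiv ℝ η t 1) ((hη0.fderiv_apply 1).memLp 2)
  simp only [hprim, hout P.T (fun h' => absurd h'.2 (not_lt.2 hb')), zero_mul, add_zero] at hw
  -- Where the switching function vanishes, ∫ p b_i y equals the constant -α_i, which the derivative
  -- of a compactly supported η annihilates.
  have e1 : ∫ t in Ioo 0 P.T, fderiv ℝ η t 1 * ∫ x in P.Ω, p (x, t) * (P.b i.succ x * y (x, t))
      = 0 := by
    have h1 : ∀ᵐ t ∂P.timeMeasure, fderiv ℝ η t 1 * ∫ x in P.Ω, p (x, t) * (P.b i.succ x * y (x, t))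
        = fderiv ℝ η t 1 * (- P.α i) := by
      have h2 := (ae_restrict_iff' measurableSet_Ioo).1 (hI i hi)
      filter_upwards [ae_restrict_of_ae h2] with t ht
      by_cases hta : t ∈ Ioo a b
      · have h3 := ht hta
        rw [switching] at h3
        have h4 : ∫ x in P.Ω, p (x, t) * (P.b i.succ x * y (x, t))
            = ∫ x in P.Ω, P.b i.succ x * y (x, t) * p (x, t) :=
          integral_congr_ae (Eventually.of_forall fun x => by simp only; ring)
        rw [h4]
        congr 1
        linarith
      · rw [hout' t hta, zero_mul, zero_mul]
    rw [integral_congr_ae h1, integral_mul_const, setIntegral_Ioo_eq_intervalIntegral hP.T_pos.le,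
      hprim, hout P.T (fun h' => absurd h'.2 (not_lt.2 hb')), zero_mul]
  have e2 : ∀ j, ∫ t in Ioc 0 P.T, η t * (∫ x in P.Ω, P.c j x * (P.b i.succ x * y (x, t)))
        ∂(μ j).measure = ∫ t in Ioo a b, η t * P.M y i j t ∂(μ j).measure := by
    intro j
    simp only [M_eq]
    exact setIntegral_eq_of_subset_of_forall_sdiff_eq_zero measurableSet_Ioc hsub' fun t ht => by
      rw [hout t ht.2, zero_mul]
  have e3 : ∫ t in Ioo 0 P.T, η t * ∫ x in P.Ω,
        P.adjointDensity u y p (fun s => P.b i.succ s.1 * y s) (x, t)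
      = ∫ t in Ioo a b, η t * ∫ x in P.Ω,
        P.adjointDensity u y p (fun s => P.b i.succ s.1 * y s) (x, t) :=
    setIntegral_eq_of_subset_of_forall_sdiff_eq_zero measurableSet_Ioo hsub fun t ht => by
      rw [hout t ht.2, zero_mul]
  rw [e1, e3] at hw
  simp only [e2] at hw
  rw [hw]
  congr 1
  refine Finset.sum_subset (Finset.subset_univ C) fun j _ hj => ?_
  rw [Measure.restrict_eq_zero.2 (hz j hj), integral_zero_measure]

end ControlProblem

/-! ### Essential one-sided limits, and the weak chain rule for cubes. -/

section EssentialLimits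

lemma neBot_nhdsGT_inf_ae (τ : ℝ) : (𝓝[>] τ ⊓ ae volume).NeBot := by
  refine inf_neBot_iff.2 fun s hs s' hs' => ?_
  obtain ⟨a, ha, has⟩ := mem_nhdsGT_iff_exists_Ioo_subset.1 hs
  by_contra hcon
  have h0 : volume (Ioo τ a) = 0 :=
    measure_mono_null (fun x hx hx' => hcon ⟨x, has hx, hx'⟩) (mem_ae_iff.1 hs')
  rw [Real.volume_Ioo, ENNReal.ofReal_eq_zero] at h0
  have := mem_Ioi.1 ha
  linarith

lemma eventually_right_of_ae {a τ : ℝ} (ha : τ < a) {Q : ℝ → Prop}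
    (h : ∀ᵐ t ∂(volume.restrict (Ioo τ a)), Q t) : ∀ᶠ t in 𝓝[>] τ ⊓ ae volume, Q t := by
  have h1 : ∀ᶠ s in ae (volume : Measure ℝ), s ∈ Ioo τ a → Q s :=
    (ae_restrict_iff' measurableSet_Ioo).1 h
  have h2 : ∀ᶠ s in 𝓝[>] τ, s ∈ Ioo τ a := Ioo_mem_nhdsGT ha
  filter_upwards [h1.filter_mono inf_le_right, h2.filter_mono inf_le_left] with s a b using a b

lemma exists_ae_of_eventually_left {τ : ℝ} {Q : ℝ → Prop}
    (h : ∀ᶠ t in 𝓝[<] τ ⊓ ae volume, Q t) :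
    ∃ a < τ, ∀ᵐ t ∂(volume.restrict (Ioo a τ)), Q t := by
  obtain ⟨s, hs, s', hs', hss⟩ := mem_inf_iff_superset.1 h
  obtain ⟨a, ha, has⟩ := mem_nhdsLT_iff_exists_Ioo_subset.1 hs
  refine ⟨a, ha, (ae_restrict_iff' measurableSet_Ioo).2 ?_⟩
  filter_upwards [hs'] with t ht hta using hss ⟨has hta, ht⟩

lemma exists_ae_of_eventually_right {τ : ℝ} {Q : ℝ → Prop}
    (h : ∀ᶠ t in 𝓝[>] τ ⊓ ae volume, Q t) :
    ∃ a > τ, ∀ᵐ t ∂(volume.restrict (Ioo τ a)), Q t := by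
  obtain ⟨s, hs, s', hs', hss⟩ := mem_inf_iff_superset.1 h
  obtain ⟨a, ha, has⟩ := mem_nhdsGT_iff_exists_Ioo_subset.1 hs
  refine ⟨a, ha, (ae_restrict_iff' measurableSet_Ioo).2 ?_⟩
  filter_upwards [hs'] with t ht hta using hss ⟨has hta, ht⟩

/-- Bounds an essential one-sided derivative by difference quotients: a limit above k would keep D
above some k' > k almost everywhere near τ, contradicting the integral bound. -/
lemma essLimit_right_le {τ b l k : ℝ} (hb : τ < b) {D : ℝ → ℝ} (hD : IntegrableOn D (Ioo τ b))
    (hl : Tendsto D (𝓝[>] τ ⊓ ae volume) (𝓝 l))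
    (h : ∀ t ∈ Ioo τ b, ∫ r in τ..t, D r ≤ k * (t - τ)) : l ≤ k := by
  by_contra hlt
  push Not at hlt
  obtain ⟨k', hk1, hk2⟩ := exists_between hlt
  obtain ⟨a, ha, hae⟩ := exists_ae_of_eventually_right (hl.eventually (lt_mem_nhds hk2))
  obtain ⟨t, ht1, ht2⟩ := exists_between (lt_min hb ha)
  have htb := ht2.trans_le (min_le_left _ _)
  have hta := ht2.trans_le (min_le_right _ _)
  have h1 := h t ⟨ht1, htb⟩
  rw [← setIntegral_Ioo_eq_intervalIntegral ht1.le] at h1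
  have h2 : ∫ _r in Ioo τ t, k' ≤ ∫ r in Ioo τ t, D r := by
    refine integral_mono_ae (integrable_const _) (hD.mono_set (Ioo_subset_Ioo_right htb.le)) ?_
    filter_upwards [ae_restrict_of_ae_restrict_of_subset (Ioo_subset_Ioo_right hta.le) hae]
      with r hr using hr.le
  rw [setIntegral_const, smul_eq_mul, Real.volume_real_Ioo_of_le ht1.le] at h2
  nlinarith

lemma essLimit_left_nonneg {τ a l : ℝ} (ha : a < τ) {D : ℝ → ℝ} (hD : IntegrableOn D (Ioo a τ))
    (hl : Tendsto D (𝓝[<] τ ⊓ ae volume) (𝓝 l))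
    (h : ∀ t ∈ Ioo a τ, 0 ≤ ∫ r in t..τ, D r) : 0 ≤ l := by
  by_contra hlt
  push Not at hlt
  obtain ⟨k', hk1, hk2⟩ := exists_between hlt
  obtain ⟨b, hb, hae⟩ := exists_ae_of_eventually_left (hl.eventually (gt_mem_nhds hk1))
  obtain ⟨t, ht1, ht2⟩ := exists_between (max_lt ha hb)
  have hta := (le_max_left _ _).trans_lt ht1
  have htb := (le_max_right _ _).trans_lt ht1
  have h1 := h t ⟨hta, ht2⟩
  rw [← setIntegral_Ioo_eq_intervalIntegral ht2.le] at h1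
  have h2 : ∫ r in Ioo t τ, D r ≤ ∫ _r in Ioo t τ, k' := by
    refine integral_mono_ae (hD.mono_set (Ioo_subset_Ioo_left hta.le)) (integrable_const _) ?_
    filter_upwards [ae_restrict_of_ae_restrict_of_subset (Ioo_subset_Ioo_left htb.le) hae]
      with r hr using hr.le
  rw [setIntegral_const, smul_eq_mul, Real.volume_real_Ioo_of_le ht2.le] at h2
  nlinarith

/-- The Leibniz rule for primitives is applied twice, first to the square and then to the square
times the function. -/
lemma primitive_cube_weak {T : ℝ} (hT : 0 ≤ T) {f : ℝ → ℝ} (hf : IntegrableOn f (Ioo 0 T)) (a : ℝ)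
    {ψ : ℝ → ℝ} (hψ : IsTestFunction (Ioo 0 T) ψ) :
    ∫ t in Ioo 0 T, (a + ∫ s in (0 : ℝ)..t, f s) ^ 3 * fderiv ℝ ψ t 1
      = - ∫ t in Ioo 0 T, 3 * ((a + ∫ s in (0 : ℝ)..t, f s) ^ 2 * f t) * ψ t := by
  set Y : ℝ → ℝ := fun t => a + ∫ s in (0 : ℝ)..t, f s with hY
  set f2 : ℝ → ℝ := fun t => f t * Y t + Y t * f t with hf2
  have hYf : IntegrableOn (fun t => Y t * f t) (Ioo 0 T) := integrableOn_primitive_mul hT hf hf a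
  have hf2i : IntegrableOn f2 (Ioo 0 T) := by
    refine (hYf.add hYf).congr (Eventually.of_forall fun t => ?_)
    simp only [hf2, Pi.add_apply]
    ring
  have h2 : ∀ t ∈ Icc 0 T, Y t * Y t = a * a + ∫ s in (0 : ℝ)..t, f2 s :=
    fun t ht => primitive_mul_primitive hT hf hf a a ht
  set f3 : ℝ → ℝ := fun t => f2 t * Y t + (a * a + ∫ s in (0 : ℝ)..t, f2 s) * f t with hf3
  have h3 : ∀ t ∈ Icc 0 T, (a * a + ∫ s in (0 : ℝ)..t, f2 s) * Y t
      = a * a * a + ∫ s in (0 : ℝ)..t, f3 s :=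
    fun t ht => primitive_mul_primitive hT hf2i hf (a * a) a ht
  have hf3i : IntegrableOn f3 (Ioo 0 T) := by
    refine ((integrableOn_primitive_mul hT hf hf2i a).add
      (integrableOn_primitive_mul hT hf2i hf (a * a))).congr (Eventually.of_forall fun t => ?_)
    simp only [hf3, Pi.add_apply, hY]
    ring
  have hw := primitive_weak hf3i (a * a * a) hT hψ
  rw [setIntegral_congr_fun measurableSet_Ioo (fun t ht => ?_), hw, neg_inj]
  · refine setIntegral_congr_fun measurableSet_Ioo fun t ht => ?_
    simp only [hf3]
    rw [← h2 t (Ioo_subset_Icc_self ht)]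
    simp only [hf2]
    ring
  · rw [← h3 t (Ioo_subset_Icc_self ht), ← h2 t (Ioo_subset_Icc_self ht)]
    simp only [hY]
    ring

end EssentialLimits

/-! ### Time derivatives of the state constraints. -/

section Pairings

variable {n : ℕ} {Ω : Set (Space n)} {T : ℝ} {Z : Space n × ℝ → ℝ}

lemma MemY.pairing_sub_eq (hΩ : IsOpen Ω) (hT : 0 < T) (h : MemY Ω T Z) {c : Space n → ℝ}
    (hc : MemLp c 2 (volume.restrict Ω)) {s t : ℝ} (hs : 0 ≤ s) (hst : s ≤ t) (ht : t ≤ T) :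
    (∫ x in Ω, c x * Z (x, t)) - ∫ x in Ω, c x * Z (x, s)
      = ∫ r in s..t, ∫ x in Ω, c x * dt Ω T Z (x, r) := by
  have hi := integrable_mul_of_memLp_two (memLp_two_fst (T := T) hc) (h.memLp_dt hΩ)
  rw [cyl_measure] at hi
  have hi' : Integrable (fun z : Space n × ℝ => c z.1 * dt Ω T Z z)
      ((volume.restrict Ω).prod (volume.restrict (Ioo s t))) :=
    hi.mono_measure (Measure.prod_mono le_rfl
      (Measure.restrict_mono (Ioo_subset_Ioo hs ht) le_rfl))
  rw [← integral_sub (integrable_mul_of_memLp_two hc (h.slice_memLp t ⟨hs.trans hst, ht⟩))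
    (integrable_mul_of_memLp_two hc (h.slice_memLp s ⟨hs, hst.trans ht⟩)),
    ← setIntegral_Ioo_eq_intervalIntegral hst,
    ← integral_integral_swap (f := fun x r => c x * dt Ω T Z (x, r)) hi']
  refine integral_congr_ae ?_
  filter_upwards [h.sub_eq_integral_dt hΩ hT hs hst ht] with x hx
  rw [← mul_sub, hx, integral_const_mul, setIntegral_Ioo_eq_intervalIntegral hst]

/-- Green's second formula; both functions vanish on the boundary, so no boundary terms appear. -/
lemma MemY.integral_mul_lap (hΩ : IsOpen Ω) (h : MemY Ω T Z) {c : Space n → ℝ}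
    (hc2 : MemW Ω 2 2 c) (hc : MemH10 Ω c) : ∀ᵐ t ∂(volume.restrict (Ioo 0 T)),
      ∫ x in Ω, c x * lap Ω T Z (x, t) = ∫ x in Ω, lapSpace Ω c x * Z (x, t) := by
  have h1 : ∀ i, ∀ᵐ t ∂(volume.restrict (Ioo 0 T)), ∀ φ, IsTestFunction Ω φ →
      ∫ x in Ω, dx Ω T i Z (x, t) * fderiv ℝ φ x (unitVec i)
        = - ∫ x in Ω, dx Ω T i (dx Ω T i Z) (x, t) * φ x :=
    fun i => (h.hasWeakDeriv_dx_dx hΩ i i).ae_slice (h.memLp_dx hΩ i) (h.memLp_dx_dx hΩ i i)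
  have h2 : ∀ i, ∀ᵐ t ∂(volume.restrict (Ioo 0 T)),
      MemLp (fun x => dx Ω T i (dx Ω T i Z) (x, t)) 2 (volume.restrict Ω) :=
    fun i => memLp_slice_time (h.memLp_dx_dx hΩ i i)
  filter_upwards [ae_all_iff.2 h1, ae_all_iff.2 h2, h.ae_pair hΩ] with t h1 h2 h3
  have hcp := hc.pair hΩ
  have hcd : ∀ i, MemLp (wderiv Ω (unitVec i) (wderiv Ω (unitVec i) c)) 2 (volume.restrict Ω) :=
    fun i => ((hc2.wderiv hΩ i).wderiv hΩ i).memLp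
  have e1 : ∀ i, ∫ x in Ω, dx Ω T i (dx Ω T i Z) (x, t) * c x
      = ∫ x in Ω, wderiv Ω (unitVec i) (wderiv Ω (unitVec i) c) x * Z (x, t) := fun i => by
    have a1 := hcp.integral_by_parts (h3.memLp_deriv i) (h2 i) (h1 i)
    have a2 := h3.integral_by_parts (hcp.memLp_deriv i) (hcd i)
      ((hc2.wderiv hΩ i).hasWeakDeriv i).2.2
    have a3 : ∫ x in Ω, dx Ω T i Z (x, t) * wderiv Ω (unitVec i) c x
        = ∫ x in Ω, wderiv Ω (unitVec i) c x * dx Ω T i Z (x, t) := by simp only [mul_comm]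
    linarith
  have e2 : ∀ x, c x * lap Ω T Z (x, t) = ∑ i, dx Ω T i (dx Ω T i Z) (x, t) * c x := fun x => by
    rw [lap, Finset.mul_sum]
    exact Finset.sum_congr rfl fun i _ => mul_comm _ _
  simp only [e2, lapSpace, Finset.sum_mul]
  rw [integral_finsetSum _ fun i _ => integrable_mul_of_memLp_two (h2 i) hcp.memLp,
    integral_finsetSum _ fun i _ => integrable_mul_of_memLp_two (hcd i) h3.memLp]
  exact Finset.sum_congr rfl fun i _ => e1 i

end Pairings

namespace ControlProblem

variable {n m q : ℕ} {P : ControlProblem n m q} {u : Fin m → ℝ → ℝ} {y p Z : Space n × ℝ → ℝ}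
  {μ : Fin q → StieltjesFunction ℝ}

/-- The pairing of `γ y³` with a function in `L²(Ω) ∩ L⁶(Ω)` is continuous in time. -/
lemma exists_continuous_cube_pairing (hP : P.Basic) (hu : P.IsAdmissibleControl u)
    (hst : P.IsState u y) {c : Space n → ℝ} (hc : MemLp c 2 (volume.restrict P.Ω))
    (hc6 : MemLp c 6 (volume.restrict P.Ω)) :
    ∃ k : ℝ → ℝ, ContinuousOn k (Icc 0 P.T) ∧
      ∀ᵐ t ∂P.timeMeasure, ∫ x in P.Ω, c x * (P.γ * y (x, t) ^ 3) = k t := by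
  have hΩ := hP.isOpen
  have hT := hP.T_pos
  have hc1 := memLp_two_fst (T := P.T) hc
  have hcube := memLp_cube hP hu hst
  have hdt := hst.1.memLp_dt hΩ
  -- The inequality a b² ≤ a³ + b³ with a = c² and b = y² bounds c² y⁴ by c⁶ + y⁶, so the L⁶ bound
  -- on c and the square integrability of γ y³ suffice. Then 3 γ c y² ∂_t y is integrable and is the
  -- weak derivative of the pairing.
  have hcy : MemLp (fun s : Space n × ℝ => P.γ * (c s.1 * y s ^ 2)) 2 P.cylMeasure := by
    have hm : AEStronglyMeasurable (fun s : Space n × ℝ => P.γ * (c s.1 * y s ^ 2)) P.cylMeasure :=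
      ((hc1.1.mul (hst.1.memLp.1.pow 2)).const_mul P.γ)
    refine (memLp_two_iff_integrable_sq hm).2 ?_
    have hc3 := (memLp_two_fst (T := P.T) (MemLp.cube_of_six hc6)).integrable_sq
    refine ((hc3.const_mul (P.γ ^ 2)).add hcube.integrable_sq).mono' (hm.pow 2)
      (Eventually.of_forall fun s => ?_)
    have key : ∀ a b : ℝ, 0 ≤ a → 0 ≤ b → a * b ^ 2 ≤ a ^ 3 + b ^ 3 := by
      intro a b ha hb
      rcases le_total a b with h | h
      · nlinarith [mul_le_mul_of_nonneg_right h (sq_nonneg b), pow_nonneg ha 3]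
      · have := mul_le_mul_of_nonneg_left (pow_le_pow_left₀ hb h 2) ha
        nlinarith [pow_nonneg hb 3]
    have h1 := mul_le_mul_of_nonneg_left (key (c s.1 ^ 2) (y s ^ 2) (sq_nonneg _) (sq_nonneg _))
      (sq_nonneg P.γ)
    simp only [Pi.add_apply]
    rw [Real.norm_of_nonneg (sq_nonneg _)]
    calc _ = P.γ ^ 2 * (c s.1 ^ 2 * (y s ^ 2) ^ 2) := by ring
      _ ≤ _ := h1
      _ = _ := by ring
  have hK := (integrable_mul_of_memLp_two hcy hdt).const_mul 3
  have hH := integrable_mul_of_memLp_two hc1 hcube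
  have hHi := integrable_integral_slice hH
  have hKi := integrable_integral_slice hK
  have hwd : HasWeakDeriv (Ioo 0 P.T) (1 : ℝ) (fun t => ∫ x in P.Ω, c x * (P.γ * y (x, t) ^ 3))
      (fun t => ∫ x in P.Ω, 3 * (P.γ * (c x * y (x, t) ^ 2) * dt P.Ω P.T y (x, t))) := by
    refine ⟨hHi.locallyIntegrableOn, hKi.locallyIntegrableOn, fun ψ hψ => ?_⟩
    obtain ⟨C1, hC1⟩ := (hψ.fderiv_apply 1).exists_bound
    obtain ⟨C2, hC2⟩ := hψ.exists_bound
    have b1 := memLp_top_snd (Ω := P.Ω) ((hψ.fderiv_apply 1).memLp (ν := P.timeMeasure) ⊤)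
    have b2 := memLp_top_snd (Ω := P.Ω) (hψ.memLp (ν := P.timeMeasure) ⊤)
    have j1 : Integrable (fun s : Space n × ℝ => c s.1 * (P.γ * y s ^ 3) * fderiv ℝ ψ s.2 1)
        P.cylMeasure := by
      refine (integrable_mul_of_memLp_two hc1 (memLp_bounded_mul b1 hcube)).congr
        (Eventually.of_forall fun s => ?_)
      simp only
      ring
    have j2 : Integrable (fun s : Space n × ℝ => 3 * (P.γ * (c s.1 * y s ^ 2)
        * dt P.Ω P.T y s) * ψ s.2) P.cylMeasure := by
      refine ((integrable_mul_of_memLp_two hcy (memLp_bounded_mul b2 hdt)).const_mul 3).congr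
        (Eventually.of_forall fun s => ?_)
      simp only
      ring
    have e1 := integral_cyl j1
    have e2 := integral_cyl j2
    rw [integral_cyl' j1] at e1
    rw [integral_cyl' j2] at e2
    simp only [integral_mul_const] at e1 e2
    rw [← e1, ← e2, ← integral_neg]
    refine integral_congr_ae ?_
    filter_upwards [hst.1.ae_eq_primitive hΩ hT, hst.1.ae_integrableOn_dt hΩ] with x h1 h2
    have h3 := primitive_cube_weak hT.le h2 (y (x, 0)) hψ
    have h4 : ∫ t in Ioo 0 P.T, c x * (P.γ * y (x, t) ^ 3) * fderiv ℝ ψ t 1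
        = c x * P.γ * ∫ t in Ioo 0 P.T, (y (x, 0) + ∫ s in (0 : ℝ)..t, dt P.Ω P.T y (x, s)) ^ 3
          * fderiv ℝ ψ t 1 := by
      rw [← integral_const_mul]
      refine integral_congr_ae ?_
      filter_upwards [h1] with t ht
      rw [← ht]
      ring
    have h5 : ∫ t in Ioo 0 P.T, 3 * (P.γ * (c x * y (x, t) ^ 2) * dt P.Ω P.T y (x, t)) * ψ t
        = c x * P.γ * ∫ t in Ioo 0 P.T, 3 * ((y (x, 0) + ∫ s in (0 : ℝ)..t,
          dt P.Ω P.T y (x, s)) ^ 2 * dt P.Ω P.T y (x, t)) * ψ t := by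
      rw [← integral_const_mul]
      refine integral_congr_ae ?_
      filter_upwards [h1] with t ht
      rw [← ht]
      ring
    rw [h4, h5, h3]
    ring
  obtain ⟨a, ha⟩ := hwd.exists_ae_eq_primitive hT hKi
  exact ⟨_, continuousOn_const.add (continuousOn_primitive_Ioo hT.le hKi), ha⟩

/-- The time derivative of a state constraint along the nominal trajectory. -/
lemma exists_constraint_deriv (hn3 : n ≤ 3) (hP : P.Basic) (hu : P.IsAdmissibleControl u)
    (hst : P.IsState u y) (j : Fin q) :
    ∃ ρ : ℝ → ℝ, ContinuousOn ρ (Icc 0 P.T) ∧ ∀ᵐ t ∂P.timeMeasure,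
      ∫ x in P.Ω, P.c j x * dt P.Ω P.T y (x, t)
        = ρ t + (∫ x in P.Ω, P.c j x * P.f (x, t)) + ∑ i, u i t * P.M y i j t := by
  have hΩ := hP.isOpen
  obtain ⟨hc2, hc0⟩ := hP.c_mem j
  have hc := hc2.memLp
  have hcp := hc0.pair hΩ
  obtain ⟨k, hk, hka⟩ := exists_continuous_cube_pairing hP hu hst hc (hcp.memLp_six hn3)
  have hlapc : MemLp (lapSpace P.Ω (P.c j)) 2 (volume.restrict P.Ω) :=
    memLp_finsetSum _ fun i _ => ((hc2.wderiv hΩ i).wderiv hΩ i).memLp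
  have hcb : ∀ i, MemLp (fun x => P.b i x * P.c j x) 2 (volume.restrict P.Ω) := fun i =>
    memLp_bounded_mul (hP.b_mem i).memLp hc
  -- ρ collects the terms that are continuous in time: the Laplacian moved onto c_j, the cubic term
  -- and the potential b_0. The terms with f and with the controls remain separate.
  refine ⟨fun t => (∫ x in P.Ω, lapSpace P.Ω (P.c j) x * y (x, t)) - k t
    + ∫ x in P.Ω, P.b 0 x * P.c j x * y (x, t), ?_, ?_⟩
  · exact ((hst.1.continuousOn_pairing hlapc).sub hk).add (hst.1.continuousOn_pairing (hcb 0))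
  filter_upwards [hka, hst.1.integral_mul_lap hΩ hc2 hc0, ae_slice_time hst.2.1,
    memLp_slice_time hst.1.memLp, memLp_slice_time (hst.1.memLp_lap hΩ),
    memLp_slice_time (memLp_cube hP hu hst), memLp_slice_time hP.f_mem] with t h1 h2 h3 m1 m2 m3 m4
  rw [← h1, ← h2]
  have i1 := integrable_mul_of_memLp_two hc m2
  have i2 := integrable_mul_of_memLp_two hc m3
  have i3 := integrable_mul_of_memLp_two (hcb 0) m1
  have i4 := integrable_mul_of_memLp_two hc m4
  have i5 : ∀ i : Fin m, Integrable (fun x => u i t * (P.b i.succ x * P.c j x * y (x, t)))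
      (volume.restrict P.Ω) := fun i => (integrable_mul_of_memLp_two (hcb i.succ) m1).const_mul _
  have j1 := i1.sub i2
  have j2 := j1.add i3
  have j3 := j2.add i4
  simp only [M, ← integral_const_mul]
  rw [← integral_finsetSum _ fun i _ => i5 i, ← integral_sub i1 i2]
  erw [← integral_add j1 i3, ← integral_add j2 i4,
    ← integral_add j3 (integrable_finsetSum _ fun i _ => i5 i)]
  refine integral_congr_ae ?_
  filter_upwards [h3] with x hx
  rw [potential] at hx
  have h6 : ∑ i : Fin m, u i t * (P.b i.succ x * P.c j x * y (x, t))
      = P.c j x * (y (x, t) * ∑ i : Fin m, u i t * P.b i.succ x) := by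
    rw [Finset.mul_sum, Finset.mul_sum]
    exact Finset.sum_congr rfl fun i _ => by ring
  simp only [Pi.add_apply, Pi.sub_apply]
  rw [h6]
  linear_combination P.c j x * hx

end ControlProblem

/-! ### The multipliers have no atoms at interior junction points. -/

/-- The algebra behind the continuity of the multipliers at junction points. -/
lemma jumps_eq_zero {ι κ : Type*} [Fintype ι] [Fintype κ] {ν Dl Dr : κ → ℝ} {dψ du : ι → ℝ}
    {M : ι → κ → ℝ} {C : Finset κ} {I : Finset ι} (hν : ∀ j, 0 ≤ ν j)
    (hψ : ∀ i, dψ i = ∑ j, M i j * ν j) (hneg : ∀ i, dψ i * du i ≤ 0)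
    (hD : ∀ j, Dl j - Dr j = ∑ i, M i j * du i)
    (hpos : ∀ j, 0 < ν j → 0 ≤ Dl j ∧ Dr j ≤ 0 ∧ (j ∉ C → Dr j < 0))
    (hI : ∀ i ∈ I, du i = 0 → dψ i = 0)
    (hinj : ∀ l : κ → ℝ, (∀ i ∈ I, ∑ j ∈ C, M i j * l j = 0) → ∀ j ∈ C, l j = 0) :
    ∀ j, ν j = 0 := by
  have hterm : ∀ j, 0 ≤ ν j * (Dl j - Dr j) := fun j => by
    rcases (hν j).eq_or_lt with h | h
    · rw [← h, zero_mul]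
    · obtain ⟨h1, h2, -⟩ := hpos j h
      exact mul_nonneg (hν j) (by linarith)
  -- Both sides equal the double sum of ν_j M_ij du_i. The left side has nonnegative terms, the
  -- right side nonpositive ones, so every single term is zero.
  have hsum : ∑ j, ν j * (Dl j - Dr j) = ∑ i, dψ i * du i := by
    simp only [hD, hψ, Finset.mul_sum, Finset.sum_mul]
    rw [Finset.sum_comm]
    exact Finset.sum_congr rfl fun i _ => Finset.sum_congr rfl fun j _ => by ring
  have h0 : ∑ i, dψ i * du i = 0 :=
    le_antisymm (Finset.sum_nonpos fun i _ => hneg i)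
      (hsum ▸ Finset.sum_nonneg fun j _ => hterm j)
  have h1 : ∀ j, ν j * (Dl j - Dr j) = 0 := fun j =>
    (Finset.sum_eq_zero_iff_of_nonneg fun j _ => hterm j).1 (hsum.trans h0) j (Finset.mem_univ j)
  have h2 : ∀ i, dψ i * du i = 0 := fun i =>
    (Finset.sum_eq_zero_iff_of_nonpos fun i _ => hneg i).1 h0 i (Finset.mem_univ i)
  -- A constraint that is charged at the junction but inactive afterwards would leave with strictly
  -- negative slope, making its term positive.
  have h3 : ∀ j, j ∉ C → ν j = 0 := fun j hj => by
    rcases (hν j).eq_or_lt with h | h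
    · exact h.symm
    · obtain ⟨g1, -, g3⟩ := hpos j h
      rcases mul_eq_zero.1 (h1 j) with g | g
      · exact g
      · linarith [g3 hj]
  -- Only the constraints in C remain. For a control in I either its jump is nonzero, so that dψ = 0
  -- by the vanishing product, or it is zero and dψ = 0 by hypothesis; thus ν lies in the kernel of
  -- M.
  have h4 : ∀ j ∈ C, ν j = 0 := hinj ν fun i hi => by
    rw [Finset.sum_subset (Finset.subset_univ C) fun j _ hj => by rw [h3 j hj, mul_zero], ← hψ]
    rcases mul_eq_zero.1 (h2 i) with g | g
    · exact g
    · exact hI i hi g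
  intro j
  by_cases hj : j ∈ C
  · exact h4 j hj
  · exact h3 j hj

namespace ControlProblem

variable {n m q : ℕ} {P : ControlProblem n m q} {u : Fin m → ℝ → ℝ} {y p Z : Space n × ℝ → ℝ}
  {μ : Fin q → StieltjesFunction ℝ}

/-- One-sided limits of the switching function. -/
lemma IsMultiplier.switching_limits (hP : P.Basic) (huy : P.IsAdmissibleTrajectory u y)
    (hb : ∀ i, MemW P.Ω ∞ 2 (P.b i)) (hΛ : P.IsMultiplier u y p μ) {τ : ℝ} (hτ : τ ∈ Ioo 0 P.T)
    (i : Fin m) : ∃ l r, Tendsto (P.switching y p i) (𝓝[<] τ ⊓ ae volume) (𝓝 l) ∧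
      Tendsto (P.switching y p i) (𝓝[>] τ ⊓ ae volume) (𝓝 r) ∧
      l - r = ∑ j, P.M y i j τ * (μ j).measure.real {τ} := by
  have hu := huy.1
  have hst := huy.2.1
  have hdir : P.IsDirection y (fun s => P.b i.succ s.1 * y s) :=
    (isDirection_state hP hu hst).mul_fst hP (hb i.succ)
  have hG := integrable_integral_slice
    (integrable_adjointDensity hP hu hst hΛ.costate.1.memLp hdir)
  have hm := fun j => integrableOn_constraintPairing (μ := μ) hP hdir.memY j
  have hform : ∀ᵐ s ∂P.timeMeasure, P.switching y p i s = P.α i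
      + (P.finalPairing y (fun s => P.b i.succ s.1 * y s)
        + (∑ j, ∫ t in Icc s P.T, (∫ x in P.Ω, P.c j x * (P.b i.succ x * y (x, t))) ∂(μ j).measure)
        + ∫ t in s..P.T, ∫ x in P.Ω,
          P.adjointDensity u y p (fun s => P.b i.succ s.1 * y s) (x, t)) := by
    filter_upwards [costate_pairing_ae hP hu hst hΛ.costate hdir] with s hs
    rw [← hs, switching]
    congr 1
    exact integral_congr_ae (Eventually.of_forall fun x => by simp only; ring)
  have hcont := (continuousOn_tail_interval hP.T_pos.le hG).continuousAt (Icc_mem_nhds hτ.1 hτ.2)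
  have hfl := eventually_left_of_ae hτ.1
    (ae_restrict_of_ae_restrict_of_subset (Ioo_subset_Ioo_right hτ.2.le) hform)
  have hfr := eventually_right_of_ae hτ.2
    (ae_restrict_of_ae_restrict_of_subset (Ioo_subset_Ioo_left hτ.1.le) hform)
  refine ⟨_, _, Tendsto.congr' (hfl.mono fun s hs => hs.symm) (Tendsto.mono_left
    (((tendsto_const_nhds.add (tendsto_finsetSum Finset.univ fun j _ =>
      tendsto_tail_left (hm j) hτ.1)).add (hcont.mono_left nhdsWithin_le_nhds)).const_add _)
    inf_le_left), Tendsto.congr' (hfr.mono fun s hs => hs.symm) (Tendsto.mono_left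
    (((tendsto_const_nhds.add (tendsto_finsetSum Finset.univ fun j _ =>
      tendsto_tail_right (hm j) hτ.1.le)).add (hcont.mono_left nhdsWithin_le_nhds)).const_add _)
    inf_le_left), ?_⟩
  -- The tails over [τ,T] and (τ,T] differ by the atom at τ, weighted by M_ij(τ).
  have h1 : ∀ j, (∫ t in Icc τ P.T, (∫ x in P.Ω, P.c j x * (P.b i.succ x * y (x, t)))
        ∂(μ j).measure)
      = P.M y i j τ * (μ j).measure.real {τ}
        + ∫ t in Ioc τ P.T, (∫ x in P.Ω, P.c j x * (P.b i.succ x * y (x, t))) ∂(μ j).measure := by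
    intro j
    have hsub : Ioc τ P.T ⊆ Ioc 0 P.T := Ioc_subset_Ioc_left hτ.1.le
    rw [← Ioc_union_left hτ.2.le, union_comm, setIntegral_union (by
      rw [disjoint_singleton_left]
      exact fun h => lt_irrefl _ h.1) measurableSet_Ioc
      ((hm j).mono_set (singleton_subset_iff.2 ⟨hτ.1, hτ.2.le⟩)) ((hm j).mono_set hsub),
      integral_singleton, smul_eq_mul, M_eq, mul_comm]
  simp only [h1, Finset.sum_add_distrib]
  ring

/-- The multipliers have no atom at a junction point. -/
lemma IsMultiplier.measure_singleton_eq_zero (hn3 : n ≤ 3) (hP : P.Basic)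
    (huy : P.IsAdmissibleTrajectory u y) (hyp : P.Hypotheses u y) (hΛ : P.IsMultiplier u y p μ)
    {τ τ' : ℝ} (hτ0 : 0 < τ) (hττ' : τ < τ') (hτT : τ' ≤ P.T)
    {C : Finset (Fin q)} {I : Finset (Fin m)}
    (hI : ∀ i ∈ I, ∀ᵐ t ∂(volume.restrict (Ioo τ τ')), u i t ≠ P.lo i ∧ u i t ≠ P.hi i)
    (hC : ∀ j, ∀ t ∈ Ioo τ τ', P.g j y t = 0 ↔ j ∈ C)
    (hinj : ∀ l : Fin q → ℝ, (∀ i ∈ I, ∑ j ∈ C, P.M y i j τ * l j = 0) → ∀ j ∈ C, l j = 0)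
    (hul : ∀ i, ∃ l, Tendsto (u i) (𝓝[<] τ ⊓ ae volume) (𝓝 l))
    (hur : ∀ i, ∃ l, Tendsto (u i) (𝓝[>] τ ⊓ ae volume) (𝓝 l))
    (hf : ∀ j, ∃ l, Tendsto (fun t => ∫ x in P.Ω, P.c j x * P.f (x, t))
      (𝓝 τ ⊓ ae volume) (𝓝 l)) (j : Fin q) :
    (μ j).measure {τ} = 0 := by
  have hΩ := hP.isOpen
  have hT := hP.T_pos
  have hu := huy.1
  have hst := huy.2.1
  have hb := hyp.b_regular
  have hτ : τ ∈ Ioo 0 P.T := ⟨hτ0, hττ'.trans_le hτT⟩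
  have hτm := Ioo_subset_Icc_self hτ
  have hsubl : Ioo 0 τ ⊆ Ioo 0 P.T := Ioo_subset_Ioo_right hτ.2.le
  have hsubr : Ioo τ τ' ⊆ Ioo 0 P.T := Ioo_subset_Ioo hτ.1.le hτT
  have hnl := neBot_nhdsLT_inf_ae τ
  have hnr := neBot_nhdsGT_inf_ae τ
  choose ul hul using hul
  choose ur hur using hur
  choose fl hfl using hf
  choose ψl ψr hψl hψr hψ using fun i => hΛ.switching_limits hP huy hb hτ i
  choose ρ hρ hρa using fun j => exists_constraint_deriv hn3 hP hu hst j
  have hMc := fun i j => (continuousOn_M hP hst hb i j).continuousAt (Icc_mem_nhds hτ.1 hτ.2)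
  have hρc := fun j => (hρ j).continuousAt (Icc_mem_nhds hτ.1 hτ.2)
  have hDl : ∀ j, Tendsto (fun t => ∫ x in P.Ω, P.c j x * dt P.Ω P.T y (x, t))
      (𝓝[<] τ ⊓ ae volume) (𝓝 (ρ j τ + fl j + ∑ i, ul i * P.M y i j τ)) := fun j => by
    have h1 := eventually_left_of_ae hτ.1
      (ae_restrict_of_ae_restrict_of_subset hsubl (hρa j))
    refine Tendsto.congr' (h1.mono fun t ht => ht.symm) ?_
    have hle : 𝓝[<] τ ⊓ ae volume ≤ 𝓝 τ := inf_le_left.trans nhdsWithin_le_nhds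
    exact (((hρc j).mono_left hle).add ((hfl j).mono_left
      (inf_le_inf_right _ nhdsWithin_le_nhds))).add (tendsto_finsetSum _ fun i _ =>
        (hul i).mul ((hMc i j).mono_left hle))
  have hDr : ∀ j, Tendsto (fun t => ∫ x in P.Ω, P.c j x * dt P.Ω P.T y (x, t))
      (𝓝[>] τ ⊓ ae volume) (𝓝 (ρ j τ + fl j + ∑ i, ur i * P.M y i j τ)) := fun j => by
    have h1 := eventually_right_of_ae hττ'
      (ae_restrict_of_ae_restrict_of_subset hsubr (hρa j))
    refine Tendsto.congr' (h1.mono fun t ht => ht.symm) ?_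
    have hle : 𝓝[>] τ ⊓ ae volume ≤ 𝓝 τ := inf_le_left.trans nhdsWithin_le_nhds
    exact (((hρc j).mono_left hle).add ((hfl j).mono_left
      (inf_le_inf_right _ nhdsWithin_le_nhds))).add (tendsto_finsetSum _ fun i _ =>
        (hur i).mul ((hMc i j).mono_left hle))
  have hDi : ∀ j, IntegrableOn (fun t => ∫ x in P.Ω, P.c j x * dt P.Ω P.T y (x, t)) (Ioo 0 P.T) :=
    fun j => integrable_integral_slice (integrable_mul_of_memLp_two
      (memLp_two_fst (T := P.T) (hP.c_mem j).1.memLp) (hst.1.memLp_dt hΩ))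
  have hgsub : ∀ j, ∀ {s t : ℝ}, 0 ≤ s → s ≤ t → t ≤ P.T → P.g j y t - P.g j y s
      = ∫ r in s..t, ∫ x in P.Ω, P.c j x * dt P.Ω P.T y (x, r) := fun j s t h1 h2 h3 => by
    rw [← hst.1.pairing_sub_eq hΩ hT (hP.c_mem j).1.memLp h1 h2 h3, g, g]
    ring
  -- The minimum condition before τ is tested with the control limit from after τ, and conversely;
  -- adding the two gives that the jumps of Ψ_i and u_i have a nonpositive product.
  have hmulS : ∀ i, 0 ≤ (ψl i) * (ur i - ul i) ∧ 0 ≤ ψr i * (ul i - ur i) := by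
    intro i
    have hae := hΛ.switching_mul_nonneg hP hu i
    have hel := eventually_left_of_ae hτ.1 (ae_restrict_of_ae_restrict_of_subset hsubl hae)
    have her := eventually_right_of_ae hττ' (ae_restrict_of_ae_restrict_of_subset hsubr hae)
    have hbl := eventually_left_of_ae hτ.1 (ae_restrict_of_ae_restrict_of_subset hsubl (hu i).2)
    have hbr := eventually_right_of_ae hττ' (ae_restrict_of_ae_restrict_of_subset hsubr (hu i).2)
    have hulm : ul i ∈ Icc (P.lo i) (P.hi i) := isClosed_Icc.mem_of_tendsto (hul i) hbl
    have hurm : ur i ∈ Icc (P.lo i) (P.hi i) := isClosed_Icc.mem_of_tendsto (hur i) hbr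
    exact ⟨ge_of_tendsto ((hψl i).mul ((hul i).const_sub (ur i))) (hel.mono fun t ht => ht _ hurm),
      ge_of_tendsto ((hψr i).mul ((hur i).const_sub (ul i))) (her.mono fun t ht => ht _ hulm)⟩
  obtain ⟨a, ha, hsharp⟩ := hyp.sharp
  obtain ⟨δ, hδ, haway⟩ := hyp.away
  have hfin : ∀ j, (μ j).measure {τ} ≠ ⊤ := fun j => by
    rw [StieltjesFunction.measure_singleton]
    exact ENNReal.ofReal_ne_top
  have hmain := jumps_eq_zero (ν := fun j => (μ j).measure.real {τ})
    (Dl := fun j => ρ j τ + fl j + ∑ i, ul i * P.M y i j τ)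
    (Dr := fun j => ρ j τ + fl j + ∑ i, ur i * P.M y i j τ)
    (dψ := fun i => ψl i - ψr i) (du := fun i => ul i - ur i) (M := fun i j => P.M y i j τ)
    (C := C) (I := I) (fun j => measureReal_nonneg) hψ ?_ ?_ ?_ ?_ hinj
  · have := hmain j
    rwa [measureReal_eq_zero_iff (hfin j)] at this
  · intro i
    obtain ⟨h1, h2⟩ := hmulS i
    nlinarith
  · intro j
    have : ∑ i, P.M y i j τ * (ul i - ur i)
        = (∑ i, ul i * P.M y i j τ) - ∑ i, ur i * P.M y i j τ := by
      rw [← Finset.sum_sub_distrib]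
      exact Finset.sum_congr rfl fun i _ => by ring
    rw [this]
    ring
  -- A positive atom forces g_j(τ) = 0 by complementarity. As g_j ≤ 0, the point τ is a maximum: the
  -- derivative is nonnegative from the left and nonpositive from the right.
  · intro j hj
    have hg0 : P.g j y τ = 0 := by
      by_contra hg
      have := hΛ.measure_eq_zero hP huy j (A := {τ})
        (singleton_subset_iff.2 ⟨hτ.1, hτ.2.le⟩) (fun t ht => by rwa [mem_singleton_iff.1 ht])
      rw [measureReal_def, this, ENNReal.toReal_zero] at hj
      exact lt_irrefl _ hj
    refine ⟨?_, ?_, fun hjC => ?_⟩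
    · refine essLimit_left_nonneg hτ.1 ((hDi j).mono_set hsubl) (hDl j) fun t ht => ?_
      rw [← hgsub j ht.1.le ht.2.le hτm.2, hg0, zero_sub, neg_nonneg]
      exact huy.2.2 j t ⟨ht.1.le, ht.2.le.trans hτm.2⟩
    · refine essLimit_right_le (k := 0) hττ' ((hDi j).mono_set hsubr) (hDr j) fun t ht => ?_
      rw [← hgsub j hτm.1 ht.1.le (ht.2.le.trans hτT), hg0, sub_zero, zero_mul]
      exact huy.2.2 j t ⟨hτm.1.trans ht.1.le, ht.2.le.trans hτT⟩
    -- There is no contact inside (τ,τ'), so up to the midpoint τ is a nearest contact point.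
    -- Sharpness then gives g_j(t) ≤ -a (t - τ), hence slope at most -a.
    · have hmid : τ < (τ + τ') / 2 := by linarith
      have hsub : Ioo τ ((τ + τ') / 2) ⊆ Ioo τ τ' := Ioo_subset_Ioo_right (by linarith)
      have hlim := essLimit_right_le (k := -a) hmid ((hDi j).mono_set (hsub.trans hsubr)) (hDr j)
        fun t ht => by
          have htm : t ∈ Icc 0 P.T := Ioo_subset_Icc_self (hsubr (hsub ht))
          rw [← hgsub j hτm.1 ht.1.le htm.2, hg0, sub_zero]
          refine (hsharp j t htm).trans ?_
          have hne : (P.contactSet y j).Nonempty := ⟨τ, hτm, hg0⟩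
          have hd : t - τ ≤ Metric.infDist t (P.contactSet y j) := by
            refine (Metric.le_infDist hne).2 fun s hs => ?_
            have hs' : s ∉ Ioo τ τ' := fun h' => hjC ((hC j s h').1 hs.2)
            rw [Real.dist_eq]
            rcases le_or_gt s τ with h | h
            · exact (by linarith : t - τ ≤ t - s).trans (le_abs_self _)
            · have h2 : τ' ≤ s := by
                by_contra h3
                exact hs' ⟨h, not_le.1 h3⟩
              have := ht.2
              exact (by linarith : t - τ ≤ -(t - s)).trans (neg_le_abs _)
          nlinarith
      linarith
  -- After τ the control stays at distance δ from its bounds, and so does its right limit. If u_i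
  -- does not jump, it is off its bounds just before τ too, and Ψ_i vanishes on both sides.
  · intro i hi hdu
    have hae : ∀ᵐ t ∂(volume.restrict (Ioo τ τ')), P.switching y p i t = 0 ∧
        (P.lo i + δ ≤ u i t ∧ u i t ≤ P.hi i - δ) := by
      filter_upwards [hI i hi, ae_restrict_of_ae_restrict_of_subset hsubr
        (hΛ.switching_eq_zero hP hu i), ae_restrict_of_ae_restrict_of_subset hsubr (haway i),
        ae_restrict_of_ae_restrict_of_subset hsubr (hu i).2] with t h1 h2 h3 h4
      obtain ⟨h5, h6⟩ := h3 h1.1 h1.2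
      rw [abs_of_nonneg (by linarith)] at h5
      rw [abs_of_nonpos (by linarith)] at h6
      exact ⟨h2 h1.1 h1.2, by linarith, by linarith⟩
    have her := eventually_right_of_ae hττ' hae
    have hr0 : ψr i = 0 := tendsto_nhds_unique (hψr i)
      (tendsto_const_nhds.congr' (her.mono fun t ht => ht.1.symm))
    have h1 : P.lo i + δ ≤ ur i := ge_of_tendsto (hur i) (her.mono fun t ht => ht.2.1)
    have h2 : ur i ≤ P.hi i - δ := le_of_tendsto (hur i) (her.mono fun t ht => ht.2.2)
    have h3 : ul i = ur i := by linarith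
    have hel := eventually_left_of_ae hτ.1
      (ae_restrict_of_ae_restrict_of_subset hsubl (hΛ.switching_eq_zero hP hu i))
    have hl0 : ψl i = 0 := by
      refine tendsto_nhds_unique (hψl i) (tendsto_const_nhds.congr' ?_)
      filter_upwards [hel, (hul i).eventually (lt_mem_nhds (show P.lo i < ul i by linarith)),
        (hul i).eventually (gt_mem_nhds (show ul i < P.hi i by linarith))] with t g1 g2 g3
      exact (g1 g2.ne' g3.ne).symm
    linarith

/-- The multipliers of the state constraints have a density on `(0,T)`. -/
lemma IsMultiplier.absolutelyContinuous (hn3 : n ≤ 3) (hP : P.Basic)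
    (huy : P.IsAdmissibleTrajectory u y) (hyp : P.Hypotheses u y) (hΛ : P.IsMultiplier u y p μ)
    (j : Fin q) : (μ j).measure.restrict (Ioo 0 P.T) ≪ volume := by
  have hst := huy.2.1
  have hb := hyp.b_regular
  obtain ⟨N, τ, lA, uA, sA, hdec, -, ⟨a, ha, hinj⟩, hulim, hflim⟩ := hyp.arcs
  have hτlt : ∀ k : Fin N, τ k.castSucc < τ k.succ := fun k => hdec.strictMono k.castSucc_lt_succ
  have hτ0 : ∀ k, 0 ≤ τ k := fun k => by
    rw [← hdec.first]
    exact hdec.strictMono.monotone (Fin.zero_le k)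
  have hτT : ∀ k, τ k ≤ P.T := fun k => by
    rw [← hdec.last]
    exact hdec.strictMono.monotone (Fin.le_last k)
  have hact : ∀ k : Fin N, ∀ i ∈ (lA k ∪ uA k)ᶜ,
      ∀ᵐ t ∂(volume.restrict (Ioo (τ k.castSucc) (τ k.succ))), u i t ≠ P.lo i ∧ u i t ≠ P.hi i := by
    intro k i hi
    rw [Finset.mem_compl, Finset.mem_union, not_or] at hi
    filter_upwards [hdec.lower k i, hdec.upper k i] with t h1 h2
    exact ⟨fun h => hi.1 (h1.1 h), fun h => hi.2 (h2.1 h)⟩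
  have hker : ∀ k : Fin N, ∀ t ∈ Icc (τ k.castSucc) (τ k.succ), ∀ l : Fin q → ℝ,
      (∀ i ∈ (lA k ∪ uA k)ᶜ, ∑ j ∈ sA k, P.M y i j t * l j = 0) → ∀ j ∈ sA k, l j = 0 := by
    intro k t ht l hl
    have hsub : Icc (τ k.castSucc) (τ k.succ) ⊆ Icc 0 P.T := Icc_subset_Icc (hτ0 _) (hτT _)
    have hcont : ContinuousOn (fun t => √(∑ i ∈ (lA k ∪ uA k)ᶜ,
        (∑ j ∈ sA k, P.M y i j t * l j) ^ 2)) (Icc (τ k.castSucc) (τ k.succ)) :=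
      (continuousOn_finsetSum _ fun i _ => (continuousOn_finsetSum _ fun j _ =>
        ((continuousOn_M hP hst hb i j).mono hsub).mul continuousOn_const).pow 2).sqrt
    have h1 := le_on_Icc_of_ae (hτlt k) (f := fun _ => a * √(∑ j ∈ sA k, l j ^ 2))
      continuousOn_const hcont ((hinj k).mono fun t ht => ht l) t ht
    rw [Finset.sum_eq_zero (s := (lA k ∪ uA k)ᶜ) fun i hi => by rw [hl i hi]; norm_num,
      Real.sqrt_zero] at h1
    have h2 : √(∑ j ∈ sA k, l j ^ 2) ≤ 0 := by
      by_contra h3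
      push Not at h3
      have := mul_pos ha h3
      linarith
    have h3 : ∑ j ∈ sA k, l j ^ 2 ≤ 0 := Real.sqrt_eq_zero'.1 (le_antisymm h2 (Real.sqrt_nonneg _))
    intro j hj
    have h4 := (Finset.sum_eq_zero_iff_of_nonneg fun j _ => sq_nonneg (l j)).1
      (le_antisymm h3 (Finset.sum_nonneg fun j _ => sq_nonneg (l j))) j hj
    exact pow_eq_zero_iff two_ne_zero |>.1 h4
  have harc : ∀ k : Fin N,
      (μ j).measure.restrict (Ioo (τ k.castSucc) (τ k.succ)) ≪ volume := fun k => by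
    refine hΛ.arc_absolutelyContinuous hP huy hb (hτ0 _) (hτT _) (C := sA k)
      (I := (lA k ∪ uA k)ᶜ) (fun i hi => ?_) (hdec.state k)
      (fun t ht => hker k t (Ioo_subset_Icc_self ht)) j
    filter_upwards [hact k i hi, ae_restrict_of_ae_restrict_of_subset
      (Ioo_subset_Ioo (hτ0 k.castSucc) (hτT k.succ)) (hΛ.switching_eq_zero hP huy.1 i)] with t h1 h2
    exact h2 h1.1 h1.2
  have hjun : ∀ k : Fin N, 0 < τ k.castSucc → (μ j).measure {τ k.castSucc} = 0 := fun k hk => by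
    have hkT : τ k.castSucc < P.T := (hτlt k).trans_le (hτT _)
    exact hΛ.measure_singleton_eq_zero hn3 hP huy hyp hk (hτlt k) (hτT _) (hact k) (hdec.state k)
      (hker k _ ⟨le_rfl, (hτlt k).le⟩) (fun i => (hulim _ hk hkT i).1)
      (fun i => (hulim _ hk hkT i).2) (hflim _ hk hkT) j
  have hcover : ∀ t ∈ Ioo 0 P.T, ∃ k : Fin N, t ∈ Ico (τ k.castSucc) (τ k.succ) := by
    intro t ht
    have hex : ∃ k : Fin (N + 1), t < τ k := ⟨Fin.last N, by rw [hdec.last]; exact ht.2⟩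
    classical
    -- The first junction point beyond t; it is not τ_0 = 0, so it closes an arc whose left end is
    -- at most t.
    let k0 := Fin.find (fun k : Fin (N + 1) => t < τ k) hex
    have hk0 : t < τ k0 := Fin.find_spec hex
    have hk0' : ∀ k < k0, τ k ≤ t := fun k hk => not_lt.1 (Fin.find_min hex hk)
    have hne : k0 ≠ 0 := fun h => by
      rw [h, hdec.first] at hk0
      exact absurd hk0 (not_lt.2 ht.1.le)
    obtain ⟨k, hk⟩ := Fin.exists_succ_eq.2 hne
    exact ⟨k, hk0' _ (hk ▸ k.castSucc_lt_succ), hk ▸ hk0⟩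
  -- (0,T) is covered by the open arcs and the interior junction points. The point T is excluded and
  -- may carry an atom.
  refine Measure.AbsolutelyContinuous.mk fun A hA hA0 => ?_
  rw [Measure.restrict_apply hA]
  refine measure_mono_null (t := (⋃ k : Fin N, A ∩ Ioo (τ k.castSucc) (τ k.succ))
    ∪ ⋃ k : Fin N, {τ k.castSucc} ∩ Ioi 0) (fun t ht => ?_) (measure_union_null
      (measure_iUnion_null fun k => ?_) (measure_iUnion_null fun k => ?_))
  · obtain ⟨k, hk⟩ := hcover t ht.2
    rcases hk.1.eq_or_lt with h | h
    · exact Or.inr (mem_iUnion.2 ⟨k, h.symm, ht.2.1⟩)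
    · exact Or.inl (mem_iUnion.2 ⟨k, ht.1, h, hk.2⟩)
  · have := harc k hA0
    rwa [Measure.restrict_apply hA] at this
  · by_cases hk : 0 < τ k.castSucc
    · exact measure_mono_null inter_subset_left (hjun k hk)
    · refine measure_mono_null (t := ∅) (fun t ht => hk ?_) measure_empty
      rw [← mem_singleton_iff.1 ht.1]
      exact ht.2

end ControlProblem

/-! ### Absolutely continuous pairings with the costate. -/

/-- `h` agrees almost everywhere on `(0,T)` with the absolutely continuous function that has the
value `e` at `T` and the derivative `-F`. -/
structure IsTail (T : ℝ) (h : ℝ → ℝ) (e : ℝ) (F : ℝ → ℝ) : Prop where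
  integrableOn : IntegrableOn F (Ioo 0 T)
  ae_eq : ∀ᵐ s ∂(volume.restrict (Ioo 0 T)), h s = e + ∫ t in s..T, F t

namespace IsTail

variable {T : ℝ} {h : ℝ → ℝ} {e : ℝ} {F : ℝ → ℝ}

lemma ae_eq_primitive (hT : 0 < T) (H : IsTail T h e F) :
    ∀ᵐ s ∂(volume.restrict (Ioo 0 T)),
      h s = (e + ∫ t in (0 : ℝ)..T, F t) + ∫ t in (0 : ℝ)..s, - F t := by
  filter_upwards [H.ae_eq, ae_restrict_mem measurableSet_Ioo] with s hs hm
  have h0 : (0 : ℝ) ∈ Icc 0 T := ⟨le_rfl, hT.le⟩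
  rw [hs, intervalIntegral.integral_neg,
    ← intervalIntegral_tail_sub H.integrableOn h0 (Ioo_subset_Icc_self hm)]
  ring

lemma hasWeakDeriv (hT : 0 < T) (H : IsTail T h e F) :
    HasWeakDeriv (Ioo 0 T) (1 : ℝ) h (fun t => - F t) := by
  have hc : IntegrableOn (fun s => (e + ∫ t in (0 : ℝ)..T, F t) + ∫ t in (0 : ℝ)..s, - F t)
      (Ioo 0 T) := by
    have := (continuousOn_const (c := e + ∫ t in (0 : ℝ)..T, F t)).add
      (continuousOn_primitive_Ioo hT.le H.integrableOn.neg)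
    exact (this.integrableOn_Icc).mono_set Ioo_subset_Icc_self
  refine HasWeakDeriv.congr (u := fun s => (e + ∫ t in (0 : ℝ)..T, F t) + ∫ t in (0 : ℝ)..s, - F t)
    ⟨hc.locallyIntegrableOn, H.integrableOn.neg.locallyIntegrableOn, fun ψ hψ =>
      primitive_weak H.integrableOn.neg _ hT.le hψ⟩ ?_ ae_eq_rfl
  filter_upwards [H.ae_eq_primitive hT] with s hs
  exact hs.symm

lemma integrableOn_mul (hT : 0 < T) (H : IsTail T h e F) {ψ : ℝ → ℝ}
    (hψ : IntegrableOn ψ (Ioo 0 T)) : IntegrableOn (fun t => ψ t * h t) (Ioo 0 T) := by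
  refine (integrableOn_primitive_mul hT.le H.integrableOn.neg hψ
    (e + ∫ t in (0 : ℝ)..T, F t)).congr ?_
  filter_upwards [H.ae_eq_primitive hT] with s hs
  rw [hs, mul_comm]
  rfl

/-- Integration by parts in time. The only boundary term is at T, because the primitive of ψ
vanishes at 0. -/
lemma integral_mul (hT : 0 < T) (H : IsTail T h e F) {ψ : ℝ → ℝ}
    (hψ : IntegrableOn ψ (Ioo 0 T)) :
    ∫ t in Ioo 0 T, ψ t * h t
      = (∫ r in (0 : ℝ)..T, ψ r) * e + ∫ t in Ioo 0 T, (∫ r in (0 : ℝ)..t, ψ r) * F t := by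
  rw [integral_primitive_mul_volume H.integrableOn hψ,
    ← setIntegral_Ioo_eq_intervalIntegral hT.le, ← integral_mul_const]
  have h1 : IntegrableOn (fun s => ψ s * ∫ t in s..T, F t) (Ioo 0 T) := by
    have h2 : IntegrableOn ψ (Icc 0 T) := by rwa [integrableOn_Icc_iff_integrableOn_Ioo]
    exact (h2.mul_continuousOn (continuousOn_tail_interval hT.le H.integrableOn)
      isCompact_Icc).mono_set Ioo_subset_Icc_self
  rw [← integral_add (hψ.mul_const e) h1]
  refine integral_congr_ae ?_
  filter_upwards [H.ae_eq] with s hs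
  rw [hs, mul_add]

/-- Here v and v' are unrelated functions. The combination of v times the primitive of v' with v'
times the primitive of v is the derivative of the product of the primitives; one summand alone is
not such a derivative, which is why the sum over S has to be symmetrized. -/
lemma integral_primitive_mul_primitive (hT : 0 < T) (H : IsTail T h e F) {v v' : ℝ → ℝ}
    (hv : IntegrableOn v (Ioo 0 T)) (hv' : IntegrableOn v' (Ioo 0 T)) :
    (∫ t in Ioo 0 T, v t * (∫ r in (0 : ℝ)..t, v' r) * h t)
        + ∫ t in Ioo 0 T, v' t * (∫ r in (0 : ℝ)..t, v r) * h t
      = (∫ r in (0 : ℝ)..T, v r) * e * (∫ r in (0 : ℝ)..T, v' r)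
        + ∫ t in Ioo 0 T, (∫ r in (0 : ℝ)..t, v r) * F t * ∫ r in (0 : ℝ)..t, v' r := by
  have i1 : IntegrableOn (fun t => v t * ∫ r in (0 : ℝ)..t, v' r) (Ioo 0 T) :=
    (integrableOn_primitive_mul hT.le hv' hv 0).congr (ae_of_all _ fun t => by ring)
  have i2 : IntegrableOn (fun t => v' t * ∫ r in (0 : ℝ)..t, v r) (Ioo 0 T) :=
    (integrableOn_primitive_mul hT.le hv hv' 0).congr (ae_of_all _ fun t => by ring)
  have key : ∀ t ∈ Icc 0 T, ∫ r in (0 : ℝ)..t, (v r * (∫ r in (0 : ℝ)..r, v' r)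
      + v' r * ∫ r in (0 : ℝ)..r, v r)
      = (∫ r in (0 : ℝ)..t, v r) * ∫ r in (0 : ℝ)..t, v' r := fun t ht => by
    have := primitive_mul_primitive hT.le hv hv' 0 0 ht
    simp only [zero_add, mul_zero] at this
    rw [this]
    refine intervalIntegral.integral_congr fun r _ => ?_
    ring
  rw [← integral_add (H.integrableOn_mul hT i1) (H.integrableOn_mul hT i2)]
  have := H.integral_mul hT (i1.add i2)
  simp only [Pi.add_apply] at this
  rw [key T ⟨hT.le, le_rfl⟩] at this
  rw [show (fun t => v t * (∫ r in (0 : ℝ)..t, v' r) * h t + v' t * (∫ r in (0 : ℝ)..t, v r) * h t)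
    = fun t => (v t * (∫ r in (0 : ℝ)..t, v' r) + v' t * ∫ r in (0 : ℝ)..t, v r) * h t from
    funext fun t => by ring, this]
  congr 1
  · ring
  · refine setIntegral_congr_fun measurableSet_Ioo fun t ht => ?_
    rw [key t (Ioo_subset_Icc_self ht)]
    ring

end IsTail

/-- An absolutely continuous Stieltjes measure on `(0,T)` has the weak derivative as density. -/
lemma StieltjesFunction.exists_density (μ : StieltjesFunction ℝ) {T : ℝ} (hT : 0 < T)
    (h : μ.measure.restrict (Ioo 0 T) ≪ volume) :
    ∃ θ, IntegrableOn θ (Ioo 0 T) ∧ HasWeakDeriv (Ioo 0 T) (1 : ℝ) (fun t => μ t) θ ∧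
      ∀ m, ContinuousOn m (Icc 0 T) → ∀ s ∈ Ioo 0 T,
        ∫ t in Icc s T, m t ∂μ.measure = m T * μ.measure.real {T} + ∫ t in s..T, θ t * m t := by
  set ν := μ.measure.restrict (Ioo 0 T) with hν
  have hfin : IsFiniteMeasure ν := ⟨by
    rw [hν, Measure.restrict_apply_univ]
    exact (measure_mono Ioo_subset_Ioc_self).trans_lt (by simp [μ.measure_Ioc])⟩
  set θ := fun t => (ν.rnDeriv volume t).toReal with hθ
  have hθi : Integrable θ volume := Measure.integrable_toReal_rnDeriv
  refine ⟨θ, hθi.integrableOn, ?_, ?_⟩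
  · have hprim : ∀ t ∈ Ioo 0 T, μ t = μ 0 + ∫ s in (0 : ℝ)..t, θ s := fun t ht => by
      rw [intervalIntegral.integral_of_le ht.1.le, hθ, Measure.setIntegral_toReal_rnDeriv h,
        measureReal_def, hν, Measure.restrict_apply measurableSet_Ioc,
        inter_eq_left.2 (show Ioc 0 t ⊆ Ioo 0 T from fun x hx => ⟨hx.1, hx.2.trans_lt ht.2⟩),
        μ.measure_Ioc,
        ENNReal.toReal_ofReal (sub_nonneg.2 (μ.mono ht.1.le))]
      ring
    have hc : IntegrableOn (fun s => μ 0 + ∫ t in (0 : ℝ)..s, θ t) (Ioo 0 T) :=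
      ((continuousOn_const.add (continuousOn_primitive_Ioo hT.le
        hθi.integrableOn)).integrableOn_Icc).mono_set Ioo_subset_Icc_self
    refine HasWeakDeriv.congr (u := fun s => μ 0 + ∫ t in (0 : ℝ)..s, θ t)
      ⟨hc.locallyIntegrableOn, hθi.integrableOn.locallyIntegrableOn, fun ψ hψ =>
        primitive_weak hθi.integrableOn _ hT.le hψ⟩ ?_ ae_eq_rfl
    filter_upwards [ae_restrict_mem measurableSet_Ioo] with t ht
    exact (hprim t ht).symm
  · intro m hm s hs
    have hmi := StieltjesFunction.integrableOn_of_continuousOn μ hm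
    have hsub : Ico s T ⊆ Ioo 0 T := fun t ht => ⟨hs.1.trans_le ht.1, ht.2⟩
    -- Absolute continuity is known only on the open interval, so the possible atom at T is split
    -- off.
    have hU : Icc s T = Ico s T ∪ {T} := (Ico_union_right hs.2.le).symm
    rw [hU, setIntegral_union (by simp) (measurableSet_singleton T)
      (hmi.mono_set (hsub.trans Ioo_subset_Ioc_self))
      (hmi.mono_set (by simp [hT])), integral_singleton, smul_eq_mul, mul_comm, add_comm]
    congr 1
    rw [intervalIntegral.integral_of_le hs.2.le, ← integral_Ico_eq_integral_Ioc]
    have h1 := integral_rnDeriv_smul h (f := (Ico s T).indicator m)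
    rw [integral_indicator measurableSet_Ico, hν, Measure.restrict_restrict measurableSet_Ico,
      inter_eq_left.2 hsub] at h1
    rw [← h1, ← integral_indicator measurableSet_Ico]
    congr 1
    ext t
    by_cases ht : t ∈ Ico s T <;> simp [ht, hθ, hν]

namespace ControlProblem

variable {n m q : ℕ} {P : ControlProblem n m q} {u : Fin m → ℝ → ℝ} {y p Z : Space n × ℝ → ℝ}
  {μ : Fin q → StieltjesFunction ℝ}

lemma muDot_spec (hT : 0 < P.T) {j : Fin q}
    (h : (μ j).measure.restrict (Ioo 0 P.T) ≪ volume) :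
    IntegrableOn (P.muDot μ j) (Ioo 0 P.T) ∧
      (∃ g, HasWeakDeriv (Ioo 0 P.T) (1 : ℝ) (fun t => μ j t) g) ∧
      ∀ m, ContinuousOn m (Icc 0 P.T) → ∀ s ∈ Ioo 0 P.T,
        ∫ t in Icc s P.T, m t ∂(μ j).measure
          = m P.T * (μ j).measure.real {P.T} + ∫ t in s..P.T, P.muDot μ j t * m t := by
  obtain ⟨θ, h1, h2, h3⟩ := StieltjesFunction.exists_density (μ j) hT h
  have he : P.muDot μ j =ᵐ[volume.restrict (Ioo 0 P.T)] θ := h2.wderiv_ae_eq isOpen_Ioo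
  refine ⟨h1.congr he.symm, ⟨θ, h2⟩, fun m hm s hs => ?_⟩
  rw [h3 m hm s hs]
  congr 1
  rw [intervalIntegral.integral_of_le hs.2.le, intervalIntegral.integral_of_le hs.2.le,
    integral_Ioc_eq_integral_Ioo, integral_Ioc_eq_integral_Ioo]
  refine integral_congr_ae ?_
  filter_upwards [ae_restrict_of_ae_restrict_of_subset (Ioo_subset_Ioo_left hs.1.le) he] with t ht
  rw [ht]

/-- Minus the time derivative of `∫_Ω p Z`. -/
def pairingRate (P : ControlProblem n m q) (u : Fin m → ℝ → ℝ) (y p : Space n × ℝ → ℝ)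
    (μ : Fin q → StieltjesFunction ℝ) (Z : Space n × ℝ → ℝ) (t : ℝ) : ℝ :=
  (∑ j, P.muDot μ j t * ∫ x in P.Ω, P.c j x * Z (x, t))
    + ∫ x in P.Ω, P.adjointDensity u y p Z (x, t)

lemma integrableOn_muDot_mul (hP : P.Basic) (hθ : IntegrableOn (P.muDot μ j) (Ioo 0 P.T))
    (hZ : MemY P.Ω P.T Z) :
    IntegrableOn (fun t => P.muDot μ j t * ∫ x in P.Ω, P.c j x * Z (x, t)) (Ioo 0 P.T) := by
  have h2 : IntegrableOn (P.muDot μ j) (Icc 0 P.T) := by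
    rwa [integrableOn_Icc_iff_integrableOn_Ioo]
  exact (h2.mul_continuousOn (hZ.continuousOn_pairing (hP.c_mem j).1.memLp)
    isCompact_Icc).mono_set Ioo_subset_Icc_self

/-- With densities for the μ_j, the tails in `costate_pairing_ae` become absolutely continuous
functions of their left end; atoms at T contribute only a constant. -/
lemma isTail_pairing (hn3 : n ≤ 3) (hP : P.Basic) (hu : P.IsAdmissibleControl u)
    (hst : P.IsState u y) (hc : P.IsCostate u y p μ)
    (hμ : ∀ j, (μ j).measure.restrict (Ioo 0 P.T) ≪ volume) (h : P.IsDirection y Z) :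
    IsTail P.T (fun t => ∫ x in P.Ω, p (x, t) * Z (x, t))
      (∫ x in P.Ω, endTrace P.Ω P.T p x * Z (x, P.T)) (P.pairingRate u y p μ Z) := by
  have hT := hP.T_pos
  have hcont := fun j => h.memY.continuousOn_pairing (hP.c_mem j).1.memLp
  have i1 := fun j => integrableOn_muDot_mul hP (muDot_spec hT (hμ j)).1 h.memY
  have i2 := integrable_integral_slice (integrable_adjointDensity hP hu hst hc.1.memLp h)
  have i1s : IntegrableOn (fun t => ∑ j, P.muDot μ j t * ∫ x in P.Ω, P.c j x * Z (x, t))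
      (Ioo 0 P.T) := integrable_finsetSum _ fun j _ => i1 j
  have hF : IntegrableOn (P.pairingRate u y p μ Z) (Ioo 0 P.T) := i1s.add i2
  have hTm : P.T ∈ Icc 0 P.T := ⟨hT.le, le_rfl⟩
  -- The final cost and the atoms at T. Letting s increase to T along almost all times identifies
  -- this constant with the pairing of the trace of p, taken before the jump at T.
  set c0 := P.finalPairing y Z
    + ∑ j, (∫ x in P.Ω, P.c j x * Z (x, P.T)) * (μ j).measure.real {P.T} with hc0
  have hae : ∀ᵐ s ∂P.timeMeasure, ∫ x in P.Ω, p (x, s) * Z (x, s)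
      = c0 + ∫ t in s..P.T, P.pairingRate u y p μ Z t := by
    filter_upwards [costate_pairing_ae hP hu hst hc h, ae_restrict_mem measurableSet_Ioo]
      with s hs hm
    have hsm : s ∈ Icc 0 P.T := Ioo_subset_Icc_self hm
    rw [hs, Finset.sum_congr rfl fun j _ => (muDot_spec hT (hμ j)).2.2 _ (hcont j) s hm,
      Finset.sum_add_distrib]
    simp only [pairingRate]
    rw [intervalIntegral.integral_add (intervalIntegrable_of_Ioo i1s hsm hTm)
      (intervalIntegrable_of_Ioo i2 hsm hTm), intervalIntegral.integral_finsetSum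
      fun j _ => intervalIntegrable_of_Ioo (i1 j) hsm hTm]
    rw [hc0]
    ring
  have htr := hasEndTrace_endTrace (exists_hasEndTrace hn3 hP hu hst hc)
  have := neBot_nhdsLT_inf_ae P.T
  have hle : 𝓝[<] P.T ⊓ ae volume ≤ 𝓝[Icc 0 P.T] P.T := by
    refine inf_le_left.trans ?_
    rw [← nhdsWithin_Ioo_eq_nhdsLT hT]
    exact nhdsWithin_mono _ Ioo_subset_Icc_self
  have l1 : Tendsto (fun s => ∫ x in P.Ω, p (x, s) * Z (x, s)) (𝓝[<] P.T ⊓ ae volume)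
      (𝓝 (∫ x in P.Ω, endTrace P.Ω P.T p x * Z (x, P.T))) :=
    tendsto_integral_mul
      (eventually_left_of_ae hT (memLp_slice_time hc.1.memLp))
      (eventually_left_of_ae hT (memLp_slice_time h.memY.memLp)) htr.1
      (h.memY.slice_memLp _ hTm) htr.2 ((h.memY.slice_continuous _ hTm).mono_left hle)
  have l2 : Tendsto (fun s => c0 + ∫ t in s..P.T, P.pairingRate u y p μ Z t)
      (𝓝[<] P.T ⊓ ae volume) (𝓝 c0) := by
    have h1 := ((continuousOn_tail_interval hT.le hF) _ hTm).tendsto.mono_left hle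
    simpa using h1.const_add c0
  have he : c0 = ∫ x in P.Ω, endTrace P.Ω P.T p x * Z (x, P.T) :=
    tendsto_nhds_unique (l2.congr' ((eventually_left_of_ae hT hae).mono fun s hs => hs.symm)) l1
  exact ⟨hF, he ▸ hae⟩

end ControlProblem

/-! ### Products with the costate, and integration by parts in space. -/

section Products

variable {n : ℕ} {Ω : Set (Space n)} {T : ℝ} {p Z : Space n × ℝ → ℝ}

/-- The product of an element of `L^∞(0,T;H^1_0)` and one of `Y` is square integrable. -/
lemma MemLinftyH10.memLp_mul (hn3 : n ≤ 3) (hΩ : IsOpen Ω) (hp : MemLinftyH10 Ω T p)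
    (hZ : MemY Ω T Z) : MemLp (fun s => p s * Z s) 2 (volume.restrict (cyl Ω T)) := by
  obtain ⟨C, hC0, hC⟩ := hp.exists_sobolevNorm_le
  obtain ⟨K, hK0, hK⟩ := exists_mul_bound hn3 Ω
  have hm : AEStronglyMeasurable (fun s => p s * Z s) (volume.restrict (cyl Ω T)) :=
    hp.memLp.1.mul hZ.memLp.1
  rw [memLp_two_iff_integrable_sq hm]
  have hm2 := hm.pow 2
  rw [cyl_measure] at hm2 ⊢
  have hN : MemLp (fun t => sobolevNorm Ω (fun x => Z (x, t)) (fun i x => dx Ω T i Z (x, t))) 2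
      (volume.restrict (Ioo 0 T)) :=
    (memLp_norm_slice hZ.memLp).add
      (memLp_finsetSum _ fun i _ => memLp_norm_slice (hZ.memLp_dx hΩ i))
  have hi : Integrable ((fun s : Space n × ℝ => p s * Z s) ^ 2)
      ((volume.restrict Ω).prod (volume.restrict (Ioo 0 T))) := by
    rw [integrable_prod_iff' hm2]
    constructor
    · filter_upwards [hp.ae_pair hΩ, hZ.ae_pair hΩ] with t h1 h2
      exact (hK _ _ _ _ h1 h2).1.integrable_sq
    · refine (hN.integrable_sq.const_mul ((K * C) ^ 2)).mono'
        hm2.norm.prod_swap.integral_prod_right' ?_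
      filter_upwards [hp.ae_pair hΩ, hZ.ae_pair hΩ, hC] with t h1 h2 h3
      obtain ⟨h4, h5⟩ := hK _ _ _ _ h1 h2
      have h6 : ∫ x in Ω, ‖((fun s : Space n × ℝ => p s * Z s) ^ 2) (x, t)‖
          = (eLpNorm (fun x => p (x, t) * Z (x, t)) 2 (volume.restrict Ω)).toReal ^ 2 := by
        rw [eLpNorm_two_sq h4]
        congr 1
        ext x
        simp only [Pi.pow_apply]
        rw [Real.norm_of_nonneg (sq_nonneg _)]
      rw [h6, Real.norm_of_nonneg (sq_nonneg _), ← mul_pow]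
      refine pow_le_pow_left₀ ENNReal.toReal_nonneg (h5.trans ?_) 2
      exact mul_le_mul_of_nonneg_right (mul_le_mul_of_nonneg_left h3 hK0) (sobolevNorm_nonneg _ _)
  exact hi

/-- θ is only integrable in time, which is compensated by the boundedness of Z in time with values
in L²(Ω). -/
lemma MemY.integrable_mul_tensor (hZ : MemY Ω T Z) {c : Space n → ℝ}
    (hc : MemLp c 2 (volume.restrict Ω)) {θ : ℝ → ℝ} (hθ : IntegrableOn θ (Ioo 0 T)) :
    Integrable (fun s => θ s.2 * (c s.1 * Z s)) (volume.restrict (cyl Ω T)) := by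
  obtain ⟨C, hC⟩ := hZ.ae_slice_bound
  have hm : AEStronglyMeasurable (fun s => θ s.2 * (c s.1 * Z s)) (volume.restrict (cyl Ω T)) :=
    (aestronglyMeasurable_snd hθ.1).mul ((aestronglyMeasurable_fst hc.1).mul hZ.memLp.1)
  have hslice : ∀ᵐ t ∂(volume.restrict (Ioo 0 T)), MemLp (fun x => Z (x, t)) 2 (volume.restrict Ω) :=
    memLp_slice_time hZ.memLp
  rw [cyl_measure] at hm ⊢
  rw [integrable_prod_iff' hm]
  constructor
  · filter_upwards [hslice] with t ht
    exact (integrable_mul_of_memLp_two hc ht).const_mul _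
  · refine (hθ.norm.mul_const ((eLpNorm c 2 (volume.restrict Ω)).toReal * C)).mono'
      hm.norm.prod_swap.integral_prod_right' ?_
    filter_upwards [hslice, hC] with t h1 h2
    rw [Real.norm_of_nonneg (integral_nonneg fun _ => norm_nonneg _)]
    have h3 : |(∫ x in Ω, ‖c x‖ * ‖Z (x, t)‖)| ≤ (eLpNorm (fun x => ‖c x‖) 2
        (volume.restrict Ω)).toReal * (eLpNorm (fun x => ‖Z (x, t)‖) 2 (volume.restrict Ω)).toReal :=
      abs_integral_mul_le hc.norm h1.norm
    rw [eLpNorm_norm c, eLpNorm_norm (fun x => Z (x, t))] at h3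
    simp only [norm_mul, integral_const_mul]
    refine mul_le_mul_of_nonneg_left ?_ (norm_nonneg _)
    exact (le_abs_self _).trans (h3.trans (mul_le_mul_of_nonneg_left h2 ENNReal.toReal_nonneg))

/-- Integration by parts in space against a costate. -/
lemma MemLinftyH10.integral_drift (hΩ : IsOpen Ω) (hp : MemLinftyH10 Ω T p) (hZ : MemY Ω T Z)
    {b : Space n → ℝ} (hb : MemW Ω ∞ 2 b) :
    ∀ᵐ t ∂(volume.restrict (Ioo 0 T)),
      ∫ x in Ω, (p (x, t) * (∑ k, wderiv Ω (unitVec k) b x * dx Ω T k Z (x, t))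
        + Z (x, t) * (lapSpace Ω b x * p (x, t))
        + Z (x, t) * ∑ k, wderiv Ω (unitVec k) b x * dx Ω T k p (x, t)) = 0 := by
  filter_upwards [hp.ae_pair hΩ, hZ.ae_pair hΩ] with t h1 h2
  have hd := fun k => hb.wderiv hΩ k
  have hF := fun k => h2.bounded_mul hΩ (hd k).memLp (fun i => ((hd k).wderiv hΩ i).memLp)
    (fun i => (hd k).hasWeakDeriv i)
  have i1 : ∀ k, Integrable (fun x => (wderiv Ω (unitVec k) b x * dx Ω T k Z (x, t)
      + wderiv Ω (unitVec k) (wderiv Ω (unitVec k) b) x * Z (x, t)) * p (x, t))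
      (volume.restrict Ω) := fun k => integrable_mul_of_memLp_two ((hF k).memLp_deriv k) h1.memLp
  have i2 : ∀ k, Integrable (fun x => wderiv Ω (unitVec k) b x * Z (x, t) * dx Ω T k p (x, t))
      (volume.restrict Ω) := fun k =>
    integrable_mul_of_memLp_two (hF k).memLp (h1.memLp_deriv k)
  -- The integrand is ∂_k(∂_k b · Z · p), whose integral vanishes since p is zero on the boundary.
  have h3 : ∀ k, ∫ x in Ω, ((wderiv Ω (unitVec k) b x * dx Ω T k Z (x, t)
      + wderiv Ω (unitVec k) (wderiv Ω (unitVec k) b) x * Z (x, t)) * p (x, t)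
      + wderiv Ω (unitVec k) b x * Z (x, t) * dx Ω T k p (x, t)) = 0 := fun k => by
    rw [integral_add (i1 k) (i2 k), h1.integral_by_parts (hF k).memLp ((hF k).memLp_deriv k)
      ((hF k).hasWeakDeriv k).2.2]
    ring
  have i3 : ∀ k, Integrable (fun x => (wderiv Ω (unitVec k) b x * dx Ω T k Z (x, t)
      + wderiv Ω (unitVec k) (wderiv Ω (unitVec k) b) x * Z (x, t)) * p (x, t)
      + wderiv Ω (unitVec k) b x * Z (x, t) * dx Ω T k p (x, t)) (volume.restrict Ω) :=
    fun k => (i1 k).add (i2 k)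
  rw [← Finset.sum_eq_zero fun k (_ : k ∈ Finset.univ) => h3 k,
    ← integral_finsetSum _ fun k _ => i3 k]
  congr 1
  ext x
  simp only [lapSpace, Finset.mul_sum, Finset.sum_mul]
  rw [← Finset.sum_add_distrib, ← Finset.sum_add_distrib]
  exact Finset.sum_congr rfl fun k _ => by ring

end Products

/-! ### Integrability of both forms, and the rate of the pairing with ζ. -/

namespace ControlProblem

variable {n m q : ℕ} {P : ControlProblem n m q} {u : Fin m → ℝ → ℝ} {y p Z : Space n × ℝ → ℝ}
  {μ : Fin q → StieltjesFunction ℝ} {v : Fin m → ℝ → ℝ} {z ζ : Space n × ℝ → ℝ}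

/-- The critical term γ y p Z² is the product of γ y Z and p Z. The first is square integrable
because its square is γ · (γ y² Z) · Z, the second by `MemLinftyH10.memLp_mul`. -/
lemma IsDirection.integrable_kappa_mul (hn3 : n ≤ 3) (hP : P.Basic) (hst : P.IsState u y)
    (hp : MemLinftyH10 P.Ω P.T p) (h : P.IsDirection y Z) :
    Integrable (fun s => P.kappa y p s * Z s ^ 2) P.cylMeasure := by
  have hZ2 := h.memY.memLp.integrable_sq
  have h1 : MemLp (fun s => P.γ * y s * Z s) 2 P.cylMeasure := by
    have hm : AEStronglyMeasurable (fun s => P.γ * y s * Z s) P.cylMeasure :=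
      (hst.1.memLp.1.const_mul _).mul h.memY.memLp.1
    rw [memLp_two_iff_integrable_sq hm]
    refine ((integrable_mul_of_memLp_two h.memLp_sq_mul h.memY.memLp).const_mul P.γ).congr
      (ae_of_all _ fun s => ?_)
    simp only
    ring
  have h2 := integrable_mul_of_memLp_two h1 (hp.memLp_mul hn3 hP.isOpen h.memY)
  refine (hZ2.sub (h2.const_mul 6)).congr (ae_of_all _ fun s => ?_)
  simp only [Pi.sub_apply, kappa]
  ring

lemma IsLinearizedState.isDirection (hP : P.Basic) (hu : P.IsAdmissibleControl u)
    (hst : P.IsState u y) (hv : ∀ i, MemLp (v i) 2 P.timeMeasure)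
    (hz : P.IsLinearizedState u y v z) : P.IsDirection y z := by
  refine isDirection_of_operator hP hu hz.1 (memLp_finsetSum Finset.univ fun i _ => ?_) hz.2.1
  obtain ⟨C, hC⟩ := hst.1.ae_slice_bound
  have h1 := memLp_bounded_mul (memLp_top_fst (T := P.T) (hP.b_mem i.succ).memLp)
    (memLp_time_mul hst.1.memLp (hv i) hC)
  refine h1.ae_eq (ae_of_all _ fun s => ?_)
  simp only
  ring

lemma memLp_top_primitive_control (hT : 0 ≤ P.T) (hv : ∀ i, MemLp (v i) 2 P.timeMeasure)
    (i : Fin m) : MemLp (primitive v i) ∞ P.timeMeasure :=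
  memLp_top_primitive hT ((hv i).integrable one_le_two)

lemma memLp_forcing (hP : P.Basic) (hu : P.IsAdmissibleControl u)
    (hst : P.IsState u y) (hb : ∀ i, MemW P.Ω ∞ 2 (P.b i))
    (hv : ∀ i, MemLp (v i) 2 P.timeMeasure) :
    MemLp (fun s => ∑ k, P.B1 y k s * primitive v k s.2) 2 P.cylMeasure := by
  refine memLp_finsetSum _ fun k _ => ?_
  refine (memLp_bounded_mul (memLp_top_snd (memLp_top_primitive_control hP.T_pos.le hv k))
    (memLp_B1 hP hu hst hb k)).ae_eq (ae_of_all _ fun s => ?_)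
  simp only
  ring

lemma IsTransformedState.isDirection (hP : P.Basic) (hu : P.IsAdmissibleControl u)
    (hst : P.IsState u y) (hb : ∀ i, MemW P.Ω ∞ 2 (P.b i))
    (hv : ∀ i, MemLp (v i) 2 P.timeMeasure)
    (hζ : P.IsTransformedState u y (primitive v) ζ) : P.IsDirection y ζ :=
  isDirection_of_operator hP hu hζ.1 (memLp_forcing hP hu hst hb hv) hζ.2.1

lemma integrable_costate_control (hP : P.Basic) (hp : MemLinftyH10 P.Ω P.T p)
    (hZ : MemY P.Ω P.T Z) (hv : ∀ i, MemLp (v i) 2 P.timeMeasure) (i : Fin m) :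
    Integrable (fun s => v i s.2 * (p s * (P.b i.succ s.1 * Z s))) P.cylMeasure := by
  obtain ⟨C, hC⟩ := hZ.ae_slice_bound
  have h1 := memLp_bounded_mul (memLp_top_fst (T := P.T) (hP.b_mem i.succ).memLp)
    (memLp_time_mul hZ.memLp (hv i) hC)
  refine (integrable_mul_of_memLp_two hp.memLp h1).congr (ae_of_all _ fun s => ?_)
  simp only
  ring

lemma integrable_quadIntegrand (hn3 : n ≤ 3) (hP : P.Basic)
    (hst : P.IsState u y) (hp : MemLinftyH10 P.Ω P.T p) (h : P.IsDirection y z)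
    (hv : ∀ i, MemLp (v i) 2 P.timeMeasure) :
    Integrable (P.quadIntegrand y p z v) P.cylMeasure := by
  have h2 := integrable_finsetSum Finset.univ fun i _ =>
    integrable_costate_control hP hp h.memY hv i
  refine ((h.integrable_kappa_mul hn3 hP hst hp).add (h2.const_mul 2)).congr
    (ae_of_all _ fun s => ?_)
  simp only [Pi.add_apply, quadIntegrand, Finset.mul_sum]
  congr 1
  exact Finset.sum_congr rfl fun i _ => by ring

lemma ae_cyl_goh (hP : P.Basic) (hst : P.IsState u y) {z ζ : Space n × ℝ → ℝ}
    (hz : MemLp z 2 P.cylMeasure) (hζ : MemLp ζ 2 P.cylMeasure)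
    (hv : ∀ i, MemLp (v i) 2 P.timeMeasure)
    (h : ∀ t ∈ Icc 0 P.T, ∀ᵐ x ∂(volume.restrict P.Ω),
      z (x, t) = ζ (x, t) + y (x, t) * ∑ i, P.b i.succ x * primitive v i t) :
    ∀ᵐ s ∂P.cylMeasure, z s = ζ s + y s * ∑ i, P.b i.succ s.1 * primitive v i s.2 := by
  have hw : ∀ i, AEStronglyMeasurable (fun s : Space n × ℝ => primitive v i s.2) P.cylMeasure :=
    fun i => aestronglyMeasurable_snd (memLp_top_primitive_control hP.T_pos.le hv i).1
  have hsum : AEStronglyMeasurable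
      (fun s : Space n × ℝ => ∑ i, P.b i.succ s.1 * primitive v i s.2) P.cylMeasure :=
    Finset.aestronglyMeasurable_fun_sum _ fun i _ =>
      (aestronglyMeasurable_fst (hP.b_mem i.succ).memLp.1).mul (hw i)
  have h1 := ae_cyl_of_ae_slice_time (hz.1.sub (hζ.1.add (hst.1.memLp.1.mul hsum))) (by
    filter_upwards [ae_restrict_mem measurableSet_Ioo] with t ht
    filter_upwards [h t (Ioo_subset_Icc_self ht)] with x hx
    simp only [Pi.sub_apply, Pi.add_apply, Pi.mul_apply]
    rw [hx, sub_self])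
  filter_upwards [h1] with s hs
  simp only [Pi.sub_apply, Pi.add_apply, Pi.mul_apply] at hs
  exact sub_eq_zero.1 hs

/-- The part of `hatCross` that does not involve the multipliers of the state constraints. -/
lemma integrable_hatCross_regular (hP : P.Basic) (hu : P.IsAdmissibleControl u)
    (hst : P.IsState u y) (hb : ∀ i, MemW P.Ω ∞ 2 (P.b i)) (hp : MemLinftyH10 P.Ω P.T p)
    (hv : ∀ i, MemLp (v i) 2 P.timeMeasure) (hζ : MemY P.Ω P.T ζ) (i : Fin m) :
    Integrable (fun s => ζ s * (- lapSpace P.Ω (P.b i.succ) s.1 * p s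
      - 2 * ∑ k, wderiv P.Ω (unitVec k) (P.b i.succ) s.1 * dx P.Ω P.T k p s
      + P.b i.succ s.1 * (y s - P.yd s))
      - P.b i.succ s.1 * p s * ∑ k, P.B1 y k s * primitive v k s.2) P.cylMeasure := by
  have hΩ := hP.isOpen
  have hd := fun k => (hb i.succ).wderiv hΩ k
  have hlap : MemLp (lapSpace P.Ω (P.b i.succ)) ∞ (volume.restrict P.Ω) :=
    memLp_finsetSum _ fun k _ => ((hd k).wderiv hΩ k).memLp
  have m1 : MemLp (fun s => - (lapSpace P.Ω (P.b i.succ) s.1 * p s)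
      - 2 * ∑ k, wderiv P.Ω (unitVec k) (P.b i.succ) s.1 * dx P.Ω P.T k p s
      + P.b i.succ s.1 * (y s - P.yd s)) 2 P.cylMeasure :=
    ((memLp_bounded_mul (memLp_top_fst hlap) hp.memLp).neg.sub
      ((memLp_finsetSum _ fun k _ => memLp_bounded_mul (memLp_top_fst (hd k).memLp)
        (hp.memLp_dx hΩ k)).const_mul 2)).add
      (memLp_bounded_mul (memLp_top_fst (hb i.succ).memLp) (hst.1.memLp.sub hP.yd_mem))
  have m2 : MemLp (fun s => P.b i.succ s.1 * p s) 2 P.cylMeasure :=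
    memLp_bounded_mul (memLp_top_fst (hb i.succ).memLp) hp.memLp
  refine ((integrable_mul_of_memLp_two hζ.memLp m1).sub
    (integrable_mul_of_memLp_two m2 (memLp_forcing hP hu hst hb hv))).congr
    (ae_of_all _ fun s => ?_)
  simp only [Pi.sub_apply]
  ring

lemma integrable_constraint_term (hP : P.Basic) (hb : ∀ i, MemW P.Ω ∞ 2 (P.b i))
    (hζ : MemY P.Ω P.T ζ) (hθ : ∀ j, IntegrableOn (P.muDot μ j) (Ioo 0 P.T)) (i : Fin m)
    (j : Fin q) :
    Integrable (fun s => P.muDot μ j s.2 * (P.c j s.1 * (P.b i.succ s.1 * ζ s))) P.cylMeasure :=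
  MemY.integrable_mul_tensor (((hζ.rep hP.isOpen).mul_fst hP.isOpen hP.T_pos.le
    (hb i.succ)).memY) (hP.c_mem j).1.memLp (hθ j)

/-- The part with the derivatives of μ_j is set apart because its time factor is only integrable. -/
lemma hatCross_eq (i : Fin m) (s : Space n × ℝ) (w : Fin m → ℝ → ℝ) :
    P.hatCross y p μ ζ w i s
      = (ζ s * (- lapSpace P.Ω (P.b i.succ) s.1 * p s
      - 2 * ∑ k, wderiv P.Ω (unitVec k) (P.b i.succ) s.1 * dx P.Ω P.T k p s
      + P.b i.succ s.1 * (y s - P.yd s))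
      - P.b i.succ s.1 * p s * ∑ k, P.B1 y k s * w k s.2)
      + ∑ j, P.muDot μ j s.2 * (P.c j s.1 * (P.b i.succ s.1 * ζ s)) := by
  have : ∑ j, P.muDot μ j s.2 * (P.c j s.1 * (P.b i.succ s.1 * ζ s))
      = ζ s * (P.b i.succ s.1 * ∑ j, P.c j s.1 * P.muDot μ j s.2) := by
    simp only [Finset.mul_sum]
    exact Finset.sum_congr rfl fun j _ => by ring
  rw [this, hatCross]
  ring

lemma integrable_hatCross (hP : P.Basic) (hu : P.IsAdmissibleControl u)
    (hst : P.IsState u y) (hb : ∀ i, MemW P.Ω ∞ 2 (P.b i)) (hp : MemLinftyH10 P.Ω P.T p)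
    (hv : ∀ i, MemLp (v i) 2 P.timeMeasure) (hζ : MemY P.Ω P.T ζ)
    (hθ : ∀ j, IntegrableOn (P.muDot μ j) (Ioo 0 P.T)) (i : Fin m) :
    Integrable (P.hatCross y p μ ζ (primitive v) i) P.cylMeasure :=
  ((integrable_hatCross_regular hP hu hst hb hp hv hζ i).add
    (integrable_finsetSum Finset.univ fun j _ =>
      integrable_constraint_term hP hb hζ hθ i j)).congr
    (ae_of_all _ fun s => (hatCross_eq i s _).symm)

lemma integrable_primitive_mul (hT : 0 ≤ P.T) (hv : ∀ i, MemLp (v i) 2 P.timeMeasure)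
    {F : Space n × ℝ → ℝ} (hF : Integrable F P.cylMeasure) (i : Fin m) :
    Integrable (fun s => primitive v i s.2 * F s) P.cylMeasure :=
  memLp_one_iff_integrable.1 (memLp_bounded_mul
    (memLp_top_snd (memLp_top_primitive_control hT hv i)) (memLp_one_iff_integrable.2 hF))

/-- The space integral of `hatCross` is minus the time derivative of `∫_Ω b_i p ζ`. -/
lemma integral_hatCross (hP : P.Basic) (hu : P.IsAdmissibleControl u)
    (hst : P.IsState u y) (hb : ∀ i, MemW P.Ω ∞ 2 (P.b i)) (hp : MemLinftyH10 P.Ω P.T p)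
    (hv : ∀ i, MemLp (v i) 2 P.timeMeasure) (hζ : P.IsTransformedState u y (primitive v) ζ)
    (hθ : ∀ j, IntegrableOn (P.muDot μ j) (Ioo 0 P.T)) (i : Fin m) :
    ∀ᵐ t ∂P.timeMeasure, ∫ x in P.Ω, P.hatCross y p μ ζ (primitive v) i (x, t)
      = P.pairingRate u y p μ (fun s => P.b i.succ s.1 * ζ s) t := by
  have hΩ := hP.isOpen
  have hdir := (hζ.isDirection hP hu hst hb hv).mul_fst hP (hb i.succ)
  have iD := integrable_adjointDensity hP hu hst hp.memLp hdir
  have iR := integrable_hatCross_regular hP hu hst hb hp hv hζ.1 i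
  -- By the Leibniz rule for b_i ζ the two densities differ by twice the expression of
  -- `integral_drift`, which integrates to zero over Ω.
  have hop : ∀ᵐ s ∂P.cylMeasure, P.adjointDensity u y p (fun s => P.b i.succ s.1 * ζ s) s
      - (ζ s * (- lapSpace P.Ω (P.b i.succ) s.1 * p s
      - 2 * ∑ k, wderiv P.Ω (unitVec k) (P.b i.succ) s.1 * dx P.Ω P.T k p s
      + P.b i.succ s.1 * (y s - P.yd s))
      - P.b i.succ s.1 * p s * ∑ k, P.B1 y k s * primitive v k s.2)
      = 2 * (p s * (∑ k, wderiv P.Ω (unitVec k) (P.b i.succ) s.1 * dx P.Ω P.T k ζ s)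
        + ζ s * (lapSpace P.Ω (P.b i.succ) s.1 * p s)
        + ζ s * ∑ k, wderiv P.Ω (unitVec k) (P.b i.succ) s.1 * dx P.Ω P.T k p s) := by
    filter_upwards [operator_mul_fst (u := u) (y := y) hΩ hP.T_pos.le hζ.1 (hb i.succ), hζ.2.1]
      with s h1 h2
    rw [adjointDensity, h1, h2]
    ring
  filter_upwards [ae_slice_time hop, hp.integral_drift hΩ hζ.1 (hb i.succ),
    integrable_slice_time iD, integrable_slice_time iR,
    ae_all_iff.2 fun j => integrable_slice_time (integrable_constraint_term (μ := μ) hP hb hζ.1 hθ i j)]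
    with t h1 h2 h3 h4 h5
  have h6 := integral_congr_ae h1
  rw [integral_sub h3 h4, integral_const_mul, h2, mul_zero, sub_eq_zero] at h6
  simp only [hatCross_eq]
  rw [integral_add h4 (integrable_finsetSum _ fun j _ => h5 j), ← h6,
    integral_finsetSum _ fun j _ => h5 j, pairingRate, add_comm]
  simp only [integral_const_mul]

end ControlProblem

/-! ### Integration by parts in time and assembly of the identity. -/

namespace ControlProblem

variable {n m q : ℕ} {P : ControlProblem n m q} {u : Fin m → ℝ → ℝ} {y p : Space n × ℝ → ℝ}
  {μ : Fin q → StieltjesFunction ℝ} {v : Fin m → ℝ → ℝ} {z ζ : Space n × ℝ → ℝ}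

lemma S_eq (i j : Fin m) (t : ℝ) : P.S y p i j t
    = ∫ x in P.Ω, p (x, t) * (P.b i.succ x * (P.b j.succ x * y (x, t))) := by
  rw [S]
  congr 1
  ext x
  ring

lemma S_symm (i j : Fin m) : P.S y p i j = P.S y p j i := by
  ext t
  simp only [S]
  congr 1
  ext x
  ring

/-- Minus the time derivative of `S_ij`. -/
def rateS (P : ControlProblem n m q) (u : Fin m → ℝ → ℝ) (y p : Space n × ℝ → ℝ)
    (μ : Fin q → StieltjesFunction ℝ) (i j : Fin m) : ℝ → ℝ :=
  P.pairingRate u y p μ (fun s => P.b i.succ s.1 * (P.b j.succ s.1 * y s))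

lemma isTail_S (hn3 : n ≤ 3) (hP : P.Basic) (hu : P.IsAdmissibleControl u)
    (hst : P.IsState u y) (hb : ∀ i, MemW P.Ω ∞ 2 (P.b i)) (hc : P.IsCostate u y p μ)
    (hμ : ∀ j, (μ j).measure.restrict (Ioo 0 P.T) ≪ volume) (i j : Fin m) :
    IsTail P.T (P.S y p i j) (P.Send y p i j) (P.rateS u y p μ i j) := by
  have h := isTail_pairing hn3 hP hu hst hc hμ
    (((isDirection_state hP hu hst).mul_fst hP (hb j.succ)).mul_fst hP (hb i.succ))
  have h1 : P.Send y p i j = ∫ x in P.Ω, endTrace P.Ω P.T p x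
      * (P.b i.succ x * (P.b j.succ x * y (x, P.T))) := by
    rw [Send]
    congr 1
    ext x
    ring
  rw [h1, funext (S_eq (P := P) i j)]
  exact h

lemma Sdot_ae (hT : 0 < P.T) {i j : Fin m} {e : ℝ} {F : ℝ → ℝ}
    (h : IsTail P.T (P.S y p i j) e F) : P.Sdot y p i j =ᵐ[P.timeMeasure] fun t => - F t :=
  (h.hasWeakDeriv hT).wderiv_ae_eq isOpen_Ioo

lemma integrable_wSw (hT : 0 < P.T) (hv : ∀ i, MemLp (v i) 2 P.timeMeasure) {i j : Fin m} {e : ℝ}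
    {F : ℝ → ℝ} (h : IsTail P.T (P.S y p i j) e F) :
    Integrable (fun t => primitive v i t * P.Sdot y p i j t * primitive v j t) P.timeMeasure := by
  have h1 : Integrable (P.Sdot y p i j) P.timeMeasure :=
    (h.integrableOn.neg).congr (Sdot_ae hT h).symm
  refine (memLp_one_iff_integrable.1 (memLp_bounded_mul (memLp_top_primitive_control hT.le hv i)
    (memLp_bounded_mul (memLp_top_primitive_control hT.le hv j)
      (memLp_one_iff_integrable.2 h1)))).congr (ae_of_all _ fun t => ?_)
  simp only
  ring

/-- The quadratic part of the second variation that involves `S`. -/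
lemma two_mul_sum_S (hT : 0 < P.T) (hv : ∀ i, MemLp (v i) 2 P.timeMeasure)
    {F : Fin m → Fin m → ℝ → ℝ}
    (h : ∀ i j, IsTail P.T (P.S y p i j) (P.Send y p i j) (F i j)) :
    2 * ∑ i, ∑ j, ∫ t in Ioo 0 P.T, v i t * primitive v j t * P.S y p i j t
      = (∑ i, ∑ j, primitive v i P.T * P.Send y p i j * primitive v j P.T)
        - ∑ i, ∑ j, ∫ t in Ioo 0 P.T, primitive v i t * P.Sdot y p i j t * primitive v j t := by
  -- Symmetry of S allows the double sum to be replaced by its symmetrization, each term of which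
  -- can be integrated by parts.
  have hsym : ∑ i, ∑ j, ∫ t in Ioo 0 P.T, v i t * primitive v j t * P.S y p i j t
      = ∑ i, ∑ j, ∫ t in Ioo 0 P.T, v j t * primitive v i t * P.S y p i j t := by
    rw [Finset.sum_comm]
    simp only [S_symm (P := P) (y := y) (p := p)]
  rw [two_mul]
  nth_rewrite 2 [hsym]
  simp only [← Finset.sum_add_distrib, ← Finset.sum_sub_distrib]
  refine Finset.sum_congr rfl fun i _ => Finset.sum_congr rfl fun j _ => ?_
  have h1 := (h i j).integral_primitive_mul_primitive hT ((hv i).integrable one_le_two)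
    ((hv j).integrable one_le_two)
  simp only [primitive]
  rw [h1, sub_eq_add_neg, ← integral_neg]
  congr 1
  refine integral_congr_ae ?_
  filter_upwards [Sdot_ae hT (h i j)] with t ht
  rw [ht]
  ring

/-- The part of the second variation that is bilinear in the control `v_i` and the state. -/
lemma integral_control_term (hn3 : n ≤ 3) (hP : P.Basic) (hu : P.IsAdmissibleControl u)
    (hst : P.IsState u y) (hb : ∀ i, MemW P.Ω ∞ 2 (P.b i)) (hc : P.IsCostate u y p μ)
    (hμ : ∀ j, (μ j).measure.restrict (Ioo 0 P.T) ≪ volume)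
    (hv : ∀ i, MemLp (v i) 2 P.timeMeasure) (hz : P.IsLinearizedState u y v z)
    (hζ : P.IsTransformedState u y (primitive v) ζ) (i : Fin m) :
    ∫ s in cyl P.Ω P.T, v i s.2 * (p s * (P.b i.succ s.1 * z s))
      = primitive v i P.T * (∫ x in P.Ω, endTrace P.Ω P.T p x * (P.b i.succ x * ζ (x, P.T)))
        + (∫ t in Ioo 0 P.T, primitive v i t *
            ∫ x in P.Ω, P.hatCross y p μ ζ (primitive v) i (x, t))
        + ∑ j, ∫ t in Ioo 0 P.T, v i t * primitive v j t * P.S y p i j t := by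
  have hT := hP.T_pos
  have hθ := fun j => (muDot_spec hT (hμ j)).1
  have hdir := (hζ.isDirection hP hu hst hb hv).mul_fst hP (hb i.succ)
  have htail := isTail_pairing hn3 hP hu hst hc hμ hdir
  have hvi : IntegrableOn (v i) (Ioo 0 P.T) := (hv i).integrable one_le_two
  have hiS : ∀ j, IntegrableOn (fun t => v i t * primitive v j t * P.S y p i j t) (Ioo 0 P.T) :=
    fun j => (isTail_S hn3 hP hu hst hb hc hμ i j).integrableOn_mul hT
      ((integrableOn_primitive_mul hT.le ((hv j).integrable one_le_two) hvi 0).congr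
        (ae_of_all _ fun t => by simp only [primitive]; ring))
  -- The substitution z = ζ + y ∑ w_j b_j inside the pairing with p b_i; the second part is a
  -- combination of the S_ij.
  have hsplit : ∀ᵐ t ∂P.timeMeasure, ∫ x in P.Ω, p (x, t) * (P.b i.succ x * z (x, t))
      = (∫ x in P.Ω, p (x, t) * (P.b i.succ x * ζ (x, t)))
        + ∑ j, primitive v j t * P.S y p i j t := by
    filter_upwards [ae_restrict_mem measurableSet_Ioo, memLp_slice_time hc.1.memLp] with t ht hpt
    have htm := Ioo_subset_Icc_self ht
    have hbb := fun j : Fin m => (hb j.succ).memLp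
    have iζ := integrable_mul_of_memLp_two hpt
      (memLp_bounded_mul (hbb i) (hζ.1.slice_memLp t htm))
    have iy := fun j => integrable_mul_of_memLp_two hpt
      (memLp_bounded_mul (hbb i) (memLp_bounded_mul (hbb j) (hst.1.slice_memLp t htm)))
    simp only [S_eq, ← integral_const_mul]
    rw [← integral_finsetSum _ fun j _ => (iy j).const_mul (primitive v j t),
      ← integral_add iζ (integrable_finsetSum _ fun j _ => (iy j).const_mul (primitive v j t))]
    refine integral_congr_ae ?_
    filter_upwards [goh_transform hP hu hst hb hv hz hζ t htm] with x hx
    rw [hx]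
    simp only [mul_add, Finset.mul_sum]
    congr 1
    exact Finset.sum_congr rfl fun j _ => by ring
  rw [integral_cyl (integrable_costate_control hP hc.1 hz.1 hv i)]
  simp only [integral_const_mul]
  have h1 : ∫ t in Ioo 0 P.T, v i t * ∫ x in P.Ω, p (x, t) * (P.b i.succ x * z (x, t))
      = ∫ t in Ioo 0 P.T, (v i t * (∫ x in P.Ω, p (x, t) * (P.b i.succ x * ζ (x, t)))
        + ∑ j, v i t * primitive v j t * P.S y p i j t) := by
    refine integral_congr_ae ?_
    filter_upwards [hsplit] with t ht
    rw [ht, mul_add, Finset.mul_sum]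
    simp only [mul_assoc]
  rw [h1, integral_add (htail.integrableOn_mul hT hvi) (integrable_finsetSum _ fun j _ => hiS j),
    integral_finsetSum _ fun j _ => hiS j, htail.integral_mul hT hvi]
  congr 2
  refine integral_congr_ae ?_
  filter_upwards [integral_hatCross hP hu hst hb hc.1 hv hζ hθ i] with t ht
  rw [ht]
  rfl

lemma hatFinal_eq (hP : P.Basic) (hst : P.IsState u y)
    (hb : ∀ i, MemW P.Ω ∞ 2 (P.b i)) (hp : ∃ g, HasEndTrace P.Ω P.T p g)
    (hζ : MemY P.Ω P.T ζ) {h : Fin m → ℝ} :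
    P.hatFinal y p ζ h
      = (∫ x in P.Ω, (ζ (x, P.T) + y (x, P.T) * ∑ i, h i * P.b i.succ x) ^ 2)
        + 2 * (∑ i, h i * ∫ x in P.Ω, endTrace P.Ω P.T p x * (P.b i.succ x * ζ (x, P.T)))
        + ∑ i, ∑ j, h i * P.Send y p i j * h j := by
  have hTm : P.T ∈ Icc 0 P.T := ⟨hP.T_pos.le, le_rfl⟩
  have hbb := fun j : Fin m => (hb j.succ).memLp
  have i1 : MemLp (fun x => ζ (x, P.T) + y (x, P.T) * ∑ i, h i * P.b i.succ x) 2
      (volume.restrict P.Ω) := by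
    have h1 : MemLp (fun x => ∑ i, h i * P.b i.succ x) ∞ (volume.restrict P.Ω) :=
      memLp_finsetSum _ fun i _ => (hbb i).const_mul (h i)
    refine ((hζ.slice_memLp _ hTm).add (memLp_bounded_mul h1 (hst.1.slice_memLp _ hTm))).ae_eq
      (ae_of_all _ fun x => ?_)
    simp only [Pi.add_apply]
    ring
  have i2 : ∀ i, Integrable (fun x => h i * (endTrace P.Ω P.T p x * (P.b i.succ x * ζ (x, P.T))))
      (volume.restrict P.Ω) := fun i =>
    (integrable_mul_of_memLp_two (hasEndTrace_endTrace hp).1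
      (memLp_bounded_mul (hbb i) (hζ.slice_memLp _ hTm))).const_mul (h i)
  rw [hatFinal]
  congr 1
  simp only [← integral_const_mul (h _)]
  rw [← integral_finsetSum _ fun i _ => i2 i, ← integral_const_mul,
    ← integral_add i1.integrable_sq ((integrable_finsetSum _ fun i _ => i2 i).const_mul 2)]
  congr 1
  ext x
  congr 2
  exact Finset.sum_congr rfl fun i _ => by ring

lemma integral_hatRunning (hS : Integrable (P.hatSquare y p ζ (primitive v)) P.cylMeasure)
    (hw : ∀ i j, Integrable (fun t => primitive v i t * P.Sdot y p i j t * primitive v j t)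
      P.timeMeasure)
    (hcr : ∀ i, Integrable (fun s => primitive v i s.2 * P.hatCross y p μ ζ (primitive v) i s)
      P.cylMeasure) :
    ∫ t in Ioo 0 P.T, P.hatRunning y p μ ζ (primitive v) t
      = (∫ s in cyl P.Ω P.T, P.hatSquare y p ζ (primitive v) s)
        - (∑ i, ∑ j, ∫ t in Ioo 0 P.T, primitive v i t * P.Sdot y p i j t * primitive v j t)
        + 2 * ∑ i, ∫ t in Ioo 0 P.T, primitive v i t *
            ∫ x in P.Ω, P.hatCross y p μ ζ (primitive v) i (x, t) := by
  have j1 := integrable_integral_slice hS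
  have j2 := integrable_finsetSum Finset.univ fun i _ =>
    integrable_finsetSum Finset.univ fun j _ => hw i j
  have j3 : ∀ i, Integrable (fun t => primitive v i t *
      ∫ x in P.Ω, P.hatCross y p μ ζ (primitive v) i (x, t)) P.timeMeasure := fun i => by
    have := integrable_integral_slice (hcr i)
    simp only [integral_const_mul] at this
    exact this
  have j12 : Integrable (fun t => (∫ x in P.Ω, P.hatSquare y p ζ (primitive v) (x, t))
      - ∑ i, ∑ j, primitive v i t * P.Sdot y p i j t * primitive v j t) P.timeMeasure := j1.sub j2
  have j4 := (integrable_finsetSum Finset.univ fun i _ => j3 i).const_mul 2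
  rw [integral_cyl hS]
  simp only [hatRunning]
  rw [integral_add j12 j4, integral_sub j1 j2, integral_const_mul,
    integral_finsetSum _ fun i _ => j3 i,
    integral_finsetSum _ fun i _ => integrable_finsetSum Finset.univ fun j _ => hw i j]
  simp only [integral_finsetSum _ fun j _ => hw _ j]

lemma integral_quadIntegrand (hn3 : n ≤ 3) (hP : P.Basic)
    (hst : P.IsState u y) (hp : MemLinftyH10 P.Ω P.T p) (h : P.IsDirection y z)
    (hv : ∀ i, MemLp (v i) 2 P.timeMeasure) :
    ∫ s in cyl P.Ω P.T, P.quadIntegrand y p z v s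
      = (∫ s in cyl P.Ω P.T, P.kappa y p s * z s ^ 2)
        + 2 * ∑ i, ∫ s in cyl P.Ω P.T, v i s.2 * (p s * (P.b i.succ s.1 * z s)) := by
  have i1 := h.integrable_kappa_mul hn3 hP hst hp
  have i2 := fun i => integrable_costate_control hP hp h.memY hv i
  rw [← integral_finsetSum _ fun i _ => i2 i, ← integral_const_mul,
    ← integral_add i1 ((integrable_finsetSum _ fun i _ => i2 i).const_mul 2)]
  congr 1
  ext s
  simp only [quadIntegrand, Finset.mul_sum]
  congr 1
  exact Finset.sum_congr rfl fun i _ => by ring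

lemma hatSquare_ae (hP : P.Basic) (hu : P.IsAdmissibleControl u) (hst : P.IsState u y)
    (hb : ∀ i, MemW P.Ω ∞ 2 (P.b i)) (hv : ∀ i, MemLp (v i) 2 P.timeMeasure)
    (hz : P.IsLinearizedState u y v z) (hζ : P.IsTransformedState u y (primitive v) ζ) :
    (fun s => P.kappa y p s * z s ^ 2) =ᵐ[P.cylMeasure] P.hatSquare y p ζ (primitive v) := by
  filter_upwards [ae_cyl_goh hP hst hz.1.memLp hζ.1.memLp hv
    (goh_transform hP hu hst hb hv hz hζ)] with s hs
  rw [hs, hatSquare]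

lemma formsWellDefined (hn3 : n ≤ 3) (hP : P.Basic) (hu : P.IsAdmissibleControl u)
    (hst : P.IsState u y) (hb : ∀ i, MemW P.Ω ∞ 2 (P.b i)) (hc : P.IsCostate u y p μ)
    (hμ : ∀ j, (μ j).measure.restrict (Ioo 0 P.T) ≪ volume)
    (hv : ∀ i, MemLp (v i) 2 P.timeMeasure) (hz : P.IsLinearizedState u y v z)
    (hζ : P.IsTransformedState u y (primitive v) ζ) :
    P.FormsWellDefined y p μ z v ζ (primitive v) := by
  have hT := hP.T_pos
  have hzd := hz.isDirection hP hu hst hv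
  have hS := isTail_S hn3 hP hu hst hb hc hμ
  exact
    { mu_deriv := fun j => (muDot_spec hT (hμ j)).2.1
      S_deriv := fun i j => ⟨_, (hS i j).hasWeakDeriv hT⟩
      trace := exists_hasEndTrace hn3 hP hu hst hc
      quad := integrable_quadIntegrand hn3 hP hst hc.1 hzd hv
      square := (hzd.integrable_kappa_mul hn3 hP hst hc.1).congr
        (hatSquare_ae hP hu hst hb hv hz hζ)
      wSw := fun i j => integrable_wSw hT hv (hS i j)
      cross := fun i => integrable_primitive_mul hT.le hv
        (integrable_hatCross hP hu hst hb hc.1 hv hζ.1 (fun j => (muDot_spec hT (hμ j)).1) i) i }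

/-- The Goh transformation of the second variation. -/
lemma quadForm_eq (hn3 : n ≤ 3) (hP : P.Basic) (hu : P.IsAdmissibleControl u)
    (hst : P.IsState u y) (hb : ∀ i, MemW P.Ω ∞ 2 (P.b i)) (hc : P.IsCostate u y p μ)
    (hμ : ∀ j, (μ j).measure.restrict (Ioo 0 P.T) ≪ volume)
    (hv : ∀ i, MemLp (v i) 2 P.timeMeasure) (hz : P.IsLinearizedState u y v z)
    (hζ : P.IsTransformedState u y (primitive v) ζ) :
    P.quadForm y p z v
      = P.hatQuadForm y p μ ζ (primitive v) (fun i => primitive v i P.T) := by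
  have hT := hP.T_pos
  have hF := formsWellDefined hn3 hP hu hst hb hc hμ hv hz hζ
  have hend : ∫ x in P.Ω, z (x, P.T) ^ 2
      = ∫ x in P.Ω, (ζ (x, P.T) + y (x, P.T) * ∑ i, primitive v i P.T * P.b i.succ x) ^ 2 := by
    refine integral_congr_ae ?_
    filter_upwards [goh_transform hP hu hst hb hv hz hζ P.T ⟨hT.le, le_rfl⟩] with x hx
    rw [hx]
    simp only [mul_comm (primitive v _ P.T)]
  have h2 := two_mul_sum_S hT hv (isTail_S hn3 hP hu hst hb hc hμ)
  rw [quadForm, hatQuadForm, integral_quadIntegrand hn3 hP hst hc.1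
    (hz.isDirection hP hu hst hv) hv, integral_hatRunning hF.square hF.wSw hF.cross,
    hatFinal_eq hP hst hb hF.trace hζ.1,
    integral_congr_ae (hatSquare_ae (p := p) hP hu hst hb hv hz hζ), hend,
    Finset.sum_congr rfl fun i _ =>
      integral_control_term hn3 hP hu hst hb hc hμ hv hz hζ i]
  simp only [Finset.sum_add_distrib, mul_add]
  rw [h2]
  ring

end ControlProblem

end GohTransform

end

theorem mainTheorem3 {n m q : ℕ} (hn : 1 ≤ n) (hn3 : n ≤ 3)
    (P : GohTransform.ControlProblem n m q) (hP : P.Basic)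
    (u : Fin m → ℝ → ℝ) (y : GohTransform.Space n × ℝ → ℝ)
    (huy : P.IsAdmissibleTrajectory u y) (hyp : P.Hypotheses u y)
    (p : GohTransform.Space n × ℝ → ℝ) (μ : Fin q → StieltjesFunction ℝ)
    (hΛ : P.IsMultiplier u y p μ)
    (v : Fin m → ℝ → ℝ) (hv : ∀ i, MemLp (v i) 2 P.timeMeasure)
    (z : GohTransform.Space n × ℝ → ℝ) (hz : P.IsLinearizedState u y v z)
    (ζ : GohTransform.Space n × ℝ → ℝ)
    (hζ : P.IsTransformedState u y (GohTransform.primitive v) ζ) :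
    P.FormsWellDefined y p μ z v ζ (GohTransform.primitive v) ∧
    P.quadForm y p z v
      = P.hatQuadForm y p μ ζ (GohTransform.primitive v)
          (fun i => GohTransform.primitive v i P.T) := by
  have hμ := fun j => hΛ.absolutelyContinuous hn3 hP huy hyp j
  exact ⟨GohTransform.ControlProblem.formsWellDefined hn3 hP huy.1 huy.2.1 hyp.b_regular
    hΛ.costate hμ hv hz hζ, GohTransform.ControlProblem.quadForm_eq hn3 hP huy.1 huy.2.1
    hyp.b_regular hΛ.costate hμ hv hz hζ⟩
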